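/- Let $a>0$ and let $\nu\in\mathbb C$ satisfy $\operatorname{Re}\nu>0$, $\nu\notin\{1,2,\dots\}$; put $\nu_0=\nu^2-\frac14$. Let $W$ be the class of functions $q:(0,\infty)\to\mathbb C$ such that, for some $T>a$, $q(x)|x-a|^{\min(0,1-2\operatorname{Re}\nu)}\in L(0,T)$ and $q\in L(T,\infty)$. Fix $c_{10},c_{20}\in\mathbb C$ with $c_{10}c_{20}=(2\nu)^{-1}$ and a matrix $A=[a_{jk}]_{j,k=1,2}$ of complex numbers with $\det A\neq0$ and $a_{12}=0$, such that $|\xi_{jj}|>|\xi_{12}|>0$ for $j=1,2$, where $$\begin{bmatrix}\xi_{11}&\xi_{12}\\ \xi_{21}&\xi_{22}\end{bmatrix}=\frac1{2\sin\pi\nu}\begin{bmatrix}-a_{11}e^{2\pi i\nu}+a_{22}e^{-2\pi i\nu}&-i(a_{11}e^{\pi i\nu}-a_{22}e^{-\pi i\nu})\\-i(a_{11}e^{\pi i\nu}-a_{22}e^{-\pi i\nu})&a_{11}-a_{22}\end{bmatrix}.$$ For $q\in W$ let $\mathcal L(q)$ be the problem for the equation $-y''+\big(\frac{\nu_0}{(x-a)^2}+q(x)\big)y=\lambda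 y$, $x>0$, with the condition $y(0)=0$ and matching at $x=a$ by means of $A$, as follows. For $j=1,2$ let $\mu_j=(-1)^j\nu+\frac12$, $z^\mu=\exp(\mu(\ln|z|+i\arg z))$ with $\arg z\in(-\pi,\pi]$, and, with $\lambda=\rho^2$, $$C_j(x,\lambda)=(x-a)^{\mu_j}\sum_{k=0}^\infty c_{jk}(\rho(x-a))^{2k},\qquad c_{jk}=(-1)^kc_{j0}\Big(\prod_{s=1}^k\big((2s+\mu_j)(2s+\mu_j-1)-\nu_0\big)\Big)^{-1}.$$ Let $s_j(x,\lambda)$, for $x\ge0$, $x\ne a$, be the solution of $$s_j(x,\lambda)=C_j(x,\lambda)+\int_a^xg(x,t,\lambda)q(t)s_j(t,\lambda)\,dt,\qquad g(x,t,\lambda)=C_1(t,\lambda)C_2(x,\lambda)-C_1(x,\lambda)C_2(t,\lambda),$$ and let $\sigma_j=s_j$ for $x<a$, $\sigma_j=\sum_{k=1}^2a_{kj}s_k$ for $x>a$. For $\operatorname{Im}\rho\ge0$, $\rho\ne0$, the discontinuous Jost solution $e(x,\rho)$ is the function of the form $e(x,\rho)=\sum_{k=1}^2A_k(\rho)\sigma_k(x,\rho^2)$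 ($x\geq 0$, $x\ne a$) with $\lim_{x\to\infty}e(x,\rho)e^{-i\rho x}=1$. Put $\Delta(\rho)=e(0,\rho)$ and, where $\Delta(\rho)\ne0$, $\Phi(x,\lambda)=e(x,\rho)/\Delta(\rho)$. The Weyl function is $M(\lambda)=\Phi'(0,\lambda)$, $\lambda=\rho^2$; here $\lambda$ runs over the plane with a two-sided cut along $[0,\infty)$, both sides of the cut included and $0$ excluded, which $\rho\mapsto\rho^2$ identifies with $\{\rho:\operatorname{Im}\rho\ge0,\ \rho\ne0\}$. Theorem. Let $q,\tilde q\in W$, and let $M,\tilde M$ be the Weyl functions of $\mathcal L(q)$ and $\mathcal L(\tilde q)$ (with the same $a$, $\nu_0$, $c_{10},c_{20}$ and $A$). If $M(\lambda)=\tilde M(\lambda)$ for all $\lambda$ at which both are defined, i.e. for all $\rho$ with $\operatorname{Im}\rho\ge0$, $\rho\ne0$, $\Delta(\rho)\ne0$ and $\tilde\Delta(\rho)\ne0$, then $q(x)=\tilde q(x)$ for almost every $x>0$. -/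

import Mathlib

noncomputable section

namespace SingularSL

open MeasureTheory Filter Topology

/-- The class `W` of potentials: `q(x) |x - a| ^ min(0, 1 - 2 Re ν)` is integrable on `(0, T)`
and `q` is integrable on `(T, ∞)` for some `T > a`. -/
def ClassW (a : ℝ) (ν : ℂ) (q : ℝ → ℂ) : Prop :=
  ∃ T : ℝ, a < T ∧
    IntegrableOn (fun x : ℝ => q x * ((|x - a| ^ min (0 : ℝ) (1 - 2 * ν.re) : ℝ) : ℂ))
      (Set.Ioo 0 T) ∧
    IntegrableOn q (Set.Ioi T)

/-- The coefficient `ν₀ = ν² - 1/4` of the singular term `ν₀ / (x - a)²`. -/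
def nu0 (ν : ℂ) : ℂ := ν ^ 2 - 1 / 4

/-- The exponents `-ν + 1/2` (index `0`) and `ν + 1/2` (index `1`). -/
def expo (ν : ℂ) (j : Fin 2) : ℂ := (-1) ^ ((j : ℕ) + 1) * ν + 1 / 2

/-- The coefficients `c_{jk}` of the Frobenius series, with prescribed leading ones `c j`. -/
def frobCoeff (ν : ℂ) (c : Fin 2 → ℂ) (j : Fin 2) (k : ℕ) : ℂ :=
  (-1) ^ k * c j *
    (∏ s ∈ Finset.Icc 1 k,
      ((2 * (s : ℂ) + expo ν j) * (2 * (s : ℂ) + expo ν j - 1) - nu0 ν))⁻¹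

/-- The Frobenius solutions `C_j(x, lam)` of the unperturbed equation
`-y'' + ν₀ / (x - a)² y = lam y`; with `lam = ρ²` the series is in powers `(ρ (x - a)) ^ (2 k)`.
The complex power uses `arg ∈ (-π, π]`. -/
def frobSol (a : ℝ) (ν : ℂ) (c : Fin 2 → ℂ) (j : Fin 2) (x : ℝ) (lam : ℂ) : ℂ :=
  ((x - a : ℝ) : ℂ) ^ expo ν j *
    ∑' k : ℕ, frobCoeff ν c j k * (lam * ((x - a : ℝ) : ℂ) ^ 2) ^ k

/-- The kernel `g(x, t, lam) = C₁(t) C₂(x) - C₁(x) C₂(t)`. -/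
def kernelG (a : ℝ) (ν : ℂ) (c : Fin 2 → ℂ) (x t : ℝ) (lam : ℂ) : ℂ :=
  frobSol a ν c 0 t lam * frobSol a ν c 1 x lam -
    frobSol a ν c 0 x lam * frobSol a ν c 1 t lam

/-- `s` solves, for `x > a` and for `0 ≤ x < a`, the integral equation
`s(x) = C_j(x) + ∫_a^x g(x, t) q(t) s(t) dt` (the integral being absolutely convergent). -/
def IsIntegralSol (a : ℝ) (ν : ℂ) (c : Fin 2 → ℂ) (q : ℝ → ℂ) (j : Fin 2) (lam : ℂ)
    (s : ℝ → ℂ) : Prop :=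
  ∀ x : ℝ, 0 ≤ x → x ≠ a →
    IntervalIntegrable (fun t => kernelG a ν c x t lam * q t * s t) volume a x ∧
    s x = frobSol a ν c j x lam + ∫ t in a..x, kernelG a ν c x t lam * q t * s t

/-- The solution `s_j(·, lam)` of the integral equation; for `q` in the class `W` its values at
the points `x ≥ 0`, `x ≠ a`, are determined by the equation, and only these are used. -/
def solS (a : ℝ) (ν : ℂ) (c : Fin 2 → ℂ) (q : ℝ → ℂ) (j : Fin 2) (lam : ℂ) : ℝ → ℂ :=
  Classical.epsilon (IsIntegralSol a ν c q j lam)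

/-- The matched fundamental system: `σ_j = s_j` for `x < a` and `σ_j = ∑ k, A k j * s_k` for
`x > a`. The value at `x = a` is irrelevant. -/
def solSigma (a : ℝ) (ν : ℂ) (c : Fin 2 → ℂ) (A : Matrix (Fin 2) (Fin 2) ℂ) (q : ℝ → ℂ)
    (j : Fin 2) (x : ℝ) (lam : ℂ) : ℂ :=
  if x < a then solS a ν c q j lam x else ∑ k : Fin 2, A k j * solS a ν c q k lam x

/-- `e` is a discontinuous Jost solution for `ρ`: a combination, with coefficients independent of
`x`, of `σ_1(·, ρ²)` and `σ_2(·, ρ²)`, with `e(x) exp(-iρx) → 1` as `x → ∞`. -/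
def IsJost (a : ℝ) (ν : ℂ) (c : Fin 2 → ℂ) (A : Matrix (Fin 2) (Fin 2) ℂ) (q : ℝ → ℂ)
    (ρ : ℂ) (e : ℝ → ℂ) : Prop :=
  (∃ B : Fin 2 → ℂ, ∀ x : ℝ, 0 ≤ x → x ≠ a →
    e x = ∑ k : Fin 2, B k * solSigma a ν c A q k x (ρ ^ 2)) ∧
  Tendsto (fun x : ℝ => e x * Complex.exp (-(Complex.I * ρ * (x : ℂ)))) atTop (𝓝 1)

/-- The discontinuous Jost solution `e(·, ρ)`. It is used for `Im ρ ≥ 0`, `ρ ≠ 0`, where its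
values at `x ≥ 0`, `x ≠ a`, are determined by the defining property. -/
def jost (a : ℝ) (ν : ℂ) (c : Fin 2 → ℂ) (A : Matrix (Fin 2) (Fin 2) ℂ) (q : ℝ → ℂ)
    (ρ : ℂ) : ℝ → ℂ :=
  Classical.epsilon (IsJost a ν c A q ρ)

/-- The characteristic function `Δ(ρ) = e(0, ρ)`. -/
def charFn (a : ℝ) (ν : ℂ) (c : Fin 2 → ℂ) (A : Matrix (Fin 2) (Fin 2) ℂ) (q : ℝ → ℂ)
    (ρ : ℂ) : ℂ :=
  jost a ν c A q ρ 0

/-- The Weyl solution `Φ(x, lam) = e(x, ρ) / Δ(ρ)`, `lam = ρ²`, for `Δ(ρ) ≠ 0`. -/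
def weylSol (a : ℝ) (ν : ℂ) (c : Fin 2 → ℂ) (A : Matrix (Fin 2) (Fin 2) ℂ) (q : ℝ → ℂ)
    (ρ : ℂ) (x : ℝ) : ℂ :=
  jost a ν c A q ρ x / charFn a ν c A q ρ

/-- The Weyl function `M(lam) = Φ'(0, lam)` (derivative from the right, as the problem lives on
`x ≥ 0`). It is written as a function of `ρ`, `lam = ρ²`: the map `ρ ↦ ρ²` identifies
`{Im ρ ≥ 0, ρ ≠ 0}` with the plane cut along `[0, ∞)`, both sides of the cut included and `0`
excluded. -/
def weylFn (a : ℝ) (ν : ℂ) (c : Fin 2 → ℂ) (A : Matrix (Fin 2) (Fin 2) ℂ) (q : ℝ → ℂ)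
    (ρ : ℂ) : ℂ :=
  derivWithin (weylSol a ν c A q ρ) (Set.Ici 0) 0

/-- The matrix of the numbers `ξ_{jk}`. -/
def xi (ν : ℂ) (A : Matrix (Fin 2) (Fin 2) ℂ) : Matrix (Fin 2) (Fin 2) ℂ :=
  let E : ℂ → ℂ := fun r => Complex.exp (r * Real.pi * Complex.I * ν)
  (1 / (2 * Complex.sin (Real.pi * ν))) •
    !![-(A 0 0) * E 2 + A 1 1 * E (-2), -Complex.I * (A 0 0 * E 1 - A 1 1 * E (-1));
       -Complex.I * (A 0 0 * E 1 - A 1 1 * E (-1)), A 0 0 - A 1 1]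

end SingularSL

end

namespace SingularSL

open MeasureTheory Filter Topology Set

/-! The substitutions x = a + z and x = a - z move the singular point to the origin and turn both
sides into one equation -y'' + (ν₀/z² + Q) y = λy on z > 0, the end x = 0 becoming z = a. On the
left the powers of a negative number contribute only phases (`isIntegralSol_iff`, `Params.solS_eq`).
Because a₁₂ = 0, the matching is an invertible triangular map from the right coefficients β of the
Jost solution to its left coefficients (`leftCoeff`, `Params.jost_eq`). The Weyl function is minus
the logarithmic derivative at z = a of the left part (`Params.weylFn_eq`).

All asymptotics are taken along two rays ρ = rω with ω² = ±i, so that λ runs through the two halves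
of the imaginary axis. There the unperturbed equation scales to λ = ω², for which a decaying
solution, built from the Macdonald function, and a growing one are known (`Params.exists_rayModel`).
In suitable weights the potential is a perturbation of relative size 1/r. One contraction argument
for Volterra equations (`VolterraBound`), used with different weights, supplies existence,
uniqueness, bounds and holomorphy.

Left interval. Let θ, φ be the solutions with data (1, 0), (0, 1) at z = a, and θ*, φ* those for the
second potential. Equality of the Weyl functions says that the left parts, divided by their values
at a, are θ + mφ and θ* + mφ* with the same m, and φθ* - φ*θ = φ(θ* + mφ*) - φ*(θ + mφ). Since ξ₁₂ ≠
0, the left part is not asymptotic to the decaying solution, so after division by its value at a it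
is of size exp(-κr(a - z)) with κ = Im ω, while φ is of size exp(κr(a - z))/r. The expression is
therefore O(1/r) on both rays (`RayModel.tendsto_leftSol_wronskian`). It is entire in λ with growth
exp(O(√|λ|)), so Phragmén–Lindelöf and Liouville make it vanish (`HalfOrder.eq_zero`). Two
fundamental systems with the same quotient and the same Wronskian coincide locally up to a sign,
hence have the same potential (`LocalSol.eq_ae_of_mul_eq_mul`).

Right half-line. Once the left potentials agree, the Weyl function fixes the left coefficients up to
a common factor, and the triangular matching then fixes the ratio of the two entries of β. The same
algebra, with the two solutions normalised at the singular point in place of θ, φ and the Jost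
solution in place of the left part, gives again a function of λ that is O(1/r) on both rays
(`RayModel.tendsto_halfSol_wronskian`), and the argument is repeated. -/

/-! ### Volterra equations with separable kernels -/

/-- Sets `D z` which behave like the half-lines `(-∞, z]` for Volterra integral operators. -/
structure VolterraFamily (D : ℝ → Set ℝ) : Prop where
  meas : ∀ z, MeasurableSet (D z)
  cont : ∀ F : ℝ → ℂ, Integrable F → Continuous (fun z => ∫ t in D z, F t)
  exp_le : ∀ h : ℝ → ℝ, Integrable h → (∀ t, 0 ≤ h t) → ∀ z,
    IntegrableOn (fun t => h t * Real.exp (2 * ∫ s in D t, h s)) (D z) ∧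
    ∫ t in D z, h t * Real.exp (2 * ∫ s in D t, h s) ≤ Real.exp (2 * ∫ s in D z, h s) / 2

lemma setIntegral_Iic_eq {E : Type*} [NormedAddCommGroup E] [NormedSpace ℝ E] {F : ℝ → E}
    (hF : Integrable F) (z : ℝ) :
    ∫ t in Iic z, F t = (∫ t in Iic (0 : ℝ), F t) + ∫ t in (0 : ℝ)..z, F t := by
  have := intervalIntegral.integral_Iic_sub_Iic (a := 0) (b := z) (f := F) (μ := volume)
    hF.integrableOn hF.integrableOn
  rw [← this]; abel

lemma continuous_setIntegral_Iic {E : Type*} [NormedAddCommGroup E] [NormedSpace ℝ E]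
    {F : ℝ → E} (hF : Integrable F) : Continuous (fun z => ∫ t in Iic z, F t) := by
  have h : (fun z => ∫ t in Iic z, F t) =
      fun z => (∫ t in Iic (0 : ℝ), F t) + ∫ t in (0 : ℝ)..z, F t :=
    funext (setIntegral_Iic_eq hF)
  rw [h]
  exact continuous_const.add
    (intervalIntegral.continuous_primitive (fun a b => hF.intervalIntegrable) 0)

lemma integrable_mul_exp_setIntegral_Iic {h : ℝ → ℝ} (hh : Integrable h) (h0 : ∀ t, 0 ≤ h t) :
    Integrable (fun t => h t * Real.exp (2 * ∫ s in Iic t, h s)) := by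
  refine hh.mul_bdd (c := Real.exp (2 * ∫ s, h s)) ?_ ?_
  · exact (Real.continuous_exp.comp
      (continuous_const.mul (continuous_setIntegral_Iic hh))).aestronglyMeasurable
  · refine Eventually.of_forall fun t => ?_
    rw [Real.norm_of_nonneg (Real.exp_pos _).le]
    gcongr
    · exact Eventually.of_forall h0
    · exact Measure.restrict_le_self

/-- With H the primitive of h, the integrand is almost everywhere half the derivative of the
monotone function exp(2H), and the derivative of a monotone function integrates to at most the
increment. The factor 2 in the exponent is what later gives the contraction constant 1/2. -/
lemma setIntegral_Iic_mul_exp_le {h : ℝ → ℝ} (hh : Integrable h) (h0 : ∀ t, 0 ≤ h t) (z : ℝ) :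
    ∫ t in Iic z, h t * Real.exp (2 * ∫ s in Iic t, h s) ≤
      Real.exp (2 * ∫ s in Iic z, h s) / 2 := by
  set H : ℝ → ℝ := fun t => ∫ s in Iic t, h s with hH
  set E : ℝ → ℝ := fun t => Real.exp (2 * H t) with hE
  have hHmono : Monotone H := fun a b hab =>
    setIntegral_mono_set hh.integrableOn (Eventually.of_forall h0)
      (Iic_subset_Iic.2 hab).eventuallyLE
  have hEmono : Monotone E := fun a b hab =>
    Real.exp_le_exp.2 (by linarith [hHmono hab])
  have hderiv : ∀ᵐ t, deriv E t = 2 * (h t * E t) := by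
    filter_upwards [LocallyIntegrable.ae_hasDerivAt_integral hh.locallyIntegrable] with t ht
    have h1 : HasDerivAt H (h t) t := by
      have h2 : H = fun z => (∫ t in Iic (0 : ℝ), h t) + ∫ t in (0 : ℝ)..z, h t :=
        funext (setIntegral_Iic_eq hh)
      rw [h2]
      exact (ht 0).const_add _
    have h3 := ((h1.const_mul 2).exp).deriv
    rw [show E = fun t => Real.exp (2 * H t) from rfl, h3]; ring
  have key : ∀ a ≤ z, ∫ t in a..z, h t * E t ≤ E z / 2 := by
    intro a ha
    have h1 := (hEmono.monotoneOn (uIcc a z)).intervalIntegral_deriv_mem_uIcc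
    have h2 : ∫ t in a..z, deriv E t = 2 * ∫ t in a..z, h t * E t := by
      rw [← intervalIntegral.integral_const_mul]
      apply intervalIntegral.integral_congr_ae
      filter_upwards [hderiv] with t ht _ using ht
    rw [h2, uIcc_of_le (by linarith [hEmono ha]), mem_Icc] at h1
    have : 0 < E a := Real.exp_pos _
    linarith [h1.2]
  have hint := integrable_mul_exp_setIntegral_Iic hh h0
  have hlim := intervalIntegral_tendsto_integral_Iic (μ := volume) z hint.integrableOn
    (tendsto_id (α := ℝ) (x := atBot))
  refine le_of_tendsto hlim ?_
  filter_upwards [eventually_le_atBot z] with a ha using key a ha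

lemma volterraFamily_Iic : VolterraFamily Iic where
  meas _ := measurableSet_Iic
  cont _ hF := continuous_setIntegral_Iic hF
  exp_le _ hh h0 z := ⟨(integrable_mul_exp_setIntegral_Iic hh h0).integrableOn,
    setIntegral_Iic_mul_exp_le hh h0 z⟩

lemma setIntegral_Ici_eq_comp_neg {E : Type*} [NormedAddCommGroup E] [NormedSpace ℝ E]
    (F : ℝ → E) (z : ℝ) : ∫ t in Ici z, F t = ∫ t in Iic (-z), F (-t) := by
  rw [integral_comp_neg_Iic, neg_neg, integral_Ici_eq_integral_Ioi]

lemma volterraFamily_Ici : VolterraFamily Ici where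
  meas _ := measurableSet_Ici
  cont F hF := by
    simp_rw [setIntegral_Ici_eq_comp_neg]
    exact (continuous_setIntegral_Iic hF.comp_neg).comp continuous_neg
  exp_le h hh h0 z := by
    have h1 := setIntegral_Iic_mul_exp_le (h := fun t => h (-t)) hh.comp_neg
      (fun t => h0 _) (-z)
    have h2 := integrable_mul_exp_setIntegral_Iic (h := fun t => h (-t)) hh.comp_neg
      (fun t => h0 _)
    constructor
    · have h3 := h2.comp_neg
      simp only [neg_neg] at h3
      simp_rw [setIntegral_Ici_eq_comp_neg h]
      exact h3.integrableOn
    · rw [setIntegral_Ici_eq_comp_neg]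
      simp_rw [setIntegral_Ici_eq_comp_neg h, neg_neg]
      exact h1

/-- The Volterra operator with the separable kernel `(c1 t * c2 z - c1 z * c2 t) * Q t`. -/
noncomputable def volterraOp (S : ℝ → Set ℝ) (c1 c2 Q y : ℝ → ℂ) (z : ℝ) : ℂ :=
  ∫ t in S z, (c1 t * c2 z - c1 z * c2 t) * Q t * y t

/-- The Picard iterates of the Volterra equation `y = f + volterraOp y`. -/
noncomputable def volterraIter (S : ℝ → Set ℝ) (c1 c2 Q f : ℝ → ℂ) : ℕ → ℝ → ℂ
  | 0 => f
  | n + 1 => volterraOp S c1 c2 Q (volterraIter S c1 c2 Q f n)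

/-- The Neumann series solution of `y = f + volterraOp y`. -/
noncomputable def volterraSol (S : ℝ → Set ℝ) (c1 c2 Q f : ℝ → ℂ) (z : ℝ) : ℂ :=
  ∑' n, volterraIter S c1 c2 Q f n z

/-- Hypotheses under which `volterraOp` is a contraction in the norm weighted by `N`. -/
structure VolterraBound (S D : ℝ → Set ℝ) (X : Set ℝ) (c1 c2 Q : ℝ → ℂ) (N h : ℝ → ℝ) :
    Prop where
  fam : VolterraFamily D
  measX : MeasurableSet X
  S_eq : ∀ z ∈ X, S z = X ∩ D z
  cont1 : ContinuousOn c1 X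
  cont2 : ContinuousOn c2 X
  contN : ContinuousOn N X
  measQ : AEStronglyMeasurable Q (volume.restrict X)
  posN : ∀ z ∈ X, 0 < N z
  nonneg : ∀ t ∈ X, 0 ≤ h t
  inth : IntegrableOn h X
  bound : ∀ z ∈ X, ∀ t ∈ X ∩ D z,
    ‖c1 t * c2 z - c1 z * c2 t‖ * ‖Q t‖ * N t ≤ N z * h t
  int1 : IntegrableOn (fun t => ‖c1 t‖ * ‖Q t‖ * N t) X
  int2 : IntegrableOn (fun t => ‖c2 t‖ * ‖Q t‖ * N t) X

namespace VolterraBound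

variable {S D : ℝ → Set ℝ} {X : Set ℝ} {c1 c2 Q : ℝ → ℂ} {N h : ℝ → ℝ}

/-- The exponential weight making the operator a contraction. -/
noncomputable def expWeight (X : Set ℝ) (D : ℝ → Set ℝ) (h : ℝ → ℝ) (z : ℝ) : ℝ :=
  Real.exp (2 * ∫ s in D z, X.indicator h s)

lemma integrable_indicator (B : VolterraBound S D X c1 c2 Q N h) :
    Integrable (X.indicator h) := B.inth.integrable_indicator B.measX

lemma indicator_nonneg (B : VolterraBound S D X c1 c2 Q N h) (t : ℝ) : 0 ≤ X.indicator h t :=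
  Set.indicator_nonneg B.nonneg t

lemma setIntegral_nonneg (B : VolterraBound S D X c1 c2 Q N h) : 0 ≤ ∫ t in X, h t :=
  MeasureTheory.setIntegral_nonneg B.measX B.nonneg

lemma one_le_expWeight (B : VolterraBound S D X c1 c2 Q N h) (z : ℝ) :
    1 ≤ expWeight X D h z :=
  Real.one_le_exp (mul_nonneg zero_le_two
    (integral_nonneg_of_ae (Eventually.of_forall B.indicator_nonneg)))

lemma expWeight_le (B : VolterraBound S D X c1 c2 Q N h) (z : ℝ) :
    expWeight X D h z ≤ Real.exp (2 * ∫ t in X, h t) := by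
  unfold expWeight
  rw [← integral_indicator B.measX]
  gcongr
  · exact Eventually.of_forall B.indicator_nonneg
  · exact B.integrable_indicator
  · exact Measure.restrict_le_self

lemma integrableOn_weight (B : VolterraBound S D X c1 c2 Q N h) {z : ℝ} (hz : z ∈ X) :
    IntegrableOn (fun t => h t * expWeight X D h t) (S z) := by
  have h1 := (B.fam.exp_le _ B.integrable_indicator B.indicator_nonneg z).1
  rw [B.S_eq z hz]
  refine (h1.mono_set inter_subset_right).congr_fun (fun t ht => ?_)
    (B.measX.inter (B.fam.meas z))
  simp only [indicator_of_mem ht.1, expWeight]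

lemma setIntegral_weight_le (B : VolterraBound S D X c1 c2 Q N h) {z : ℝ} (hz : z ∈ X) :
    ∫ t in S z, h t * expWeight X D h t ≤ expWeight X D h z / 2 := by
  have h1 := (B.fam.exp_le _ B.integrable_indicator B.indicator_nonneg z).2
  rw [B.S_eq z hz, inter_comm, ← setIntegral_indicator B.measX]
  refine le_trans (le_of_eq ?_) h1
  refine integral_congr_ae (Eventually.of_forall fun t => ?_)
  by_cases ht : t ∈ X <;> simp [ht, expWeight]

/-- The contraction estimate. By `bound` the kernel times N t is at most N z * h t, and the integral
of h against its own exponential weight returns half of that weight at z. The integrable majorant is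
kept because the exchange of sum and integral and the holomorphy in a parameter both need it. -/
lemma norm_volterraOp_le (B : VolterraBound S D X c1 c2 Q N h) {y : ℝ → ℂ} {K : ℝ}
    (hy : ∀ z ∈ X, ‖y z‖ ≤ K * (N z * expWeight X D h z)) {z : ℝ} (hz : z ∈ X) :
    ∫ t in S z, K * (N z * (h t * expWeight X D h t)) ≤ K / 2 * (N z * expWeight X D h z) ∧
    IntegrableOn (fun t => K * (N z * (h t * expWeight X D h t))) (S z) ∧
    ∀ t ∈ S z, ‖(c1 t * c2 z - c1 z * c2 t) * Q t * y t‖ ≤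
      K * (N z * (h t * expWeight X D h t)) := by
  have hK : 0 ≤ K := by
    have h1 := (norm_nonneg _).trans (hy z hz)
    exact nonneg_of_mul_nonneg_left h1 (mul_pos (B.posN z hz) (Real.exp_pos _))
  refine ⟨?_, ((B.integrableOn_weight hz).const_mul _).const_mul _, ?_⟩
  · rw [integral_const_mul, integral_const_mul]
    have := B.setIntegral_weight_le hz
    have hN := B.posN z hz
    calc _ ≤ K * (N z * (expWeight X D h z / 2)) := by gcongr
      _ = _ := by ring
  · intro t ht
    rw [B.S_eq z hz] at ht
    rw [norm_mul, norm_mul]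
    have h1 := B.bound z hz t ht
    have h2 := hy t ht.1
    have hE : 0 < expWeight X D h t := Real.exp_pos _
    calc _ ≤ ‖c1 t * c2 z - c1 z * c2 t‖ * ‖Q t‖ * (K * (N t * expWeight X D h t)) := by gcongr
      _ = K * expWeight X D h t * (‖c1 t * c2 z - c1 z * c2 t‖ * ‖Q t‖ * N t) := by ring
      _ ≤ K * expWeight X D h t * (N z * h t) := by gcongr
      _ = _ := by ring

lemma measurableSet_S (B : VolterraBound S D X c1 c2 Q N h) {z : ℝ} (hz : z ∈ X) :
    MeasurableSet (S z) := by
  rw [B.S_eq z hz]; exact B.measX.inter (B.fam.meas z)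

lemma op_bound (B : VolterraBound S D X c1 c2 Q N h) {y : ℝ → ℂ} {K : ℝ}
    (hy : ∀ z ∈ X, ‖y z‖ ≤ K * (N z * expWeight X D h z)) {z : ℝ} (hz : z ∈ X) :
    ‖volterraOp S c1 c2 Q y z‖ ≤ K / 2 * (N z * expWeight X D h z) := by
  obtain ⟨h1, h2, h3⟩ := B.norm_volterraOp_le hy hz
  refine le_trans (norm_integral_le_of_norm_le h2 ?_) h1
  exact (ae_restrict_iff' (B.measurableSet_S hz)).2 (Eventually.of_forall h3)

lemma integrableOn_mul (B : VolterraBound S D X c1 c2 Q N h) {y : ℝ → ℂ} {K : ℝ}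
    (hyc : ContinuousOn y X) (hy : ∀ z ∈ X, ‖y z‖ ≤ K * N z) :
    IntegrableOn (fun t => c1 t * Q t * y t) X ∧ IntegrableOn (fun t => c2 t * Q t * y t) X := by
  have aux : ∀ c : ℝ → ℂ, ContinuousOn c X → IntegrableOn (fun t => ‖c t‖ * ‖Q t‖ * N t) X →
      IntegrableOn (fun t => c t * Q t * y t) X := by
    intro c hc hi
    refine Integrable.mono' (hi.const_mul K) ?_ ?_
    · exact ((hc.aestronglyMeasurable B.measX).mul B.measQ).mul (hyc.aestronglyMeasurable B.measX)
    · refine (ae_restrict_iff' B.measX).2 (Eventually.of_forall fun t ht => ?_)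
      rw [norm_mul, norm_mul]
      calc _ ≤ ‖c t‖ * ‖Q t‖ * (K * N t) := by gcongr; exact hy t ht
        _ = _ := by ring
  exact ⟨aux c1 B.cont1 B.int1, aux c2 B.cont2 B.int2⟩

lemma volterraOp_eq (B : VolterraBound S D X c1 c2 Q N h) {y : ℝ → ℂ}
    (h1 : IntegrableOn (fun t => c1 t * Q t * y t) X)
    (h2 : IntegrableOn (fun t => c2 t * Q t * y t) X) {z : ℝ} (hz : z ∈ X) :
    volterraOp S c1 c2 Q y z =
      c2 z * (∫ t in S z, c1 t * Q t * y t) - c1 z * ∫ t in S z, c2 t * Q t * y t := by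
  have hS : S z ⊆ X := by rw [B.S_eq z hz]; exact inter_subset_left
  rw [← integral_const_mul, ← integral_const_mul, ← integral_sub]
  · unfold volterraOp
    congr 1; ext t; ring
  · exact (h1.mono_set hS).const_mul _
  · exact (h2.mono_set hS).const_mul _

lemma continuousOn_setIntegral (B : VolterraBound S D X c1 c2 Q N h) {F : ℝ → ℂ}
    (hF : IntegrableOn F X) : ContinuousOn (fun z => ∫ t in S z, F t) X := by
  have h1 := B.fam.cont _ (hF.integrable_indicator B.measX)
  refine h1.continuousOn.congr fun z hz => ?_
  simp only
  rw [B.S_eq z hz, setIntegral_indicator B.measX, inter_comm]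

lemma continuousOn_op (B : VolterraBound S D X c1 c2 Q N h) {y : ℝ → ℂ} {K : ℝ}
    (hyc : ContinuousOn y X) (hy : ∀ z ∈ X, ‖y z‖ ≤ K * N z) :
    ContinuousOn (volterraOp S c1 c2 Q y) X := by
  obtain ⟨h1, h2⟩ := B.integrableOn_mul hyc hy
  refine ContinuousOn.congr ?_ (fun z hz => B.volterraOp_eq h1 h2 hz)
  exact (B.cont2.mul (B.continuousOn_setIntegral h1)).sub
    (B.cont1.mul (B.continuousOn_setIntegral h2))

lemma le_of_le_expWeight (B : VolterraBound S D X c1 c2 Q N h) {x K : ℝ} (hK : 0 ≤ K) {z : ℝ}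
    (hz : z ∈ X) (hx : x ≤ K * (N z * expWeight X D h z)) :
    x ≤ K * Real.exp (2 * ∫ t in X, h t) * N z := by
  have := B.expWeight_le z
  have hN := B.posN z hz
  calc x ≤ _ := hx
    _ ≤ K * (N z * Real.exp (2 * ∫ t in X, h t)) := by gcongr
    _ = _ := by ring

lemma iter_spec (B : VolterraBound S D X c1 c2 Q N h) {f : ℝ → ℂ} {K : ℝ} (hK : 0 ≤ K)
    (hfc : ContinuousOn f X) (hf : ∀ z ∈ X, ‖f z‖ ≤ K * N z) (n : ℕ) :
    ContinuousOn (volterraIter S c1 c2 Q f n) X ∧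
    ∀ z ∈ X, ‖volterraIter S c1 c2 Q f n z‖ ≤ K * (1 / 2) ^ n * (N z * expWeight X D h z) := by
  induction n with
  | zero =>
    refine ⟨hfc, fun z hz => ?_⟩
    have h1 := B.one_le_expWeight z
    have hN := B.posN z hz
    calc ‖f z‖ ≤ K * (N z * 1) := by simpa using hf z hz
      _ ≤ K * (1 / 2) ^ 0 * (N z * expWeight X D h z) := by
        rw [pow_zero, mul_one K]; gcongr
  | succ n ih =>
    have hK' : 0 ≤ K * (1 / 2) ^ n := by positivity
    refine ⟨B.continuousOn_op ih.1 (fun z hz => B.le_of_le_expWeight hK' hz (ih.2 z hz)),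
      fun z hz => ?_⟩
    refine (B.op_bound ih.2 hz).trans (le_of_eq ?_)
    rw [pow_succ]; ring

lemma summable_iter (B : VolterraBound S D X c1 c2 Q N h) {f : ℝ → ℂ} {K : ℝ} (hK : 0 ≤ K)
    (hfc : ContinuousOn f X) (hf : ∀ z ∈ X, ‖f z‖ ≤ K * N z) {z : ℝ} (hz : z ∈ X) :
    Summable (fun n => volterraIter S c1 c2 Q f n z) := by
  refine Summable.of_norm_bounded (g := fun n => K * (N z * expWeight X D h z) * (1 / 2) ^ n)
    (summable_geometric_two.mul_left _) (fun n => ?_)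
  exact ((B.iter_spec hK hfc hf n).2 z hz).trans (le_of_eq (by ring))

lemma norm_sol_le' (B : VolterraBound S D X c1 c2 Q N h) {f : ℝ → ℂ} {K : ℝ} (hK : 0 ≤ K)
    (hfc : ContinuousOn f X) (hf : ∀ z ∈ X, ‖f z‖ ≤ K * N z) {z : ℝ} (hz : z ∈ X) :
    ‖volterraSol S c1 c2 Q f z‖ ≤ 2 * K * (N z * expWeight X D h z) := by
  refine (tsum_of_norm_bounded (hasSum_geometric_two.mul_left (K * (N z * expWeight X D h z)))
    (fun n => ?_)).trans (le_of_eq (by ring))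
  exact ((B.iter_spec hK hfc hf n).2 z hz).trans (le_of_eq (by ring))

lemma norm_sol_le (B : VolterraBound S D X c1 c2 Q N h) {f : ℝ → ℂ} {K : ℝ} (hK : 0 ≤ K)
    (hfc : ContinuousOn f X) (hf : ∀ z ∈ X, ‖f z‖ ≤ K * N z) {z : ℝ} (hz : z ∈ X) :
    ‖volterraSol S c1 c2 Q f z‖ ≤ 2 * K * Real.exp (2 * ∫ t in X, h t) * N z :=
  B.le_of_le_expWeight (by positivity) hz (B.norm_sol_le' hK hfc hf hz)

/-- The bounds on the iterates are relative to N, which may be unbounded on X. Division by N makes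
the series uniformly convergent, and N is multiplied back afterwards. -/
lemma continuousOn_sol (B : VolterraBound S D X c1 c2 Q N h) {f : ℝ → ℂ} {K : ℝ} (hK : 0 ≤ K)
    (hfc : ContinuousOn f X) (hf : ∀ z ∈ X, ‖f z‖ ≤ K * N z) :
    ContinuousOn (volterraSol S c1 c2 Q f) X := by
  have hNc : ContinuousOn (fun z => ((N z : ℝ) : ℂ)) X :=
    Complex.continuous_ofReal.comp_continuousOn B.contN
  have h0 : ∀ z ∈ X, ((N z : ℝ) : ℂ) ≠ 0 := fun z hz =>
    Complex.ofReal_ne_zero.2 (B.posN z hz).ne'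
  have h1 : ContinuousOn (fun z => ∑' n, volterraIter S c1 c2 Q f n z / ((N z : ℝ) : ℂ)) X := by
    refine continuousOn_tsum (u := fun n => K * Real.exp (2 * ∫ t in X, h t) * (1 / 2) ^ n)
      (fun n => (B.iter_spec hK hfc hf n).1.div hNc h0) (summable_geometric_two.mul_left _) ?_
    intro n z hz
    have hN := B.posN z hz
    rw [norm_div, Complex.norm_of_nonneg hN.le, div_le_iff₀ hN]
    refine (B.le_of_le_expWeight (by positivity) hz ((B.iter_spec hK hfc hf n).2 z hz)).trans
      (le_of_eq (by ring))
  refine (hNc.mul h1).congr fun z hz => ?_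
  simp only [volterraSol, Pi.mul_apply]
  rw [tsum_div_const, mul_div_cancel₀ _ (h0 z hz)]

lemma sol_eq (B : VolterraBound S D X c1 c2 Q N h) {f : ℝ → ℂ} {K : ℝ} (hK : 0 ≤ K)
    (hfc : ContinuousOn f X) (hf : ∀ z ∈ X, ‖f z‖ ≤ K * N z) {z : ℝ} (hz : z ∈ X) :
    volterraSol S c1 c2 Q f z = f z + volterraOp S c1 c2 Q (volterraSol S c1 c2 Q f) z := by
  have hsum := B.summable_iter hK hfc hf hz
  have hS : S z ⊆ X := by rw [B.S_eq z hz]; exact inter_subset_left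
  set F : ℕ → ℝ → ℂ := fun n t =>
    (c1 t * c2 z - c1 z * c2 t) * Q t * volterraIter S c1 c2 Q f n t with hF
  have hb : ∀ n, ∫ t in S z, ‖F n t‖ ≤ K / 2 * (N z * expWeight X D h z) * (1 / 2) ^ n ∧
      IntegrableOn (F n) (S z) := by
    intro n
    obtain ⟨h1, h2, h3⟩ := B.norm_volterraOp_le (B.iter_spec hK hfc hf n).2 hz
    have hm : AEStronglyMeasurable (F n) (volume.restrict (S z)) := by
      have hi := B.integrableOn_mul (B.iter_spec hK hfc hf n).1
        (fun z hz => B.le_of_le_expWeight (by positivity) hz ((B.iter_spec hK hfc hf n).2 z hz))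
      have := ((hi.1.mono_set hS).const_mul (c2 z)).sub ((hi.2.mono_set hS).const_mul (c1 z))
      refine this.aestronglyMeasurable.congr (Eventually.of_forall fun t => ?_)
      simp only [hF, Pi.sub_apply]; ring
    have h3' := (ae_restrict_iff' (μ := volume) (B.measurableSet_S hz)).2 (Eventually.of_forall h3)
    have hi : IntegrableOn (F n) (S z) := Integrable.mono' h2 hm h3'
    refine ⟨?_, hi⟩
    refine (integral_mono_ae hi.norm h2 h3').trans (h1.trans (le_of_eq (by ring)))
  have h1 := hasSum_integral_of_summable_integral_norm (fun n => (hb n).2)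
    (Summable.of_nonneg_of_le (fun n => integral_nonneg fun t => norm_nonneg _)
      (fun n => (hb n).1) (summable_geometric_two.mul_left _))
  unfold volterraSol
  rw [hsum.tsum_eq_zero_add]
  congr 1
  calc ∑' n, volterraIter S c1 c2 Q f (n + 1) z = ∑' n, ∫ t in S z, F n t := rfl
    _ = _ := h1.tsum_eq
    _ = _ := by
      unfold volterraOp
      refine integral_congr_ae (Eventually.of_forall fun t => ?_)
      simp only [hF]
      rw [tsum_mul_left]

/-- The difference is the operator applied once to the solution, hence proportional to the integral
of h. It is small either because h carries a factor 1/r, or because the domain of integration is a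
tail. -/
lemma norm_sol_sub_le (B : VolterraBound S D X c1 c2 Q N h) {f : ℝ → ℂ} {K : ℝ} (hK : 0 ≤ K)
    (hfc : ContinuousOn f X) (hf : ∀ z ∈ X, ‖f z‖ ≤ K * N z) {z : ℝ} (hz : z ∈ X) :
    ‖volterraSol S c1 c2 Q f z - f z‖ ≤
      2 * K * Real.exp (2 * ∫ t in X, h t) * N z * ∫ t in S z, h t := by
  have hS : S z ⊆ X := by rw [B.S_eq z hz]; exact inter_subset_left
  rw [B.sol_eq hK hfc hf hz, add_sub_cancel_left, ← integral_const_mul]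
  refine norm_integral_le_of_norm_le ((B.inth.mono_set hS).const_mul _) ?_
  refine (ae_restrict_iff' (B.measurableSet_S hz)).2 (Eventually.of_forall fun t ht => ?_)
  rw [B.S_eq z hz] at ht
  have h1 := B.bound z hz t ht
  rw [norm_mul, norm_mul]
  calc _ ≤ ‖c1 t * c2 z - c1 z * c2 t‖ * ‖Q t‖ *
        (2 * K * Real.exp (2 * ∫ t in X, h t) * N t) := by
        gcongr; exact B.norm_sol_le hK hfc hf ht.1
    _ = 2 * K * Real.exp (2 * ∫ t in X, h t) *
        (‖c1 t * c2 z - c1 z * c2 t‖ * ‖Q t‖ * N t) := by ring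
    _ ≤ 2 * K * Real.exp (2 * ∫ t in X, h t) * (N z * h t) := by gcongr
    _ = _ := by ring

lemma norm_sol_sub_le' (B : VolterraBound S D X c1 c2 Q N h) {f : ℝ → ℂ} {K : ℝ} (hK : 0 ≤ K)
    (hfc : ContinuousOn f X) (hf : ∀ z ∈ X, ‖f z‖ ≤ K * N z) {z : ℝ} (hz : z ∈ X) :
    ‖volterraSol S c1 c2 Q f z - f z‖ ≤
      2 * K * Real.exp (2 * ∫ t in X, h t) * N z * ∫ t in X, h t := by
  have hS : S z ⊆ X := by rw [B.S_eq z hz]; exact inter_subset_left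
  refine (B.norm_sol_sub_le hK hfc hf hz).trans ?_
  have hN := B.posN z hz
  have : ∫ t in S z, h t ≤ ∫ t in X, h t :=
    setIntegral_mono_set B.inth ((ae_restrict_iff' B.measX).2 (Eventually.of_forall B.nonneg))
      hS.eventuallyLE
  gcongr

/-- The contraction can be applied any number of times, each time gaining a factor 1/2. Uniqueness
is thus obtained in the class of functions bounded by a multiple of N. -/
lemma eq_zero_of_eq_op (B : VolterraBound S D X c1 c2 Q N h) {d : ℝ → ℂ} {K : ℝ}
    (hd : ∀ z ∈ X, ‖d z‖ ≤ K * N z) (heq : ∀ z ∈ X, d z = volterraOp S c1 c2 Q d z)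
    {z : ℝ} (hz : z ∈ X) : d z = 0 := by
  have hK : 0 ≤ K := nonneg_of_mul_nonneg_left ((norm_nonneg _).trans (hd z hz)) (B.posN z hz)
  have key : ∀ n : ℕ, ∀ z ∈ X, ‖d z‖ ≤ K * (1 / 2) ^ n * (N z * expWeight X D h z) := by
    intro n
    induction n with
    | zero =>
      intro z hz
      have h1 := B.one_le_expWeight z
      have hN := B.posN z hz
      calc ‖d z‖ ≤ K * (N z * 1) := by simpa using hd z hz
        _ ≤ K * (1 / 2) ^ 0 * (N z * expWeight X D h z) := by
          rw [pow_zero, mul_one K]; gcongr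
    | succ n ih =>
      intro z hz
      rw [heq z hz]
      refine (B.op_bound ih hz).trans (le_of_eq ?_)
      rw [pow_succ]; ring
  have hlim : Tendsto (fun n : ℕ => K * (1 / 2 : ℝ) ^ n * (N z * expWeight X D h z)) atTop
      (𝓝 (K * 0 * (N z * expWeight X D h z))) :=
    ((tendsto_pow_atTop_nhds_zero_of_lt_one (by norm_num) (by norm_num)).const_mul K).mul_const _
  have := ge_of_tendsto' hlim (fun n => key n z hz)
  simpa using this

end VolterraBound

/-! ### Holomorphic dependence on a parameter -/

/-- Holomorphy of a dominated parametric integral with holomorphic integrand. -/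
lemma differentiableOn_integral {α : Type*} [MeasurableSpace α] {μ : Measure α} {U : Set ℂ}
    (hU : IsOpen U) {F : ℂ → α → ℂ} {b : α → ℝ}
    (hm : ∀ l ∈ U, AEStronglyMeasurable (F l) μ)
    (hd : ∀ᵐ t ∂μ, DifferentiableOn ℂ (fun l => F l t) U)
    (hb : ∀ᵐ t ∂μ, ∀ l ∈ U, ‖F l t‖ ≤ b t) (hbi : Integrable b μ) :
    DifferentiableOn ℂ (fun l => ∫ t, F l t ∂μ) U := by
  intro l₀ hl₀
  obtain ⟨ε, hε, hball⟩ := Metric.isOpen_iff.1 hU l₀ hl₀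
  have hint : Integrable (F l₀) μ := hbi.mono' (hm l₀ hl₀) (hb.mono fun t ht => ht l₀ hl₀)
  have hmem : Metric.ball l₀ (ε / 2) ⊆ U := (Metric.ball_subset_ball (by linarith)).trans hball
  refine (hasDerivAt_integral_of_dominated_loc_of_deriv_le (𝕜 := ℂ) (F := F)
    (F' := fun l t => deriv (fun l => F l t) l) (bound := fun t => b t / (ε / 4))
    (Metric.ball_mem_nhds l₀ (by positivity : 0 < ε / 2)) ?_ hint ?_ ?_ (hbi.div_const _) ?_).2
      |>.differentiableAt.differentiableWithinAt
  · filter_upwards [hU.mem_nhds hl₀] with l hl using hm l hl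
  -- The derivative of the integrand is measurable as a limit of difference quotients along a
  -- sequence tending to l₀.
  · have hu : Tendsto (fun n : ℕ => l₀ + ((ε / 2 / ((n : ℝ) + 1) : ℝ) : ℂ)) atTop (𝓝[≠] l₀) := by
      refine tendsto_nhdsWithin_iff.2 ⟨?_, Eventually.of_forall fun n => ?_⟩
      · have h1 : Tendsto (fun n : ℕ => ε / 2 / ((n : ℝ) + 1)) atTop (𝓝 0) :=
          tendsto_const_nhds.div_atTop
            (tendsto_atTop_add_const_right _ _ tendsto_natCast_atTop_atTop)
        have h2 := (Complex.continuous_ofReal.tendsto 0).comp h1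
        simpa using h2.const_add l₀
      · have : ((ε / 2 / ((n : ℝ) + 1) : ℝ) : ℂ) ≠ 0 :=
          Complex.ofReal_ne_zero.2 (by positivity)
        simpa using this
    refine aestronglyMeasurable_of_tendsto_ae atTop
      (f := fun (n : ℕ) t => slope (fun l => F l t) l₀ (l₀ + ((ε / 2 / ((n : ℝ) + 1) : ℝ) : ℂ)))
      (fun n => ?_) ?_
    · simp only [slope, vsub_eq_sub]
      refine AEStronglyMeasurable.const_smul (𝕜 := ℂ) (AEStronglyMeasurable.sub (hm _ (hball ?_))
        (hm _ hl₀)) _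
      rw [Metric.mem_ball, dist_eq_norm, add_sub_cancel_left,
        Complex.norm_of_nonneg (by positivity)]
      have : ε / 2 / ((n : ℝ) + 1) ≤ ε / 2 :=
        div_le_self (by positivity) (by linarith [(Nat.cast_nonneg n : (0 : ℝ) ≤ n)])
      linarith
    · filter_upwards [hd] with t ht
      exact (hasDerivAt_iff_tendsto_slope.1
        ((ht l₀ hl₀).differentiableAt (hU.mem_nhds hl₀)).hasDerivAt).comp hu
  · filter_upwards [hd, hb] with t ht hbt l hl
    -- Cauchy's estimate: a circle of radius ε/4 around a point of the ball of radius ε/2 stays in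
    -- the ball of radius ε, where b is a bound.
    refine Complex.norm_deriv_le_of_forall_mem_sphere_norm_le (by positivity) ?_ ?_
    · refine DifferentiableOn.diffContOnCl (ht.mono ?_)
      rw [closure_ball _ (by positivity)]
      intro w hw
      refine hball ?_
      rw [Metric.mem_closedBall] at hw
      rw [Metric.mem_ball] at hl ⊢
      linarith [dist_triangle w l l₀]
    · intro w hw
      refine hbt w (hball ?_)
      rw [Metric.mem_sphere] at hw
      rw [Metric.mem_ball] at hl ⊢
      linarith [dist_triangle w l l₀]
  · filter_upwards [hd] with t ht l hl
    exact ((ht l (hmem hl)).differentiableAt (hU.mem_nhds (hmem hl))).hasDerivAt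

/-- The Neumann series solution depends holomorphically on a parameter. -/
lemma differentiableOn_volterraSol {S D : ℝ → Set ℝ} {X : Set ℝ} {c1 c2 f : ℂ → ℝ → ℂ}
    {Q : ℝ → ℂ} {N h : ℝ → ℝ} {U : Set ℂ} (hU : IsOpen U)
    (B : ∀ l ∈ U, VolterraBound S D X (c1 l) (c2 l) Q N h) {K : ℝ} (hK : 0 ≤ K)
    (hfc : ∀ l ∈ U, ContinuousOn (f l) X) (hf : ∀ l ∈ U, ∀ z ∈ X, ‖f l z‖ ≤ K * N z)
    (hd1 : ∀ t ∈ X, DifferentiableOn ℂ (fun l => c1 l t) U)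
    (hd2 : ∀ t ∈ X, DifferentiableOn ℂ (fun l => c2 l t) U)
    (hdf : ∀ t ∈ X, DifferentiableOn ℂ (fun l => f l t) U) {z : ℝ} (hz : z ∈ X) :
    DifferentiableOn ℂ (fun l => volterraSol S (c1 l) (c2 l) Q (f l) z) U := by
  -- Each iterate is holomorphic by the previous lemma, with the contraction bound as majorant. That
  -- bound involves only N and h, which do not depend on the parameter.
  have hiter : ∀ n, ∀ z ∈ X,
      DifferentiableOn ℂ (fun l => volterraIter S (c1 l) (c2 l) Q (f l) n z) U := by
    intro n
    induction n with
    | zero => exact hdf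
    | succ n ih =>
      intro z hz
      rcases U.eq_empty_or_nonempty with rfl | ⟨l₁, hl₁⟩
      · exact differentiableOn_empty
      have hSX : S z ⊆ X := by rw [(B l₁ hl₁).S_eq z hz]; exact inter_subset_left
      have hSm := (B l₁ hl₁).measurableSet_S hz
      refine differentiableOn_integral hU (μ := volume.restrict (S z))
        (b := fun t => K * (1 / 2) ^ n * (N z * (h t * VolterraBound.expWeight X D h t)))
        ?_ ?_ ?_ ?_
      · intro l hl
        have hi := (B l hl).integrableOn_mul ((B l hl).iter_spec hK (hfc l hl) (hf l hl) n).1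
          (fun z hz => (B l hl).le_of_le_expWeight (by positivity) hz
            (((B l hl).iter_spec hK (hfc l hl) (hf l hl) n).2 z hz))
        have := ((hi.1.mono_set hSX).const_mul (c2 l z)).sub
          ((hi.2.mono_set hSX).const_mul (c1 l z))
        refine this.aestronglyMeasurable.congr (Eventually.of_forall fun t => ?_)
        simp only [Pi.sub_apply]; ring
      · refine (ae_restrict_iff' hSm).2 (Eventually.of_forall fun t ht => ?_)
        exact ((((hd1 t (hSX ht)).mul (hd2 z hz)).sub ((hd1 z hz).mul (hd2 t (hSX ht)))).mul_const
          (Q t)).mul (ih t (hSX ht))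
      · refine (ae_restrict_iff' hSm).2 (Eventually.of_forall fun t ht l hl => ?_)
        exact ((B l hl).norm_volterraOp_le
          ((B l hl).iter_spec hK (hfc l hl) (hf l hl) n).2 hz).2.2 t ht
      · exact ((B l₁ hl₁).norm_volterraOp_le
          ((B l₁ hl₁).iter_spec hK (hfc l₁ hl₁) (hf l₁ hl₁) n).2 hz).2.1
  refine Complex.differentiableOn_tsum_of_summable_norm
    (u := fun n => K * (N z * VolterraBound.expWeight X D h z) * (1 / 2) ^ n)
    (summable_geometric_two.mul_left _) (fun n => hiter n z hz) hU ?_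
  intro n l hl
  exact (((B l hl).iter_spec hK (hfc l hl) (hf l hl) n).2 z hz).trans (le_of_eq (by ring))

/-! ### A Phragmén–Lindelöf argument for order 1/2 -/

lemma exists_bound_of_tendsto_zero {g : ℝ → ℂ} (hc : Continuous g)
    (h : Tendsto g atTop (𝓝 0)) : ∃ M, ∀ t, 0 ≤ t → ‖g t‖ ≤ M := by
  have h1 : ∀ᶠ t in atTop, ‖g t‖ ≤ 1 := by
    have := (tendsto_zero_iff_norm_tendsto_zero.1 h).eventually (ge_mem_nhds zero_lt_one)
    exact this
  obtain ⟨T, hT⟩ := eventually_atTop.1 h1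
  obtain ⟨M, hM⟩ := (isCompact_Icc (a := (0 : ℝ)) (b := T)).exists_bound_of_continuousOn
    hc.continuousOn
  refine ⟨max M 1, fun t ht => ?_⟩
  rcases le_total t T with h2 | h2
  · exact (hM t ⟨ht, h2⟩).trans (le_max_left _ _)
  · exact (hT t h2).trans (le_max_right _ _)

/-- An entire function of order at most `1/2` which tends to zero along both halves of the
imaginary axis vanishes. -/
lemma eq_zero_of_tendsto_zero_imaginary {F : ℂ → ℂ} (hF : Differentiable ℂ F) {A B : ℝ}
    (hg : ∀ l, ‖F l‖ ≤ A * Real.exp (B * √‖l‖))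
    (h1 : Tendsto (fun t : ℝ => F (t * Complex.I)) atTop (𝓝 0))
    (h2 : Tendsto (fun t : ℝ => F (-t * Complex.I)) atTop (𝓝 0)) (l : ℂ) : F l = 0 := by
  -- Substituting l = iz² maps the real and imaginary z-axes onto the two halves of the imaginary
  -- l-axis and raises the order from 1/2 to 1, below the critical order 2 for a quadrant. So H is
  -- bounded in all four quadrants, hence constant.
  set H : ℂ → ℂ := fun z => F (Complex.I * z ^ 2) with hH
  have hHd : Differentiable ℂ H := hF.comp ((differentiable_id.pow 2).const_mul _)
  obtain ⟨M1, hM1⟩ := exists_bound_of_tendsto_zero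
    (hF.continuous.comp (by fun_prop : Continuous fun t : ℝ => (t : ℂ) * Complex.I)) h1
  obtain ⟨M2, hM2⟩ := exists_bound_of_tendsto_zero
    (hF.continuous.comp (by fun_prop : Continuous fun t : ℝ => -(t : ℂ) * Complex.I)) h2
  set M := max M1 M2
  have hre : ∀ x : ℝ, ‖H x‖ ≤ M := by
    intro x
    have := hM1 (x ^ 2) (sq_nonneg x)
    refine le_trans (le_of_eq ?_) (this.trans (le_max_left _ _))
    simp only [hH, Function.comp]; push_cast; rw [mul_comm]
  have him : ∀ x : ℝ, ‖H (x * Complex.I)‖ ≤ M := by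
    intro x
    have := hM2 (x ^ 2) (sq_nonneg x)
    refine le_trans (le_of_eq ?_) (this.trans (le_max_right _ _))
    simp only [hH, Function.comp]; push_cast; rw [mul_pow, Complex.I_sq]; ring_nf
  have hgrowth : ∀ l : Filter ℂ, ∃ c < (2 : ℝ), ∃ B', H =O[l] fun z => Real.exp (B' * ‖z‖ ^ c) := by
    intro l
    refine ⟨1, by norm_num, B, Asymptotics.IsBigO.of_bound A (Eventually.of_forall fun z => ?_)⟩
    rw [Real.norm_of_nonneg (Real.exp_pos _).le, Real.rpow_one]
    refine (hg _).trans (le_of_eq ?_)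
    rw [norm_mul, Complex.norm_I, one_mul, norm_pow, Real.sqrt_sq (norm_nonneg _)]
  have hbound : ∀ z, ‖H z‖ ≤ M := by
    intro z
    rcases le_total 0 z.re with hz | hz <;> rcases le_total 0 z.im with hw | hw
    · exact PhragmenLindelof.quadrant_I hHd.diffContOnCl (hgrowth _) (fun x _ => hre x)
        (fun x _ => him x) hz hw
    · exact PhragmenLindelof.quadrant_IV hHd.diffContOnCl (hgrowth _) (fun x _ => hre x)
        (fun x _ => him x) hz hw
    · exact PhragmenLindelof.quadrant_II hHd.diffContOnCl (hgrowth _) (fun x _ => hre x)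
        (fun x _ => him x) hz hw
    · exact PhragmenLindelof.quadrant_III hHd.diffContOnCl (hgrowth _) (fun x _ => hre x)
        (fun x _ => him x) hz hw
  have hb : Bornology.IsBounded (range H) :=
    isBounded_iff_forall_norm_le.2 ⟨M, by rintro _ ⟨z, rfl⟩; exact hbound z⟩
  have hconst : ∀ z, H z = H 0 := fun z => hHd.apply_eq_apply_of_bounded hb z 0
  have hzero : H 0 = 0 := by
    have h3 : ∀ᶠ t : ℝ in atTop, F (t * Complex.I) = H 0 := by
      filter_upwards [eventually_ge_atTop 0] with t ht
      rw [← hconst (√t : ℝ)]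
      simp only [hH]
      rw [← Complex.ofReal_pow, Real.sq_sqrt ht, mul_comm]
    exact tendsto_nhds_unique (tendsto_const_nhds.congr' (h3.mono fun t ht => ht.symm)) h1
  obtain ⟨z, hz⟩ := IsAlgClosed.exists_pow_nat_eq (l / Complex.I) (n := 2) (by norm_num)
  have : H z = F l := by
    simp only [hH]; rw [hz, mul_div_cancel₀ _ Complex.I_ne_zero]
  rw [← this, hconst z, hzero]

/-! ### Everywhere convergent power series -/

section PowerSeries

lemma summable_shift_coeff {a : ℕ → ℂ} (ha : ∀ R : ℝ, 0 ≤ R → Summable fun k => ‖a k‖ * R ^ k)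
    (R : ℝ) (hR : 0 ≤ R) : Summable fun k : ℕ => ‖((k : ℂ) + 1) * a (k + 1)‖ * R ^ k := by
  -- In the radius 2(R + 1), the power of 2 absorbs the factor k + 1, and R + 1 ≥ 1 absorbs the
  -- shift of the exponent.
  have h1 := (summable_nat_add_iff 1).2 (ha (2 * (R + 1)) (by positivity))
  refine Summable.of_nonneg_of_le (fun k => by positivity) (fun k => ?_) h1
  have h2 : ‖(k : ℂ) + 1‖ ≤ 2 ^ (k + 1) := by
    have : ((k + 1 : ℕ) : ℝ) ≤ (2 : ℝ) ^ (k + 1) := by exact_mod_cast (Nat.lt_two_pow_self).le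
    calc ‖(k : ℂ) + 1‖ = ((k + 1 : ℕ) : ℝ) := by
          rw [← Nat.cast_succ, Complex.norm_natCast]
      _ ≤ _ := this
  have h3 : R ^ k ≤ (R + 1) ^ (k + 1) :=
    (pow_le_pow_left₀ hR (by linarith) k).trans (pow_le_pow_right₀ (by linarith) (by omega))
  rw [norm_mul, mul_pow]
  calc _ ≤ 2 ^ (k + 1) * ‖a (k + 1)‖ * (R + 1) ^ (k + 1) := by gcongr
    _ = _ := by ring

lemma summable_powerSeries {a : ℕ → ℂ} (ha : ∀ R : ℝ, 0 ≤ R → Summable fun k => ‖a k‖ * R ^ k)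
    (w : ℂ) : Summable fun k => a k * w ^ k := by
  refine Summable.of_norm ?_
  simpa only [norm_mul, norm_pow] using ha ‖w‖ (norm_nonneg _)

lemma hasDerivAt_powerSeries {a : ℕ → ℂ}
    (ha : ∀ R : ℝ, 0 ≤ R → Summable fun k => ‖a k‖ * R ^ k) (w : ℂ) :
    HasDerivAt (fun w => ∑' k, a k * w ^ k) (∑' k : ℕ, ((k : ℂ) + 1) * a (k + 1) * w ^ k) w := by
  have hR : 0 ≤ ‖w‖ + 1 := by positivity
  have h1 := hasDerivAt_tsum_of_isPreconnected
    (g := fun k w => a (k + 1) * w ^ (k + 1))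
    (g' := fun (k : ℕ) w => ((k : ℂ) + 1) * a (k + 1) * w ^ k)
    (summable_shift_coeff ha (‖w‖ + 1) hR) (Metric.isOpen_ball (x := (0 : ℂ)) (ε := ‖w‖ + 1))
    (convex_ball (0 : ℂ) _).isPreconnected (fun k y _ => ?_) (fun k y hy => ?_)
    (y₀ := w) (y := w) (by simp) ?_ (by simp)
  · have h2 : (fun w => ∑' k, a k * w ^ k) = fun w => a 0 + ∑' k, a (k + 1) * w ^ (k + 1) := by
      ext w
      rw [(summable_powerSeries ha w).tsum_eq_zero_add]; simp
    rw [h2]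
    exact h1.const_add _
  · have := (hasDerivAt_pow (k + 1) y).const_mul (a (k + 1))
    convert! this using 1
    push_cast [Nat.add_sub_cancel]; ring
  · rw [norm_mul, norm_pow]
    have : ‖y‖ ≤ ‖w‖ + 1 := by simpa using (mem_ball_zero_iff.1 hy).le
    gcongr
  · exact (summable_nat_add_iff 1).2 (summable_powerSeries ha w)

end PowerSeries

/-! ### The Frobenius solutions -/

/-- Standing assumptions on the parameters. -/
structure Params (ν : ℂ) (c : Fin 2 → ℂ) : Prop where
  re_pos : 0 < ν.re
  not_nat : ∀ n : ℕ, ν ≠ n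
  prod : c 0 * c 1 = (2 * ν)⁻¹

/-- The entire function `f_j` with `C_j(z) = z ^ μ_j * f_j(lam * z ^ 2)`. -/
noncomputable def frobF (ν : ℂ) (c : Fin 2 → ℂ) (j : Fin 2) (w : ℂ) : ℂ :=
  ∑' k : ℕ, frobCoeff ν c j k * w ^ k

/-- The derivative of `frobF`. -/
noncomputable def frobF1 (ν : ℂ) (c : Fin 2 → ℂ) (j : Fin 2) (w : ℂ) : ℂ :=
  ∑' k : ℕ, ((k : ℂ) + 1) * frobCoeff ν c j (k + 1) * w ^ k

/-- The second derivative of `frobF`. -/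
noncomputable def frobF2 (ν : ℂ) (c : Fin 2 → ℂ) (j : Fin 2) (w : ℂ) : ℂ :=
  ∑' k : ℕ, ((k : ℂ) + 1) * ((((k + 1 : ℕ) : ℂ) + 1) * frobCoeff ν c j (k + 1 + 1)) * w ^ k

/-- The Frobenius solution as a function of a complex variable. -/
noncomputable def hs (ν : ℂ) (c : Fin 2 → ℂ) (j : Fin 2) (z lam : ℂ) : ℂ :=
  z ^ expo ν j * frobF ν c j (lam * z ^ 2)

/-- The derivative of the Frobenius solution. -/
noncomputable def hsD (ν : ℂ) (c : Fin 2 → ℂ) (j : Fin 2) (z lam : ℂ) : ℂ :=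
  z ^ expo ν j * (expo ν j * frobF ν c j (lam * z ^ 2) / z +
    2 * lam * z * frobF1 ν c j (lam * z ^ 2))

lemma expo_zero (ν : ℂ) : expo ν 0 = -ν + 1 / 2 := by simp [expo]

lemma expo_one (ν : ℂ) : expo ν 1 = ν + 1 / 2 := by simp [expo]

lemma expo_add (ν : ℂ) : expo ν 0 + expo ν 1 = 1 := by rw [expo_zero, expo_one]; ring

lemma expo_mul (ν : ℂ) (j : Fin 2) : expo ν j * (expo ν j - 1) = nu0 ν := by
  fin_cases j <;> simp [expo, nu0] <;> ring

/-- As ν₀ = μ(μ - 1), the denominators factor as 4s(s - ν) for the first exponent and 4s(s + ν) for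
the second. -/
lemma factor_eq (ν : ℂ) (j : Fin 2) (s : ℂ) :
    (2 * s + expo ν j) * (2 * s + expo ν j - 1) - nu0 ν =
      4 * s * (s + (expo ν j - 1 / 2)) := by
  rw [← expo_mul ν j]; ring

/-- The real part of the exponent. -/
noncomputable def tau (ν : ℂ) (j : Fin 2) : ℝ := (expo ν j).re

lemma tau_zero (ν : ℂ) : tau ν 0 = 1 / 2 - ν.re := by
  simp [tau, expo_zero]; ring

lemma tau_one (ν : ℂ) : tau ν 1 = 1 / 2 + ν.re := by
  simp [tau, expo_one]; ring

lemma frobF_zero (ν : ℂ) (c : Fin 2 → ℂ) (j : Fin 2) : frobF ν c j 0 = c j := by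
  unfold frobF
  rw [tsum_eq_single 0 (fun k hk => by simp [hk])]
  simp [frobCoeff]

namespace Params

variable {ν : ℂ} {c : Fin 2 → ℂ} (P : Params ν c)
include P

lemma nu_ne_zero : ν ≠ 0 := by
  rintro rfl; simpa using P.re_pos

lemma c_ne_zero (j : Fin 2) : c j ≠ 0 := by
  have h : c 0 * c 1 ≠ 0 := by
    rw [P.prod]; exact inv_ne_zero (mul_ne_zero two_ne_zero P.nu_ne_zero)
  fin_cases j
  · exact left_ne_zero_of_mul h
  · exact right_ne_zero_of_mul h

/-- The quotient s / |s ∓ ν| tends to 1, hence is bounded. The denominator does not vanish: for the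
first exponent because ν is not a natural number, for the second because Re ν > 0. -/
lemma exists_le_mul_norm (j : Fin 2) :
    ∃ M : ℝ, 1 ≤ M ∧ ∀ s : ℕ, 1 ≤ s → (s : ℝ) ≤ M * ‖(s : ℂ) + (expo ν j - 1 / 2)‖ := by
  have h0 : ∀ s : ℕ, 1 ≤ s → (s : ℂ) + (expo ν j - 1 / 2) ≠ 0 := by
    intro s hs h
    have hs' : (1 : ℝ) ≤ s := by exact_mod_cast hs
    fin_cases j
    · simp only [Fin.zero_eta, expo_zero] at h
      exact P.not_nat s (by linear_combination -h)
    · simp only [Fin.mk_one, expo_one] at h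
      have := congrArg Complex.re h
      simp at this
      linarith [P.re_pos]
  have hlim : Tendsto (fun s : ℕ => (s : ℝ) / ‖(s : ℂ) + (expo ν j - 1 / 2)‖) atTop (𝓝 1) := by
    have h1 : Tendsto (fun s : ℕ => ‖1 + (expo ν j - 1 / 2) * ((s : ℂ))⁻¹‖⁻¹) atTop
        (𝓝 (‖(1 : ℂ) + (expo ν j - 1 / 2) * 0‖⁻¹)) :=
      (((tendsto_inv_atTop_nhds_zero_nat (𝕜 := ℂ)).const_mul _).const_add 1).norm.inv₀ (by simp)
    simp only [mul_zero, add_zero, norm_one, inv_one] at h1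
    refine h1.congr' ?_
    filter_upwards [eventually_ge_atTop 1] with s hs
    have hs' : (s : ℂ) ≠ 0 := by exact_mod_cast (by omega : s ≠ 0)
    have : (s : ℂ) + (expo ν j - 1 / 2) = s * (1 + (expo ν j - 1 / 2) * ((s : ℂ))⁻¹) := by
      field_simp
    rw [this, norm_mul, Complex.norm_natCast]
    have hs2 : (s : ℝ) ≠ 0 := by exact_mod_cast (by omega : s ≠ 0)
    field_simp
  obtain ⟨M, hM⟩ := hlim.bddAbove_range
  refine ⟨max M 1, le_max_right _ _, fun s hs => ?_⟩
  have h1 := hM ⟨s, rfl⟩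
  simp only at h1
  rw [div_le_iff₀ (norm_pos_iff.2 (h0 s hs))] at h1
  exact h1.trans (by gcongr; exact le_max_left _ _)

lemma factor_ne_zero (j : Fin 2) (s : ℕ) (hs : 1 ≤ s) :
    (2 * (s : ℂ) + expo ν j) * (2 * s + expo ν j - 1) - nu0 ν ≠ 0 := by
  obtain ⟨M, hM, h⟩ := P.exists_le_mul_norm j
  have h1 := h s hs
  have hs' : (0 : ℝ) < s := by exact_mod_cast hs
  rw [factor_eq]
  refine mul_ne_zero (mul_ne_zero (by norm_num) (by exact_mod_cast (by omega : s ≠ 0))) ?_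
  intro h2
  rw [h2, norm_zero, mul_zero] at h1
  linarith

lemma frobCoeff_succ (j : Fin 2) (k : ℕ) :
    ((k : ℂ) + 1) * (4 * k + 4 * expo ν j + 2) * frobCoeff ν c j (k + 1) =
      -frobCoeff ν c j k := by
  have h := P.factor_ne_zero j (k + 1) (by omega)
  have h2 : (2 * ((k + 1 : ℕ) : ℂ) + expo ν j) * (2 * ((k + 1 : ℕ) : ℂ) + expo ν j - 1) - nu0 ν =
      ((k : ℂ) + 1) * (4 * k + 4 * expo ν j + 2) := by
    rw [factor_eq]; push_cast; ring
  unfold frobCoeff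
  rw [Finset.prod_Icc_succ_top (by omega), mul_inv, h2, pow_succ]
  rw [h2] at h
  linear_combination (-(-1) ^ k * c j * (∏ s ∈ Finset.Icc 1 k,
    ((2 * (s : ℂ) + expo ν j) * (2 * (s : ℂ) + expo ν j - 1) - nu0 ν))⁻¹) * mul_inv_cancel₀ h

/-- Each new denominator has modulus at least 4(k + 1)²/M, and 4(k + 1)² ≥ (2k + 2)(2k + 1). The
resulting (2k)! compares the series with cosh √(M|w|), which is the source of the order 1/2 in λ. -/
lemma norm_frobCoeff_le (j : Fin 2) : ∃ M : ℝ, 1 ≤ M ∧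
    ∀ k, ‖frobCoeff ν c j k‖ ≤ ‖c j‖ * (M ^ k / (2 * k).factorial) := by
  obtain ⟨M, hM, h⟩ := P.exists_le_mul_norm j
  refine ⟨M, hM, fun k => ?_⟩
  induction k with
  | zero => simp [frobCoeff]
  | succ k ih =>
    have h1 := h (k + 1) (by omega)
    have h2 := congrArg norm (P.frobCoeff_succ j k)
    have h3 : ((k : ℂ) + 1) * (4 * k + 4 * expo ν j + 2) =
        4 * ((k + 1 : ℕ) : ℂ) * (((k + 1 : ℕ) : ℂ) + (expo ν j - 1 / 2)) := by push_cast; ring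
    rw [h3, norm_mul, norm_neg, norm_mul, norm_mul, Complex.norm_natCast] at h2
    norm_num at h2 h1
    have h4 : ‖frobCoeff ν c j (k + 1)‖ * (4 * (k + 1) ^ 2) ≤ M * ‖frobCoeff ν c j k‖ := by
      rw [← h2]
      have := mul_le_mul_of_nonneg_left h1
        (show 0 ≤ 4 * ((k : ℝ) + 1) * ‖frobCoeff ν c j (k + 1)‖ by positivity)
      linarith
    have h5 : (((2 * (k + 1)).factorial : ℕ) : ℝ) =
        (2 * k + 2) * (2 * k + 1) * (2 * k).factorial := by
      rw [show 2 * (k + 1) = 2 * k + 1 + 1 by ring, Nat.factorial_succ, Nat.factorial_succ]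
      push_cast; ring
    rw [h5]
    have hf : (0 : ℝ) < (2 * k).factorial := by exact_mod_cast Nat.factorial_pos _
    have hk : (0 : ℝ) ≤ k := Nat.cast_nonneg k
    rw [← mul_div_assoc, le_div_iff₀ (by positivity)]
    rw [← mul_div_assoc, le_div_iff₀ hf] at ih
    calc _ ≤ ‖frobCoeff ν c j (k + 1)‖ * (4 * (k + 1) ^ 2) * (2 * k).factorial := by
          have h6 : (2 * (k : ℝ) + 2) * (2 * k + 1) ≤ 4 * (k + 1) ^ 2 := by nlinarith
          rw [← mul_assoc]
          exact mul_le_mul_of_nonneg_right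
            (mul_le_mul_of_nonneg_left h6 (norm_nonneg _)) hf.le
      _ ≤ M * ‖frobCoeff ν c j k‖ * (2 * k).factorial := by gcongr
      _ ≤ M * (‖c j‖ * M ^ k) := by rw [mul_assoc]; gcongr
      _ = _ := by ring

lemma exists_coeff_sum_le (j : Fin 2) : ∃ D : ℝ, 1 ≤ D ∧ ∀ R : ℝ, 0 ≤ R →
    Summable (fun k => ‖frobCoeff ν c j k‖ * R ^ k) ∧
    ∑' k, ‖frobCoeff ν c j k‖ * R ^ k ≤ ‖c j‖ * Real.exp (D * √R) := by
  obtain ⟨M, hM, h⟩ := P.norm_frobCoeff_le j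
  refine ⟨√M, Real.one_le_sqrt.2 hM, fun R hR => ?_⟩
  have h1 := (Real.hasSum_cosh (√M * √R)).mul_left ‖c j‖
  have hle : ∀ k, ‖frobCoeff ν c j k‖ * R ^ k ≤
      ‖c j‖ * ((√M * √R) ^ (2 * k) / (2 * k).factorial) := by
    intro k
    rw [mul_pow, pow_mul, pow_mul, Real.sq_sqrt (by linarith), Real.sq_sqrt hR]
    calc _ ≤ ‖c j‖ * (M ^ k / (2 * k).factorial) * R ^ k := by gcongr; exact h k
      _ = _ := by ring
  have hs := Summable.of_nonneg_of_le (fun k => by positivity) hle h1.summable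
  refine ⟨hs, (hs.tsum_le_tsum hle h1.summable).trans ?_⟩
  rw [h1.tsum_eq]
  gcongr
  rw [Real.cosh_eq]
  have : Real.exp (-(√M * √R)) ≤ Real.exp (√M * √R) :=
    Real.exp_le_exp.2 (by have := mul_nonneg (Real.sqrt_nonneg M) (Real.sqrt_nonneg R); linarith)
  linarith

lemma summable_coeff (j : Fin 2) (R : ℝ) (hR : 0 ≤ R) :
    Summable fun k => ‖frobCoeff ν c j k‖ * R ^ k := by
  obtain ⟨D, -, h⟩ := P.exists_coeff_sum_le j
  exact (h R hR).1

lemma norm_frobF_le (j : Fin 2) : ∃ D : ℝ, 1 ≤ D ∧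
    ∀ w, ‖frobF ν c j w‖ ≤ ‖c j‖ * Real.exp (D * √‖w‖) := by
  obtain ⟨D, hD, h⟩ := P.exists_coeff_sum_le j
  refine ⟨D, hD, fun w => ?_⟩
  obtain ⟨h1, h2⟩ := h ‖w‖ (norm_nonneg _)
  refine le_trans ?_ h2
  refine (norm_tsum_le_tsum_norm ?_).trans (le_of_eq ?_)
  · simpa only [norm_mul, norm_pow] using h1
  · simp only [norm_mul, norm_pow]

lemma hasDerivAt_frobF (j : Fin 2) (w : ℂ) :
    HasDerivAt (frobF ν c j) (frobF1 ν c j w) w :=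
  hasDerivAt_powerSeries (P.summable_coeff j) w

lemma hasDerivAt_frobF1 (j : Fin 2) (w : ℂ) :
    HasDerivAt (frobF1 ν c j) (frobF2 ν c j w) w :=
  hasDerivAt_powerSeries (a := fun k => ((k : ℂ) + 1) * frobCoeff ν c j (k + 1))
    (summable_shift_coeff (P.summable_coeff j)) w

lemma differentiable_frobF (j : Fin 2) : Differentiable ℂ (frobF ν c j) :=
  fun w => (P.hasDerivAt_frobF j w).differentiableAt

/-- The coefficient recursion multiplied by w ^ k and summed. It is the differential equation in the
variable w = λz², with the power of z removed. -/
lemma frobF_ode (j : Fin 2) (w : ℂ) :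
    (4 * expo ν j + 2) * frobF1 ν c j w + 4 * (w * frobF2 ν c j w) = -frobF ν c j w := by
  have hs0 := summable_powerSeries (P.summable_coeff j) w
  have hc1 := summable_shift_coeff (P.summable_coeff j)
  have hs1 := summable_powerSeries hc1 w
  have hs2 := summable_powerSeries (summable_shift_coeff hc1) w
  have h2 : w * frobF2 ν c j w =
      ∑' k : ℕ, (k : ℂ) * (((k : ℂ) + 1) * frobCoeff ν c j (k + 1)) * w ^ k := by
    have hs3 : Summable fun k : ℕ =>
        (k : ℂ) * (((k : ℂ) + 1) * frobCoeff ν c j (k + 1)) * w ^ k := by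
      rw [← summable_nat_add_iff 1]
      refine (hs2.mul_left w).congr fun k => ?_
      push_cast; ring
    rw [hs3.tsum_eq_zero_add]
    unfold frobF2
    rw [← tsum_mul_left]
    simp only [Nat.cast_zero, zero_mul, zero_add]
    refine tsum_congr fun k => ?_
    push_cast; ring
  have hs3 : Summable fun k : ℕ =>
      (k : ℂ) * (((k : ℂ) + 1) * frobCoeff ν c j (k + 1)) * w ^ k := by
    rw [← summable_nat_add_iff 1]
    refine (hs2.mul_left w).congr fun k => ?_
    push_cast; ring
  rw [h2]
  unfold frobF1 frobF
  rw [← tsum_mul_left, ← tsum_mul_left, ← tsum_neg, ← (hs1.mul_left _).tsum_add (hs3.mul_left _)]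
  refine tsum_congr fun k => ?_
  linear_combination (P.frobCoeff_succ j k) * w ^ k

/-- The expression is the Wronskian written in w = λz². Its derivative vanishes by the equation, and
its value at w = 0 is 2ν c₁₀c₂₀ = 1 by the normalisation of the leading coefficients. -/
lemma frob_wronskian (w : ℂ) :
    2 * ν * (frobF ν c 0 w * frobF ν c 1 w) +
      2 * (w * (frobF ν c 0 w * frobF1 ν c 1 w - frobF1 ν c 0 w * frobF ν c 1 w)) = 1 := by
  set Ψ : ℂ → ℂ := fun w => 2 * ν * (frobF ν c 0 w * frobF ν c 1 w) +
      2 * (w * (frobF ν c 0 w * frobF1 ν c 1 w - frobF1 ν c 0 w * frobF ν c 1 w)) with hΨ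
  have hd : ∀ w, HasDerivAt Ψ 0 w := by
    intro w
    have a0 := P.hasDerivAt_frobF 0 w
    have a1 := P.hasDerivAt_frobF 1 w
    have b0 := P.hasDerivAt_frobF1 0 w
    have b1 := P.hasDerivAt_frobF1 1 w
    have h := ((a0.mul a1).const_mul (2 * ν)).add
      (((hasDerivAt_id w).mul ((a0.mul b1).sub (b0.mul a1))).const_mul 2)
    refine h.congr_deriv ?_
    have e0 := P.frobF_ode 0 w
    have e1 := P.frobF_ode 1 w
    rw [expo_zero] at e0
    rw [expo_one] at e1
    simp only [id, Pi.mul_apply, Pi.sub_apply]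
    linear_combination (1 / 2 * frobF ν c 0 w) * e1 - (1 / 2 * frobF ν c 1 w) * e0
  have hc := is_const_of_deriv_eq_zero (fun w => (hd w).differentiableAt)
    (fun w => (hd w).deriv) w 0
  change Ψ w = 1
  rw [hc]
  simp only [hΨ, frobF_zero, zero_mul, mul_zero, add_zero, P.prod]
  exact mul_inv_cancel₀ (mul_ne_zero two_ne_zero P.nu_ne_zero)

lemma hs_wronskian {z : ℂ} (hz : z ≠ 0) (lam : ℂ) :
    hs ν c 0 z lam * hsD ν c 1 z lam - hsD ν c 0 z lam * hs ν c 1 z lam = 1 := by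
  have h := P.frob_wronskian (lam * z ^ 2)
  have h2 : z ^ expo ν 0 * z ^ expo ν 1 = z := by
    rw [← Complex.cpow_add _ _ hz, expo_add, Complex.cpow_one]
  unfold hs hsD
  have h3 : expo ν 1 - expo ν 0 = 2 * ν := by rw [expo_zero, expo_one]; ring
  field_simp
  rw [← h3] at h
  linear_combination ((expo ν 1 - expo ν 0) *
    (frobF ν c 0 (lam * z ^ 2) * frobF ν c 1 (lam * z ^ 2)) +
    2 * lam * z ^ 2 * (frobF ν c 0 (lam * z ^ 2) * frobF1 ν c 1 (lam * z ^ 2) -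
      frobF1 ν c 0 (lam * z ^ 2) * frobF ν c 1 (lam * z ^ 2))) * h2 + z * h

lemma hasDerivAt_hs (j : Fin 2) {z : ℂ} (hz : z ∈ Complex.slitPlane) (lam : ℂ) :
    HasDerivAt (fun z => hs ν c j z lam) (hsD ν c j z lam) z := by
  have hz0 := Complex.slitPlane_ne_zero hz
  have h1 : HasDerivAt (fun z : ℂ => z ^ expo ν j) (expo ν j * z ^ (expo ν j - 1)) z :=
    by simpa using (hasDerivAt_id z).cpow_const (c := expo ν j) hz
  have h2 : HasDerivAt (fun z : ℂ => lam * z ^ 2) (lam * (2 * z)) z := by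
    simpa using (hasDerivAt_pow 2 z).const_mul lam
  have h3 := h1.mul ((P.hasDerivAt_frobF j (lam * z ^ 2)).comp z h2)
  refine h3.congr_deriv ?_
  rw [Complex.cpow_sub _ _ hz0, Complex.cpow_one]
  unfold hsD
  simp only [Function.comp]
  field_simp

lemma hasDerivAt_hsD (j : Fin 2) {z : ℂ} (hz : z ∈ Complex.slitPlane) (lam : ℂ) :
    HasDerivAt (fun z => hsD ν c j z lam) ((nu0 ν / z ^ 2 - lam) * hs ν c j z lam) z := by
  have hz0 := Complex.slitPlane_ne_zero hz
  have h1 : HasDerivAt (fun z : ℂ => z ^ expo ν j) (expo ν j * z ^ (expo ν j - 1)) z :=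
    by simpa using (hasDerivAt_id z).cpow_const (c := expo ν j) hz
  have h2 : HasDerivAt (fun z : ℂ => lam * z ^ 2) (lam * (2 * z)) z := by
    simpa using (hasDerivAt_pow 2 z).const_mul lam
  have f0 := (P.hasDerivAt_frobF j (lam * z ^ 2)).comp z h2
  have f1 := (P.hasDerivAt_frobF1 j (lam * z ^ 2)).comp z h2
  have h3 := h1.mul (((f0.const_mul (expo ν j)).div (hasDerivAt_id z) hz0).add
    (((hasDerivAt_id z).const_mul (2 * lam)).mul f1))
  refine h3.congr_deriv ?_
  have ode := P.frobF_ode j (lam * z ^ 2)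
  rw [Complex.cpow_sub _ _ hz0, Complex.cpow_one, ← expo_mul ν j]
  unfold hs
  simp only [Function.comp, id, Pi.mul_apply, Pi.add_apply, Pi.div_apply]
  generalize frobF ν c j (lam * z ^ 2) = a at *
  generalize frobF1 ν c j (lam * z ^ 2) = b at *
  generalize frobF2 ν c j (lam * z ^ 2) = d at *
  field_simp
  linear_combination z ^ expo ν j * lam * z ^ 2 * ode

lemma hasDerivAt_hs_real (j : Fin 2) {z : ℝ} (hz : 0 < z) (lam : ℂ) :
    HasDerivAt (fun z : ℝ => hs ν c j z lam) (hsD ν c j z lam) z :=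
  (P.hasDerivAt_hs j (Complex.ofReal_mem_slitPlane.2 hz) lam).comp_ofReal

lemma hasDerivAt_hsD_real (j : Fin 2) {z : ℝ} (hz : 0 < z) (lam : ℂ) :
    HasDerivAt (fun z : ℝ => hsD ν c j z lam) ((nu0 ν / (z : ℂ) ^ 2 - lam) * hs ν c j z lam) z :=
  (P.hasDerivAt_hsD j (Complex.ofReal_mem_slitPlane.2 hz) lam).comp_ofReal

lemma continuousOn_hs (j : Fin 2) (lam : ℂ) :
    ContinuousOn (fun z : ℝ => hs ν c j z lam) (Ioi 0) :=
  fun _ hz => (P.hasDerivAt_hs_real j hz lam).continuousAt.continuousWithinAt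

lemma differentiable_hs_lam (j : Fin 2) (z : ℂ) :
    Differentiable ℂ (fun lam => hs ν c j z lam) :=
  ((P.differentiable_frobF j).comp (differentiable_id.mul_const _)).const_mul _

lemma norm_hs_le : ∃ D K : ℝ, 1 ≤ D ∧ 0 < K ∧ ∀ j, ∀ z : ℝ, 0 < z → ∀ lam,
    ‖hs ν c j z lam‖ ≤ K * z ^ tau ν j * Real.exp (D * √‖lam‖ * z) := by
  obtain ⟨D0, hD0, h0⟩ := P.norm_frobF_le 0
  obtain ⟨D1, hD1, h1⟩ := P.norm_frobF_le 1
  have hc0 := norm_pos_iff.2 (P.c_ne_zero 0)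
  have hc1 := norm_pos_iff.2 (P.c_ne_zero 1)
  refine ⟨max D0 D1, max ‖c 0‖ ‖c 1‖, hD0.trans (le_max_left _ _),
    hc0.trans_le (le_max_left _ _), ?_⟩
  have aux : ∀ (j : Fin 2) (z : ℝ), 0 < z → ∀ lam, ∀ D, D ≤ max D0 D1 →
      ‖c j‖ ≤ max ‖c 0‖ ‖c 1‖ → (∀ w, ‖frobF ν c j w‖ ≤ ‖c j‖ * Real.exp (D * √‖w‖)) →
      ‖hs ν c j z lam‖ ≤
        max ‖c 0‖ ‖c 1‖ * z ^ tau ν j * Real.exp (max D0 D1 * √‖lam‖ * z) := by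
    intro j z hz lam D hD hcj h
    unfold hs tau
    rw [norm_mul, Complex.norm_cpow_eq_rpow_re_of_pos hz]
    have h3 := h (lam * (z : ℂ) ^ 2)
    rw [norm_mul, norm_pow, Complex.norm_of_nonneg hz.le, Real.sqrt_mul (norm_nonneg _),
      Real.sqrt_sq hz.le, ← mul_assoc] at h3
    calc _ ≤ z ^ (expo ν j).re * (‖c j‖ * Real.exp (D * √‖lam‖ * z)) := by gcongr
      _ ≤ z ^ (expo ν j).re * (max ‖c 0‖ ‖c 1‖ * Real.exp (max D0 D1 * √‖lam‖ * z)) := by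
        gcongr
      _ = _ := by ring
  intro j z hz lam
  match j with
  | 0 => exact aux 0 z hz lam D0 (le_max_left _ _) (le_max_left _ _) h0
  | 1 => exact aux 1 z hz lam D1 (le_max_right _ _) (le_max_right _ _) h1

end Params

/-! ### Growth of the Green kernel in λ -/

/-- The Green kernel `G(z, t)` of the half-line problem. -/
noncomputable def hsG (ν : ℂ) (c : Fin 2 → ℂ) (z t : ℝ) (lam : ℂ) : ℂ :=
  hs ν c 0 t lam * hs ν c 1 z lam - hs ν c 0 z lam * hs ν c 1 t lam

/-- After division by the common powers this is t ^ (2σ) ≤ z ^ (2σ). It absorbs the second product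
in the Green kernel into the first. -/
lemma rpow_exchange {σ : ℝ} (hσ : 0 < σ) {t z : ℝ} (ht : 0 < t) (htz : t ≤ z) :
    z ^ (1 / 2 - σ) * t ^ (1 / 2 + σ) ≤ t ^ (1 / 2 - σ) * z ^ (1 / 2 + σ) := by
  have hz := ht.trans_le htz
  have h1 : z ^ (1 / 2 + σ) = z ^ (1 / 2 - σ) * z ^ (2 * σ) := by
    rw [← Real.rpow_add hz]; ring_nf
  have h2 : t ^ (1 / 2 + σ) = t ^ (1 / 2 - σ) * t ^ (2 * σ) := by
    rw [← Real.rpow_add ht]; ring_nf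
  have h3 : t ^ (2 * σ) ≤ z ^ (2 * σ) := Real.rpow_le_rpow ht.le htz (by positivity)
  rw [h1, h2]
  have := mul_le_mul_of_nonneg_left h3
    (mul_pos (Real.rpow_pos_of_pos hz (1 / 2 - σ)) (Real.rpow_pos_of_pos ht (1 / 2 - σ))).le
  linarith

/-- Energy estimate for solutions of `y'' = (n / z ^ 2 - lam) y`. -/
lemma energy_estimate {y yd : ℝ → ℂ} {n lam : ℂ} {s : ℝ} (hs : 0 < s) (hlam : ‖lam‖ = s ^ 2)
    (hy : ∀ z : ℝ, 0 < z → HasDerivAt y (yd z) z)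
    (hyd : ∀ z : ℝ, 0 < z → HasDerivAt yd ((n / (z : ℂ) ^ 2 - lam) * y z) z)
    {t z : ℝ} (ht : 0 < t) (htz : t ≤ z) :
    s ^ 2 * ‖y z‖ ^ 2 + ‖yd z‖ ^ 2 ≤
      (s ^ 2 * ‖y t‖ ^ 2 + ‖yd t‖ ^ 2) * Real.exp (2 * s * (z - t) + ‖n‖ / (s * t)) := by
  set E : ℝ → ℝ := fun z => s ^ 2 * ‖y z‖ ^ 2 + ‖yd z‖ ^ 2 with hE
  -- The logarithmic derivative of the exponential factor is -(2s + |n|/(s z²)), which compensates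
  -- the largest possible growth rate of the energy E. Hence g is nonincreasing.
  set g : ℝ → ℝ := fun z => E z * Real.exp (-(2 * s * z) + ‖n‖ / s * z⁻¹) with hg
  have hE0 : ∀ z, 0 ≤ E z := fun z => by positivity
  have hderiv : ∀ z, 0 < z → HasDerivAt g
      ((s ^ 2 * (2 * inner ℝ (y z) (yd z)) + 2 * inner ℝ (yd z) ((n / (z : ℂ) ^ 2 - lam) * y z)) *
        Real.exp (-(2 * s * z) + ‖n‖ / s * z⁻¹) +
        E z * (Real.exp (-(2 * s * z) + ‖n‖ / s * z⁻¹) *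
          (-(2 * s) + ‖n‖ / s * (-(z ^ 2)⁻¹)))) z := by
    intro z hz
    have h1 := ((hy z hz).norm_sq.const_mul (s ^ 2)).add (hyd z hz).norm_sq
    have h2 : HasDerivAt (fun z : ℝ => -(2 * s * z) + ‖n‖ / s * z⁻¹)
        (-(2 * s) + ‖n‖ / s * (-(z ^ 2)⁻¹)) z := by
      exact ((((hasDerivAt_id z).const_mul (2 * s)).neg).add
        ((hasDerivAt_inv hz.ne').const_mul (‖n‖ / s))).congr_deriv (by simp)
    exact h1.mul h2.exp
  have hanti : AntitoneOn g (Ioi 0) := by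
    refine antitoneOn_of_hasDerivWithinAt_nonpos (convex_Ioi 0)
      (fun z hz => (hderiv z hz).continuousAt.continuousWithinAt)
      (fun z hz => (hderiv z (by simpa using hz)).hasDerivWithinAt) ?_
    intro z hz
    have hz : 0 < z := by simpa using hz
    have i1 : inner ℝ (y z) (yd z) ≤ ‖y z‖ * ‖yd z‖ := real_inner_le_norm _ _
    have i2 : inner ℝ (yd z) ((n / (z : ℂ) ^ 2 - lam) * y z) ≤
        ‖yd z‖ * ((‖n‖ / z ^ 2 + s ^ 2) * ‖y z‖) := by
      refine (real_inner_le_norm _ _).trans ?_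
      rw [norm_mul]
      gcongr
      refine (norm_sub_le _ _).trans (le_of_eq ?_)
      rw [hlam, norm_div, norm_pow, Complex.norm_of_nonneg hz.le]
    have i3 : 2 * (s * (‖y z‖ * ‖yd z‖)) ≤ E z := by
      have := sq_nonneg (s * ‖y z‖ - ‖yd z‖)
      simp only [hE]; nlinarith
    have key : s ^ 2 * (2 * inner ℝ (y z) (yd z)) +
        2 * inner ℝ (yd z) ((n / (z : ℂ) ^ 2 - lam) * y z) ≤
        E z * (2 * s + ‖n‖ / s * (z ^ 2)⁻¹) := by
      calc _ ≤ s ^ 2 * (2 * (‖y z‖ * ‖yd z‖)) +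
            2 * (‖yd z‖ * ((‖n‖ / z ^ 2 + s ^ 2) * ‖y z‖)) := by gcongr
        _ = (2 * (s * (‖y z‖ * ‖yd z‖))) * (2 * s + ‖n‖ / s * (z ^ 2)⁻¹) := by
          field_simp; ring
        _ ≤ _ := by gcongr
    have he : 0 < Real.exp (-(2 * s * z) + ‖n‖ / s * z⁻¹) := Real.exp_pos _
    nlinarith [mul_le_mul_of_nonneg_right key he.le]
  have h := hanti (mem_Ioi.2 ht) (mem_Ioi.2 (ht.trans_le htz)) htz
  simp only [hg] at h
  have hz := ht.trans_le htz
  have hn : 0 ≤ ‖n‖ / s * z⁻¹ := by positivity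
  calc E z = E z * Real.exp (-(2 * s * z) + ‖n‖ / s * z⁻¹) *
        Real.exp (2 * s * z - ‖n‖ / s * z⁻¹) := by
        rw [mul_assoc, ← Real.exp_add]; ring_nf; simp
    _ ≤ E t * Real.exp (-(2 * s * t) + ‖n‖ / s * t⁻¹) *
        Real.exp (2 * s * z - ‖n‖ / s * z⁻¹) := by gcongr
    _ = E t * Real.exp (2 * s * (z - t) + ‖n‖ / (s * t) - ‖n‖ / s * z⁻¹) := by
        rw [mul_assoc, ← Real.exp_add]; congr 2; field_simp; ring
    _ ≤ _ := by
      have := hE0 t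
      gcongr
      linarith

namespace Params

variable {ν : ℂ} {c : Fin 2 → ℂ} (P : Params ν c)
include P

/-- The product bounds alone give the exponent z + t in place of z - t. For √|λ| t ≤ 1 the loss is
at most exp(2D). For √|λ| t ≥ 1 the energy estimate started at t is used, where the kernel vanishes
and has derivative 1 and where the contribution of ν₀ to the exponent is bounded. -/
lemma norm_hsG_le : ∃ D K : ℝ, 1 ≤ D ∧ 0 < K ∧
    (∀ j, ∀ z : ℝ, 0 < z → ∀ lam,
      ‖hs ν c j z lam‖ ≤ K * z ^ tau ν j * Real.exp (D * √‖lam‖ * z)) ∧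
    ∀ t z : ℝ, 0 < t → t ≤ z → ∀ lam,
      ‖hsG ν c z t lam‖ ≤
        K * t ^ tau ν 0 * z ^ tau ν 1 * Real.exp (D * √‖lam‖ * (z - t)) := by
  obtain ⟨D, K, hD, hK, h⟩ := P.norm_hs_le
  set K' := max K (max (2 * K ^ 2 * Real.exp (2 * D)) (Real.exp (‖nu0 ν‖ / 2))) with hK'
  have hKK' : K ≤ K' := le_max_left _ _
  refine ⟨D, K', hD, hK.trans_le hKK', fun j z hz lam => (h j z hz lam).trans (by
    have := Real.rpow_pos_of_pos hz (tau ν j); gcongr), ?_⟩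
  intro t z ht htz lam
  have hz := ht.trans_le htz
  have hex := rpow_exchange P.re_pos ht htz
  rw [← tau_zero, ← tau_one] at hex
  have ht0 := Real.rpow_pos_of_pos ht (tau ν 0)
  have hz1 := Real.rpow_pos_of_pos hz (tau ν 1)
  set s := √‖lam‖ with hsdef
  rcases le_total (s * t) 1 with hst | hst
  · have e1 : ‖hsG ν c z t lam‖ ≤
        K ^ 2 * Real.exp (D * s * (z + t)) * (t ^ tau ν 0 * z ^ tau ν 1) * 2 := by
      unfold hsG
      refine (norm_sub_le _ _).trans ?_
      rw [norm_mul, norm_mul]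
      have a1 := mul_le_mul (h 0 t ht lam) (h 1 z hz lam) (norm_nonneg _) (by positivity)
      have a2 := mul_le_mul (h 0 z hz lam) (h 1 t ht lam) (norm_nonneg _)
        (by have := Real.rpow_pos_of_pos hz (tau ν 0); positivity)
      have a3 : Real.exp (D * s * (z + t)) = Real.exp (D * s * t) * Real.exp (D * s * z) := by
        rw [← Real.exp_add]; ring_nf
      have a4 := mul_le_mul_of_nonneg_left hex
        (show 0 ≤ K ^ 2 * (Real.exp (D * s * t) * Real.exp (D * s * z)) by positivity)
      rw [a3]
      calc _ ≤ _ := add_le_add a1 a2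
        _ = K ^ 2 * (Real.exp (D * s * t) * Real.exp (D * s * z)) *
            (t ^ tau ν 0 * z ^ tau ν 1) + K ^ 2 * (Real.exp (D * s * t) * Real.exp (D * s * z)) *
            (z ^ tau ν 0 * t ^ tau ν 1) := by ring
        _ ≤ _ := by linarith
    refine e1.trans ?_
    have e2 : Real.exp (D * s * (z + t)) ≤ Real.exp (2 * D) * Real.exp (D * s * (z - t)) := by
      rw [← Real.exp_add]
      apply Real.exp_le_exp.2
      nlinarith
    calc _ ≤ K ^ 2 * (Real.exp (2 * D) * Real.exp (D * s * (z - t))) *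
          (t ^ tau ν 0 * z ^ tau ν 1) * 2 := by gcongr
      _ = (2 * K ^ 2 * Real.exp (2 * D)) * t ^ tau ν 0 * z ^ tau ν 1 *
          Real.exp (D * s * (z - t)) := by ring
      _ ≤ _ := by
        gcongr
        exact (le_max_left _ _).trans (le_max_right _ _)
  · have hs : 0 < s := by
      by_contra hcon
      nlinarith
    have hlam : ‖lam‖ = s ^ 2 := (Real.sq_sqrt (norm_nonneg _)).symm
    have hen := energy_estimate (y := fun z => hsG ν c z t lam)
      (yd := fun z : ℝ => SingularSL.hs ν c 0 t lam * hsD ν c 1 z lam -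
        hsD ν c 0 z lam * SingularSL.hs ν c 1 t lam) (n := nu0 ν) (lam := lam) hs hlam
      (fun z hz => ((P.hasDerivAt_hs_real 1 hz lam).const_mul _).sub
        ((P.hasDerivAt_hs_real 0 hz lam).mul_const _))
      (fun z hz => by
        refine (((P.hasDerivAt_hsD_real 1 hz lam).const_mul _).sub
          ((P.hasDerivAt_hsD_real 0 hz lam).mul_const _)).congr_deriv ?_
        unfold hsG; ring) ht htz
    have hW := P.hs_wronskian (z := (t : ℂ)) (Complex.ofReal_ne_zero.2 ht.ne') lam
    have h0 : hsG ν c t t lam = 0 := by unfold hsG; ring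
    simp only [hW, h0, norm_zero, norm_one] at hen
    have e1 : ‖nu0 ν‖ / (s * t) ≤ ‖nu0 ν‖ := div_le_self (norm_nonneg _) hst
    have e2 : (s * ‖hsG ν c z t lam‖) ^ 2 ≤
        (Real.exp (‖nu0 ν‖ / 2) * Real.exp (s * (z - t))) ^ 2 := by
      calc _ = s ^ 2 * ‖hsG ν c z t lam‖ ^ 2 := by ring
        _ ≤ Real.exp (2 * s * (z - t) + ‖nu0 ν‖ / (s * t)) := by
          nlinarith [sq_nonneg ‖SingularSL.hs ν c 0 t lam * hsD ν c 1 z lam -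
            hsD ν c 0 z lam * SingularSL.hs ν c 1 t lam‖]
        _ ≤ Real.exp (2 * s * (z - t) + ‖nu0 ν‖) := by gcongr
        _ = _ := by rw [← Real.exp_add, sq, ← Real.exp_add]; ring_nf
    have e3 := abs_le_of_sq_le_sq' e2 (by positivity)
    -- The two real exponents add up to 1, so 1/s ≤ t = t ^ τ₀ * t ^ τ₁; as τ₁ > 0, t may be
    -- replaced by z in the last factor.
    have e4 : 1 / s ≤ t ^ tau ν 0 * z ^ tau ν 1 := by
      have : t = t ^ tau ν 0 * t ^ tau ν 1 := by
        rw [← Real.rpow_add ht, tau_zero, tau_one]; ring_nf; simp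
      calc 1 / s ≤ t := by rw [div_le_iff₀ hs]; linarith
        _ = t ^ tau ν 0 * t ^ tau ν 1 := this
        _ ≤ _ := by
          gcongr
          rw [tau_one]; linarith [P.re_pos]
    have e5 : Real.exp (s * (z - t)) ≤ Real.exp (D * s * (z - t)) := by
      apply Real.exp_le_exp.2
      have : 0 ≤ s * (z - t) := mul_nonneg hs.le (by linarith)
      nlinarith
    calc ‖hsG ν c z t lam‖ = (s * ‖hsG ν c z t lam‖) * (1 / s) := by field_simp
      _ ≤ (Real.exp (‖nu0 ν‖ / 2) * Real.exp (s * (z - t))) * (1 / s) :=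
        mul_le_mul_of_nonneg_right e3.2 (by positivity)
      _ ≤ (Real.exp (‖nu0 ν‖ / 2) * Real.exp (D * s * (z - t))) *
          (t ^ tau ν 0 * z ^ tau ν 1) := by gcongr
      _ = Real.exp (‖nu0 ν‖ / 2) * t ^ tau ν 0 * z ^ tau ν 1 * Real.exp (D * s * (z - t)) := by
        ring
      _ ≤ _ := by
        gcongr
        exact (le_max_right _ _).trans (le_max_right _ _)

end Params

/-! ### The Macdonald function and its asymptotics -/

section Macdonald

/-- The moments `∫₀^∞ (cosh s) ^ n exp(-w cosh s) cosh(ν s) ds`; `n = 0` gives the Macdonald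
function `K_ν(w)` and increasing `n` gives its derivatives. -/
noncomputable def besselKer (ν : ℂ) (n : ℕ) (w : ℂ) (s : ℝ) : ℂ :=
  (Real.cosh s : ℂ) ^ n * Complex.exp (-w * Real.cosh s) * Complex.cosh (ν * s)

/-- The integral of `besselKer`. -/
noncomputable def besselMoment (ν : ℂ) (n : ℕ) (w : ℂ) : ℂ :=
  ∫ s in Ioi (0 : ℝ), besselKer ν n w s

lemma norm_cexp_half_add_le (z w : ℂ) (B : ℝ) (h1 : z.re ≤ B) (h2 : w.re ≤ B) :
    ‖(Complex.exp z + Complex.exp w) / 2‖ ≤ Real.exp B ∧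
    ‖(Complex.exp z - Complex.exp w) / 2‖ ≤ Real.exp B := by
  have e1 : ‖Complex.exp z‖ ≤ Real.exp B := by
    rw [Complex.norm_exp]; exact Real.exp_le_exp.2 h1
  have e2 : ‖Complex.exp w‖ ≤ Real.exp B := by
    rw [Complex.norm_exp]; exact Real.exp_le_exp.2 h2
  constructor
  · rw [norm_div, Complex.norm_ofNat]
    linarith [norm_add_le (Complex.exp z) (Complex.exp w)]
  · rw [norm_div, Complex.norm_ofNat]
    linarith [norm_sub_le (Complex.exp z) (Complex.exp w)]

lemma norm_cosh_mul_le (ν : ℂ) {s : ℝ} (hs : 0 ≤ s) :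
    ‖Complex.cosh (ν * s)‖ ≤ Real.exp (‖ν‖ * s) ∧ ‖Complex.sinh (ν * s)‖ ≤ Real.exp (‖ν‖ * s) := by
  have h1 : (ν * s).re ≤ ‖ν‖ * s := by
    refine (Complex.re_le_norm _).trans (le_of_eq ?_)
    rw [norm_mul, Complex.norm_of_nonneg hs]
  have h2 : (-(ν * s)).re ≤ ‖ν‖ * s := by
    refine (Complex.re_le_norm _).trans (le_of_eq ?_)
    rw [norm_neg, norm_mul, Complex.norm_of_nonneg hs]
  exact norm_cexp_half_add_le _ _ _ h1 h2

lemma cosh_sub_one_eq (s : ℝ) : Real.cosh s - 1 = 2 * Real.sinh (s / 2) ^ 2 := by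
  have h := Real.cosh_two_mul (s / 2)
  have h2 := Real.cosh_sq (s / 2)
  rw [show 2 * (s / 2) = s by ring] at h
  linarith

lemma sq_half_le_cosh_sub_one {s : ℝ} (hs : 0 ≤ s) : s ^ 2 / 2 ≤ Real.cosh s - 1 := by
  have h := Real.self_le_sinh_iff.2 (show 0 ≤ s / 2 by linarith)
  rw [cosh_sub_one_eq]
  nlinarith

lemma cosh_le_exp {s : ℝ} (hs : 0 ≤ s) : Real.cosh s ≤ Real.exp s := by
  rw [Real.cosh_eq]
  have : Real.exp (-s) ≤ Real.exp s := Real.exp_le_exp.2 (by linarith)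
  linarith

lemma integrable_gaussian_bound {δ : ℝ} (hδ : 0 < δ) (B : ℝ) :
    Integrable (fun s : ℝ => Real.exp (-(δ * s ^ 2) + B * s)) := by
  refine ((integrable_exp_neg_mul_sq (half_pos hδ)).const_mul (Real.exp (B ^ 2 / (2 * δ)))).mono'
    (by fun_prop) (Eventually.of_forall fun s => ?_)
  rw [Real.norm_of_nonneg (Real.exp_pos _).le, ← Real.exp_add]
  apply Real.exp_le_exp.2
  have h : 0 ≤ (δ * s - B) ^ 2 / (2 * δ) := by positivity
  have h2 : (δ * s - B) ^ 2 / (2 * δ) = δ * s ^ 2 / 2 - B * s + B ^ 2 / (2 * δ) := by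
    field_simp; ring
  linarith

/-- Since cosh s ≥ 1 + s²/2, the factor exp(-w cosh s) decays like a Gaussian and dominates the
exponential growth of the rest. The bound depends on w only through a lower bound of Re w, so it is
locally uniform. -/
lemma norm_besselKer_le (ν : ℂ) (n : ℕ) {w : ℂ} {δ : ℝ} (hδ : 0 < δ) (hw : δ ≤ w.re) {s : ℝ}
    (hs : 0 ≤ s) :
    ‖besselKer ν n w s‖ ≤ Real.exp (-(δ / 2 * s ^ 2) + (n + ‖ν‖) * s) := by
  unfold besselKer
  rw [norm_mul, norm_mul, norm_pow, Complex.norm_of_nonneg (Real.cosh_pos s).le, Complex.norm_exp]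
  have h1 : Real.cosh s ^ n ≤ Real.exp (n * s) := by
    rw [Real.exp_nat_mul]
    exact pow_le_pow_left₀ (Real.cosh_pos s).le (cosh_le_exp hs) n
  have h2 : (-w * (Real.cosh s : ℂ)).re ≤ -(δ / 2 * s ^ 2) := by
    rw [Complex.re_mul_ofReal, Complex.neg_re]
    have := sq_half_le_cosh_sub_one hs
    have := Real.one_le_cosh s
    nlinarith
  calc _ ≤ Real.exp (n * s) * Real.exp (-(δ / 2 * s ^ 2)) * Real.exp (‖ν‖ * s) := by
        gcongr; exact (norm_cosh_mul_le ν hs).1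
    _ = _ := by rw [← Real.exp_add, ← Real.exp_add]; ring_nf

lemma continuous_besselKer (ν : ℂ) (n : ℕ) (w : ℂ) : Continuous (besselKer ν n w) := by
  unfold besselKer
  have := Complex.continuous_cosh
  fun_prop

lemma integrableOn_besselKer (ν : ℂ) (n : ℕ) {w : ℂ} (hw : 0 < w.re) :
    IntegrableOn (besselKer ν n w) (Ioi 0) := by
  refine (integrable_gaussian_bound (half_pos hw) (n + ‖ν‖)).integrableOn.mono'
    (continuous_besselKer ν n w).aestronglyMeasurable ?_
  refine (ae_restrict_iff' measurableSet_Ioi).2 (Eventually.of_forall fun s hs => ?_)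
  exact norm_besselKer_le ν n hw le_rfl (le_of_lt hs)

lemma hasDerivAt_besselMoment (ν : ℂ) (n : ℕ) {w : ℂ} (hw : 0 < w.re) :
    HasDerivAt (besselMoment ν n) (-besselMoment ν (n + 1) w) w := by
  have hball : ∀ x ∈ Metric.ball w (w.re / 2), w.re / 2 ≤ x.re := by
    intro x hx
    have h1 := (Complex.abs_re_le_norm (x - w)).trans_lt (mem_ball_iff_norm.1 hx)
    rw [Complex.sub_re] at h1
    linarith [(abs_lt.1 h1).1]
  have h := (hasDerivAt_integral_of_dominated_loc_of_deriv_le (𝕜 := ℂ)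
    (μ := volume.restrict (Ioi (0 : ℝ))) (F := besselKer ν n)
    (F' := fun w s => -besselKer ν (n + 1) w s)
    (bound := fun s => Real.exp (-(w.re / 2 / 2 * s ^ 2) + ((n + 1 : ℕ) + ‖ν‖) * s))
    (Metric.ball_mem_nhds w (half_pos hw))
    (Eventually.of_forall fun x => (continuous_besselKer ν n x).aestronglyMeasurable)
    (integrableOn_besselKer ν n hw)
    (continuous_besselKer ν (n + 1) w).neg.aestronglyMeasurable ?_
    (integrable_gaussian_bound (half_pos (half_pos hw)) _).integrableOn ?_).2
  · rw [integral_neg] at h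
    exact h
  · refine (ae_restrict_iff' measurableSet_Ioi).2 (Eventually.of_forall fun s hs x hx => ?_)
    rw [norm_neg]
    exact norm_besselKer_le ν (n + 1) (half_pos hw) (hball x hx) (le_of_lt hs)
  · refine Eventually.of_forall fun s x _ => ?_
    unfold besselKer
    have h1 : HasDerivAt (fun x : ℂ => Complex.exp (-x * Real.cosh s))
        (Complex.exp (-x * Real.cosh s) * (-1 * Real.cosh s)) x :=
      ((hasDerivAt_neg x).mul_const _).cexp
    refine ((h1.const_mul ((Real.cosh s : ℂ) ^ n)).mul_const _).congr_deriv ?_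
    ring

/-- The combination of integrands is an exact derivative, of a function vanishing at s = 0 and at
infinity. -/
lemma besselMoment_ode (ν : ℂ) {w : ℂ} (hw : 0 < w.re) :
    w ^ 2 * besselMoment ν 2 w - w * besselMoment ν 1 w - (w ^ 2 + ν ^ 2) * besselMoment ν 0 w =
      0 := by
  set B : ℝ → ℂ := fun s => Complex.exp (-w * Real.cosh s) *
    (-w * Real.sinh s * Complex.cosh (ν * s) - ν * Complex.sinh (ν * s)) with hB
  have hd : ∀ s : ℝ, HasDerivAt B (w ^ 2 * besselKer ν 2 w s - w * besselKer ν 1 w s -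
      (w ^ 2 + ν ^ 2) * besselKer ν 0 w s) s := by
    intro s
    have hc : HasDerivAt (fun s : ℝ => (Real.cosh s : ℂ)) (Real.sinh s : ℂ) s :=
      (Real.hasDerivAt_cosh s).ofReal_comp
    have hsn : HasDerivAt (fun s : ℝ => (Real.sinh s : ℂ)) (Real.cosh s : ℂ) s :=
      (Real.hasDerivAt_sinh s).ofReal_comp
    have hlin : HasDerivAt (fun s : ℝ => ν * (s : ℂ)) (ν * 1) s :=
      (Complex.ofRealCLM.hasDerivAt).const_mul ν
    have h1 := (hc.const_mul (-w)).cexp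
    have h2 : HasDerivAt (fun s : ℝ => Complex.cosh (ν * s)) (Complex.sinh (ν * s) * (ν * 1)) s :=
      (Complex.hasDerivAt_cosh _).comp s hlin
    have h3 : HasDerivAt (fun s : ℝ => Complex.sinh (ν * s)) (Complex.cosh (ν * s) * (ν * 1)) s :=
      (Complex.hasDerivAt_sinh _).comp s hlin
    refine (h1.mul (((hsn.const_mul (-w)).mul h2).sub (h3.const_mul ν))).congr_deriv ?_
    have hsq : (Real.sinh s : ℂ) ^ 2 = (Real.cosh s : ℂ) ^ 2 - 1 := by
      have := Real.cosh_sq s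
      have h4 : Real.sinh s ^ 2 = Real.cosh s ^ 2 - 1 := by linarith
      exact_mod_cast congrArg (fun x : ℝ => (x : ℂ)) h4
    unfold besselKer
    simp only [Pi.mul_apply, Pi.sub_apply]
    linear_combination (w ^ 2 * Complex.exp (-w * Real.cosh s) * Complex.cosh (ν * s)) * hsq
  have i0 := integrableOn_besselKer ν 0 hw
  have i1 := integrableOn_besselKer ν 1 hw
  have i2 := integrableOn_besselKer ν 2 hw
  have hlim : Tendsto B atTop (𝓝 0) := by
    have h1 : Tendsto (fun s : ℝ => (‖w‖ + ‖ν‖) *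
        Real.exp (-(w.re / 2 * s ^ 2) + (1 + ‖ν‖) * s)) atTop (𝓝 0) := by
      rw [← mul_zero (‖w‖ + ‖ν‖)]
      refine Tendsto.const_mul _ (Real.tendsto_exp_atBot.comp ?_)
      have h2 : Tendsto (fun s : ℝ => s * (-(w.re / 2) * s + (1 + ‖ν‖))) atTop atBot := by
        refine Tendsto.atTop_mul_atBot₀ tendsto_id ?_
        refine tendsto_atBot_add_const_right _ _ ?_
        exact tendsto_id.const_mul_atTop_of_neg (by linarith)
      refine h2.congr fun s => ?_
      ring
    refine squeeze_zero_norm' ?_ h1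
    filter_upwards [eventually_ge_atTop 0] with s hs
    have k1 := norm_cosh_mul_le ν hs
    have k2 : ‖(Real.sinh s : ℂ)‖ ≤ Real.exp s := by
      rw [Complex.norm_of_nonneg (Real.sinh_nonneg_iff.2 hs)]
      exact (Real.sinh_lt_cosh s).le.trans (cosh_le_exp hs)
    have k3 : Complex.re (-w * (Real.cosh s : ℂ)) ≤ -(w.re / 2 * s ^ 2) := by
      rw [Complex.re_mul_ofReal, Complex.neg_re]
      have := sq_half_le_cosh_sub_one hs
      have := Real.one_le_cosh s
      nlinarith
    have k4 : (1 : ℝ) ≤ Real.exp s := Real.one_le_exp hs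
    simp only [hB]
    rw [norm_mul, Complex.norm_exp]
    have k5 : ‖-w * Real.sinh s * Complex.cosh (ν * s) - ν * Complex.sinh (ν * s)‖ ≤
        (‖w‖ + ‖ν‖) * (Real.exp s * Real.exp (‖ν‖ * s)) := by
      refine (norm_sub_le _ _).trans ?_
      rw [norm_mul, norm_mul, norm_mul, norm_neg]
      calc _ ≤ ‖w‖ * Real.exp s * Real.exp (‖ν‖ * s) + ‖ν‖ * (1 * Real.exp (‖ν‖ * s)) := by
            rw [one_mul]; gcongr; exacts [k1.1, k1.2]
        _ ≤ ‖w‖ * Real.exp s * Real.exp (‖ν‖ * s) + ‖ν‖ * (Real.exp s * Real.exp (‖ν‖ * s)) := by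
            gcongr
        _ = _ := by ring
    calc _ ≤ Real.exp (-(w.re / 2 * s ^ 2)) *
          ((‖w‖ + ‖ν‖) * (Real.exp s * Real.exp (‖ν‖ * s))) := by gcongr
      _ = (‖w‖ + ‖ν‖) * (Real.exp (-(w.re / 2 * s ^ 2)) * (Real.exp s * Real.exp (‖ν‖ * s))) := by
          ring
      _ = _ := by rw [← Real.exp_add, ← Real.exp_add]; ring_nf
  have hint := integral_Ioi_of_hasDerivAt_of_tendsto' (a := (0 : ℝ)) (fun s _ => hd s)
    (((i2.const_mul _).sub (i1.const_mul _)).sub (i0.const_mul _)) hlim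
  have hB0 : B 0 = 0 := by simp [hB]
  have i21 : IntegrableOn (fun s => w ^ 2 * besselKer ν 2 w s - w * besselKer ν 1 w s) (Ioi 0) :=
    (i2.const_mul _).sub (i1.const_mul _)
  rw [hB0, sub_zero, integral_sub i21 (i0.const_mul _),
    integral_sub (i2.const_mul _) (i1.const_mul _), integral_const_mul, integral_const_mul,
    integral_const_mul] at hint
  exact hint

/-- The solution `√w K_ν(w)` of `y'' = (1 + ν₀ / w²) y`. -/
noncomputable def decaySol (ν : ℂ) (w : ℂ) : ℂ := w ^ (1 / 2 : ℂ) * besselMoment ν 0 w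

/-- The derivative of `decaySol`. -/
noncomputable def decaySolD (ν : ℂ) (w : ℂ) : ℂ :=
  w ^ (1 / 2 : ℂ) * (besselMoment ν 0 w / (2 * w) - besselMoment ν 1 w)

lemma hasDerivAt_decaySol (ν : ℂ) {w : ℂ} (hw : 0 < w.re) :
    HasDerivAt (decaySol ν) (decaySolD ν w) w := by
  have hw' : w ∈ Complex.slitPlane := Or.inl hw
  have hw0 := Complex.slitPlane_ne_zero hw'
  have h1 : HasDerivAt (fun z : ℂ => z ^ (1 / 2 : ℂ)) ((1 / 2) * w ^ ((1 / 2 : ℂ) - 1)) w := by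
    simpa using (hasDerivAt_id w).cpow_const (c := (1 / 2 : ℂ)) hw'
  refine (h1.mul (hasDerivAt_besselMoment ν 0 hw)).congr_deriv ?_
  rw [Complex.cpow_sub _ _ hw0, Complex.cpow_one]
  unfold decaySolD
  field_simp
  ring

lemma hasDerivAt_decaySolD (ν : ℂ) {w : ℂ} (hw : 0 < w.re) :
    HasDerivAt (decaySolD ν) ((nu0 ν / w ^ 2 + 1) * decaySol ν w) w := by
  have hw' : w ∈ Complex.slitPlane := Or.inl hw
  have hw0 := Complex.slitPlane_ne_zero hw'
  have h1 : HasDerivAt (fun z : ℂ => z ^ (1 / 2 : ℂ)) ((1 / 2) * w ^ ((1 / 2 : ℂ) - 1)) w := by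
    simpa using (hasDerivAt_id w).cpow_const (c := (1 / 2 : ℂ)) hw'
  have h2 := ((hasDerivAt_besselMoment ν 0 hw).div ((hasDerivAt_id w).const_mul 2)
    (by simpa using hw0)).sub (hasDerivAt_besselMoment ν 1 hw)
  refine (h1.mul h2).congr_deriv ?_
  have ode := besselMoment_ode ν hw
  rw [Complex.cpow_sub _ _ hw0, Complex.cpow_one]
  unfold decaySol nu0
  simp only [Pi.sub_apply, Pi.div_apply, id]
  generalize besselMoment ν 0 w = a at *
  generalize besselMoment ν (0 + 1) w = b at *
  generalize besselMoment ν (1 + 1) w = d at *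
  generalize w ^ (1 / 2 : ℂ) = e at *
  field_simp
  linear_combination 16 * e * ode

lemma cpow_mul_pos {η : ℂ} (hη : η ≠ 0) {t : ℝ} (ht : 0 < t) (μ : ℂ) :
    (η * t) ^ μ = η ^ μ * (t : ℂ) ^ μ := by
  have ht' : (t : ℂ) ≠ 0 := Complex.ofReal_ne_zero.2 ht.ne'
  rw [Complex.cpow_def_of_ne_zero (mul_ne_zero hη ht'), Complex.cpow_def_of_ne_zero hη,
    Complex.cpow_def_of_ne_zero ht', ← Complex.exp_add, Complex.log_mul_ofReal _ ht _ hη,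
    Complex.ofReal_log ht.le]
  ring_nf

lemma tendsto_sinh_scaled (x : ℝ) :
    Tendsto (fun t : ℝ => t * Real.sinh (x / t)) atTop (𝓝 x) := by
  rcases eq_or_ne x 0 with rfl | hx
  · simp
  have h1 : HasDerivAt Real.sinh 1 0 := by simpa using Real.hasDerivAt_sinh 0
  have h2 := (hasDerivAt_iff_tendsto_slope.1 h1)
  have h3 : Tendsto (fun t : ℝ => x / t) atTop (𝓝[≠] 0) := by
    refine tendsto_nhdsWithin_iff.2 ⟨tendsto_const_nhds.div_atTop tendsto_id, ?_⟩
    filter_upwards [eventually_gt_atTop 0] with t ht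
    exact div_ne_zero hx ht.ne'
  have h4 := (h2.comp h3).const_mul x
  rw [mul_one] at h4
  refine h4.congr' ?_
  filter_upwards [eventually_gt_atTop 0] with t ht
  simp only [Function.comp, slope, vsub_eq_sub, sub_zero, Real.sinh_zero, smul_eq_mul]
  field_simp

/-- Asymptotics of `√w K_ν(w)` along rays. -/
lemma tendsto_decaySol (ν : ℂ) {η : ℂ} (hη : 0 < η.re) :
    Tendsto (fun t : ℝ => decaySol ν (η * t) * Complex.exp (η * t)) atTop
      (𝓝 (η ^ (1 / 2 : ℂ) * ((Real.pi / (η / 2)) ^ (1 / 2 : ℂ) / 2))) := by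
  have hη0 : η ≠ 0 := by rintro rfl; simp at hη
  -- Laplace's method: after rescaling s = x/√t the exponent -ηt(cosh(x/√t) - 1) tends to -ηx²/2,
  -- and a Gaussian dominates for t ≥ 1.
  set F : ℝ → ℝ → ℂ := fun t x =>
    Complex.exp (-η * ((t * (Real.cosh (x / √t) - 1) : ℝ) : ℂ)) *
      Complex.cosh (ν * ((x / √t : ℝ) : ℂ)) with hF
  have hcong : ∀ᶠ t : ℝ in atTop, η ^ (1 / 2 : ℂ) * ∫ x in Ioi (0 : ℝ), F t x =
      decaySol ν (η * t) * Complex.exp (η * t) := by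
    filter_upwards [eventually_gt_atTop 0] with t ht
    have hst : 0 < √t := Real.sqrt_pos.2 ht
    have h1 := integral_comp_mul_left_Ioi
      (fun s : ℝ => besselKer ν 0 (η * t) s * Complex.exp (η * t)) 0 (inv_pos.2 hst)
    rw [mul_zero, inv_inv, integral_mul_const] at h1
    have h2 : ∀ x : ℝ, F t x = besselKer ν 0 (η * t) ((√t)⁻¹ * x) * Complex.exp (η * t) := by
      intro x
      simp only [hF, besselKer]
      rw [pow_zero, one_mul, mul_right_comm, ← Complex.exp_add, div_eq_inv_mul]
      congr 2
      push_cast; ring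
    simp_rw [h2]
    rw [integral_mul_const, h1, integral_mul_const]
    unfold decaySol
    have h3 : (t : ℂ) ^ (1 / 2 : ℂ) = ((√t : ℝ) : ℂ) := by
      rw [Real.sqrt_eq_rpow, Complex.ofReal_cpow ht.le]; norm_num
    rw [cpow_mul_pos hη0 ht, h3, Complex.real_smul]
    unfold besselMoment
    ring
  refine Tendsto.congr' hcong (Tendsto.const_mul _ ?_)
  rw [← integral_gaussian_complex_Ioi (by simpa using hη : 0 < (η / 2).re)]
  refine tendsto_integral_filter_of_dominated_convergence
    (fun x => Real.exp (-(η.re / 2 * x ^ 2) + ‖ν‖ * x)) ?_ ?_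
    (integrable_gaussian_bound (half_pos hη) _).integrableOn ?_
  · refine Eventually.of_forall fun t => Continuous.aestronglyMeasurable ?_
    have := Complex.continuous_cosh
    simp only [hF]
    fun_prop
  · filter_upwards [eventually_ge_atTop 1] with t ht
    refine (ae_restrict_iff' measurableSet_Ioi).2 (Eventually.of_forall fun x hx => ?_)
    have hx : 0 < x := hx
    have hst : 1 ≤ √t := Real.one_le_sqrt.2 ht
    have hxt : 0 ≤ x / √t := by positivity
    have k1 := sq_half_le_cosh_sub_one hxt
    have k2 : t * (x / √t) ^ 2 = x ^ 2 := by
      rw [div_pow, Real.sq_sqrt (by linarith)]; field_simp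
    simp only [hF]
    rw [norm_mul, Complex.norm_exp, Complex.re_mul_ofReal, Complex.neg_re, Real.exp_add]
    have k3 : x ^ 2 / 2 ≤ t * (Real.cosh (x / √t) - 1) := by nlinarith
    have k4 : x / √t ≤ x := div_le_self hx.le hst
    have k5 := (norm_cosh_mul_le ν hxt).1
    gcongr
    · nlinarith
    · refine k5.trans ?_
      gcongr
  · refine Eventually.of_forall fun x => ?_
    have h1 : Tendsto (fun t : ℝ => t * (Real.cosh (x / √t) - 1)) atTop (𝓝 (x ^ 2 / 2)) := by
      have h2 := (((tendsto_sinh_scaled (x / 2)).comp Real.tendsto_sqrt_atTop).pow 2).const_mul 2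
      have h3 : 2 * (x / 2) ^ 2 = x ^ 2 / 2 := by ring
      rw [h3] at h2
      refine h2.congr' ?_
      filter_upwards [eventually_gt_atTop 0] with t ht
      simp only [Function.comp]
      rw [cosh_sub_one_eq, mul_pow, Real.sq_sqrt ht.le, show x / 2 / √t = x / √t / 2 by ring]
      ring
    have h4 : Tendsto (fun t : ℝ => x / √t) atTop (𝓝 0) :=
      tendsto_const_nhds.div_atTop Real.tendsto_sqrt_atTop
    have h5 := ((Complex.continuous_ofReal.tendsto _).comp h1).const_mul (-η)
    have h6 := ((Complex.continuous_ofReal.tendsto _).comp h4).const_mul ν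
    have h7 := ((Complex.continuous_exp.tendsto _).comp h5).mul
      ((Complex.continuous_cosh.tendsto _).comp h6)
    simp only [Complex.ofReal_zero, mul_zero, Complex.cosh_zero, mul_one] at h7
    convert! h7 using 2
    push_cast; ring_nf

end Macdonald

/-! ### The decaying solution in terms of the Frobenius solutions -/

namespace Params

variable {ν : ℂ} {c : Fin 2 → ℂ} (P : Params ν c)
include P

/-- The coefficients are, up to sign, the Wronskians with the two Frobenius solutions at λ = -1,
which are constant on the right half-plane. -/
lemma exists_decaySol_eq : ∃ β : Fin 2 → ℂ, ∀ w : ℂ, 0 < w.re →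
    decaySol ν w = β 0 * hs ν c 0 w (-1) + β 1 * hs ν c 1 w (-1) := by
  have hopen : IsOpen {w : ℂ | 0 < w.re} := isOpen_lt continuous_const Complex.continuous_re
  have hconv : Convex ℝ {w : ℂ | 0 < w.re} := convex_halfSpace_re_gt 0
  have key : ∀ j, ∀ w : ℂ, 0 < w.re →
      HasDerivAt (fun w => decaySol ν w * hsD ν c j w (-1) - decaySolD ν w * hs ν c j w (-1))
        0 w := by
    intro j w hw
    refine (((hasDerivAt_decaySol ν hw).mul (P.hasDerivAt_hsD j (Or.inl hw) (-1))).sub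
      ((hasDerivAt_decaySolD ν hw).mul (P.hasDerivAt_hs j (Or.inl hw) (-1)))).congr_deriv ?_
    ring
  have hconst : ∀ j, ∀ w : ℂ, 0 < w.re →
      decaySol ν w * hsD ν c j w (-1) - decaySolD ν w * hs ν c j w (-1) =
      decaySol ν 1 * hsD ν c j 1 (-1) - decaySolD ν 1 * hs ν c j 1 (-1) := by
    intro j w hw
    exact hopen.is_const_of_deriv_eq_zero hconv.isPreconnected
      (fun w hw => (key j w hw).differentiableAt.differentiableWithinAt)
      (fun w hw => (key j w hw).deriv) hw (by simp)
  refine ⟨![decaySol ν 1 * hsD ν c 1 1 (-1) - decaySolD ν 1 * hs ν c 1 1 (-1),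
    -(decaySol ν 1 * hsD ν c 0 1 (-1) - decaySolD ν 1 * hs ν c 0 1 (-1))], fun w hw => ?_⟩
  have hw0 : w ≠ 0 := by rintro rfl; simp at hw
  have hW := P.hs_wronskian hw0 (-1)
  simp only [Matrix.cons_val_zero, Matrix.cons_val_one]
  rw [← hconst 1 w hw, ← hconst 0 w hw]
  linear_combination (-decaySol ν w) * hW

/-- A single Frobenius solution is not a multiple of the decaying solution. -/
lemma decaySol_ne_mul_hs (j : Fin 2) (b : ℂ) :
    ¬ ∀ w : ℂ, 0 < w.re → decaySol ν w = b * hs ν c j w (-1) := by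
  intro hb
  obtain ⟨D, -, hD⟩ := P.norm_frobF_le j
  -- On the ray w = η√t the assumption says that b times the entire factor at -w² equals the
  -- decaying solution times w ^ (-μ), which is exponentially small.
  have hlim : ∀ η : ℂ, 0 < η.re →
      Tendsto (fun t : ℝ => b * frobF ν c j (-1 * (η * ((√t : ℝ) : ℂ)) ^ 2)) atTop (𝓝 0) := by
    intro η hη
    have hη0 : η ≠ 0 := by rintro rfl; simp at hη
    have h1 := tendsto_decaySol ν hη
    have h2 : Tendsto (fun t : ℝ => Complex.exp (-(η * t)) * (η * (t : ℂ)) ^ (-expo ν j)) atTop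
        (𝓝 0) := by
      rw [tendsto_zero_iff_norm_tendsto_zero]
      have h3 := (tendsto_rpow_mul_exp_neg_mul_atTop_nhds_zero (-expo ν j).re η.re hη).const_mul
        ‖η ^ (-expo ν j)‖
      rw [mul_zero] at h3
      refine h3.congr' ?_
      filter_upwards [eventually_gt_atTop 0] with t ht
      rw [cpow_mul_pos hη0 ht, norm_mul, norm_mul, Complex.norm_cpow_eq_rpow_re_of_pos ht,
        Complex.norm_exp]
      simp only [Complex.neg_re, Complex.re_mul_ofReal]
      ring_nf
    have h4 := h1.mul h2
    rw [mul_zero] at h4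
    refine (h4.comp Real.tendsto_sqrt_atTop).congr' ?_
    filter_upwards [eventually_gt_atTop 0] with t ht
    have hst := Real.sqrt_pos.2 ht
    have hw : 0 < (η * ((√t : ℝ) : ℂ)).re := by
      rw [Complex.re_mul_ofReal]; positivity
    have hw0 : η * ((√t : ℝ) : ℂ) ≠ 0 := mul_ne_zero hη0 (Complex.ofReal_ne_zero.2 hst.ne')
    simp only [Function.comp]
    rw [hb _ hw]
    unfold hs
    rw [Complex.cpow_neg, Complex.exp_neg]
    have hp : (η * ((√t : ℝ) : ℂ)) ^ expo ν j ≠ 0 := by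
      rw [Ne, Complex.cpow_eq_zero_iff]; tauto
    have hex := Complex.exp_ne_zero (η * ((√t : ℝ) : ℂ))
    field_simp
  -- For η = 1 ∓ i one has -η² = ±2i, so both halves of the imaginary axis are reached; the
  -- rescaling by 1/2 removes the factor 2. The entire factor does not vanish at 0, so b = 0
  -- follows.
  have hzero : ∀ l, b * frobF ν c j l = 0 := by
    refine eq_zero_of_tendsto_zero_imaginary ((P.differentiable_frobF j).const_mul b)
      (A := ‖b‖ * ‖c j‖) (B := D) (fun l => ?_) ?_ ?_
    · rw [norm_mul, mul_assoc]
      gcongr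
      exact hD l
    · refine (hlim (1 - Complex.I) (by simp)).const_mul ((1 : ℂ)) |>.comp
        (tendsto_id.const_mul_atTop (by norm_num : (0 : ℝ) < 1 / 2)) |>.congr' ?_ |>.trans
        (by simp)
      filter_upwards [eventually_gt_atTop 0] with t ht
      simp only [Function.comp, id, one_mul]
      rw [mul_pow, ← Complex.ofReal_pow, Real.sq_sqrt (by positivity)]
      congr 2
      push_cast
      linear_combination (-(t : ℂ) / 2) * Complex.I_sq
    · refine (hlim (1 + Complex.I) (by simp)).const_mul ((1 : ℂ)) |>.comp
        (tendsto_id.const_mul_atTop (by norm_num : (0 : ℝ) < 1 / 2)) |>.congr' ?_ |>.trans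
        (by simp)
      filter_upwards [eventually_gt_atTop 0] with t ht
      simp only [Function.comp, id, one_mul]
      rw [mul_pow, ← Complex.ofReal_pow, Real.sq_sqrt (by positivity)]
      congr 2
      push_cast
      linear_combination (-(t : ℂ) / 2) * Complex.I_sq
  have hb0 : b = 0 := by
    have := hzero 0
    rw [frobF_zero] at this
    exact (mul_eq_zero.1 this).resolve_right (P.c_ne_zero j)
  -- With b = 0 the decaying solution would vanish on the positive axis, against its nonzero
  -- asymptotic constant.
  have h1 := tendsto_decaySol ν (η := 1) (by simp)
  have h2 : ∀ᶠ t : ℝ in atTop, decaySol ν (1 * t) * Complex.exp (1 * t) = 0 := by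
    filter_upwards [eventually_gt_atTop 0] with t ht
    rw [hb (1 * (t : ℂ)) (by simpa using ht), hb0]; simp
  have h3 := tendsto_nhds_unique h1 (tendsto_const_nhds.congr' (h2.mono fun t ht => ht.symm))
  have hpi : (Real.pi : ℂ) ≠ 0 := Complex.ofReal_ne_zero.2 Real.pi_ne_zero
  simp [Complex.cpow_eq_zero_iff, hpi] at h3

end Params

/-! ### Decaying and growing solutions of the model equation -/

/-- With x = t - s this is a convolution of a bounded function having a limit with an integrable
exponential. Dominated convergence gives l times the integral of exp(ax) over (0, ∞). -/
lemma tendsto_integral_exp_mul {h : ℝ → ℂ} {T : ℝ} {l a : ℂ} (hc : ContinuousOn h (Ici T))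
    (hl : Tendsto h atTop (𝓝 l)) (ha : a.re < 0) :
    Tendsto (fun t : ℝ => ∫ s in T..t, Complex.exp (a * ((t - s : ℝ) : ℂ)) * h s) atTop
      (𝓝 (-l / a)) := by
  obtain ⟨M, hM⟩ : ∃ M, ∀ s, T ≤ s → ‖h s‖ ≤ M := by
    have h1 : ∀ᶠ s in atTop, ‖h s‖ ≤ ‖l‖ + 1 :=
      hl.norm.eventually (ge_mem_nhds (by linarith))
    obtain ⟨T', hT'⟩ := eventually_atTop.1 h1
    obtain ⟨M, hM⟩ := (isCompact_Icc (a := T) (b := T')).exists_bound_of_continuousOn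
      (hc.mono Icc_subset_Ici_self)
    refine ⟨max M (‖l‖ + 1), fun s hs => ?_⟩
    rcases le_total s T' with h2 | h2
    · exact (hM s ⟨hs, h2⟩).trans (le_max_left _ _)
    · exact (hT' s h2).trans (le_max_right _ _)
  set F : ℝ → ℝ → ℂ := fun t => (Ioc 0 (t - T)).indicator
    (fun x => Complex.exp (a * x) * h (t - x)) with hF
  have hcong : ∀ᶠ t in atTop, ∫ x in Ioi (0 : ℝ), F t x =
      ∫ s in T..t, Complex.exp (a * ((t - s : ℝ) : ℂ)) * h s := by
    filter_upwards [eventually_ge_atTop T] with t ht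
    have h1 := intervalIntegral.integral_comp_sub_left (a := T) (b := t)
      (fun x : ℝ => Complex.exp (a * x) * h (t - x)) t
    simp only [sub_sub_cancel, sub_self] at h1
    rw [h1, intervalIntegral.integral_of_le (by linarith)]
    simp only [hF]
    rw [setIntegral_indicator measurableSet_Ioc, inter_eq_self_of_subset_right Ioc_subset_Ioi_self]
  refine Tendsto.congr' hcong ?_
  have hval : ∫ x in Ioi (0 : ℝ), Complex.exp (a * x) * l = -l / a := by
    rw [integral_mul_const, integral_exp_mul_complex_Ioi ha]
    simp; ring
  rw [← hval]
  refine tendsto_integral_filter_of_dominated_convergence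
    (fun x => ‖Complex.exp (a * x)‖ * M) ?_ ?_
    ((integrableOn_exp_mul_complex_Ioi ha 0).norm.mul_const M) ?_
  · refine Eventually.of_forall fun t => ?_
    simp only [hF]
    refine AEStronglyMeasurable.restrict ?_
    rw [aestronglyMeasurable_indicator_iff measurableSet_Ioc]
    refine ContinuousOn.aestronglyMeasurable ?_ measurableSet_Ioc
    refine ContinuousOn.mul (by fun_prop) (hc.comp (by fun_prop) fun x hx => ?_)
    simp only [mem_Ici]
    linarith [hx.2]
  · refine Eventually.of_forall fun t => Eventually.of_forall fun x => ?_
    simp only [hF]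
    by_cases hx : x ∈ Ioc 0 (t - T)
    · rw [indicator_of_mem hx, norm_mul]
      gcongr
      exact hM _ (by linarith [hx.2])
    · rw [indicator_of_notMem hx, norm_zero]
      have := (norm_nonneg _).trans (hM T le_rfl)
      positivity
  · refine (ae_restrict_iff' measurableSet_Ioi).2 (Eventually.of_forall fun x hx => ?_)
    have h1 : Tendsto (fun t : ℝ => t - x) atTop atTop :=
      tendsto_atTop_add_const_right _ _ tendsto_id
    refine ((hl.comp h1).const_mul (Complex.exp (a * x))).congr' ?_
    filter_upwards [eventually_ge_atTop (x + T)] with t ht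
    simp only [hF, Function.comp]
    rw [indicator_of_mem (show x ∈ Ioc 0 (t - T) from ⟨hx, by linarith⟩)]

/-- Data describing the solutions of the model equation `y'' = (ν₀ / t² - ω²) y`. -/
structure RayModel (ν : ℂ) (c : Fin 2 → ℂ) (ω : ℂ) (b : Fin 2 → ℂ) (d : ℂ) (C : ℝ) : Prop where
  im_pos : 0 < ω.im
  b_ne : ∀ j, b j ≠ 0
  d_ne : d ≠ 0
  C_pos : 0 < C
  lim_jost : Tendsto (fun t : ℝ => (b 0 * hs ν c 0 t (ω ^ 2) + b 1 * hs ν c 1 t (ω ^ 2)) *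
    Complex.exp (-(Complex.I * ω * t))) atTop (𝓝 1)
  lim_grow : Tendsto (fun t : ℝ => hs ν c 1 t (ω ^ 2) * Complex.exp (Complex.I * ω * t)) atTop
    (𝓝 d)
  bound_jost : ∀ t : ℝ, 0 < t → ‖b 0 * hs ν c 0 t (ω ^ 2) + b 1 * hs ν c 1 t (ω ^ 2)‖ ≤
    C * min 1 t ^ tau ν 0 * Real.exp (-(ω.im * t))
  bound : ∀ j, ∀ t : ℝ, 0 < t →
    ‖hs ν c j t (ω ^ 2)‖ ≤ C * min 1 t ^ tau ν j * Real.exp (ω.im * t)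

lemma norm_exp_I_mul (ω : ℂ) (t : ℝ) :
    ‖Complex.exp (Complex.I * ω * t)‖ = Real.exp (-(ω.im * t)) ∧
    ‖Complex.exp (-(Complex.I * ω * t))‖ = Real.exp (ω.im * t) := by
  constructor <;> simp [Complex.norm_exp]

lemma exists_bound_Ici_one {g : ℝ → ℂ} {l : ℂ} (hc : ContinuousOn g (Ioi 0))
    (hl : Tendsto g atTop (𝓝 l)) : ∃ M, 0 < M ∧ ∀ t, 1 ≤ t → ‖g t‖ ≤ M := by
  have h1 : ∀ᶠ s in atTop, ‖g s‖ ≤ ‖l‖ + 1 := hl.norm.eventually (ge_mem_nhds (by linarith))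
  obtain ⟨T', hT'⟩ := eventually_atTop.1 h1
  obtain ⟨M, hM⟩ := (isCompact_Icc (a := 1) (b := T')).exists_bound_of_continuousOn
    (hc.mono fun x hx => lt_of_lt_of_le one_pos hx.1)
  refine ⟨max M (‖l‖ + 1), by positivity, fun s hs => ?_⟩
  rcases le_total s T' with h2 | h2
  · exact (hM s ⟨hs, h2⟩).trans (le_max_left _ _)
  · exact (hT' s h2).trans (le_max_right _ _)

namespace Params

variable {ν : ℂ} {c : Fin 2 → ℂ} (P : Params ν c)
include P

/-- The decaying solution is evaluated at w = -iωt, where -w² = ω²t², and normalised by its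
asymptotic constant. Both coefficients are nonzero because neither Frobenius solution alone is a
multiple of it. -/
lemma exists_jost_model {ω : ℂ} (hω : 0 < ω.im) : ∃ b : Fin 2 → ℂ, (∀ j, b j ≠ 0) ∧
    Tendsto (fun t : ℝ => (b 0 * hs ν c 0 t (ω ^ 2) + b 1 * hs ν c 1 t (ω ^ 2)) *
      Complex.exp (-(Complex.I * ω * t))) atTop (𝓝 1) := by
  set η : ℂ := -(Complex.I * ω) with hη
  have hηre : 0 < η.re := by simpa [hη] using hω
  have hη0 : η ≠ 0 := by intro h; rw [h] at hηre; simp at hηre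
  obtain ⟨β, hβ⟩ := P.exists_decaySol_eq
  have hβ0 : β 0 ≠ 0 := fun h => P.decaySol_ne_mul_hs 1 (β 1) fun w hw => by
    rw [hβ w hw, h]; ring
  have hβ1 : β 1 ≠ 0 := fun h => P.decaySol_ne_mul_hs 0 (β 0) fun w hw => by
    rw [hβ w hw, h]; ring
  have hlim := tendsto_decaySol ν hηre
  set l : ℂ := η ^ (1 / 2 : ℂ) * ((Real.pi / (η / 2)) ^ (1 / 2 : ℂ) / 2) with hl
  have hl0 : l ≠ 0 := by
    have hpi : (Real.pi : ℂ) ≠ 0 := Complex.ofReal_ne_zero.2 Real.pi_ne_zero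
    simp [hl, Complex.cpow_eq_zero_iff, hpi, hη0]
  have hp : ∀ j, η ^ expo ν j ≠ 0 := fun j => by
    rw [Ne, Complex.cpow_eq_zero_iff]; tauto
  refine ⟨fun j => l⁻¹ * β j * η ^ expo ν j, fun j => ?_, ?_⟩
  · match j with
    | 0 => exact mul_ne_zero (mul_ne_zero (inv_ne_zero hl0) hβ0) (hp 0)
    | 1 => exact mul_ne_zero (mul_ne_zero (inv_ne_zero hl0) hβ1) (hp 1)
  · have h1 := hlim.const_mul l⁻¹
    rw [inv_mul_cancel₀ hl0] at h1
    refine h1.congr' ?_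
    filter_upwards [eventually_gt_atTop 0] with t ht
    rw [hβ _ (by rw [Complex.re_mul_ofReal]; positivity)]
    unfold hs
    have e1 : -1 * (η * (t : ℂ)) ^ 2 = ω ^ 2 * (t : ℂ) ^ 2 := by
      rw [hη]; linear_combination (-ω ^ 2 * (t : ℂ) ^ 2) * Complex.I_sq
    rw [e1, cpow_mul_pos hη0 ht, cpow_mul_pos hη0 ht,
      show η * (t : ℂ) = -(Complex.I * ω * t) by rw [hη]; ring]
    ring

/-- Reduction of order: with V the decaying solution, the Wronskian identity gives (hs₁/V)' = b₀/V².
As V ~ exp(iωt), integration yields growth like exp(-iωt) with the constant -b₀/(2iω), which is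
nonzero since b₀ ≠ 0. -/
lemma exists_grow_limit {ω : ℂ} (hω : 0 < ω.im) {b : Fin 2 → ℂ} (hb : ∀ j, b j ≠ 0)
    (hlim : Tendsto (fun t : ℝ => (b 0 * hs ν c 0 t (ω ^ 2) + b 1 * hs ν c 1 t (ω ^ 2)) *
      Complex.exp (-(Complex.I * ω * t))) atTop (𝓝 1)) : ∃ d : ℂ, d ≠ 0 ∧
    Tendsto (fun t : ℝ => hs ν c 1 t (ω ^ 2) * Complex.exp (Complex.I * ω * t)) atTop (𝓝 d) := by
  set V : ℝ → ℂ := fun t => b 0 * hs ν c 0 t (ω ^ 2) + b 1 * hs ν c 1 t (ω ^ 2) with hV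
  have hω0 : ω ≠ 0 := by rintro rfl; simp at hω
  have hVd : ∀ t : ℝ, 0 < t → HasDerivAt V
      (b 0 * hsD ν c 0 t (ω ^ 2) + b 1 * hsD ν c 1 t (ω ^ 2)) t := fun t ht =>
    ((P.hasDerivAt_hs_real 0 ht _).const_mul _).add ((P.hasDerivAt_hs_real 1 ht _).const_mul _)
  obtain ⟨T, hT1, hT⟩ : ∃ T : ℝ, 1 ≤ T ∧ ∀ t, T ≤ t → V t ≠ 0 := by
    obtain ⟨T, hT⟩ := eventually_atTop.1 (hlim.eventually_ne one_ne_zero)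
    exact ⟨max T 1, le_max_right _ _, fun t ht h0 =>
      hT t ((le_max_left _ _).trans ht) (by simp only [hV] at h0; rw [h0, zero_mul])⟩
  have hT0 : ∀ t, T ≤ t → 0 < t := fun t ht => by linarith
  have hVc : ContinuousOn V (Ici T) := fun t ht =>
    (hVd t (hT0 t ht)).continuousAt.continuousWithinAt
  have hquot : ∀ t, T ≤ t → HasDerivAt (fun t : ℝ => hs ν c 1 t (ω ^ 2) / V t)
      (b 0 * (V t ^ 2)⁻¹) t := by
    intro t ht
    refine ((P.hasDerivAt_hs_real 1 (hT0 t ht) (ω ^ 2)).div (hVd t (hT0 t ht))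
      (hT t ht)).congr_deriv ?_
    have hW := P.hs_wronskian (z := (t : ℂ)) (Complex.ofReal_ne_zero.2 (hT0 t ht).ne') (ω ^ 2)
    rw [div_eq_mul_inv]
    congr 1
    simp only [hV]
    linear_combination b 0 * hW
  have hinvc : ContinuousOn (fun t => (V t ^ 2)⁻¹) (Ici T) :=
    (hVc.pow 2).inv₀ fun t ht => pow_ne_zero 2 (hT t ht)
  have hFTC : ∀ t, T ≤ t → hs ν c 1 t (ω ^ 2) / V t = hs ν c 1 T (ω ^ 2) / V T +
      ∫ s in T..t, b 0 * (V s ^ 2)⁻¹ := by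
    intro t ht
    rw [intervalIntegral.integral_eq_sub_of_hasDerivAt (f := fun t : ℝ => hs ν c 1 t (ω ^ 2) / V t)
      (fun s hs => hquot s (by rw [uIcc_of_le ht] at hs; exact hs.1))]
    · ring
    · refine (ContinuousOn.intervalIntegrable ?_)
      rw [uIcc_of_le ht]
      exact (continuousOn_const.mul hinvc).mono Icc_subset_Ici_self
  set h : ℝ → ℂ := fun s => (V s ^ 2)⁻¹ * Complex.exp (2 * (Complex.I * ω * s)) with hh
  have hhlim : Tendsto h atTop (𝓝 1) := by
    have h1 := (hlim.pow 2).inv₀ (by norm_num)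
    rw [one_pow, inv_one] at h1
    refine h1.congr fun s => ?_
    rw [mul_pow, mul_inv, ← Complex.exp_nat_mul, ← Complex.exp_neg]
    simp only [hh, hV]
    congr 2; push_cast; ring
  have hhc : ContinuousOn h (Ici T) := hinvc.mul (by fun_prop)
  set a : ℂ := 2 * (Complex.I * ω) with ha
  have hare : a.re < 0 := by simp [ha]; exact hω
  have hmain := tendsto_integral_exp_mul hhc hhlim hare
  have hexp0 : Tendsto (fun t : ℝ => Complex.exp (a * t)) atTop (𝓝 0) := by
    rw [tendsto_zero_iff_norm_tendsto_zero]
    have : Tendsto (fun t : ℝ => Real.exp (a.re * t)) atTop (𝓝 0) :=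
      Real.tendsto_exp_atBot.comp (tendsto_id.const_mul_atTop_of_neg hare)
    refine this.congr fun t => ?_
    rw [Complex.norm_exp, Complex.re_mul_ofReal]
  have ha0 : a ≠ 0 := by intro h; rw [h] at hare; simp at hare
  refine ⟨b 0 * (-1 / a), mul_ne_zero (hb 0) (div_ne_zero (by norm_num) ha0), ?_⟩
  have htot := hlim.mul ((hexp0.mul_const (hs ν c 1 T (ω ^ 2) / V T)).add (hmain.const_mul (b 0)))
  rw [zero_mul, zero_add, one_mul] at htot
  refine htot.congr' ?_
  filter_upwards [eventually_ge_atTop T] with t ht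
  have e1 : ∫ s in T..t, Complex.exp (a * ((t - s : ℝ) : ℂ)) * h s =
      Complex.exp (a * t) * ∫ s in T..t, (V s ^ 2)⁻¹ := by
    rw [← intervalIntegral.integral_const_mul]
    refine intervalIntegral.integral_congr fun s _ => ?_
    simp only [hh]
    rw [mul_left_comm, ← Complex.exp_add, mul_comm]
    congr 2
    rw [ha]; push_cast; ring
  have e2 := hFTC t ht
  rw [intervalIntegral.integral_const_mul] at e2
  rw [e1]
  have e3 : hs ν c 1 t (ω ^ 2) = V t * (hs ν c 1 T (ω ^ 2) / V T +
      b 0 * ∫ s in T..t, (V s ^ 2)⁻¹) := by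
    rw [← e2, mul_div_cancel₀ _ (hT t ht)]
  have e4 : Complex.exp (-(Complex.I * ω * t)) * Complex.exp (a * t) =
      Complex.exp (Complex.I * ω * t) := by
    rw [← Complex.exp_add]; congr 1; rw [ha]; ring
  change V t * _ * _ = _
  rw [e3, ← e4]
  ring

/-- For t ≤ 1 the general bounds at the fixed λ = ω² suffice, for t ≥ 1 the two limits do. The first
Frobenius solution is recovered there from the decaying and the second one, by division by b₀ ≠ 0.
-/
lemma exists_rayModel {ω : ℂ} (hω : 0 < ω.im) : ∃ b d C, RayModel ν c ω b d C := by
  obtain ⟨b, hb, hlim⟩ := P.exists_jost_model hω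
  obtain ⟨d, hd, hgrow⟩ := P.exists_grow_limit hω hb hlim
  obtain ⟨D, K, hD, hK, hbd⟩ := P.norm_hs_le
  have hc := fun j => P.continuousOn_hs j (ω ^ 2)
  obtain ⟨M1, hM1p, hM1⟩ := exists_bound_Ici_one
    (((continuousOn_const.mul (hc 0)).add (continuousOn_const.mul (hc 1))).mul
      (by fun_prop)) hlim
  obtain ⟨M2, hM2p, hM2⟩ := exists_bound_Ici_one ((hc 1).mul (by fun_prop)) hgrow
  have hb0 : 0 < ‖b 0‖ := norm_pos_iff.2 (hb 0)
  set κ := ω.im with hκ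
  set K' := K * Real.exp (D * √‖ω ^ 2‖) with hK'
  have hK'p : 0 < K' := by positivity
  have hsmall : ∀ j, ∀ t : ℝ, 0 < t → t ≤ 1 → ‖hs ν c j t (ω ^ 2)‖ ≤ K' * t ^ tau ν j := by
    intro j t ht ht1
    have := Real.rpow_pos_of_pos ht (tau ν j)
    calc _ ≤ K * t ^ tau ν j * Real.exp (D * √‖ω ^ 2‖ * t) := hbd j t ht _
      _ ≤ K * t ^ tau ν j * Real.exp (D * √‖ω ^ 2‖) := by
        have h1 : D * √‖ω ^ 2‖ * t ≤ D * √‖ω ^ 2‖ := mul_le_of_le_one_right (by positivity) ht1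
        gcongr
      _ = _ := by rw [hK']; ring
  have hV1 : ∀ t : ℝ, 1 ≤ t → ‖b 0 * hs ν c 0 t (ω ^ 2) + b 1 * hs ν c 1 t (ω ^ 2)‖ ≤
      M1 * Real.exp (-(κ * t)) := by
    intro t ht
    have h1 := hM1 t ht
    rw [Pi.mul_apply, norm_mul, (norm_exp_I_mul ω t).2] at h1
    rw [Real.exp_neg, ← div_eq_mul_inv, le_div_iff₀ (Real.exp_pos _)]
    exact h1
  have hP1 : ∀ t : ℝ, 1 ≤ t → ‖hs ν c 1 t (ω ^ 2)‖ ≤ M2 * Real.exp (κ * t) := by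
    intro t ht
    have h1 := hM2 t ht
    rw [Pi.mul_apply, norm_mul, (norm_exp_I_mul ω t).1, Real.exp_neg, ← div_eq_mul_inv,
      div_le_iff₀ (Real.exp_pos _)] at h1
    exact h1
  have hP0 : ∀ t : ℝ, 1 ≤ t → ‖hs ν c 0 t (ω ^ 2)‖ ≤
      (M1 + ‖b 1‖ * M2) / ‖b 0‖ * Real.exp (κ * t) := by
    intro t ht
    have h1 : ‖b 0 * hs ν c 0 t (ω ^ 2)‖ ≤ (M1 + ‖b 1‖ * M2) * Real.exp (κ * t) := by
      have h2 : b 0 * hs ν c 0 t (ω ^ 2) =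
          (b 0 * hs ν c 0 t (ω ^ 2) + b 1 * hs ν c 1 t (ω ^ 2)) - b 1 * hs ν c 1 t (ω ^ 2) := by
        ring
      rw [h2]
      refine (norm_sub_le _ _).trans ?_
      have h3 : Real.exp (-(κ * t)) ≤ Real.exp (κ * t) :=
        Real.exp_le_exp.2 (by have := mul_pos hω (lt_of_lt_of_le one_pos ht); linarith)
      have h4 := hV1 t ht
      have h5 := hP1 t ht
      rw [norm_mul (b 1)]
      calc _ ≤ M1 * Real.exp (-(κ * t)) + ‖b 1‖ * (M2 * Real.exp (κ * t)) := by gcongr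
        _ ≤ M1 * Real.exp (κ * t) + ‖b 1‖ * (M2 * Real.exp (κ * t)) := by gcongr
        _ = _ := by ring
    rw [norm_mul] at h1
    rw [div_mul_eq_mul_div, le_div_iff₀ hb0]
    linarith
  have hone : ∀ (t : ℝ), 0 ≤ t → 1 ≤ Real.exp (κ * t) := fun t ht =>
    Real.one_le_exp (mul_nonneg hω.le ht)
  set CV := (‖b 0‖ + ‖b 1‖) * K' * Real.exp κ + M1 with hCV
  set CP := K' + M2 + (M1 + ‖b 1‖ * M2) / ‖b 0‖ with hCP
  have hCVp : 0 < CV := by positivity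
  have hCPp : 0 < CP := by positivity
  refine ⟨b, d, CV + CP, hω, hb, hd, by positivity, hlim, hgrow, fun t ht => ?_, fun j t ht => ?_⟩
  · rcases le_total t 1 with h | h
    · rw [min_eq_right h]
      have h0 := hsmall 0 t ht h
      have h1 := hsmall 1 t ht h
      have h2 : t ^ tau ν 1 ≤ t ^ tau ν 0 :=
        Real.rpow_le_rpow_of_exponent_ge ht h (by rw [tau_zero, tau_one]; linarith [P.re_pos])
      have h3 : 1 ≤ Real.exp κ * Real.exp (-(κ * t)) := by
        rw [← Real.exp_add]
        exact Real.one_le_exp (by nlinarith)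
      have ht0 := Real.rpow_pos_of_pos ht (tau ν 0)
      calc _ ≤ ‖b 0‖ * (K' * t ^ tau ν 0) + ‖b 1‖ * (K' * t ^ tau ν 1) := by
            refine (norm_add_le _ _).trans ?_
            rw [norm_mul, norm_mul]
            gcongr
        _ ≤ ‖b 0‖ * (K' * t ^ tau ν 0) + ‖b 1‖ * (K' * t ^ tau ν 0) := by gcongr
        _ = (‖b 0‖ + ‖b 1‖) * K' * t ^ tau ν 0 * 1 := by ring
        _ ≤ (‖b 0‖ + ‖b 1‖) * K' * t ^ tau ν 0 * (Real.exp κ * Real.exp (-(κ * t))) := by gcongr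
        _ = ((‖b 0‖ + ‖b 1‖) * K' * Real.exp κ) * t ^ tau ν 0 * Real.exp (-(κ * t)) := by ring
        _ ≤ _ := by
          gcongr
          linarith
    · rw [min_eq_left h, Real.one_rpow, mul_one]
      refine (hV1 t h).trans ?_
      gcongr
      have : 0 < (‖b 0‖ + ‖b 1‖) * K' * Real.exp κ := by positivity
      linarith
  · rcases le_total t 1 with h | h
    · rw [min_eq_right h]
      have ht0 := Real.rpow_pos_of_pos ht (tau ν j)
      calc _ ≤ K' * t ^ tau ν j * 1 := by rw [mul_one]; exact hsmall j t ht h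
        _ ≤ (CV + CP) * t ^ tau ν j * Real.exp (κ * t) := by
          gcongr
          · have : 0 ≤ (M1 + ‖b 1‖ * M2) / ‖b 0‖ := by positivity
            linarith
          · exact hone t ht.le
    · rw [min_eq_left h, Real.one_rpow, mul_one]
      have h0 : 0 < (M1 + ‖b 1‖ * M2) / ‖b 0‖ := by positivity
      match j with
      | 0 => exact (hP0 t h).trans (by gcongr; linarith)
      | 1 => exact (hP1 t h).trans (by gcongr; linarith)

end Params

/-! ### Half-line potentials and Volterra bounds of exponential type √|λ| -/

/-- The weight `1 + t ^ min(0, 1 - 2σ)`. -/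
noncomputable def potWeight (σ t : ℝ) : ℝ := 1 + t ^ min 0 (1 - 2 * σ)

/-- Potentials on the half-line `(0, ∞)` with the singular point at `0`. -/
structure HalfPot (σ : ℝ) (Q : ℝ → ℂ) : Prop where
  meas : AEStronglyMeasurable Q (volume.restrict (Ioi 0))
  int : IntegrableOn (fun t => potWeight σ t * ‖Q t‖) (Ioi 0)

lemma one_le_potWeight (σ : ℝ) {t : ℝ} (ht : 0 < t) : 1 ≤ potWeight σ t := by
  have := Real.rpow_pos_of_pos ht (min 0 (1 - 2 * σ))
  unfold potWeight; linarith

/-- The admissible range of e contains all sums of two real exponents, which are 1 - 2σ, 1 and 1 +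
2σ. Near 0 the smallest exponent is the worst and is what the weight in the class of potentials
controls; away from 0 the largest one is bounded by a constant. -/
lemma rpow_le_potWeight {σ : ℝ} (hσ : 0 < σ) {t L : ℝ} (ht : 0 < t) (htL : t ≤ L) {e : ℝ}
    (h1 : 1 - 2 * σ ≤ e) (h2 : e ≤ 1 + 2 * σ) :
    t ^ e ≤ (1 + L) ^ (1 + 2 * σ) * potWeight σ t := by
  have hL : 1 ≤ (1 + L) ^ (1 + 2 * σ) := Real.one_le_rpow (by linarith) (by linarith)
  have hw := one_le_potWeight σ ht
  rcases le_total t 1 with h | h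
  · have h3 : t ^ e ≤ t ^ min 0 (1 - 2 * σ) :=
      Real.rpow_le_rpow_of_exponent_ge ht h ((min_le_right _ _).trans h1)
    have h4 : t ^ min 0 (1 - 2 * σ) ≤ potWeight σ t := by unfold potWeight; linarith
    nlinarith
  · have h3 : t ^ e ≤ t ^ (1 + 2 * σ) := Real.rpow_le_rpow_of_exponent_le h h2
    have h4 : t ^ (1 + 2 * σ) ≤ (1 + L) ^ (1 + 2 * σ) :=
      Real.rpow_le_rpow ht.le (by linarith) (by linarith)
    nlinarith

lemma HalfPot.integrableOn {σ : ℝ} {Q : ℝ → ℂ} (hQ : HalfPot σ Q) : IntegrableOn Q (Ioi 0) := by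
  refine Integrable.mono' hQ.int hQ.meas ?_
  refine (ae_restrict_iff' measurableSet_Ioi).2 (Eventually.of_forall fun t ht => ?_)
  have := one_le_potWeight σ ht
  nlinarith [norm_nonneg (Q t)]

/-- The Frobenius solutions as functions of a real variable. -/
noncomputable def hsr (ν : ℂ) (c : Fin 2 → ℂ) (j : Fin 2) (lam : ℂ) (t : ℝ) : ℂ := hs ν c j t lam

/-- Exponential bounds, of type `√|lam|`, of the Frobenius solutions and the Green kernel. -/
structure GrowthBound (ν : ℂ) (c : Fin 2 → ℂ) (D K : ℝ) : Prop where
  one_le : 1 ≤ D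
  K_pos : 0 < K
  bound : ∀ j, ∀ z : ℝ, 0 < z → ∀ lam,
    ‖hs ν c j z lam‖ ≤ K * z ^ tau ν j * Real.exp (D * √‖lam‖ * z)
  boundG : ∀ t z : ℝ, 0 < t → t ≤ z → ∀ lam,
    ‖hsG ν c z t lam‖ ≤ K * t ^ tau ν 0 * z ^ tau ν 1 * Real.exp (D * √‖lam‖ * (z - t))

lemma Params.exists_growthBound {ν : ℂ} {c : Fin 2 → ℂ} (P : Params ν c) :
    ∃ D K, GrowthBound ν c D K := by
  obtain ⟨D, K, h1, h2, h3, h4⟩ := P.norm_hsG_le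
  exact ⟨D, K, h1, h2, h3, h4⟩

/-- The weight controlling solutions of growth type `s = √|lam|`. -/
noncomputable def growthN (ν : ℂ) (D : ℝ) (j : Fin 2) (s z : ℝ) : ℝ :=
  z ^ tau ν j * Real.exp (D * s * z)

/-- The integrable majorant of the Volterra kernel on `(0, L]`. -/
noncomputable def growthH (σ K L : ℝ) (Q : ℝ → ℂ) (t : ℝ) : ℝ :=
  K * (1 + L ^ (2 * σ)) * (1 + L) ^ (1 + 2 * σ) * (potWeight σ t * ‖Q t‖)

lemma two_tau (ν : ℂ) : 2 * tau ν 0 = 1 - 2 * ν.re ∧ tau ν 0 + tau ν 1 = 1 ∧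
    tau ν 1 - tau ν 0 = 2 * ν.re := by
  rw [tau_zero, tau_one]; refine ⟨?_, ?_, ?_⟩ <;> ring

section Growth

variable {ν : ℂ} {c : Fin 2 → ℂ} {Q : ℝ → ℂ} {D K : ℝ}

lemma Params.continuousOn_hsr (P : Params ν c) (j : Fin 2) (lam : ℂ) :
    ContinuousOn (hsr ν c j lam) (Ioi 0) := P.continuousOn_hs j lam

lemma continuousOn_growthN (j : Fin 2) (s : ℝ) : ContinuousOn (growthN ν D j s) (Ioi 0) := by
  unfold growthN
  refine ContinuousOn.mul (fun z hz => ?_) (by fun_prop)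
  exact (Real.continuousAt_rpow_const z _ (Or.inl (ne_of_gt hz))).continuousWithinAt

lemma integrableOn_of_le_potWeight {σ : ℝ} (hQ : HalfPot σ Q) {X : Set ℝ} (hX : MeasurableSet X)
    (hX0 : X ⊆ Ioi 0) {g N : ℝ → ℝ} {M : ℝ} (hg : ContinuousOn g X) (hN : ContinuousOn N X)
    (hb : ∀ t ∈ X, ‖g t * N t‖ ≤ M * potWeight σ t) :
    IntegrableOn (fun t => g t * ‖Q t‖ * N t) X := by
  refine Integrable.mono' ((hQ.int.mono_set hX0).const_mul M) ?_ ?_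
  · exact ((hg.aestronglyMeasurable hX).mul
      (hQ.meas.norm.mono_measure (Measure.restrict_mono_set _ hX0))).mul
      (hN.aestronglyMeasurable hX)
  · refine (ae_restrict_iff' hX).2 (Eventually.of_forall fun t ht => ?_)
    have h1 := hb t ht
    rw [norm_mul] at h1
    rw [norm_mul, norm_mul, norm_norm]
    calc _ = (‖g t‖ * ‖N t‖) * ‖Q t‖ := by ring
      _ ≤ M * potWeight σ t * ‖Q t‖ := by gcongr
      _ = _ := by ring

/-- The kernel bound times the weight at t reproduces the weight at z: the exponentials combine
exactly, and the leftover power of t, namely t ^ (1 - 2σ) or t, is absorbed by the weight of the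
potential. Only √|λ| ≤ s is required, so that one bound serves a whole disc of λ and gives
holomorphy. -/
lemma Params.volterraBound_growth (P : Params ν c) (hQ : HalfPot ν.re Q)
    (G : GrowthBound ν c D K) {L : ℝ} (hL : 0 < L) (j : Fin 2) {lam : ℂ} {s : ℝ}
    (hs : √‖lam‖ ≤ s) :
    VolterraBound (fun z => Ioc 0 z) Iic (Ioc 0 L) (hsr ν c 0 lam) (hsr ν c 1 lam) Q
      (growthN ν D j s) (growthH ν.re K L Q) := by
  have hsub : Ioc 0 L ⊆ Ioi 0 := fun x hx => hx.1
  have hσ := P.re_pos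
  have hK := G.K_pos
  have hD : 0 < D := lt_of_lt_of_le one_pos G.one_le
  have hs0 : 0 ≤ s := (Real.sqrt_nonneg _).trans hs
  obtain ⟨t1, t2, t3⟩ := two_tau ν
  have hL2 : 0 < L ^ (2 * ν.re) := Real.rpow_pos_of_pos hL _
  have hL1 : 0 < (1 + L) ^ (1 + 2 * ν.re) := Real.rpow_pos_of_pos (by linarith) _
  have hsr_le : ∀ i, ∀ t : ℝ, 0 < t →
      ‖hsr ν c i lam t‖ ≤ K * t ^ tau ν i * Real.exp (D * s * t) := by
    intro i t ht
    have := Real.rpow_pos_of_pos ht (tau ν i)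
    refine (G.bound i t ht lam).trans ?_
    gcongr
  have hsumle : ∀ i : Fin 2, 1 - 2 * ν.re ≤ tau ν i + tau ν j ∧
      tau ν i + tau ν j ≤ 1 + 2 * ν.re := by
    intro i
    have h0 := tau_zero ν
    have h1 := tau_one ν
    fin_cases i <;> fin_cases j <;> simp only [Fin.zero_eta, Fin.mk_one] <;>
      constructor <;> linarith
  have hint : ∀ i, IntegrableOn (fun t => ‖hsr ν c i lam t‖ * ‖Q t‖ * growthN ν D j s t)
      (Ioc 0 L) := by
    intro i
    refine integrableOn_of_le_potWeight hQ measurableSet_Ioc hsub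
      (M := K * Real.exp (D * s * L) * Real.exp (D * s * L) * (1 + L) ^ (1 + 2 * ν.re))
      ((P.continuousOn_hsr i lam).norm.mono hsub) ((continuousOn_growthN j s).mono hsub) ?_
    intro t ht
    have ht0 := Real.rpow_pos_of_pos ht.1 (tau ν j)
    have ht1 := Real.rpow_pos_of_pos ht.1 (tau ν i)
    rw [norm_mul, norm_norm, growthN, norm_mul, Real.norm_of_nonneg ht0.le,
      Real.norm_of_nonneg (Real.exp_pos _).le]
    have he : Real.exp (D * s * t) ≤ Real.exp (D * s * L) := by
      have := ht.2
      gcongr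
    calc _ ≤ K * t ^ tau ν i * Real.exp (D * s * t) * (t ^ tau ν j * Real.exp (D * s * t)) := by
          gcongr; exact hsr_le i t ht.1
      _ ≤ K * t ^ tau ν i * Real.exp (D * s * L) * (t ^ tau ν j * Real.exp (D * s * L)) := by
          gcongr
      _ = K * Real.exp (D * s * L) * Real.exp (D * s * L) * t ^ (tau ν i + tau ν j) := by
          rw [Real.rpow_add ht.1]; ring
      _ ≤ K * Real.exp (D * s * L) * Real.exp (D * s * L) *
          ((1 + L) ^ (1 + 2 * ν.re) * potWeight ν.re t) := by
          gcongr
          exact rpow_le_potWeight hσ ht.1 ht.2 (hsumle i).1 (hsumle i).2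
      _ = _ := by ring
  have hH0 : ∀ t ∈ Ioc 0 L, 0 ≤ growthH ν.re K L Q t := by
    intro t ht
    have := one_le_potWeight ν.re ht.1
    unfold growthH
    positivity
  refine ⟨volterraFamily_Iic, measurableSet_Ioc, ?_, (P.continuousOn_hsr 0 lam).mono hsub,
    (P.continuousOn_hsr 1 lam).mono hsub, (continuousOn_growthN j s).mono hsub,
    hQ.meas.mono_measure (Measure.restrict_mono_set _ hsub), ?_, hH0, ?_, ?_, hint 0, hint 1⟩
  · intro z hz
    ext t
    simp only [mem_Ioc, mem_inter_iff, mem_Iic]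
    exact ⟨fun h => ⟨⟨h.1, h.2.trans hz.2⟩, h.2⟩, fun h => ⟨h.1.1, h.2⟩⟩
  · intro z hz
    exact mul_pos (Real.rpow_pos_of_pos hz.1 _) (Real.exp_pos _)
  · exact (hQ.int.mono_set hsub).const_mul _
  · intro z hz t ht
    have ht0 : 0 < t := ht.1.1
    have htz : t ≤ z := ht.2
    have p0 := Real.rpow_pos_of_pos ht0 (tau ν 0)
    have p1 := Real.rpow_pos_of_pos hz.1 (tau ν 1)
    have pj := Real.rpow_pos_of_pos ht0 (tau ν j)
    have hw := one_le_potWeight ν.re ht0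
    have hG : ‖hsr ν c 0 lam t * hsr ν c 1 lam z - hsr ν c 0 lam z * hsr ν c 1 lam t‖ ≤
        K * t ^ tau ν 0 * z ^ tau ν 1 * Real.exp (D * s * (z - t)) := by
      refine (G.boundG t z ht0 htz lam).trans ?_
      have : 0 ≤ z - t := by linarith
      gcongr
    have hmain : t ^ tau ν 0 * z ^ tau ν 1 * t ^ tau ν j ≤
        z ^ tau ν j * ((1 + L ^ (2 * ν.re)) * ((1 + L) ^ (1 + 2 * ν.re) * potWeight ν.re t)) := by
      match j with
      | 0 =>
        have e1 : t ^ tau ν 0 * t ^ tau ν 0 = t ^ (1 - 2 * ν.re) := by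
          rw [← Real.rpow_add ht0, ← t1]; ring_nf
        have e2 : z ^ tau ν 1 = z ^ tau ν 0 * z ^ (2 * ν.re) := by
          rw [← Real.rpow_add hz.1, ← t3]; ring_nf
        have e3 : z ^ (2 * ν.re) ≤ 1 + L ^ (2 * ν.re) := by
          have := Real.rpow_le_rpow hz.1.le hz.2 (show 0 ≤ 2 * ν.re by linarith)
          linarith
        have e4 := rpow_le_potWeight hσ ht0 (htz.trans hz.2) le_rfl
          (show 1 - 2 * ν.re ≤ 1 + 2 * ν.re by linarith)
        have pz := Real.rpow_pos_of_pos hz.1 (tau ν 0)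
        calc _ = z ^ tau ν 0 * (z ^ (2 * ν.re) * (t ^ tau ν 0 * t ^ tau ν 0)) := by rw [e2]; ring
          _ ≤ _ := by
            rw [e1]
            gcongr
      | 1 =>
        have e1 : t ^ tau ν 0 * t ^ tau ν 1 = t ^ (1 : ℝ) := by
          rw [← Real.rpow_add ht0, t2]
        have e4 := rpow_le_potWeight hσ ht0 (htz.trans hz.2)
          (show 1 - 2 * ν.re ≤ 1 by linarith) (show 1 ≤ 1 + 2 * ν.re by linarith)
        calc _ = z ^ tau ν 1 * (1 * (t ^ tau ν 0 * t ^ tau ν 1)) := by ring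
          _ ≤ _ := by
            rw [e1]
            gcongr
            linarith
    have hexp : Real.exp (D * s * (z - t)) * Real.exp (D * s * t) = Real.exp (D * s * z) := by
      rw [← Real.exp_add]; ring_nf
    calc _ ≤ K * t ^ tau ν 0 * z ^ tau ν 1 * Real.exp (D * s * (z - t)) * ‖Q t‖ *
          (t ^ tau ν j * Real.exp (D * s * t)) := by unfold growthN; gcongr
      _ = K * (t ^ tau ν 0 * z ^ tau ν 1 * t ^ tau ν j) *
          (Real.exp (D * s * (z - t)) * Real.exp (D * s * t)) * ‖Q t‖ := by ring
      _ ≤ K * (z ^ tau ν j * ((1 + L ^ (2 * ν.re)) * ((1 + L) ^ (1 + 2 * ν.re) *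
          potWeight ν.re t))) * (Real.exp (D * s * (z - t)) * Real.exp (D * s * t)) * ‖Q t‖ := by
          gcongr
      _ = _ := by rw [hexp]; unfold growthN growthH; ring

/-- The weight for solutions with data at the right end point `a`. -/
noncomputable def leftN (ν : ℂ) (D a s z : ℝ) : ℝ := z ^ tau ν 0 * Real.exp (D * s * (a - z))

/-- Integration runs from z to a, so the two Frobenius solutions change roles in the kernel. Here t
^ τ₁ * t ^ τ₀ = t, and the integrable majorant is simply a multiple of |Q|. -/
lemma Params.volterraBound_left (P : Params ν c) (hQ : HalfPot ν.re Q)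
    (G : GrowthBound ν c D K) {a : ℝ} {lam : ℂ} {s : ℝ} (hs : √‖lam‖ ≤ s) :
    VolterraBound (fun z => Icc z a) Ici (Ioc 0 a) (hsr ν c 1 lam) (hsr ν c 0 lam) Q
      (leftN ν D a s) (fun t => K * a * ‖Q t‖) := by
  have hsub : Ioc 0 a ⊆ Ioi 0 := fun x hx => hx.1
  have hσ := P.re_pos
  have hK := G.K_pos
  have hD : 0 < D := lt_of_lt_of_le one_pos G.one_le
  have hs0 : 0 ≤ s := (Real.sqrt_nonneg _).trans hs
  obtain ⟨t1, t2, t3⟩ := two_tau ν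
  have hNc : ContinuousOn (leftN ν D a s) (Ioi 0) := by
    unfold leftN
    refine ContinuousOn.mul (fun z hz => ?_) (by fun_prop)
    exact (Real.continuousAt_rpow_const z _ (Or.inl (ne_of_gt hz))).continuousWithinAt
  have hint : ∀ i, IntegrableOn (fun t => ‖hsr ν c i lam t‖ * ‖Q t‖ * leftN ν D a s t)
      (Ioc 0 a) := by
    intro i
    refine integrableOn_of_le_potWeight hQ measurableSet_Ioc hsub
      (M := K * Real.exp (D * s * a) * Real.exp (D * s * a) * (1 + a) ^ (1 + 2 * ν.re))
      ((P.continuousOn_hsr i lam).norm.mono hsub) (hNc.mono hsub) ?_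
    intro t ht
    have ht0 := Real.rpow_pos_of_pos ht.1 (tau ν 0)
    have ht1 := Real.rpow_pos_of_pos ht.1 (tau ν i)
    have hta := ht.2
    have htp := ht.1
    have hsumle : 1 - 2 * ν.re ≤ tau ν i + tau ν 0 ∧ tau ν i + tau ν 0 ≤ 1 + 2 * ν.re := by
      have h0 := tau_zero ν
      have h1 := tau_one ν
      fin_cases i <;> simp only [Fin.zero_eta, Fin.mk_one] <;> constructor <;> linarith
    rw [norm_mul, norm_norm, leftN, norm_mul, Real.norm_of_nonneg ht0.le,
      Real.norm_of_nonneg (Real.exp_pos _).le]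
    have hle : √‖lam‖ * t ≤ s * a := by gcongr
    calc _ ≤ K * t ^ tau ν i * Real.exp (D * √‖lam‖ * t) *
          (t ^ tau ν 0 * Real.exp (D * s * (a - t))) := by
          gcongr; exact G.bound i t ht.1 lam
      _ ≤ K * t ^ tau ν i * Real.exp (D * s * a) * (t ^ tau ν 0 * Real.exp (D * s * a)) := by
          gcongr
          linarith
      _ = K * Real.exp (D * s * a) * Real.exp (D * s * a) * t ^ (tau ν i + tau ν 0) := by
          rw [Real.rpow_add ht.1]; ring
      _ ≤ K * Real.exp (D * s * a) * Real.exp (D * s * a) *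
          ((1 + a) ^ (1 + 2 * ν.re) * potWeight ν.re t) := by
          gcongr
          exact rpow_le_potWeight hσ ht.1 ht.2 hsumle.1 hsumle.2
      _ = _ := by ring
  refine ⟨volterraFamily_Ici, measurableSet_Ioc, ?_, (P.continuousOn_hsr 1 lam).mono hsub,
    (P.continuousOn_hsr 0 lam).mono hsub, hNc.mono hsub,
    hQ.meas.mono_measure (Measure.restrict_mono_set _ hsub), ?_, ?_, ?_, ?_, hint 1, hint 0⟩
  · intro z hz
    ext t
    simp only [mem_Ioc, mem_inter_iff, mem_Ici, mem_Icc]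
    exact ⟨fun h => ⟨⟨hz.1.trans_le h.1, h.2⟩, h.1⟩, fun h => ⟨h.2, h.1.2⟩⟩
  · intro z hz
    exact mul_pos (Real.rpow_pos_of_pos hz.1 _) (Real.exp_pos _)
  · intro t ht
    have : 0 < a := ht.1.trans_le ht.2
    positivity
  · exact (hQ.integrableOn.mono_set hsub).norm.const_mul _
  · intro z hz t ht
    have ht0 : 0 < t := ht.1.1
    have htz : z ≤ t := ht.2
    have p0 := Real.rpow_pos_of_pos hz.1 (tau ν 0)
    have p1 := Real.rpow_pos_of_pos ht0 (tau ν 1)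
    have pt := Real.rpow_pos_of_pos ht0 (tau ν 0)
    have hG : ‖hsr ν c 1 lam t * hsr ν c 0 lam z - hsr ν c 1 lam z * hsr ν c 0 lam t‖ ≤
        K * z ^ tau ν 0 * t ^ tau ν 1 * Real.exp (D * s * (t - z)) := by
      have := G.boundG z t hz.1 htz lam
      refine le_trans (le_of_eq ?_) (this.trans ?_)
      · unfold hsG hsr; congr 1; ring
      · have : 0 ≤ t - z := by linarith
        gcongr
    have e1 : t ^ tau ν 1 * t ^ tau ν 0 = t := by
      rw [← Real.rpow_add ht0, add_comm, t2, Real.rpow_one]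
    have hexp : Real.exp (D * s * (t - z)) * Real.exp (D * s * (a - t)) =
        Real.exp (D * s * (a - z)) := by
      rw [← Real.exp_add]; ring_nf
    calc _ ≤ K * z ^ tau ν 0 * t ^ tau ν 1 * Real.exp (D * s * (t - z)) * ‖Q t‖ *
          (t ^ tau ν 0 * Real.exp (D * s * (a - t))) := by unfold leftN; gcongr
      _ = K * z ^ tau ν 0 * (t ^ tau ν 1 * t ^ tau ν 0) *
          (Real.exp (D * s * (t - z)) * Real.exp (D * s * (a - t))) * ‖Q t‖ := by ring
      _ = z ^ tau ν 0 * Real.exp (D * s * (a - z)) * (K * t * ‖Q t‖) := by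
          rw [e1, hexp]; ring
      _ ≤ _ := by
          unfold leftN
          have := ht.1.2
          gcongr

end Growth

/-! ### Local solutions and their Wronskians -/

/-- Primitives of complex-valued integrable functions are absolutely continuous. -/
lemma absolutelyContinuousOnInterval_of_sub_eq_integral {f F : ℝ → ℂ} {x z : ℝ}
    (hF : IntervalIntegrable F volume x z)
    (h : ∀ s ∈ uIcc x z, ∀ t ∈ uIcc x z, f t - f s = ∫ r in s..t, F r) :
    AbsolutelyContinuousOnInterval f x z := by
  -- The increments of f are dominated by those of the primitive of |F|, which is absolutely
  -- continuous.
  have h1 := hF.norm.absolutelyContinuousOnInterval_intervalIntegral (c := x) left_mem_uIcc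
  unfold AbsolutelyContinuousOnInterval at h1 ⊢
  refine squeeze_zero' (Eventually.of_forall fun _ => Finset.sum_nonneg fun i _ => dist_nonneg)
    ?_ h1
  rw [eventually_inf_principal]
  refine Eventually.of_forall fun E hE => Finset.sum_le_sum fun i hi => ?_
  obtain ⟨m1, m2⟩ := hE.1 i hi
  have i1 : IntervalIntegrable (fun t => ‖F t‖) volume x (E.2 i).1 :=
    hF.norm.mono_set (uIcc_subset_uIcc left_mem_uIcc m1)
  have i2 : IntervalIntegrable (fun t => ‖F t‖) volume x (E.2 i).2 :=
    hF.norm.mono_set (uIcc_subset_uIcc left_mem_uIcc m2)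
  rw [dist_comm, dist_eq_norm, h _ m1 _ m2, dist_comm, Real.dist_eq,
    intervalIntegral.integral_interval_sub_left i2 i1]
  exact intervalIntegral.norm_integral_le_abs_integral_norm

/-- `y` solves `-y'' + (ν₀ / z² + Q) y = lam y` on `(0, L)`, in variation-of-constants form with
coefficients `u` and `v`. -/
structure LocalSol (ν : ℂ) (c : Fin 2 → ℂ) (Q : ℝ → ℂ) (lam : ℂ) (L : ℝ) (y u v : ℝ → ℂ) :
    Prop where
  cont : ContinuousOn y (Ioo 0 L)
  eq : ∀ z ∈ Ioo 0 L, y z = hsr ν c 1 lam z * u z + hsr ν c 0 lam z * v z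
  u_sub : ∀ x ∈ Ioo 0 L, ∀ z ∈ Ioo 0 L, u z - u x = ∫ t in x..z, hsr ν c 0 lam t * Q t * y t
  v_sub : ∀ x ∈ Ioo 0 L, ∀ z ∈ Ioo 0 L, v z - v x = -∫ t in x..z, hsr ν c 1 lam t * Q t * y t

/-- The derivative of a solution in variation-of-constants form. -/
noncomputable def solD (ν : ℂ) (c : Fin 2 → ℂ) (lam : ℂ) (u v : ℝ → ℂ) (z : ℝ) : ℂ :=
  hsD ν c 1 z lam * u z + hsD ν c 0 z lam * v z

lemma uIcc_subset_Ioo {L x z : ℝ} (hx : x ∈ Ioo 0 L) (hz : z ∈ Ioo 0 L) :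
    uIcc x z ⊆ Ioo 0 L := fun _ ht =>
  ⟨(lt_min hx.1 hz.1).trans_le ht.1, ht.2.trans_lt (max_lt hx.2 hz.2)⟩

lemma intervalIntegrable_mul_mul {Q f g : ℝ → ℂ} {L x z : ℝ} (hQ : IntegrableOn Q (Ioi 0))
    (hf : ContinuousOn f (Ioo 0 L)) (hg : ContinuousOn g (Ioo 0 L))
    (hx : x ∈ Ioo 0 L) (hz : z ∈ Ioo 0 L) :
    IntervalIntegrable (fun t => f t * Q t * g t) volume x z := by
  have hs := uIcc_subset_Ioo hx hz
  have h1 : IntervalIntegrable Q volume x z :=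
    (hQ.mono_set (hs.trans Ioo_subset_Ioi_self)).intervalIntegrable
  exact (h1.continuousOn_mul (hf.mono hs)).mul_continuousOn (hg.mono hs)

section

variable {ν : ℂ} {c : Fin 2 → ℂ} {Q : ℝ → ℂ} {lam : ℂ} {L : ℝ} {y u v : ℝ → ℂ}

lemma Params.continuousOn_hsr_Ioo (P : Params ν c) (j : Fin 2) (lam : ℂ) (L : ℝ) :
    ContinuousOn (hsr ν c j lam) (Ioo 0 L) :=
  (P.continuousOn_hsr j lam).mono Ioo_subset_Ioi_self

namespace LocalSol

variable (H : LocalSol ν c Q lam L y u v)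
include H

lemma ii (P : Params ν c) (hQ : IntegrableOn Q (Ioi 0)) (j : Fin 2) {x z : ℝ}
    (hx : x ∈ Ioo 0 L) (hz : z ∈ Ioo 0 L) :
    IntervalIntegrable (fun t => hsr ν c j lam t * Q t * y t) volume x z :=
  intervalIntegrable_mul_mul hQ (P.continuousOn_hsr_Ioo j lam L) H.cont hx hz

lemma smul (k : ℂ) :
    LocalSol ν c Q lam L (fun z => k * y z) (fun z => k * u z) (fun z => k * v z) where
  cont := continuousOn_const.mul H.cont
  eq z hz := by simp only [H.eq z hz]; ring
  u_sub x hx z hz := by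
    rw [← mul_sub, H.u_sub x hx z hz, ← intervalIntegral.integral_const_mul]
    congr 1; ext t; ring
  v_sub x hx z hz := by
    rw [← mul_sub, H.v_sub x hx z hz, mul_neg, ← intervalIntegral.integral_const_mul]
    congr 2; ext t; ring

lemma add (P : Params ν c) (hQ : IntegrableOn Q (Ioi 0)) {y2 u2 v2 : ℝ → ℂ}
    (H2 : LocalSol ν c Q lam L y2 u2 v2) :
    LocalSol ν c Q lam L (fun z => y z + y2 z) (fun z => u z + u2 z) (fun z => v z + v2 z) where
  cont := H.cont.add H2.cont
  eq z hz := by simp only [H.eq z hz, H2.eq z hz]; ring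
  u_sub x hx z hz := by
    rw [add_sub_add_comm, H.u_sub x hx z hz, H2.u_sub x hx z hz,
      ← intervalIntegral.integral_add (H.ii P hQ 0 hx hz) (H2.ii P hQ 0 hx hz)]
    congr 1; ext t; ring
  v_sub x hx z hz := by
    rw [add_sub_add_comm, H.v_sub x hx z hz, H2.v_sub x hx z hz, ← neg_add,
      ← intervalIntegral.integral_add (H.ii P hQ 1 hx hz) (H2.ii P hQ 1 hx hz)]
    congr 2; ext t; ring

/-- The coefficients u, v are differentiable only almost everywhere, but y is differentiable at
every point. With u, v frozen at z, the remainder is the integral from z to w of a kernel of size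
O(|w - z|) against an integrable function, hence o(w - z). -/
lemma hasDerivAt (P : Params ν c) (hQ : IntegrableOn Q (Ioi 0)) {z : ℝ} (hz : z ∈ Ioo 0 L) :
    HasDerivAt y (solD ν c lam u v z) z := by
  have h0 : HasDerivAt (hsr ν c 0 lam) (hsD ν c 0 z lam) z := P.hasDerivAt_hs_real 0 hz.1 lam
  have h1 : HasDerivAt (hsr ν c 1 lam) (hsD ν c 1 z lam) z := P.hasDerivAt_hs_real 1 hz.1 lam
  have hmain : HasDerivAt (fun w => hsr ν c 1 lam w * u z + hsr ν c 0 lam w * v z)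
      (solD ν c lam u v z) z := (h1.mul_const _).add (h0.mul_const _)
  have hnhds : Ioo 0 L ∈ 𝓝 z := Ioo_mem_nhds hz.1 hz.2
  have lip : ∀ j, ∃ M > 0, ∃ ε > 0, Metric.ball z ε ⊆ Ioo 0 L ∧ ∀ t ∈ Metric.ball z ε,
      ‖hsr ν c j lam t - hsr ν c j lam z‖ ≤ M * |t - z| ∧ ‖hsr ν c j lam t‖ ≤ M := by
    intro j
    have hj : HasDerivAt (hsr ν c j lam) (hsD ν c j z lam) z := P.hasDerivAt_hs_real j hz.1 lam
    obtain ⟨M, hM⟩ := hj.differentiableAt.isBigO_sub.bound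
    have hb : ∀ᶠ t in 𝓝 z, ‖hsr ν c j lam t‖ ≤ ‖hsr ν c j lam z‖ + 1 :=
      hj.continuousAt.norm.eventually (ge_mem_nhds (by linarith))
    obtain ⟨ε, hε, hball⟩ := Metric.eventually_nhds_iff_ball.1 ((hM.and hb).and hnhds)
    refine ⟨|M| + (‖hsr ν c j lam z‖ + 1), by positivity, ε, hε,
      fun t ht => (hball t ht).2, fun t ht => ⟨?_, ?_⟩⟩
    · have := (hball t ht).1.1
      rw [Real.norm_eq_abs] at this
      refine this.trans ?_
      gcongr
      linarith [le_abs_self M, norm_nonneg (hsr ν c j lam z)]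
    · have := (hball t ht).1.2
      linarith [abs_nonneg M]
  obtain ⟨M0, hM0, ε0, hε0, hb0, hl0⟩ := lip 0
  obtain ⟨M1, hM1, ε1, hε1, hb1, hl1⟩ := lip 1
  have hrem : (fun w => y w - (hsr ν c 1 lam w * u z + hsr ν c 0 lam w * v z)) =o[𝓝 z]
      fun w => w - z := by
    have hQy : ∀ w ∈ Ioo 0 L, IntervalIntegrable (fun t => ‖Q t * y t‖) volume z w := by
      intro w hw
      have := intervalIntegrable_mul_mul hQ (continuousOn_const (c := (1 : ℂ))) H.cont hz hw
      simpa using this.norm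
    have hc : Tendsto (fun w => ∫ t in z..w, ‖Q t * y t‖) (𝓝 z) (𝓝 0) := by
      have p1 : z - ε0 / 2 ∈ Ioo 0 L := hb0 (by
        rw [Metric.mem_ball, Real.dist_eq, sub_sub_cancel_left, abs_neg, abs_of_pos] <;> linarith)
      have p2 : z + ε0 / 2 ∈ Ioo 0 L := hb0 (by
        rw [Metric.mem_ball, Real.dist_eq, add_sub_cancel_left, abs_of_pos] <;> linarith)
      have hcont := intervalIntegral.continuousOn_primitive_interval' (a := z) (b₁ := z - ε0 / 2)
        (b₂ := z + ε0 / 2) (f := fun t => ‖Q t * y t‖) (μ := volume)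
        ((hQy _ p1).symm.trans (hQy _ p2)) ?_
      · have h := hcont.continuousAt (x := z) (by
          rw [uIcc_of_le (by linarith)]; exact Icc_mem_nhds (by linarith) (by linarith))
        simpa [ContinuousAt] using h
      · rw [uIcc_of_le (by linarith)]; constructor <;> linarith
    rw [Asymptotics.isLittleO_iff]
    intro δ hδ
    have hδ' : 0 < δ / (4 * M0 * M1) := by positivity
    filter_upwards [Metric.ball_mem_nhds z hε0, Metric.ball_mem_nhds z hε1,
      (Metric.tendsto_nhds.1 hc) _ hδ'] with w hw0 hw1 hw2
    have hw := hb0 hw0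
    have heq : y w - (hsr ν c 1 lam w * u z + hsr ν c 0 lam w * v z) =
        ∫ t in z..w, (hsr ν c 0 lam t * hsr ν c 1 lam w - hsr ν c 0 lam w * hsr ν c 1 lam t) *
          (Q t * y t) := by
      have e1 := H.u_sub z hz w hw
      have e2 := H.v_sub z hz w hw
      have e3 : hsr ν c 1 lam w * (u w - u z) + hsr ν c 0 lam w * (v w - v z) =
          y w - (hsr ν c 1 lam w * u z + hsr ν c 0 lam w * v z) := by
        rw [H.eq w hw]; ring
      rw [← e3, e1, e2, mul_neg, ← sub_eq_add_neg, ← intervalIntegral.integral_const_mul,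
        ← intervalIntegral.integral_const_mul, ← intervalIntegral.integral_sub
          ((H.ii P hQ 0 hz hw).const_mul _) ((H.ii P hQ 1 hz hw).const_mul _)]
      congr 1; ext t; ring
    rw [heq, Real.norm_eq_abs]
    have hbound : ‖∫ t in z..w, (hsr ν c 0 lam t * hsr ν c 1 lam w -
        hsr ν c 0 lam w * hsr ν c 1 lam t) * (Q t * y t)‖ ≤
        |∫ t in z..w, 4 * M0 * M1 * |w - z| * ‖Q t * y t‖| := by
      refine intervalIntegral.norm_integral_le_abs_of_norm_le ?_ ((hQy w hw).const_mul _)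
      refine (ae_restrict_iff' measurableSet_uIoc).2 (Eventually.of_forall fun t ht => ?_)
      have ht' : |t - z| ≤ |w - z| := abs_sub_left_of_mem_uIcc (uIoc_subset_uIcc ht)
      have ht0 : t ∈ Metric.ball z ε0 := lt_of_le_of_lt ht' hw0
      have ht1 : t ∈ Metric.ball z ε1 := lt_of_le_of_lt ht' hw1
      rw [norm_mul]
      gcongr
      -- The kernel vanishes on the diagonal; this splitting exhibits an increment of a Frobenius
      -- solution in each of the four terms.
      have e : hsr ν c 0 lam t * hsr ν c 1 lam w - hsr ν c 0 lam w * hsr ν c 1 lam t =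
        hsr ν c 0 lam t * (hsr ν c 1 lam w - hsr ν c 1 lam z) -
        hsr ν c 0 lam t * (hsr ν c 1 lam t - hsr ν c 1 lam z) -
        (hsr ν c 0 lam w - hsr ν c 0 lam z) * hsr ν c 1 lam t +
        (hsr ν c 0 lam t - hsr ν c 0 lam z) * hsr ν c 1 lam t := by ring
      rw [e]
      refine (norm_add_le _ _).trans ((add_le_add (norm_sub_le _ _) le_rfl).trans
        ((add_le_add (add_le_add (norm_sub_le _ _) le_rfl) le_rfl).trans ?_))
      simp only [norm_mul]
      have b1 := (hl0 t ht0).2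
      have b2 := (hl1 t ht1).2
      have b3 := (hl1 w hw1).1
      have b4 : ‖hsr ν c 1 lam t - hsr ν c 1 lam z‖ ≤ M1 * |w - z| :=
        ((hl1 t ht1).1).trans (by gcongr)
      have b5 := (hl0 w hw0).1
      have b6 : ‖hsr ν c 0 lam t - hsr ν c 0 lam z‖ ≤ M0 * |w - z| :=
        ((hl0 t ht0).1).trans (by gcongr)
      calc _ ≤ M0 * (M1 * |w - z|) + M0 * (M1 * |w - z|) + M0 * |w - z| * M1
            + M0 * |w - z| * M1 := by gcongr
        _ = _ := by ring
    refine hbound.trans ?_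
    rw [intervalIntegral.integral_const_mul, abs_mul, abs_of_nonneg (by positivity)]
    rw [Real.dist_eq, sub_zero, lt_div_iff₀ (by positivity)] at hw2
    nlinarith [abs_nonneg (w - z)]
  have h2 := (hasDerivAt_iff_isLittleO.1 hmain).add hrem
  have hyz : y z = hsr ν c 1 lam z * u z + hsr ν c 0 lam z * v z := H.eq z hz
  rw [hasDerivAt_iff_isLittleO]
  refine h2.congr_left fun w => ?_
  simp only [hyz]; ring

/-- Cramer's rule with Wronskian 1. Consequently an equality of solutions on an open set passes to
the coefficients u and v. -/
lemma coeff_eq (P : Params ν c) {z : ℝ} (hz : z ∈ Ioo 0 L) :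
    u z = hsr ν c 0 lam z * solD ν c lam u v z - hsD ν c 0 z lam * y z ∧
    v z = hsD ν c 1 z lam * y z - hsr ν c 1 lam z * solD ν c lam u v z := by
  have hW : hsr ν c 0 lam z * hsD ν c 1 z lam - hsD ν c 0 z lam * hsr ν c 1 lam z = 1 :=
    P.hs_wronskian (Complex.ofReal_ne_zero.2 hz.1.ne') lam
  rw [H.eq z hz, solD]
  constructor
  · linear_combination -(u z) * hW
  · linear_combination -(v z) * hW

lemma wronskian_eq (P : Params ν c) {y2 u2 v2 : ℝ → ℂ} (H2 : LocalSol ν c Q lam L y2 u2 v2)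
    {z : ℝ} (hz : z ∈ Ioo 0 L) :
    v z * u2 z - u z * v2 z = y z * solD ν c lam u2 v2 z - solD ν c lam u v z * y2 z := by
  have hW : hsr ν c 0 lam z * hsD ν c 1 z lam - hsD ν c 0 z lam * hsr ν c 1 lam z = 1 :=
    P.hs_wronskian (Complex.ofReal_ne_zero.2 hz.1.ne') lam
  rw [H.eq z hz, H2.eq z hz, solD, solD]
  linear_combination -(v z * u2 z - u z * v2 z) * hW

lemma absolutelyContinuous (P : Params ν c) (hQ : IntegrableOn Q (Ioi 0)) {x z : ℝ}
    (hx : x ∈ Ioo 0 L) (hz : z ∈ Ioo 0 L) :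
    AbsolutelyContinuousOnInterval u x z ∧ AbsolutelyContinuousOnInterval v x z ∧
      ∀ᵐ t, t ∈ uIcc x z → HasDerivAt u (hsr ν c 0 lam t * Q t * y t) t ∧
        HasDerivAt v (-(hsr ν c 1 lam t * Q t * y t)) t := by
  have hs := uIcc_subset_Ioo hx hz
  have i0 := H.ii P hQ 0 hx hz
  have i1 := H.ii P hQ 1 hx hz
  refine ⟨absolutelyContinuousOnInterval_of_sub_eq_integral i0
    (fun s hs' t ht => H.u_sub s (hs hs') t (hs ht)),
    absolutelyContinuousOnInterval_of_sub_eq_integral i1.neg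
    (fun s hs' t ht => ?_), ?_⟩
  · rw [H.v_sub s (hs hs') t (hs ht), ← intervalIntegral.integral_neg]; rfl
  · filter_upwards [i0.ae_hasDerivAt_integral, i1.ae_hasDerivAt_integral] with t h0 h1 ht
    have hev : ∀ᶠ w in 𝓝 t, w ∈ Ioo 0 L := Ioo_mem_nhds (hs ht).1 (hs ht).2
    refine ⟨((h0 ht x left_mem_uIcc).const_add (u x)).congr_of_eventuallyEq ?_,
      ((h1 ht x left_mem_uIcc).neg.const_add (v x)).congr_of_eventuallyEq ?_⟩
    · filter_upwards [hev] with w hw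
      rw [← H.u_sub x hx w hw]; ring
    · filter_upwards [hev] with w hw
      simp only [Pi.neg_apply]
      rw [← H.v_sub x hx w hw]; ring

/-- Absolute continuity reduces the claim to the almost everywhere derivative, in which the two
terms containing Q cancel. -/
lemma wronskian_const (P : Params ν c) (hQ : IntegrableOn Q (Ioi 0)) {y2 u2 v2 : ℝ → ℂ}
    (H2 : LocalSol ν c Q lam L y2 u2 v2) {x z : ℝ} (hx : x ∈ Ioo 0 L) (hz : z ∈ Ioo 0 L) :
    v x * u2 x - u x * v2 x = v z * u2 z - u z * v2 z := by
  have hs := uIcc_subset_Ioo hx hz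
  obtain ⟨a1, a2, a3⟩ := H.absolutelyContinuous P hQ hx hz
  obtain ⟨b1, b2, b3⟩ := H2.absolutelyContinuous P hQ hx hz
  have hac : AbsolutelyContinuousOnInterval (fun t => v t * u2 t - u t * v2 t) x z :=
    (a2.smul b1).sub (a1.smul b2)
  obtain ⟨C, hC⟩ := hac.const_of_ae_hasDerivAt_zero (by
    filter_upwards [a3, b3] with t h1 h2 ht
    obtain ⟨d1, d2⟩ := h1 ht
    obtain ⟨d3, d4⟩ := h2 ht
    convert! (d2.mul d3).sub (d1.mul d4) using 1
    rw [H.eq t (hs ht), H2.eq t (hs ht)]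
    ring)
  exact (hC x left_mem_uIcc).trans (hC z right_mem_uIcc).symm

end LocalSol

end

/-! ### Recovering the potential from quotients of solutions -/

section LocalUniqueness

variable {ν : ℂ} {c : Fin 2 → ℂ} {Q Q' : ℝ → ℂ} {lam : ℂ} {L : ℝ}
  {y1 u1 v1 y2 u2 v2 y1' u1' v1' y2' u2' v2' : ℝ → ℂ}

/-- Equal solutions have equal derivatives, hence equal coefficients. Differentiating the
coefficients almost everywhere and combining with the Wronskian identity gives (Q - Q') y₁ = 0. -/
lemma LocalSol.eq_ae_of_eventuallyEq (P : Params ν c) (hQ : IntegrableOn Q (Ioi 0))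
    (hQ' : IntegrableOn Q' (Ioi 0)) (H : LocalSol ν c Q lam L y1 u1 v1)
    (H' : LocalSol ν c Q' lam L y1' u1' v1') {z ε : ℝ} (hε : 0 < ε)
    (hsub : Metric.ball z ε ⊆ Ioo 0 L) (hne : ∀ t ∈ Metric.ball z ε, y1 t ≠ 0)
    (heq : ∀ t ∈ Metric.ball z ε, y1 t = y1' t) :
    ∀ᵐ t, t ∈ Metric.ball z (ε / 2) → Q t = Q' t := by
  have hev : ∀ t ∈ Metric.ball z ε, ∀ᶠ w in 𝓝 t, w ∈ Metric.ball z ε := fun t ht =>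
    Metric.isOpen_ball.mem_nhds ht
  have hD : ∀ t ∈ Metric.ball z ε, solD ν c lam u1 v1 t = solD ν c lam u1' v1' t := by
    intro t ht
    refine (H.hasDerivAt P hQ (hsub ht)).unique
      ((H'.hasDerivAt P hQ' (hsub ht)).congr_of_eventuallyEq ?_)
    filter_upwards [hev t ht] with w hw using heq w hw
  have hu : ∀ t ∈ Metric.ball z ε, u1 t = u1' t ∧ v1 t = v1' t := by
    intro t ht
    obtain ⟨e1, e2⟩ := H.coeff_eq P (hsub ht)
    obtain ⟨e3, e4⟩ := H'.coeff_eq P (hsub ht)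
    rw [e1, e2, e3, e4, heq t ht, hD t ht]
    exact ⟨rfl, rfl⟩
  have m1 : z - ε / 2 ∈ Metric.ball z ε := by
    rw [Metric.mem_ball, Real.dist_eq, sub_sub_cancel_left, abs_neg, abs_of_pos] <;> linarith
  have m2 : z + ε / 2 ∈ Metric.ball z ε := by
    rw [Metric.mem_ball, Real.dist_eq, add_sub_cancel_left, abs_of_pos] <;> linarith
  filter_upwards [(H.absolutelyContinuous P hQ (hsub m1) (hsub m2)).2.2,
    (H'.absolutelyContinuous P hQ' (hsub m1) (hsub m2)).2.2] with t h1 h2 ht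
  have htm : t ∈ uIcc (z - ε / 2) (z + ε / 2) := by
    rw [Real.ball_eq_Ioo] at ht
    rw [uIcc_of_le (by linarith)]
    exact Ioo_subset_Icc_self ht
  have htb : t ∈ Metric.ball z ε := Metric.ball_subset_ball (by linarith) ht
  obtain ⟨d1, d2⟩ := h1 htm
  obtain ⟨d3, d4⟩ := h2 htm
  have e1 := d1.unique (d3.congr_of_eventuallyEq
    ((hev t htb).mono fun w hw => (hu w hw).1))
  have e2 := d2.unique (d4.congr_of_eventuallyEq
    ((hev t htb).mono fun w hw => (hu w hw).2))
  rw [← heq t htb] at e1 e2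
  have hW : hsr ν c 0 lam t * hsD ν c 1 t lam - hsD ν c 0 t lam * hsr ν c 1 lam t = 1 :=
    P.hs_wronskian (Complex.ofReal_ne_zero.2 (hsub htb).1.ne') lam
  refine mul_right_cancel₀ (hne t htb) ?_
  linear_combination (hsD ν c 1 t lam) * e1 + (hsD ν c 0 t lam) * e2 -
    (Q t * y1 t - Q' t * y1 t) * hW

/-- The quotients y₂/y₁ of the two systems coincide near z, and their derivatives are w/y₁² and
w/y₁'² with the same nonzero w. -/
lemma LocalSol.sq_eq_sq (P : Params ν c) (hQ : IntegrableOn Q (Ioi 0))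
    (hQ' : IntegrableOn Q' (Ioi 0)) (H1 : LocalSol ν c Q lam L y1 u1 v1)
    (H2 : LocalSol ν c Q lam L y2 u2 v2) (H1' : LocalSol ν c Q' lam L y1' u1' v1')
    (H2' : LocalSol ν c Q' lam L y2' u2' v2') {w : ℂ} (hw : w ≠ 0)
    (hW : ∀ t ∈ Ioo 0 L, v1 t * u2 t - u1 t * v2 t = w)
    (hW' : ∀ t ∈ Ioo 0 L, v1' t * u2' t - u1' t * v2' t = w)
    (hprod : ∀ t ∈ Ioo 0 L, y1 t * y2' t = y2 t * y1' t) {z : ℝ} (hz : z ∈ Ioo 0 L)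
    (h1 : ∀ᶠ t in 𝓝 z, y1 t ≠ 0) (h1' : ∀ᶠ t in 𝓝 z, y1' t ≠ 0) : y1 z ^ 2 = y1' z ^ 2 := by
  have hz1 := h1.self_of_nhds
  have hz1' := h1'.self_of_nhds
  have d := (H2.hasDerivAt P hQ hz).div (H1.hasDerivAt P hQ hz) hz1
  have d' := (H2'.hasDerivAt P hQ' hz).div (H1'.hasDerivAt P hQ' hz) hz1'
  have e := d.unique (d'.congr_of_eventuallyEq (by
    filter_upwards [h1, h1', Ioo_mem_nhds hz.1 hz.2] with t a b ht
    simp only [Pi.div_apply]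
    rw [div_eq_div_iff a b, ← hprod t ht]; ring))
  have k1 := (H1.wronskian_eq P H2 hz).symm.trans (hW z hz)
  have k1' := (H1'.wronskian_eq P H2' hz).symm.trans (hW' z hz)
  rw [div_eq_div_iff (pow_ne_zero 2 hz1) (pow_ne_zero 2 hz1')] at e
  refine (mul_left_cancel₀ hw ?_).symm
  linear_combination e - y1' z ^ 2 * k1 + y1 z ^ 2 * k1'

/-- The squares agree on a ball free of zeros, so by connectedness the solutions agree up to one
global sign. The sign is harmless because the equation is linear. -/
lemma LocalSol.exists_ball_eq_ae (P : Params ν c) (hQ : IntegrableOn Q (Ioi 0))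
    (hQ' : IntegrableOn Q' (Ioi 0)) (H1 : LocalSol ν c Q lam L y1 u1 v1)
    (H2 : LocalSol ν c Q lam L y2 u2 v2) (H1' : LocalSol ν c Q' lam L y1' u1' v1')
    (H2' : LocalSol ν c Q' lam L y2' u2' v2') {w : ℂ} (hw : w ≠ 0)
    (hW : ∀ t ∈ Ioo 0 L, v1 t * u2 t - u1 t * v2 t = w)
    (hW' : ∀ t ∈ Ioo 0 L, v1' t * u2' t - u1' t * v2' t = w)
    (hprod : ∀ t ∈ Ioo 0 L, y1 t * y2' t = y2 t * y1' t) {z : ℝ} (hz : z ∈ Ioo 0 L)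
    (hne : y1 z ≠ 0) : ∃ δ > 0, ∀ᵐ t, t ∈ Metric.ball z δ → Q t = Q' t := by
  have hne' : y1' z ≠ 0 := by
    intro h0
    have h2 : y2' z = 0 := by
      have := hprod z hz
      rw [h0, mul_zero] at this
      exact (mul_eq_zero.1 this).resolve_left hne
    have := H1'.wronskian_eq P H2' hz
    rw [hW' z hz, h0, h2] at this
    exact hw (by simpa using this)
  have hnh := Ioo_mem_nhds hz.1 hz.2
  have c1 := (H1.cont.continuousAt hnh).eventually_ne hne
  have c1' := (H1'.cont.continuousAt hnh).eventually_ne hne'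
  obtain ⟨ε, hε, hball⟩ := Metric.eventually_nhds_iff_ball.1 ((c1.and c1').and hnh)
  have hsub : Metric.ball z ε ⊆ Ioo 0 L := fun t ht => (hball t ht).2
  have hev : ∀ t ∈ Metric.ball z ε, ∀ᶠ w in 𝓝 t, w ∈ Metric.ball z ε := fun t ht =>
    Metric.isOpen_ball.mem_nhds ht
  have hsq : ∀ t ∈ Metric.ball z ε, y1 t ^ 2 = y1' t ^ 2 := fun t ht =>
    LocalSol.sq_eq_sq P hQ hQ' H1 H2 H1' H2' hw hW hW' hprod (hsub ht)
      ((hev t ht).mono fun w hw => (hball w hw).1.1) ((hev t ht).mono fun w hw => (hball w hw).1.2)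
  have hpre : IsPreconnected (Metric.ball z ε) := (convex_ball z ε).isPreconnected
  refine ⟨ε / 2, by positivity, ?_⟩
  rcases hpre.eq_or_eq_neg_of_sq_eq (H1.cont.mono hsub) (H1'.cont.mono hsub) hsq
    (fun {t} ht => (hball t ht).1.2) with h | h
  · exact H1.eq_ae_of_eventuallyEq P hQ hQ' H1' hε hsub (fun t ht => (hball t ht).1.1) h
  · refine H1.eq_ae_of_eventuallyEq P hQ hQ' (H1'.smul (-1)) hε hsub
      (fun t ht => (hball t ht).1.1) fun t ht => ?_
    rw [h ht, Pi.neg_apply]; ring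

/-- Two fundamental systems with the same quotient and the same Wronskian belong to the same
potential. -/
lemma LocalSol.eq_ae_of_mul_eq_mul (P : Params ν c) (hQ : IntegrableOn Q (Ioi 0))
    (hQ' : IntegrableOn Q' (Ioi 0)) (H1 : LocalSol ν c Q lam L y1 u1 v1)
    (H2 : LocalSol ν c Q lam L y2 u2 v2) (H1' : LocalSol ν c Q' lam L y1' u1' v1')
    (H2' : LocalSol ν c Q' lam L y2' u2' v2') {w : ℂ} (hw : w ≠ 0)
    (hW : ∀ t ∈ Ioo 0 L, v1 t * u2 t - u1 t * v2 t = w)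
    (hW' : ∀ t ∈ Ioo 0 L, v1' t * u2' t - u1' t * v2' t = w)
    (hprod : ∀ t ∈ Ioo 0 L, y1 t * y2' t = y2 t * y1' t) :
    ∀ᵐ t, t ∈ Ioo 0 L → Q t = Q' t := by
  have key : ∀ z ∈ Ioo 0 L, ∃ δ > 0, ∀ᵐ t, t ∈ Metric.ball z δ → Q t = Q' t := by
    intro z hz
    -- The nonzero Wronskian forbids a common zero. If the first solution vanishes at z, the two are
    -- interchanged, which replaces w by -w.
    by_cases h1 : y1 z = 0
    · have h2 : y2 z ≠ 0 := by
        intro h2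
        have := H1.wronskian_eq P H2 hz
        rw [hW z hz, h1, h2] at this
        exact hw (by simpa using this)
      refine LocalSol.exists_ball_eq_ae P hQ hQ' H2 H1 H2' H1' (w := -w) (neg_ne_zero.2 hw)
        (fun t ht => ?_) (fun t ht => ?_) (fun t ht => (hprod t ht).symm) hz h2
      · rw [← hW t ht]; ring
      · rw [← hW' t ht]; ring
    · exact LocalSol.exists_ball_eq_ae P hQ hQ' H1 H2 H1' H2' hw hW hW' hprod hz h1
  -- Equality is known almost everywhere near each point; a set that is locally null is null.
  have hnull : volume {t | t ∈ Ioo 0 L ∧ Q t ≠ Q' t} = 0 := by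
    refine measure_null_of_locally_null _ fun z hz => ?_
    obtain ⟨δ, hδ, hae⟩ := key z hz.1
    refine ⟨Metric.ball z δ ∩ {t | t ∈ Ioo 0 L ∧ Q t ≠ Q' t},
      inter_mem (mem_nhdsWithin_of_mem_nhds (Metric.ball_mem_nhds z hδ)) self_mem_nhdsWithin, ?_⟩
    refine measure_mono_null (fun t ht => ?_) hae
    simp only [mem_compl_iff, mem_ofPred_eq, Classical.not_imp]
    exact ⟨ht.1, ht.2.2⟩
  refine measure_mono_null (fun t ht => ?_) hnull
  simp only [mem_compl_iff, mem_ofPred_eq, Classical.not_imp] at ht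
  exact ht

end LocalUniqueness

/-! ### Growth of order 1/2 -/

/-- Functions of growth order at most `1 / 2`, of finite type. -/
def HalfOrder (F : ℂ → ℂ) : Prop :=
  ∃ A B : ℝ, 0 ≤ A ∧ 0 ≤ B ∧ ∀ l, ‖F l‖ ≤ A * Real.exp (B * √‖l‖)

namespace HalfOrder

variable {F G : ℂ → ℂ}

lemma mul (hF : HalfOrder F) (hG : HalfOrder G) : HalfOrder (fun l => F l * G l) := by
  obtain ⟨A, B, hA, hB, h⟩ := hF
  obtain ⟨A', B', hA', hB', h'⟩ := hG
  refine ⟨A * A', B + B', by positivity, by positivity, fun l => ?_⟩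
  rw [norm_mul, add_mul, Real.exp_add]
  calc _ ≤ A * Real.exp (B * √‖l‖) * (A' * Real.exp (B' * √‖l‖)) :=
        mul_le_mul (h l) (h' l) (norm_nonneg _) (by positivity)
    _ = _ := by ring

lemma add (hF : HalfOrder F) (hG : HalfOrder G) : HalfOrder (fun l => F l + G l) := by
  obtain ⟨A, B, hA, hB, h⟩ := hF
  obtain ⟨A', B', hA', hB', h'⟩ := hG
  refine ⟨A + A', max B B', by positivity, by positivity, fun l => ?_⟩
  calc _ ≤ A * Real.exp (B * √‖l‖) + A' * Real.exp (B' * √‖l‖) :=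
        (norm_add_le _ _).trans (add_le_add (h l) (h' l))
    _ ≤ A * Real.exp (max B B' * √‖l‖) + A' * Real.exp (max B B' * √‖l‖) := by
        gcongr
        · exact le_max_left _ _
        · exact le_max_right _ _
    _ = _ := by ring

lemma const (k : ℂ) : HalfOrder (fun _ => k) :=
  ⟨‖k‖, 0, norm_nonneg _, le_rfl, fun l => by simp⟩

lemma sub (hF : HalfOrder F) (hG : HalfOrder G) : HalfOrder (fun l => F l - G l) := by
  have := hF.add ((const (-1)).mul hG)
  simpa [sub_eq_add_neg] using this

lemma id : HalfOrder (fun l => l) := by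
  refine ⟨2, 1, by norm_num, by norm_num, fun l => ?_⟩
  have h1 := Real.quadratic_le_exp_of_nonneg (Real.sqrt_nonneg ‖l‖)
  have h2 := Real.sq_sqrt (norm_nonneg l)
  have h3 := Real.sqrt_nonneg ‖l‖
  rw [one_mul]
  nlinarith

/-- Cauchy's estimate on circles of radius 1: since √(|l| + 1) ≤ √|l| + 1, passing to the circle
costs only the factor exp(B). -/
lemma deriv (hF : HalfOrder F) (hd : Differentiable ℂ F) : HalfOrder (deriv F) := by
  obtain ⟨A, B, hA, hB, h⟩ := hF
  refine ⟨A * Real.exp B, B, by positivity, hB, fun l => ?_⟩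
  have := Complex.norm_deriv_le_of_forall_mem_sphere_norm_le (R := 1)
    (C := A * Real.exp B * Real.exp (B * √‖l‖)) one_pos (hd.diffContOnCl (s := Metric.ball l 1))
    (fun w hw => ?_)
  · simpa using this
  · refine (h w).trans ?_
    rw [mul_assoc A, ← Real.exp_add]
    have h1 : ‖w‖ ≤ ‖l‖ + 1 := by
      rw [mem_sphere_iff_norm] at hw
      calc ‖w‖ = ‖l + (w - l)‖ := by congr 1; ring
        _ ≤ _ := (norm_add_le _ _).trans (by rw [hw])
    have h2 : √‖w‖ ≤ √‖l‖ + 1 := by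
      rw [Real.sqrt_le_left (by positivity)]
      nlinarith [Real.sq_sqrt (norm_nonneg l), Real.sqrt_nonneg ‖l‖]
    gcongr
    nlinarith

end HalfOrder

/-! ### Solutions normalised at the singular point -/

section HalfLine

variable {ν : ℂ} {c : Fin 2 → ℂ} {Q : ℝ → ℂ}

lemma Params.differentiable_hsD_lam (P : Params ν c) (j : Fin 2) (z : ℂ) :
    Differentiable ℂ (fun lam => hsD ν c j z lam) := by
  have h1 := P.differentiable_frobF j
  have h2 : Differentiable ℂ (frobF1 ν c j) := fun w => (P.hasDerivAt_frobF1 j w).differentiableAt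
  unfold hsD
  fun_prop

lemma Params.halfOrder_hs (P : Params ν c) (j : Fin 2) {z : ℝ} (hz : 0 < z) :
    HalfOrder (fun lam => hs ν c j z lam) := by
  obtain ⟨D, K, G⟩ := P.exists_growthBound
  have h1 := Real.rpow_pos_of_pos hz (tau ν j)
  have := G.K_pos
  have := G.one_le
  refine ⟨K * z ^ tau ν j, D * z, by positivity, by positivity, fun l => ?_⟩
  refine (G.bound j z hz l).trans (le_of_eq ?_)
  ring_nf

/-- Apart from the power of z, the solution depends on λz² only. Hence z times its z-derivative
equals μ times the solution plus 2λ times its λ-derivative, and the growth of the latter follows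
from Cauchy's estimate. -/
lemma Params.halfOrder_hsD (P : Params ν c) (j : Fin 2) {z : ℝ} (hz : 0 < z) :
    HalfOrder (fun lam => hsD ν c j z lam) := by
  have hz0 : (z : ℂ) ≠ 0 := Complex.ofReal_ne_zero.2 hz.ne'
  have hd : ∀ l, HasDerivAt (fun lam => hs ν c j z lam)
      ((z : ℂ) ^ expo ν j * (frobF1 ν c j (l * z ^ 2) * (1 * z ^ 2))) l := fun l =>
    ((P.hasDerivAt_frobF j _).comp l ((hasDerivAt_id l).mul_const _)).const_mul _
  have h1 := (P.halfOrder_hs j hz).deriv (P.differentiable_hs_lam j z)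
  have h2 := ((HalfOrder.const (expo ν j / z)).mul (P.halfOrder_hs j hz)).add
    (((HalfOrder.const (2 / z)).mul HalfOrder.id).mul h1)
  convert h2 using 2 with lam
  rw [(hd lam).deriv, hs, hsD]
  field_simp

/-- The solution on `(0, ∞)` behaving like the Frobenius solution at the singular point. -/
noncomputable def halfSol (ν : ℂ) (c : Fin 2 → ℂ) (Q : ℝ → ℂ) (j : Fin 2) (lam : ℂ) : ℝ → ℂ :=
  volterraSol (fun z => Ioc 0 z) (hsr ν c 0 lam) (hsr ν c 1 lam) Q (hsr ν c j lam)

/-- The coefficient of `hsr 1` in the variation of constants formula on `(0, ∞)`. -/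
noncomputable def halfU (ν : ℂ) (c : Fin 2 → ℂ) (Q : ℝ → ℂ) (lam α : ℂ) (y : ℝ → ℂ) (z : ℝ) : ℂ :=
  α + ∫ t in Ioc 0 z, hsr ν c 0 lam t * Q t * y t

/-- The coefficient of `hsr 0` in the variation of constants formula on `(0, ∞)`. -/
noncomputable def halfV (ν : ℂ) (c : Fin 2 → ℂ) (Q : ℝ → ℂ) (lam α : ℂ) (y : ℝ → ℂ) (z : ℝ) : ℂ :=
  α - ∫ t in Ioc 0 z, hsr ν c 1 lam t * Q t * y t

lemma setIntegral_Ioc_sub {F : ℝ → ℂ} {L x z : ℝ} (hF : IntegrableOn F (Ioc 0 L))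
    (hx : x ∈ Ioc 0 L) (hz : z ∈ Ioc 0 L) :
    (∫ t in Ioc 0 z, F t) - ∫ t in Ioc 0 x, F t = ∫ t in x..z, F t := by
  have hi : ∀ w ∈ Ioc 0 L, IntervalIntegrable F volume 0 w := fun w hw =>
    (intervalIntegrable_iff_integrableOn_Ioc_of_le hw.1.le).2
      (hF.mono_set (Ioc_subset_Ioc_right hw.2))
  rw [← intervalIntegral.integral_of_le hz.1.le, ← intervalIntegral.integral_of_le hx.1.le,
    intervalIntegral.integral_interval_sub_left (hi z hz) (hi x hx)]

lemma tendsto_setIntegral_Ioc {F : ℝ → ℂ} {L : ℝ} (hL : 0 < L) (hF : IntegrableOn F (Ioc 0 L)) :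
    Tendsto (fun z => ∫ t in Ioc 0 z, F t) (𝓝[>] 0) (𝓝 0) := by
  have h1 := intervalIntegral.continuousOn_primitive (a := 0) (b := L) (f := F) (μ := volume)
    ((integrableOn_Icc_iff_integrableOn_Ioc).2 hF)
  have h2 := (h1 0 ⟨le_rfl, hL.le⟩).tendsto
  simp only [Ioc_self, Measure.restrict_empty, integral_zero_measure] at h2
  refine h2.mono_left ?_
  rw [← nhdsWithin_Ioo_eq_nhdsGT hL]
  exact nhdsWithin_mono _ Ioo_subset_Icc_self

namespace Params

variable (P : Params ν c) (hQ : HalfPot ν.re Q)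
include P hQ

lemma norm_halfSol_le {D K : ℝ} (G : GrowthBound ν c D K) {L : ℝ} (hL : 0 < L) (j : Fin 2)
    {lam : ℂ} {s : ℝ} (hs : √‖lam‖ ≤ s) {z : ℝ} (hz : z ∈ Ioc 0 L) :
    ‖halfSol ν c Q j lam z‖ ≤
      2 * K * Real.exp (2 * ∫ t in Ioc 0 L, growthH ν.re K L Q t) * growthN ν D j s z ∧
    halfSol ν c Q j lam z = hsr ν c j lam z + volterraOp (fun z => Ioc 0 z) (hsr ν c 0 lam)
      (hsr ν c 1 lam) Q (halfSol ν c Q j lam) z ∧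
    ContinuousOn (halfSol ν c Q j lam) (Ioc 0 L) := by
  have B := P.volterraBound_growth hQ G hL j hs
  have hK := G.K_pos
  have hD := G.one_le
  have hf : ∀ w ∈ Ioc 0 L, ‖hsr ν c j lam w‖ ≤ K * growthN ν D j s w := by
    intro w hw
    have := Real.rpow_pos_of_pos hw.1 (tau ν j)
    have hw0 := hw.1
    refine (G.bound j w hw.1 lam).trans ?_
    unfold growthN
    rw [mul_assoc]
    gcongr
  have hc : ContinuousOn (hsr ν c j lam) (Ioc 0 L) :=
    (P.continuousOn_hsr j lam).mono fun x hx => hx.1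
  exact ⟨B.norm_sol_le hK.le hc hf hz, B.sol_eq hK.le hc hf hz, B.continuousOn_sol hK.le hc hf⟩

lemma halfSol_eq (j : Fin 2) (lam : ℂ) {z : ℝ} (hz : 0 < z) :
    halfSol ν c Q j lam z = hsr ν c j lam z + volterraOp (fun z => Ioc 0 z) (hsr ν c 0 lam)
      (hsr ν c 1 lam) Q (halfSol ν c Q j lam) z := by
  obtain ⟨D, K, G⟩ := P.exists_growthBound
  exact (P.norm_halfSol_le hQ G hz j le_rfl ⟨hz, le_rfl⟩).2.1

lemma continuousOn_halfSol (j : Fin 2) (lam : ℂ) :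
    ContinuousOn (halfSol ν c Q j lam) (Ioi 0) := by
  obtain ⟨D, K, G⟩ := P.exists_growthBound
  intro z hz
  have hz' : (0 : ℝ) < z := hz
  have := (P.norm_halfSol_le hQ G (L := z + 1) (by linarith) j le_rfl
    (⟨hz, by linarith⟩ : z ∈ Ioc 0 (z + 1)) (lam := lam)).2.2
  exact (this.continuousAt (Ioc_mem_nhds hz' (by linarith))).continuousWithinAt

lemma halfOrder_halfSol (j : Fin 2) {z : ℝ} (hz : 0 < z) :
    HalfOrder (fun lam => halfSol ν c Q j lam z) := by
  obtain ⟨D, K, G⟩ := P.exists_growthBound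
  have h1 := Real.rpow_pos_of_pos hz (tau ν j)
  have := G.K_pos
  have := G.one_le
  refine ⟨2 * K * Real.exp (2 * ∫ t in Ioc 0 z, growthH ν.re K z Q t) * z ^ tau ν j, D * z,
    by positivity, by positivity, fun l => ?_⟩
  refine (P.norm_halfSol_le hQ G hz j le_rfl ⟨hz, le_rfl⟩).1.trans (le_of_eq ?_)
  unfold growthN
  ring_nf

lemma differentiable_halfSol (j : Fin 2) {z : ℝ} (hz : 0 < z) :
    Differentiable ℂ (fun lam => halfSol ν c Q j lam z) := by
  obtain ⟨D, K, G⟩ := P.exists_growthBound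
  have hK := G.K_pos
  have hD := G.one_le
  intro l
  have hU : Metric.ball (0 : ℂ) (‖l‖ + 1) ∈ 𝓝 l := by
    refine Metric.isOpen_ball.mem_nhds ?_
    rw [mem_ball_zero_iff]; linarith
  have hs : ∀ m ∈ Metric.ball (0 : ℂ) (‖l‖ + 1), √‖m‖ ≤ √(‖l‖ + 1) := fun m hm =>
    Real.sqrt_le_sqrt (mem_ball_zero_iff.1 hm).le
  refine (differentiableOn_volterraSol (f := fun m => hsr ν c j m) Metric.isOpen_ball
    (fun m hm => P.volterraBound_growth hQ G hz j (hs m hm)) hK.le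
    (fun m _ => (P.continuousOn_hsr j m).mono fun x hx => hx.1) (fun m hm w hw => ?_)
    (fun t _ => (P.differentiable_hs_lam 0 t).differentiableOn)
    (fun t _ => (P.differentiable_hs_lam 1 t).differentiableOn)
    (fun t _ => (P.differentiable_hs_lam j t).differentiableOn) ⟨hz, le_rfl⟩).differentiableAt hU
  have := Real.rpow_pos_of_pos hw.1 (tau ν j)
  have hw0 := hw.1
  refine (G.bound j w hw.1 m).trans ?_
  unfold growthN
  rw [mul_assoc]
  have := hs m hm
  gcongr

/-- The solutions on the half-line are `O(z ^ τ₀)` at the singular point. -/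
lemma norm_halfSol_le_rpow (j : Fin 2) (lam : ℂ) {L : ℝ} (hL : 0 < L) :
    ∃ M, 0 ≤ M ∧ ∀ z ∈ Ioc 0 L, ‖halfSol ν c Q j lam z‖ ≤ M * z ^ tau ν 0 := by
  obtain ⟨D, K, G⟩ := P.exists_growthBound
  have := G.K_pos
  have hD := G.one_le
  have hσ := P.re_pos
  have hL2 : 0 < L ^ (2 * ν.re) := Real.rpow_pos_of_pos hL _
  refine ⟨2 * K * Real.exp (2 * ∫ t in Ioc 0 L, growthH ν.re K L Q t) *
    ((1 + L ^ (2 * ν.re)) * Real.exp (D * √‖lam‖ * L)), by positivity, fun z hz => ?_⟩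
  refine (P.norm_halfSol_le hQ G hL j le_rfl hz).1.trans ?_
  have hz0 := hz.1
  have hzL := hz.2
  have h0 := Real.rpow_pos_of_pos hz.1 (tau ν 0)
  have hj : z ^ tau ν j ≤ (1 + L ^ (2 * ν.re)) * z ^ tau ν 0 := by
    match j with
    | 0 => nlinarith
    | 1 =>
      have e2 : z ^ tau ν 1 = z ^ tau ν 0 * z ^ (2 * ν.re) := by
        rw [← Real.rpow_add hz.1, ← (two_tau ν).2.2]; ring_nf
      have := Real.rpow_le_rpow hz.1.le hz.2 (show 0 ≤ 2 * ν.re by linarith)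
      rw [e2]; nlinarith
  unfold growthN
  rw [mul_assoc]
  calc _ ≤ 2 * K * (Real.exp (2 * ∫ t in Ioc 0 L, growthH ν.re K L Q t) *
      ((1 + L ^ (2 * ν.re)) * z ^ tau ν 0 * Real.exp (D * √‖lam‖ * L))) := by gcongr
    _ = _ := by ring

lemma integrableOn_hsr_mul {y : ℝ → ℂ} {L M : ℝ} (hL : 0 < L) (lam : ℂ)
    (hc : ContinuousOn y (Ioc 0 L)) (hb : ∀ z ∈ Ioc 0 L, ‖y z‖ ≤ M * z ^ tau ν 0) (j : Fin 2) :
    IntegrableOn (fun t => hsr ν c j lam t * Q t * y t) (Ioc 0 L) := by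
  obtain ⟨D, K, G⟩ := P.exists_growthBound
  have B := P.volterraBound_growth hQ G hL 0 (le_refl √‖lam‖)
  have hM : 0 ≤ M := by
    have := (norm_nonneg _).trans (hb L ⟨hL, le_rfl⟩)
    exact nonneg_of_mul_nonneg_left this (Real.rpow_pos_of_pos hL _)
  have := B.integrableOn_mul hc (K := M) (fun z hz => (hb z hz).trans ?_)
  · match j with
    | 0 => exact this.1
    | 1 => exact this.2
  · have h0 := Real.rpow_pos_of_pos hz.1 (tau ν 0)
    have hz0 := hz.1
    have hD := G.one_le
    have : 1 ≤ Real.exp (D * √‖lam‖ * z) := Real.one_le_exp (by positivity)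
    unfold growthN
    gcongr
    nlinarith

/-- As τ₀ < τ₁, near the singular point the class O(z ^ τ₀) contains both basic solutions and all
their combinations, so the bound with weight index 0 alone settles uniqueness. -/
lemma eq_zero_of_eq_volterraOp {d : ℝ → ℂ} {L M : ℝ} (hL : 0 < L) (lam : ℂ)
    (hb : ∀ z ∈ Ioc 0 L, ‖d z‖ ≤ M * z ^ tau ν 0)
    (heq : ∀ z ∈ Ioc 0 L, d z = volterraOp (fun z => Ioc 0 z) (hsr ν c 0 lam)
      (hsr ν c 1 lam) Q d z) {z : ℝ} (hz : z ∈ Ioc 0 L) : d z = 0 := by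
  obtain ⟨D, K, G⟩ := P.exists_growthBound
  have B := P.volterraBound_growth hQ G hL 0 (le_refl √‖lam‖)
  have hM : 0 ≤ M := by
    have := (norm_nonneg _).trans (hb L ⟨hL, le_rfl⟩)
    exact nonneg_of_mul_nonneg_left this (Real.rpow_pos_of_pos hL _)
  refine B.eq_zero_of_eq_op (K := M) (fun z hz => (hb z hz).trans ?_) heq hz
  have h0 := Real.rpow_pos_of_pos hz.1 (tau ν 0)
  have hz0 := hz.1
  have hD := G.one_le
  have : 1 ≤ Real.exp (D * √‖lam‖ * z) := Real.one_le_exp (by positivity)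
  unfold growthN
  gcongr
  nlinarith

lemma integrableOn_hsr_mul_halfSol (i j : Fin 2) (lam : ℂ) {L : ℝ} (hL : 0 < L) :
    IntegrableOn (fun t => hsr ν c i lam t * Q t * halfSol ν c Q j lam t) (Ioc 0 L) := by
  obtain ⟨M, -, hM⟩ := P.norm_halfSol_le_rpow hQ j lam hL
  exact P.integrableOn_hsr_mul hQ hL lam
    ((P.continuousOn_halfSol hQ j lam).mono fun x hx => hx.1) hM i

lemma localSol_halfSol (j : Fin 2) (lam : ℂ) (L : ℝ) :
    LocalSol ν c Q lam L (halfSol ν c Q j lam)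
      (halfU ν c Q lam (if j = 1 then 1 else 0) (halfSol ν c Q j lam))
      (halfV ν c Q lam (if j = 0 then 1 else 0) (halfSol ν c Q j lam)) where
  cont := (P.continuousOn_halfSol hQ j lam).mono Ioo_subset_Ioi_self
  eq z hz := by
    have hi := fun i => P.integrableOn_hsr_mul_halfSol hQ i j lam hz.1
    have h1 : volterraOp (fun z => Ioc 0 z) (hsr ν c 0 lam) (hsr ν c 1 lam) Q
        (halfSol ν c Q j lam) z =
        hsr ν c 1 lam z * (∫ t in Ioc 0 z, hsr ν c 0 lam t * Q t * halfSol ν c Q j lam t) -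
        hsr ν c 0 lam z * ∫ t in Ioc 0 z, hsr ν c 1 lam t * Q t * halfSol ν c Q j lam t := by
      obtain ⟨D, K, G⟩ := P.exists_growthBound
      exact (P.volterraBound_growth hQ G hz.1 j (le_refl √‖lam‖)).volterraOp_eq (hi 0) (hi 1)
        ⟨hz.1, le_rfl⟩
    rw [P.halfSol_eq hQ j lam hz.1, h1, halfU, halfV]
    fin_cases j <;> simp <;> ring
  u_sub x hx z hz := by
    have := setIntegral_Ioc_sub (P.integrableOn_hsr_mul_halfSol hQ 0 j lam (hx.1.trans hx.2))
      (Ioo_subset_Ioc_self hx) (Ioo_subset_Ioc_self hz)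
    rw [← this, halfU, halfU]; ring
  v_sub x hx z hz := by
    have := setIntegral_Ioc_sub (P.integrableOn_hsr_mul_halfSol hQ 1 j lam (hx.1.trans hx.2))
      (Ioo_subset_Ioc_self hx) (Ioo_subset_Ioc_self hz)
    rw [← this, halfV, halfV]; ring

/-- The Wronskian is constant, and as z → 0 the integrals in the coefficients vanish, leaving the
Wronskian 1 of the leading terms. -/
lemma wronskian_halfSol (lam : ℂ) {z : ℝ} (hz : 0 < z) :
    halfV ν c Q lam (if (0 : Fin 2) = 0 then 1 else 0) (halfSol ν c Q 0 lam) z *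
      halfU ν c Q lam (if (1 : Fin 2) = 1 then 1 else 0) (halfSol ν c Q 1 lam) z -
    halfU ν c Q lam (if (0 : Fin 2) = 1 then 1 else 0) (halfSol ν c Q 0 lam) z *
      halfV ν c Q lam (if (1 : Fin 2) = 0 then 1 else 0) (halfSol ν c Q 1 lam) z = 1 := by
  have hzz : z ∈ Ioo 0 (z + 1) := ⟨hz, by linarith⟩
  have hconst : ∀ x ∈ Ioo 0 (z + 1), _ := fun x hx =>
    (P.localSol_halfSol hQ 0 lam (z + 1)).wronskian_const P hQ.integrableOn
      (P.localSol_halfSol hQ 1 lam (z + 1)) hx hzz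
  have hev : ∀ᶠ x in 𝓝[>] (0 : ℝ), x ∈ Ioo 0 (z + 1) := Ioo_mem_nhdsGT (by linarith)
  have hl := fun i j => tendsto_setIntegral_Ioc hz (P.integrableOn_hsr_mul_halfSol hQ i j lam hz)
  have hlim := ((hl 1 0).const_sub 1).mul ((hl 0 1).const_add 1) |>.sub
    (((hl 0 0).const_add 0).mul ((hl 1 1).const_sub 0))
  refine tendsto_nhds_unique (tendsto_const_nhds.congr' ?_) (hlim.trans (by simp))
  filter_upwards [hev] with x hx
  rw [← hconst x hx]
  simp [halfU, halfV]

/-- Solutions of the integral equation are determined by absolute convergence of the integral. -/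
lemma eq_halfSol_of_integral_eq (j : Fin 2) (lam : ℂ) {y : ℝ → ℂ} {L : ℝ} (hL : 0 < L)
    (hint : ∀ z ∈ Ioc 0 L, IntegrableOn (fun t => hsG ν c z t lam * Q t * y t) (Ioc 0 z))
    (heq : ∀ z ∈ Ioc 0 L, y z = hsr ν c j lam z + ∫ t in Ioc 0 z, hsG ν c z t lam * Q t * y t)
    {z : ℝ} (hz : z ∈ Ioc 0 L) : y z = halfSol ν c Q j lam z := by
  have hlt : ∀ z ∈ Ioo 0 L, y z = halfSol ν c Q j lam z := by
    intro z hz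
    have hW : hsr ν c 0 lam L * hsD ν c 1 L lam - hsD ν c 0 L lam * hsr ν c 1 lam L = 1 :=
      P.hs_wronskian (Complex.ofReal_ne_zero.2 hL.ne') lam
    -- The determinant of the two Frobenius solutions at the points L and w vanishes at w = L with
    -- derivative 1. So some w strictly between z and L makes it nonzero.
    have hd : HasDerivAt (fun w => hsr ν c 0 lam L * hsr ν c 1 lam w -
        hsr ν c 0 lam w * hsr ν c 1 lam L) 1 L := by
      have := ((P.hasDerivAt_hs_real 1 hL lam).const_mul (hsr ν c 0 lam L)).sub
        ((P.hasDerivAt_hs_real 0 hL lam).mul_const (hsr ν c 1 lam L))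
      rw [hW] at this
      exact this
    have hev := hd.eventually_ne one_ne_zero (c := 0)
    have hev2 : ∀ᶠ w in 𝓝[≠] L, w ∈ Ioi z := mem_nhdsWithin_of_mem_nhds (Ioi_mem_nhds hz.2)
    have hle : 𝓝[<] L ≤ 𝓝[≠] L := nhdsWithin_mono L fun x (hx : x < L) => ne_of_lt hx
    obtain ⟨w, ⟨hw, hwz⟩, hwL⟩ :=
      (((hev.and hev2).filter_mono hle).and self_mem_nhdsWithin).exists
    have hwL' : w < L := hwL
    have hwz' : z < w := hwz
    have hL' := (hint L ⟨hL, le_rfl⟩).mono_set (Ioc_subset_Ioc_right hz.2.le)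
    have hw' := (hint w ⟨hz.1.trans hwz, hwL'.le⟩).mono_set (Ioc_subset_Ioc_right hwz'.le)
    set g := hsr ν c 0 lam L * hsr ν c 1 lam w - hsr ν c 0 lam w * hsr ν c 1 lam L with hg
    -- The equation only supplies integrability of the Green kernel times Qy. Using it at the two
    -- upper points L and w and inverting the 2 × 2 system separates the two Frobenius factors.
    have hI : ∀ i, IntegrableOn (fun t => hsr ν c i lam t * Q t * y t) (Ioc 0 z) := by
      intro i
      have := (hL'.const_mul (hsr ν c i lam w / -g)).add (hw'.const_mul (hsr ν c i lam L / g))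
      refine this.congr (Eventually.of_forall fun t => ?_)
      have hg0 : g ≠ 0 := hw
      simp only [Pi.add_apply, hsG]
      change hsr ν c i lam w / -g * ((hsr ν c 0 lam t * hsr ν c 1 lam L -
        hsr ν c 0 lam L * hsr ν c 1 lam t) * Q t * y t) + hsr ν c i lam L / g *
        ((hsr ν c 0 lam t * hsr ν c 1 lam w - hsr ν c 0 lam w * hsr ν c 1 lam t) * Q t * y t) = _
      rw [div_neg, neg_mul, div_mul_eq_mul_div, div_mul_eq_mul_div, neg_add_eq_sub, ← sub_div,
        div_eq_iff hg0, hg]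
      match i with
      | 0 => ring
      | 1 => ring
    have hform : ∀ x ∈ Ioc 0 z, y x = hsr ν c j lam x +
        (hsr ν c 1 lam x * (∫ t in Ioc 0 x, hsr ν c 0 lam t * Q t * y t) -
        hsr ν c 0 lam x * ∫ t in Ioc 0 x, hsr ν c 1 lam t * Q t * y t) := by
      intro x hx
      have hi := fun i => (hI i).mono_set (Ioc_subset_Ioc_right hx.2)
      rw [heq x ⟨hx.1, hx.2.trans hz.2.le⟩, ← integral_const_mul, ← integral_const_mul,
        ← integral_sub ((hi 0).const_mul _) ((hi 1).const_mul _)]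
      congr 2; ext t; simp only [hsG, hsr]; ring
    have hcI : ∀ i, ContinuousOn (fun x => ∫ t in Ioc 0 x, hsr ν c i lam t * Q t * y t)
        (Icc 0 z) := fun i => intervalIntegral.continuousOn_primitive
      ((integrableOn_Icc_iff_integrableOn_Ioc).2 (hI i))
    have hch : ∀ i, ContinuousOn (hsr ν c i lam) (Ioc 0 z) := fun i =>
      (P.continuousOn_hsr i lam).mono fun x hx => hx.1
    have hcont : ContinuousOn y (Ioc 0 z) := by
      refine ContinuousOn.congr ?_ hform
      exact (hch j).add (((hch 1).mul ((hcI 0).mono Ioc_subset_Icc_self)).sub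
        ((hch 0).mul ((hcI 1).mono Ioc_subset_Icc_self)))
    obtain ⟨M0, hM0⟩ := isCompact_Icc.exists_bound_of_continuousOn (hcI 0)
    obtain ⟨M1, hM1⟩ := isCompact_Icc.exists_bound_of_continuousOn (hcI 1)
    have hhb : ∀ i, ∃ M, 0 ≤ M ∧ ∀ x ∈ Ioc 0 z, ‖hsr ν c i lam x‖ ≤ M * x ^ tau ν 0 := by
      intro i
      -- For the zero potential the solution is the Frobenius solution itself, so the bound already
      -- proved for solutions can be reused.
      have hzero : HalfPot ν.re (fun _ => 0) := ⟨aestronglyMeasurable_const, by simp⟩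
      obtain ⟨M, hM, h⟩ := P.norm_halfSol_le_rpow hzero i lam hz.1
      refine ⟨M, hM, fun x hx => ?_⟩
      have h1 := h x hx
      rw [P.halfSol_eq hzero i lam hx.1] at h1
      simpa [volterraOp] using h1
    obtain ⟨A0, hA0, h0⟩ := hhb 0
    obtain ⟨A1, hA1, h1⟩ := hhb 1
    obtain ⟨Aj, hAj, hj⟩ := hhb j
    have hb : ∀ x ∈ Ioc 0 z, ‖y x‖ ≤ (Aj + A1 * |M0| + A0 * |M1|) * x ^ tau ν 0 := by
      intro x hx
      have hx' := Ioc_subset_Icc_self hx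
      rw [hform x hx]
      refine (norm_add_le _ _).trans ((add_le_add le_rfl (norm_sub_le _ _)).trans ?_)
      rw [norm_mul, norm_mul]
      have := Real.rpow_pos_of_pos hx.1 (tau ν 0)
      calc _ ≤ Aj * x ^ tau ν 0 + (A1 * x ^ tau ν 0 * |M0| + A0 * x ^ tau ν 0 * |M1|) := by
            gcongr
            · exact hj x hx
            · exact h1 x hx
            · exact (hM0 x hx').trans (le_abs_self _)
            · exact h0 x hx
            · exact (hM1 x hx').trans (le_abs_self _)
        _ = _ := by ring
    obtain ⟨M, hM, hbS⟩ := P.norm_halfSol_le_rpow hQ j lam hz.1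
    have hIS := fun i => P.integrableOn_hsr_mul_halfSol hQ i j lam hz.1
    refine sub_eq_zero.1 (P.eq_zero_of_eq_volterraOp hQ (L := z) hz.1 lam
      (d := fun x => y x - halfSol ν c Q j lam x) (M := (Aj + A1 * |M0| + A0 * |M1|) + M)
      (fun x hx => ?_) (fun x hx => ?_) ⟨hz.1, le_rfl⟩)
    · rw [add_mul]
      exact (norm_sub_le _ _).trans (add_le_add (hb x hx) (hbS x hx))
    · have hi := fun i => (hI i).mono_set (Ioc_subset_Ioc_right hx.2)
      have hi' := fun i => (hIS i).mono_set (Ioc_subset_Ioc_right hx.2)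
      rw [heq x ⟨hx.1, hx.2.trans hz.2.le⟩, P.halfSol_eq hQ j lam hx.1, add_sub_add_left_eq_sub]
      unfold volterraOp
      rw [← integral_sub]
      · congr 1; ext t; simp only [hsG, hsr]; ring
      · refine (((hi 0).const_mul (hsr ν c 1 lam x)).sub
          ((hi 1).const_mul (hsr ν c 0 lam x))).congr (Eventually.of_forall fun t => ?_)
        simp only [hsG, hsr, Pi.sub_apply]; ring
      · refine (((hi' 0).const_mul (hsr ν c 1 lam x)).sub
          ((hi' 1).const_mul (hsr ν c 0 lam x))).congr (Eventually.of_forall fun t => ?_)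
        simp only [hsr, Pi.sub_apply]; ring
  -- The separation above needs z < L. At z = L the equation itself gives the value, since its
  -- integral ignores the end point.
  rcases lt_or_eq_of_le hz.2 with h | h
  · exact hlt z ⟨hz.1, h⟩
  · rw [heq z hz, P.halfSol_eq hQ j lam hz.1]
    congr 1
    unfold volterraOp
    rw [integral_Ioc_eq_integral_Ioo, integral_Ioc_eq_integral_Ioo]
    refine setIntegral_congr_fun measurableSet_Ioo fun t ht => ?_
    rw [hlt t ⟨ht.1, ht.2.trans_le hz.2⟩]
    rfl

end Params

end HalfLine

/-! ### Solutions with Cauchy data at the regular end -/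

section Left

variable {ν : ℂ} {c : Fin 2 → ℂ} {Q : ℝ → ℂ} {D K a : ℝ}

lemma GrowthBound.norm_hsr_le (G : GrowthBound ν c D K) (hσ : 0 < ν.re) (j : Fin 2) {lam : ℂ}
    {s : ℝ} (hs : √‖lam‖ ≤ s) {z : ℝ} (hz : z ∈ Ioc 0 a) :
    ‖hsr ν c j lam z‖ ≤ K * (1 + a ^ (2 * ν.re)) * Real.exp (D * s * a) * z ^ tau ν 0 := by
  have hK := G.K_pos
  have hD := G.one_le
  have hz0 := hz.1
  have hza := hz.2
  have ha : 0 < a := hz0.trans_le hza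
  have h0 := Real.rpow_pos_of_pos hz.1 (tau ν 0)
  have ha2 : 0 < a ^ (2 * ν.re) := Real.rpow_pos_of_pos ha _
  have hj : z ^ tau ν j ≤ (1 + a ^ (2 * ν.re)) * z ^ tau ν 0 := by
    match j with
    | 0 => nlinarith
    | 1 =>
      have e2 : z ^ tau ν 1 = z ^ tau ν 0 * z ^ (2 * ν.re) := by
        rw [← Real.rpow_add hz.1, ← (two_tau ν).2.2]; ring_nf
      have := Real.rpow_le_rpow hz.1.le hz.2 (show 0 ≤ 2 * ν.re by linarith)
      rw [e2]; nlinarith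
  have hs0 : 0 ≤ s := (Real.sqrt_nonneg _).trans hs
  calc _ ≤ _ := G.bound j z hz0 lam
    _ ≤ K * ((1 + a ^ (2 * ν.re)) * z ^ tau ν 0) * Real.exp (D * s * a) := by gcongr
    _ = _ := by ring

lemma rpow_le_leftN (hD : 1 ≤ D) {s : ℝ} (hs : 0 ≤ s) {z : ℝ} (hz : z ∈ Ioc 0 a) :
    z ^ tau ν 0 ≤ leftN ν D a s z := by
  have h0 := Real.rpow_pos_of_pos hz.1 (tau ν 0)
  have : 1 ≤ Real.exp (D * s * (a - z)) :=
    Real.one_le_exp (mul_nonneg (by positivity) (by linarith [hz.2]))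
  unfold leftN
  nlinarith

/-- The coefficient of `hsr 1` of the free solution with data `p`, `p'` at `a`. -/
noncomputable def leftU (ν : ℂ) (c : Fin 2 → ℂ) (a : ℝ) (p p' lam : ℂ) : ℂ :=
  hs ν c 0 a lam * p' - hsD ν c 0 a lam * p

/-- The coefficient of `hsr 0` of the free solution with data `p`, `p'` at `a`. -/
noncomputable def leftV (ν : ℂ) (c : Fin 2 → ℂ) (a : ℝ) (p p' lam : ℂ) : ℂ :=
  hsD ν c 1 a lam * p - hs ν c 1 a lam * p'

/-- The free solution with data `p`, `p'` at `a`. -/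
noncomputable def leftF (ν : ℂ) (c : Fin 2 → ℂ) (a : ℝ) (p p' lam : ℂ) (z : ℝ) : ℂ :=
  leftU ν c a p p' lam * hsr ν c 1 lam z + leftV ν c a p p' lam * hsr ν c 0 lam z

/-- The solution on `(0, a]` with data `p`, `p'` at `a`. -/
noncomputable def leftSol (ν : ℂ) (c : Fin 2 → ℂ) (Q : ℝ → ℂ) (a : ℝ) (p p' lam : ℂ) : ℝ → ℂ :=
  volterraSol (fun z => Icc z a) (hsr ν c 1 lam) (hsr ν c 0 lam) Q (leftF ν c a p p' lam)

namespace Params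

variable (P : Params ν c)
include P

lemma halfOrder_leftUV (ha : 0 < a) (p p' : ℂ) :
    HalfOrder (leftU ν c a p p') ∧ HalfOrder (leftV ν c a p p') :=
  ⟨((P.halfOrder_hs 0 ha).mul (HalfOrder.const p')).sub
    ((P.halfOrder_hsD 0 ha).mul (HalfOrder.const p)),
   ((P.halfOrder_hsD 1 ha).mul (HalfOrder.const p)).sub
    ((P.halfOrder_hs 1 ha).mul (HalfOrder.const p'))⟩

lemma differentiable_leftF (a : ℝ) (p p' : ℂ) (z : ℝ) :
    Differentiable ℂ (fun lam => leftF ν c a p p' lam z) := by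
  have h0 := P.differentiable_hs_lam 0 a
  have h1 := P.differentiable_hs_lam 1 a
  have d0 := P.differentiable_hsD_lam 0 a
  have d1 := P.differentiable_hsD_lam 1 a
  have z0 := P.differentiable_hs_lam 0 z
  have z1 := P.differentiable_hs_lam 1 z
  unfold leftF leftU leftV hsr
  fun_prop

lemma continuousOn_leftF (p p' lam : ℂ) : ContinuousOn (leftF ν c a p p' lam) (Ioc 0 a) := by
  have h0 := (P.continuousOn_hsr 0 lam).mono (fun x (hx : x ∈ Ioc 0 a) => hx.1)
  have h1 := (P.continuousOn_hsr 1 lam).mono (fun x (hx : x ∈ Ioc 0 a) => hx.1)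
  unfold leftF
  fun_prop

lemma norm_leftF_le (ha : 0 < a) (G : GrowthBound ν c D K) (p p' : ℂ) :
    ∃ A B : ℝ, 0 ≤ A ∧ 0 ≤ B ∧ ∀ lam : ℂ, ∀ s : ℝ, √‖lam‖ ≤ s → ∀ z ∈ Ioc 0 a,
      ‖leftF ν c a p p' lam z‖ ≤ A * Real.exp (B * s) * z ^ tau ν 0 := by
  obtain ⟨⟨A1, B1, hA1, hB1, h1⟩, A0, B0, hA0, hB0, h0⟩ := P.halfOrder_leftUV ha p p'
  have hK := G.K_pos
  have hD := G.one_le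
  have ha2 : 0 < a ^ (2 * ν.re) := Real.rpow_pos_of_pos ha _
  refine ⟨(A1 + A0) * (K * (1 + a ^ (2 * ν.re))), max B1 B0 + D * a, by positivity, by positivity,
    fun lam s hs z hz => ?_⟩
  have hz0 := Real.rpow_pos_of_pos hz.1 (tau ν 0)
  have hs0 : 0 ≤ s := (Real.sqrt_nonneg _).trans hs
  have e1 : ‖leftU ν c a p p' lam‖ ≤ A1 * Real.exp (max B1 B0 * s) := (h1 lam).trans (by
    gcongr; exact le_max_left _ _)
  have e0 : ‖leftV ν c a p p' lam‖ ≤ A0 * Real.exp (max B1 B0 * s) := (h0 lam).trans (by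
    gcongr; exact le_max_right _ _)
  unfold leftF
  refine (norm_add_le _ _).trans ?_
  rw [norm_mul, norm_mul]
  calc _ ≤ A1 * Real.exp (max B1 B0 * s) * (K * (1 + a ^ (2 * ν.re)) * Real.exp (D * s * a) *
        z ^ tau ν 0) + A0 * Real.exp (max B1 B0 * s) * (K * (1 + a ^ (2 * ν.re)) *
        Real.exp (D * s * a) * z ^ tau ν 0) := by
        gcongr
        · exact G.norm_hsr_le P.re_pos 1 hs hz
        · exact G.norm_hsr_le P.re_pos 0 hs hz
    _ = _ := by rw [add_mul _ _ s, Real.exp_add]; ring_nf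

variable (hQ : HalfPot ν.re Q)
include hQ

lemma leftSol_spec (ha : 0 < a) (G : GrowthBound ν c D K) (p p' : ℂ) :
    ∃ A B : ℝ, 0 ≤ A ∧ 0 ≤ B ∧ ∀ lam : ℂ,
      (∀ z ∈ Ioc 0 a, ‖leftSol ν c Q a p p' lam z‖ ≤
        A * Real.exp (B * √‖lam‖) * leftN ν D a √‖lam‖ z) ∧
      ContinuousOn (leftSol ν c Q a p p' lam) (Ioc 0 a) ∧
      ∀ z ∈ Ioc 0 a, leftSol ν c Q a p p' lam z = leftF ν c a p p' lam z +
        volterraOp (fun z => Icc z a) (hsr ν c 1 lam) (hsr ν c 0 lam) Q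
          (leftSol ν c Q a p p' lam) z := by
  obtain ⟨A, B, hA, hB, h⟩ := P.norm_leftF_le ha G p p'
  refine ⟨2 * A * Real.exp (2 * ∫ t in Ioc 0 a, K * a * ‖Q t‖), B, by positivity, hB,
    fun lam => ?_⟩
  have V := P.volterraBound_left hQ G (a := a) (le_refl √‖lam‖)
  have hf : ∀ z ∈ Ioc 0 a, ‖leftF ν c a p p' lam z‖ ≤
      A * Real.exp (B * √‖lam‖) * leftN ν D a √‖lam‖ z := fun z hz =>
    (h lam _ le_rfl z hz).trans (by
      gcongr
      exact rpow_le_leftN G.one_le (Real.sqrt_nonneg _) hz)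
  have hc := P.continuousOn_leftF (a := a) p p' lam
  refine ⟨fun z hz => (V.norm_sol_le (by positivity) hc hf hz).trans (le_of_eq (by ring)),
    V.continuousOn_sol (by positivity) hc hf, fun z hz => V.sol_eq (by positivity) hc hf hz⟩

lemma halfOrder_leftSol (p p' : ℂ) {z : ℝ} (hz : z ∈ Ioc 0 a) :
    HalfOrder (fun lam => leftSol ν c Q a p p' lam z) := by
  obtain ⟨D, K, G⟩ := P.exists_growthBound
  have ha := hz.1.trans_le hz.2
  have hD := G.one_le
  obtain ⟨A, B, hA, hB, h⟩ := P.leftSol_spec hQ ha G p p'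
  have hz0 := Real.rpow_pos_of_pos hz.1 (tau ν 0)
  have haz : 0 ≤ a - z := by linarith [hz.2]
  refine ⟨A * z ^ tau ν 0, B + D * (a - z), by positivity, by positivity, fun l => ?_⟩
  refine ((h l).1 z hz).trans (le_of_eq ?_)
  rw [leftN, add_mul, Real.exp_add]
  ring_nf

lemma differentiable_leftSol (p p' : ℂ) {z : ℝ} (hz : z ∈ Ioc 0 a) :
    Differentiable ℂ (fun lam => leftSol ν c Q a p p' lam z) := by
  obtain ⟨D, K, G⟩ := P.exists_growthBound
  have ha := hz.1.trans_le hz.2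
  obtain ⟨A, B, hA, hB, h⟩ := P.norm_leftF_le ha G p p'
  intro l
  have hU : Metric.ball (0 : ℂ) (‖l‖ + 1) ∈ 𝓝 l := by
    refine Metric.isOpen_ball.mem_nhds ?_
    rw [mem_ball_zero_iff]; linarith
  have hs : ∀ m ∈ Metric.ball (0 : ℂ) (‖l‖ + 1), √‖m‖ ≤ √(‖l‖ + 1) := fun m hm =>
    Real.sqrt_le_sqrt (mem_ball_zero_iff.1 hm).le
  exact (differentiableOn_volterraSol (f := fun m => leftF ν c a p p' m) Metric.isOpen_ball
    (fun m hm => P.volterraBound_left hQ G (hs m hm))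
    (K := A * Real.exp (B * √(‖l‖ + 1))) (by positivity)
    (fun m _ => P.continuousOn_leftF p p' m) (fun m hm w hw => (h m _ (hs m hm) w hw).trans (by
      gcongr
      exact rpow_le_leftN G.one_le (Real.sqrt_nonneg _) hw))
    (fun t _ => (P.differentiable_hs_lam 1 t).differentiableOn)
    (fun t _ => (P.differentiable_hs_lam 0 t).differentiableOn)
    (fun t _ => (P.differentiable_leftF a p p' t).differentiableOn) hz).differentiableAt hU

lemma exists_norm_leftSol_le (ha : 0 < a) (p p' lam : ℂ) :
    ∃ M, 0 ≤ M ∧ ∀ z ∈ Ioc 0 a, ‖leftSol ν c Q a p p' lam z‖ ≤ M * z ^ tau ν 0 := by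
  obtain ⟨D, K, G⟩ := P.exists_growthBound
  obtain ⟨A, B, hA, hB, h⟩ := P.leftSol_spec hQ ha G p p'
  have hD := G.one_le
  refine ⟨A * Real.exp (B * √‖lam‖) * Real.exp (D * √‖lam‖ * a), by positivity, fun z hz => ?_⟩
  refine ((h lam).1 z hz).trans ?_
  have hz0 := Real.rpow_pos_of_pos hz.1 (tau ν 0)
  have hz1 := hz.1
  unfold leftN
  calc _ ≤ A * Real.exp (B * √‖lam‖) * (z ^ tau ν 0 * Real.exp (D * √‖lam‖ * a)) := by
        gcongr; linarith
    _ = _ := by ring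

lemma continuousOn_leftSol (ha : 0 < a) (p p' lam : ℂ) :
    ContinuousOn (leftSol ν c Q a p p' lam) (Ioc 0 a) := by
  obtain ⟨D, K, G⟩ := P.exists_growthBound
  obtain ⟨A, B, hA, hB, h⟩ := P.leftSol_spec hQ ha G p p'
  exact (h lam).2.1

lemma leftSol_eq (p p' lam : ℂ) {z : ℝ} (hz : z ∈ Ioc 0 a) :
    leftSol ν c Q a p p' lam z = leftF ν c a p p' lam z +
        volterraOp (fun z => Icc z a) (hsr ν c 1 lam) (hsr ν c 0 lam) Q
          (leftSol ν c Q a p p' lam) z := by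
  obtain ⟨D, K, G⟩ := P.exists_growthBound
  obtain ⟨A, B, hA, hB, h⟩ := P.leftSol_spec hQ (hz.1.trans_le hz.2) G p p'
  exact (h lam).2.2 z hz

lemma leftOp_eq {y : ℝ → ℂ} {M : ℝ} (lam : ℂ) (hc : ContinuousOn y (Ioc 0 a))
    (hb : ∀ z ∈ Ioc 0 a, ‖y z‖ ≤ M * z ^ tau ν 0) {z : ℝ} (hz : z ∈ Ioc 0 a) :
    volterraOp (fun z => Icc z a) (hsr ν c 1 lam) (hsr ν c 0 lam) Q y z =
      hsr ν c 0 lam z * (∫ t in z..a, hsr ν c 1 lam t * Q t * y t) -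
      hsr ν c 1 lam z * ∫ t in z..a, hsr ν c 0 lam t * Q t * y t := by
  obtain ⟨D, K, G⟩ := P.exists_growthBound
  have ha := hz.1.trans_le hz.2
  have hI := P.integrableOn_hsr_mul hQ ha lam hc hb
  rw [(P.volterraBound_left hQ G (a := a) (le_refl √‖lam‖)).volterraOp_eq (hI 1) (hI 0) hz,
    integral_Icc_eq_integral_Ioc, integral_Icc_eq_integral_Ioc,
    intervalIntegral.integral_of_le hz.2, intervalIntegral.integral_of_le hz.2]

lemma localSol_leftSol (ha : 0 < a) (p p' lam : ℂ) :
    LocalSol ν c Q lam a (leftSol ν c Q a p p' lam)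
      (fun z => leftU ν c a p p' lam -
        ∫ t in z..a, hsr ν c 0 lam t * Q t * leftSol ν c Q a p p' lam t)
      (fun z => leftV ν c a p p' lam +
        ∫ t in z..a, hsr ν c 1 lam t * Q t * leftSol ν c Q a p p' lam t) := by
  obtain ⟨M, -, hM⟩ := P.exists_norm_leftSol_le hQ ha p p' lam
  have hc := P.continuousOn_leftSol hQ ha p p' lam
  have hI := P.integrableOn_hsr_mul hQ ha lam hc hM
  have hii : ∀ i, ∀ z ∈ Ioo 0 a, IntervalIntegrable
      (fun t => hsr ν c i lam t * Q t * leftSol ν c Q a p p' lam t) volume z a := fun i z hz =>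
    (intervalIntegrable_iff_integrableOn_Ioc_of_le hz.2.le).2
      ((hI i).mono_set (Ioc_subset_Ioc_left hz.1.le))
  refine ⟨hc.mono Ioo_subset_Ioc_self, fun z hz => ?_, fun x hx z hz => ?_, fun x hx z hz => ?_⟩
  · rw [P.leftSol_eq hQ p p' lam (Ioo_subset_Ioc_self hz),
      P.leftOp_eq hQ lam hc hM (Ioo_subset_Ioc_self hz), leftF]
    ring
  · rw [sub_sub_sub_cancel_left,
      intervalIntegral.integral_interval_sub_interval_comm (hii 0 x hx) (hii 0 z hz)
        ((hii 0 x hx).trans (hii 0 z hz).symm), intervalIntegral.integral_same, sub_zero]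
  · rw [add_sub_add_left_eq_sub,
      intervalIntegral.integral_interval_sub_interval_comm (hii 1 z hz) (hii 1 x hx)
        ((hii 1 z hz).trans (hii 1 x hx).symm), intervalIntegral.integral_same, sub_zero,
      intervalIntegral.integral_symm]

/-- The Wronskian is constant and is evaluated as z → a from the left, where the integrals vanish
and the free solutions have the data (1, 0) and (0, 1). -/
lemma wronskian_leftSol (lam : ℂ) {z : ℝ} (hz : z ∈ Ioo 0 a) :
    (leftV ν c a 1 0 lam + ∫ t in z..a, hsr ν c 1 lam t * Q t * leftSol ν c Q a 1 0 lam t) *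
      (leftU ν c a 0 1 lam - ∫ t in z..a, hsr ν c 0 lam t * Q t * leftSol ν c Q a 0 1 lam t) -
    (leftU ν c a 1 0 lam - ∫ t in z..a, hsr ν c 0 lam t * Q t * leftSol ν c Q a 1 0 lam t) *
      (leftV ν c a 0 1 lam + ∫ t in z..a, hsr ν c 1 lam t * Q t * leftSol ν c Q a 0 1 lam t) =
    1 := by
  have ha := hz.1.trans hz.2
  have hlim : ∀ i : Fin 2, ∀ p p', Tendsto (fun x => ∫ t in x..a,
      hsr ν c i lam t * Q t * leftSol ν c Q a p p' lam t) (𝓝[<] a) (𝓝 0) := by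
    intro i p p'
    obtain ⟨M, -, hM⟩ := P.exists_norm_leftSol_le hQ ha p p' lam
    have hI := P.integrableOn_hsr_mul hQ ha lam (P.continuousOn_leftSol hQ ha p p' lam) hM i
    have h1 := intervalIntegral.continuousOn_primitive_interval' (a := a)
      ((intervalIntegrable_iff_integrableOn_Ioc_of_le hz.2.le).2
      (hI.mono_set (Ioc_subset_Ioc_left hz.1.le))) right_mem_uIcc
    have h2 := (h1 a right_mem_uIcc).tendsto.neg
    simp only [intervalIntegral.integral_same, neg_zero] at h2
    simp_rw [← intervalIntegral.integral_symm] at h2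
    refine h2.mono_left ?_
    rw [← nhdsWithin_Ioo_eq_nhdsLT hz.2, uIcc_of_le hz.2.le]
    exact nhdsWithin_mono _ Ioo_subset_Icc_self
  have hconst : ∀ x ∈ Ioo 0 a, _ := fun x hx =>
    (P.localSol_leftSol hQ ha 1 0 lam).wronskian_const P hQ.integrableOn
      (P.localSol_leftSol hQ ha 0 1 lam) hx hz
  have hev : ∀ᶠ x in 𝓝[<] a, x ∈ Ioo 0 a := Ioo_mem_nhdsLT ha
  have hl := ((hlim 1 1 0).const_add (leftV ν c a 1 0 lam)).mul
    ((hlim 0 0 1).const_sub (leftU ν c a 0 1 lam)) |>.sub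
    (((hlim 0 1 0).const_sub (leftU ν c a 1 0 lam)).mul
    ((hlim 1 0 1).const_add (leftV ν c a 0 1 lam)))
  have hW := P.hs_wronskian (Complex.ofReal_ne_zero.2 ha.ne') lam
  refine tendsto_nhds_unique (tendsto_const_nhds.congr' ?_) (hl.trans (le_of_eq ?_))
  · filter_upwards [hev] with x hx
    exact (hconst x hx).symm
  · congr 1
    simp only [leftU, leftV]
    linear_combination hW

/-- A solution which is regular at the singular point is determined by its data at `a`. -/
lemma eq_leftSol {lam : ℂ} {y u v : ℝ → ℂ} {L : ℝ} (ha : 0 < a) (haL : a < L)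
    (H : LocalSol ν c Q lam L y u v) {M : ℝ} (hM : ∀ z ∈ Ioc 0 a, ‖y z‖ ≤ M * z ^ tau ν 0)
    {z : ℝ} (hz : z ∈ Ioc 0 a) :
    y z = y a * leftSol ν c Q a 1 0 lam z + solD ν c lam u v a * leftSol ν c Q a 0 1 lam z := by
  have hsub : ∀ x ∈ Ioc 0 a, x ∈ Ioo 0 L := fun x hx => ⟨hx.1, hx.2.trans_lt haL⟩
  have haa : a ∈ Ioo 0 L := ⟨ha, haL⟩
  obtain ⟨D, K, G⟩ := P.exists_growthBound
  have B := P.volterraBound_left hQ G (a := a) (le_refl √‖lam‖)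
  obtain ⟨M1, hM1, h1⟩ := P.exists_norm_leftSol_le hQ ha 1 0 lam
  obtain ⟨M2, hM2, h2⟩ := P.exists_norm_leftSol_le hQ ha 0 1 lam
  have c1 := P.continuousOn_leftSol hQ ha 1 0 lam
  have c2 := P.continuousOn_leftSol hQ ha 0 1 lam
  have hc : ContinuousOn y (Ioc 0 a) := H.cont.mono hsub
  -- The difference has zero data at a, so its Volterra equation from a has no free term; the bound
  -- O(z ^ τ₀) places it in the uniqueness class.
  set d : ℝ → ℂ := fun x => y x - (y a * leftSol ν c Q a 1 0 lam x +
    solD ν c lam u v a * leftSol ν c Q a 0 1 lam x) with hd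
  have hM0 : 0 ≤ M := by
    have := (norm_nonneg _).trans (hM a ⟨ha, le_rfl⟩)
    exact nonneg_of_mul_nonneg_left this (Real.rpow_pos_of_pos ha _)
  have hdb : ∀ x ∈ Ioc 0 a, ‖d x‖ ≤
      (M + (‖y a‖ * M1 + ‖solD ν c lam u v a‖ * M2)) * x ^ tau ν 0 := by
    intro x hx
    refine (norm_sub_le _ _).trans ((add_le_add le_rfl (norm_add_le _ _)).trans ?_)
    rw [norm_mul, norm_mul]
    calc _ ≤ M * x ^ tau ν 0 + (‖y a‖ * (M1 * x ^ tau ν 0) +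
          ‖solD ν c lam u v a‖ * (M2 * x ^ tau ν 0)) := by
          gcongr
          · exact hM x hx
          · exact h1 x hx
          · exact h2 x hx
      _ = _ := by ring
  have hdc : ContinuousOn d (Ioc 0 a) :=
    hc.sub ((c1.const_smul (y a)).add (c2.const_smul (solD ν c lam u v a)))
  refine sub_eq_zero.1 (B.eq_zero_of_eq_op (d := d)
    (K := M + (‖y a‖ * M1 + ‖solD ν c lam u v a‖ * M2)) (fun x hx => (hdb x hx).trans ?_)
    (fun x hx => ?_) hz)
  · gcongr
    exact rpow_le_leftN G.one_le (Real.sqrt_nonneg _) hx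
  · have i0 := H.ii P hQ.integrableOn 0 (hsub x hx) haa
    have i1 := H.ii P hQ.integrableOn 1 (hsub x hx) haa
    have il : ∀ i : Fin 2, ∀ f : ℝ → ℂ, ∀ M', ContinuousOn f (Ioc 0 a) →
        (∀ z ∈ Ioc 0 a, ‖f z‖ ≤ M' * z ^ tau ν 0) →
        IntervalIntegrable (fun t => hsr ν c i lam t * Q t * f t) volume x a :=
      fun i f M' hf hb => (intervalIntegrable_iff_integrableOn_Ioc_of_le hx.2).2
        ((P.integrableOn_hsr_mul hQ ha lam hf hb i).mono_set (Ioc_subset_Ioc_left hx.1.le))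
    have hint : ∀ i : Fin 2, ∫ t in x..a, hsr ν c i lam t * Q t * d t =
        (∫ t in x..a, hsr ν c i lam t * Q t * y t) -
        (y a * (∫ t in x..a, hsr ν c i lam t * Q t * leftSol ν c Q a 1 0 lam t) +
        solD ν c lam u v a * ∫ t in x..a, hsr ν c i lam t * Q t * leftSol ν c Q a 0 1 lam t) := by
      intro i
      rw [← intervalIntegral.integral_const_mul, ← intervalIntegral.integral_const_mul,
        ← intervalIntegral.integral_add ((il i _ _ c1 h1).const_mul _)
          ((il i _ _ c2 h2).const_mul _),
        ← intervalIntegral.integral_sub (il i _ _ hc hM) (((il i _ _ c1 h1).const_mul _).add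
          ((il i _ _ c2 h2).const_mul _))]
      congr 1; ext t; simp only [hd]; ring
    rw [P.leftOp_eq hQ lam hdc hdb hx, hint 0, hint 1]
    have e0 := H.u_sub x (hsub x hx) a haa
    have e1 := H.v_sub x (hsub x hx) a haa
    obtain ⟨eu, ev⟩ := H.coeff_eq P haa
    have ey := H.eq x (hsub x hx)
    have f1 := P.leftSol_eq hQ 1 0 lam hx
    have f2 := P.leftSol_eq hQ 0 1 lam hx
    rw [P.leftOp_eq hQ lam c1 h1 hx] at f1
    rw [P.leftOp_eq hQ lam c2 h2 hx] at f2
    simp only [leftF, leftU, leftV] at f1 f2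
    simp only [hsr] at e0 e1 eu ev ey f1 f2 ⊢
    simp only [hd]
    linear_combination ey - (hs ν c 1 x lam) * e0 - (hs ν c 0 x lam) * e1 +
      (hs ν c 1 x lam) * eu + (hs ν c 0 x lam) * ev - y a * f1 - solD ν c lam u v a * f2

end Params

end Left

/-! ### Weights and kernel bounds on a ray -/

/-- The spectral parameter `(r ω)²` on the ray through `ω`. -/
noncomputable def rayLam (ω : ℂ) (r : ℝ) : ℂ := ((r : ℂ) * ω) ^ 2

/-- The decaying weight on a ray. -/
noncomputable def decayN (ν ω : ℂ) (r z : ℝ) : ℝ :=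
  min 1 (r * z) ^ tau ν 0 * Real.exp (-(ω.im * (r * z)))

/-- The growing weights on a ray. -/
noncomputable def expN (ν ω : ℂ) (j : Fin 2) (r z : ℝ) : ℝ :=
  min 1 (r * z) ^ tau ν j * Real.exp (ω.im * (r * z))

/-- The free Jost solution on a ray. -/
noncomputable def freeJost (ν : ℂ) (c : Fin 2 → ℂ) (ω : ℂ) (b : Fin 2 → ℂ) (r z : ℝ) : ℂ :=
  b 0 * hs ν c 0 ((r * z : ℝ) : ℂ) (ω ^ 2) + b 1 * hs ν c 1 ((r * z : ℝ) : ℂ) (ω ^ 2)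

section Ray

variable {ν ω : ℂ} {c b : Fin 2 → ℂ} {d : ℂ} {C : ℝ} {Q : ℝ → ℂ} {r : ℝ}

lemma hs_scale (j : Fin 2) (hr : 0 < r) {z : ℝ} (hz : 0 < z) :
    hs ν c j ((r * z : ℝ) : ℂ) (ω ^ 2) = (r : ℂ) ^ expo ν j * hsr ν c j (rayLam ω r) z := by
  have hr0 : (r : ℂ) ≠ 0 := Complex.ofReal_ne_zero.2 hr.ne'
  rw [hs, hsr, hs, Complex.ofReal_mul, cpow_mul_pos hr0 hz, rayLam, mul_assoc]
  congr 3
  ring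

lemma norm_cpow_expo (j : Fin 2) (hr : 0 < r) : ‖(r : ℂ) ^ expo ν j‖ = r ^ tau ν j :=
  Complex.norm_cpow_eq_rpow_re_of_pos hr _

lemma hsr_eq_scale (j : Fin 2) (hr : 0 < r) {z : ℝ} (hz : 0 < z) :
    hsr ν c j (rayLam ω r) z = hs ν c j ((r * z : ℝ) : ℂ) (ω ^ 2) / (r : ℂ) ^ expo ν j := by
  have hr0 : (r : ℂ) ≠ 0 := Complex.ofReal_ne_zero.2 hr.ne'
  rw [hs_scale j hr hz, mul_div_cancel_left₀ _ (by simp [Complex.cpow_eq_zero_iff, hr0])]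

lemma freeJost_eq (hr : 0 < r) {z : ℝ} (hz : 0 < z) :
    freeJost ν c ω b r z = b 0 * (r : ℂ) ^ expo ν 0 * hsr ν c 0 (rayLam ω r) z +
      b 1 * (r : ℂ) ^ expo ν 1 * hsr ν c 1 (rayLam ω r) z := by
  rw [freeJost, hs_scale 0 hr hz, hs_scale 1 hr hz]; ring

lemma min_one_pos {x : ℝ} (hx : 0 < x) : 0 < min 1 x := lt_min one_pos hx

/-- The bound is uniform in r ≥ 1: the exponent can be lowered to min(0, 1 - 2σ) ≤ 0, and then r to
that exponent is at most 1. -/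
lemma min_rpow_le_potWeight {σ : ℝ} (hr : 1 ≤ r) {z : ℝ} (hz : 0 < z) {e : ℝ}
    (he : 1 - 2 * σ ≤ e) : min 1 (r * z) ^ e ≤ potWeight σ z := by
  have hrz : 0 < r * z := by positivity
  have hm := min_one_pos hrz
  have h1 : min 1 (r * z) ^ e ≤ min 1 (r * z) ^ min 0 (1 - 2 * σ) :=
    Real.rpow_le_rpow_of_exponent_ge hm (min_le_left _ _) ((min_le_right _ _).trans he)
  refine h1.trans ?_
  have hz' := Real.rpow_pos_of_pos hz (min 0 (1 - 2 * σ))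
  unfold potWeight
  rcases le_total 1 (r * z) with h | h
  · rw [min_eq_left h, Real.one_rpow]; linarith
  · rw [min_eq_right h, Real.mul_rpow (by linarith) hz.le]
    have : r ^ min 0 (1 - 2 * σ) ≤ 1 := Real.rpow_le_one_of_one_le_of_nonpos hr (min_le_left _ _)
    nlinarith

lemma decayN_pos (hr : 0 < r) {z : ℝ} (hz : 0 < z) : 0 < decayN ν ω r z :=
  mul_pos (Real.rpow_pos_of_pos (min_one_pos (by positivity)) _) (Real.exp_pos _)

lemma expN_pos (j : Fin 2) (hr : 0 < r) {z : ℝ} (hz : 0 < z) : 0 < expN ν ω j r z :=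
  mul_pos (Real.rpow_pos_of_pos (min_one_pos (by positivity)) _) (Real.exp_pos _)

lemma continuousOn_min_rpow (hr : 0 < r) (e : ℝ) :
    ContinuousOn (fun z : ℝ => min 1 (r * z) ^ e) (Ioi 0) := by
  refine ContinuousOn.rpow_const (by fun_prop) fun z hz => Or.inl ?_
  exact (min_one_pos (mul_pos hr hz)).ne'

lemma continuousOn_decayN (hr : 0 < r) : ContinuousOn (decayN ν ω r) (Ioi 0) :=
  (continuousOn_min_rpow hr _).mul (by fun_prop)

lemma continuousOn_expN (j : Fin 2) (hr : 0 < r) : ContinuousOn (expN ν ω j r) (Ioi 0) :=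
  (continuousOn_min_rpow hr _).mul (by fun_prop)

lemma expN_mul_decayN (j : Fin 2) (hr : 0 < r) {z : ℝ} (hz : 0 < z) :
    expN ν ω j r z * decayN ν ω r z = min 1 (r * z) ^ (tau ν j + tau ν 0) := by
  have hrz : 0 < r * z := by positivity
  rw [expN, decayN, Real.rpow_add (min_one_pos hrz), mul_mul_mul_comm, ← Real.exp_add,
    add_neg_cancel, Real.exp_zero, mul_one]

lemma tau_add_bounds (hσ : 0 < ν.re) (i j : Fin 2) : 1 - 2 * ν.re ≤ tau ν i + tau ν j := by
  have h0 := tau_zero ν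
  have h1 := tau_one ν
  fin_cases i <;> fin_cases j <;> simp only [Fin.zero_eta, Fin.mk_one] <;> linarith

/-- The total mass of the potential. -/
noncomputable def potMass (σ : ℝ) (Q : ℝ → ℂ) : ℝ := ∫ t in Ioi 0, potWeight σ t * ‖Q t‖

lemma potWeight_mul_nonneg (σ : ℝ) (Q : ℝ → ℂ) {t : ℝ} (ht : 0 < t) :
    0 ≤ potWeight σ t * ‖Q t‖ :=
  mul_nonneg (zero_le_one.trans (one_le_potWeight σ ht)) (norm_nonneg _)

lemma potMass_nonneg (σ : ℝ) (Q : ℝ → ℂ) : 0 ≤ potMass σ Q :=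
  setIntegral_nonneg measurableSet_Ioi fun _ ht => potWeight_mul_nonneg σ Q ht

lemma HalfPot.setIntegral_le_potMass {σ : ℝ} (hQ : HalfPot σ Q) {X : Set ℝ} (hX : X ⊆ Ioi 0) :
    ∫ t in X, potWeight σ t * ‖Q t‖ ≤ potMass σ Q :=
  setIntegral_mono_set hQ.int ((ae_restrict_iff' measurableSet_Ioi).2
    (Eventually.of_forall fun _ ht => potWeight_mul_nonneg σ Q ht)) hX.eventuallyLE

namespace RayModel

variable (R : RayModel ν c ω b d C)
include R

lemma norm_hsr_le (j : Fin 2) (hr : 0 < r) {z : ℝ} (hz : 0 < z) :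
    ‖hsr ν c j (rayLam ω r) z‖ ≤ C * r ^ (-tau ν j) * expN ν ω j r z := by
  rw [hsr_eq_scale j hr hz, norm_div, norm_cpow_expo j hr, div_le_iff₀
    (Real.rpow_pos_of_pos hr _)]
  refine (R.bound j _ (by positivity)).trans (le_of_eq ?_)
  rw [Real.rpow_neg hr.le, expN]
  have := (Real.rpow_pos_of_pos hr (tau ν j)).ne'
  field_simp

lemma norm_freeJost_le (hr : 0 < r) {z : ℝ} (hz : 0 < z) :
    ‖freeJost ν c ω b r z‖ ≤ C * decayN ν ω r z := by
  have := R.bound_jost (r * z) (by positivity)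
  rw [mul_assoc] at this
  exact this

/-- The first Frobenius solution is eliminated in favour of the decaying one, which leaves the
kernel unchanged up to the factor b₀r coming from the scaling. This produces both the gain 1/r and
the exponent proportional to z - t. -/
lemma norm_hsG_le (hσ : 0 < ν.re) (hr : 0 < r) {t z : ℝ} (ht : 0 < t) (htz : t ≤ z) :
    ‖hsG ν c z t (rayLam ω r)‖ ≤ 2 * C ^ 2 / ‖b 0‖ / r *
      (min 1 (r * t) ^ tau ν 0 * min 1 (r * z) ^ tau ν 1 * Real.exp (ω.im * (r * (z - t)))) := by
  have hz := ht.trans_le htz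
  have hr0 : (r : ℂ) ≠ 0 := Complex.ofReal_ne_zero.2 hr.ne'
  have hb0 := R.b_ne 0
  have hC := R.C_pos
  have hω := R.im_pos
  have hrt : 0 < r * t := by positivity
  have hrz : 0 < r * z := by positivity
  have hm := min_one_pos hrt
  have hle : min 1 (r * t) ≤ min 1 (r * z) := min_le_min le_rfl (by gcongr)
  have hmz := hm.trans_le hle
  have hexch : min 1 (r * z) ^ tau ν 0 * min 1 (r * t) ^ tau ν 1 ≤
      min 1 (r * t) ^ tau ν 0 * min 1 (r * z) ^ tau ν 1 := by
    rw [tau_zero, tau_one]; exact rpow_exchange hσ hm hle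
  have h01 : (r : ℂ) ^ expo ν 0 * (r : ℂ) ^ expo ν 1 = r := by
    rw [← Complex.cpow_add _ _ hr0, expo_add, Complex.cpow_one]
  have hG : hsG ν c z t (rayLam ω r) = (freeJost ν c ω b r t * hs ν c 1 ((r * z : ℝ) : ℂ) (ω ^ 2) -
      freeJost ν c ω b r z * hs ν c 1 ((r * t : ℝ) : ℂ) (ω ^ 2)) / (b 0 * r) := by
    rw [eq_div_iff (mul_ne_zero hb0 hr0), freeJost, freeJost, hs_scale 0 hr ht, hs_scale 0 hr hz,
      hs_scale 1 hr hz, hs_scale 1 hr ht, hsG]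
    simp only [hsr]
    linear_combination (-(b 0) * (hs ν c 0 t (rayLam ω r) * hs ν c 1 z (rayLam ω r) -
      hs ν c 0 z (rayLam ω r) * hs ν c 1 t (rayLam ω r))) * h01
  rw [hG, norm_div, norm_mul, Complex.norm_of_nonneg hr.le]
  have hbpos : 0 < ‖b 0‖ := norm_pos_iff.2 hb0
  rw [div_le_iff₀ (by positivity)]
  refine (norm_sub_le _ _).trans ?_
  rw [norm_mul, norm_mul]
  have p0 := Real.rpow_pos_of_pos hm (tau ν 0)
  have p1 := Real.rpow_pos_of_pos hm (tau ν 1)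
  have q0 := Real.rpow_pos_of_pos hmz (tau ν 0)
  have q1 := Real.rpow_pos_of_pos hmz (tau ν 1)
  have e1 : Real.exp (-(ω.im * (r * t))) * Real.exp (ω.im * (r * z)) =
      Real.exp (ω.im * (r * (z - t))) := by rw [← Real.exp_add]; ring_nf
  have e2 : Real.exp (-(ω.im * (r * z))) * Real.exp (ω.im * (r * t)) ≤
      Real.exp (ω.im * (r * (z - t))) := by
    rw [← Real.exp_add]
    gcongr
    have : 0 ≤ ω.im * (r * (z - t)) := mul_nonneg hω.le (mul_nonneg hr.le (by linarith))
    linarith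
  calc _ ≤ C * decayN ν ω r t * (C * min 1 (r * z) ^ tau ν 1 * Real.exp (ω.im * (r * z))) +
        C * decayN ν ω r z * (C * min 1 (r * t) ^ tau ν 1 * Real.exp (ω.im * (r * t))) := by
        have := decayN_pos (ν := ν) (ω := ω) hr ht
        have := decayN_pos (ν := ν) (ω := ω) hr hz
        gcongr
        · exact R.norm_freeJost_le hr ht
        · exact R.bound 1 _ hrz
        · exact R.norm_freeJost_le hr hz
        · exact R.bound 1 _ hrt
    _ = C ^ 2 * (min 1 (r * t) ^ tau ν 0 * min 1 (r * z) ^ tau ν 1 *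
        (Real.exp (-(ω.im * (r * t))) * Real.exp (ω.im * (r * z)))) +
        C ^ 2 * (min 1 (r * z) ^ tau ν 0 * min 1 (r * t) ^ tau ν 1 *
        (Real.exp (-(ω.im * (r * z))) * Real.exp (ω.im * (r * t)))) := by
        unfold decayN; ring
    _ ≤ C ^ 2 * (min 1 (r * t) ^ tau ν 0 * min 1 (r * z) ^ tau ν 1 *
        Real.exp (ω.im * (r * (z - t)))) +
        C ^ 2 * (min 1 (r * t) ^ tau ν 0 * min 1 (r * z) ^ tau ν 1 *
        Real.exp (ω.im * (r * (z - t)))) := by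
        rw [e1]; gcongr
    _ = _ := by field_simp; ring

variable (P : Params ν c) (hQ : HalfPot ν.re Q) (hr : 1 ≤ r)
include P hQ hr

/-- The exponentials of the kernel and of the weight at t combine to the weight at z, and the
leftover power is min(1, rt) ≤ 1. The set X is left free since both (0, ∞), for the Jost solution,
and (0, a], for the solutions with data at a, are needed. -/
lemma volterraBound_decay {X : Set ℝ} {S : ℝ → Set ℝ} (hX : MeasurableSet X) (hX0 : X ⊆ Ioi 0)
    (hS : ∀ z ∈ X, S z = X ∩ Ici z) :
    VolterraBound S Ici X (hsr ν c 1 (rayLam ω r)) (hsr ν c 0 (rayLam ω r)) Q (decayN ν ω r)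
      (fun t => 2 * C ^ 2 / ‖b 0‖ / r * (potWeight ν.re t * ‖Q t‖)) := by
  have hr0 : 0 < r := by linarith
  have hb0 : 0 < ‖b 0‖ := norm_pos_iff.2 (R.b_ne 0)
  have hC := R.C_pos
  have hσ := P.re_pos
  have hint : ∀ i, IntegrableOn (fun t => ‖hsr ν c i (rayLam ω r) t‖ * ‖Q t‖ * decayN ν ω r t)
      X := by
    intro i
    refine integrableOn_of_le_potWeight hQ hX hX0 (M := C * r ^ (-tau ν i))
      ((P.continuousOn_hsr i _).norm.mono hX0) ((continuousOn_decayN hr0).mono hX0) ?_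
    intro t ht
    have ht0 : 0 < t := hX0 ht
    have := decayN_pos (ν := ν) (ω := ω) hr0 ht0
    rw [norm_mul, norm_norm, Real.norm_of_nonneg this.le]
    calc _ ≤ C * r ^ (-tau ν i) * expN ν ω i r t * decayN ν ω r t := by
          gcongr; exact R.norm_hsr_le i hr0 ht0
      _ = C * r ^ (-tau ν i) * min 1 (r * t) ^ (tau ν i + tau ν 0) := by
          rw [mul_assoc, expN_mul_decayN i hr0 ht0]
      _ ≤ _ := by
          have := Real.rpow_pos_of_pos hr0 (-tau ν i)
          gcongr
          exact min_rpow_le_potWeight hr ht0 (tau_add_bounds hσ i 0)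
  refine ⟨volterraFamily_Ici, hX, hS, (P.continuousOn_hsr 1 _).mono hX0,
    (P.continuousOn_hsr 0 _).mono hX0, (continuousOn_decayN hr0).mono hX0,
    hQ.meas.mono_measure (Measure.restrict_mono_set _ hX0), fun z hz => decayN_pos hr0 (hX0 hz),
    fun t ht => mul_nonneg (by positivity) (potWeight_mul_nonneg _ _ (hX0 ht)),
    (hQ.int.mono_set hX0).const_mul _, ?_, hint 1, hint 0⟩
  intro z hz t ht
  have hz0 : 0 < z := hX0 hz
  have hzt : z ≤ t := ht.2
  have ht0 : 0 < t := hz0.trans_le hzt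
  have hG := R.norm_hsG_le hσ hr0 hz0 hzt
  have hG' : ‖hsr ν c 1 (rayLam ω r) t * hsr ν c 0 (rayLam ω r) z -
      hsr ν c 1 (rayLam ω r) z * hsr ν c 0 (rayLam ω r) t‖ = ‖hsG ν c t z (rayLam ω r)‖ := by
    unfold hsG hsr; congr 1; ring
  have hw := one_le_potWeight ν.re ht0
  have hm : min 1 (r * t) ^ tau ν 1 * min 1 (r * t) ^ tau ν 0 ≤ 1 := by
    rw [← Real.rpow_add (min_one_pos (by positivity)), add_comm, (two_tau ν).2.1, Real.rpow_one]
    exact min_le_left _ _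
  have hexp : Real.exp (ω.im * (r * (t - z))) * Real.exp (-(ω.im * (r * t))) =
      Real.exp (-(ω.im * (r * z))) := by rw [← Real.exp_add]; ring_nf
  have p0 := Real.rpow_pos_of_pos (min_one_pos (show 0 < r * z by positivity)) (tau ν 0)
  rw [hG']
  have hdt := decayN_pos (ν := ν) (ω := ω) hr0 ht0
  calc _ ≤ 2 * C ^ 2 / ‖b 0‖ / r * (min 1 (r * z) ^ tau ν 0 * min 1 (r * t) ^ tau ν 1 *
        Real.exp (ω.im * (r * (t - z)))) * ‖Q t‖ * decayN ν ω r t := by gcongr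
    _ = 2 * C ^ 2 / ‖b 0‖ / r * ((min 1 (r * t) ^ tau ν 1 * min 1 (r * t) ^ tau ν 0) *
        (min 1 (r * z) ^ tau ν 0 * (Real.exp (ω.im * (r * (t - z))) *
        Real.exp (-(ω.im * (r * t)))))) * ‖Q t‖ := by unfold decayN; ring
    _ ≤ 2 * C ^ 2 / ‖b 0‖ / r * (potWeight ν.re t *
        (min 1 (r * z) ^ tau ν 0 * (Real.exp (ω.im * (r * (t - z))) *
        Real.exp (-(ω.im * (r * t)))))) * ‖Q t‖ := by
        gcongr
        exact hm.trans hw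
    _ = _ := by rw [hexp]; unfold decayN; ring

/-- The counterpart for integration from 0, with growing weights. The power of min(1, rz) is
exchanged for that of min(1, rt) as in the λ-uniform bounds, now with the factor 1/r. -/
lemma volterraBound_exp (j : Fin 2) (L : ℝ) :
    VolterraBound (fun z => Ioc 0 z) Iic (Ioc 0 L) (hsr ν c 0 (rayLam ω r))
      (hsr ν c 1 (rayLam ω r)) Q (expN ν ω j r)
      (fun t => 2 * C ^ 2 / ‖b 0‖ / r * (potWeight ν.re t * ‖Q t‖)) := by
  have hX0 : Ioc 0 L ⊆ Ioi 0 := fun x hx => hx.1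
  have hr0 : 0 < r := by linarith
  have hb0 : 0 < ‖b 0‖ := norm_pos_iff.2 (R.b_ne 0)
  have hC := R.C_pos
  have hω := R.im_pos
  have hσ := P.re_pos
  have hint : ∀ i, IntegrableOn (fun t => ‖hsr ν c i (rayLam ω r) t‖ * ‖Q t‖ * expN ν ω j r t)
      (Ioc 0 L) := by
    intro i
    refine integrableOn_of_le_potWeight hQ measurableSet_Ioc hX0
      (M := C * r ^ (-tau ν i) * (Real.exp (ω.im * (r * L)) * Real.exp (ω.im * (r * L))))
      ((P.continuousOn_hsr i _).norm.mono hX0) ((continuousOn_expN j hr0).mono hX0) ?_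
    intro t ht
    have ht0 : 0 < t := hX0 ht
    have htL := ht.2
    have hm := min_one_pos (show 0 < r * t by positivity)
    have := expN_pos (ν := ν) (ω := ω) j hr0 ht0
    have p := Real.rpow_pos_of_pos hr0 (-tau ν i)
    have p2 := Real.rpow_pos_of_pos hm (tau ν i + tau ν j)
    rw [norm_mul, norm_norm, Real.norm_of_nonneg this.le]
    calc _ ≤ C * r ^ (-tau ν i) * expN ν ω i r t * expN ν ω j r t := by
          gcongr; exact R.norm_hsr_le i hr0 ht0
      _ = C * r ^ (-tau ν i) * (Real.exp (ω.im * (r * t)) * Real.exp (ω.im * (r * t))) *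
          min 1 (r * t) ^ (tau ν i + tau ν j) := by
          rw [expN, expN, Real.rpow_add hm]; ring
      _ ≤ _ := by
          gcongr
          exact min_rpow_le_potWeight hr ht0 (tau_add_bounds hσ i j)
  refine ⟨volterraFamily_Iic, measurableSet_Ioc, ?_, (P.continuousOn_hsr 0 _).mono hX0,
    (P.continuousOn_hsr 1 _).mono hX0, (continuousOn_expN j hr0).mono hX0,
    hQ.meas.mono_measure (Measure.restrict_mono_set _ hX0), fun z hz => expN_pos j hr0 (hX0 hz),
    fun t ht => mul_nonneg (by positivity) (potWeight_mul_nonneg _ _ (hX0 ht)),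
    (hQ.int.mono_set hX0).const_mul _, ?_, hint 0, hint 1⟩
  · intro z hz
    ext t
    simp only [mem_Ioc, mem_inter_iff, mem_Iic]
    exact ⟨fun h => ⟨⟨h.1, h.2.trans hz.2⟩, h.2⟩, fun h => ⟨h.1.1, h.2⟩⟩
  intro z hz t ht
  have hz0 : 0 < z := hX0 hz
  have htz : t ≤ z := ht.2
  have ht0 : 0 < t := ht.1.1
  have hw := one_le_potWeight ν.re ht0
  have hmt := min_one_pos (show 0 < r * t by positivity)
  have hmz := min_one_pos (show 0 < r * z by positivity)
  have hmain : min 1 (r * t) ^ tau ν 0 * min 1 (r * z) ^ tau ν 1 * min 1 (r * t) ^ tau ν j ≤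
      min 1 (r * z) ^ tau ν j * potWeight ν.re t := by
    match j with
    | 0 =>
      have e1 : min 1 (r * t) ^ tau ν 0 * min 1 (r * t) ^ tau ν 0 ≤ potWeight ν.re t := by
        rw [← Real.rpow_add hmt]
        exact min_rpow_le_potWeight hr ht0 (tau_add_bounds hσ 0 0)
      have e2 : min 1 (r * z) ^ tau ν 1 ≤ min 1 (r * z) ^ tau ν 0 :=
        Real.rpow_le_rpow_of_exponent_ge hmz (min_le_left _ _)
          (by rw [tau_zero, tau_one]; linarith)
      have p0 := Real.rpow_pos_of_pos hmt (tau ν 0)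
      have p1 := Real.rpow_pos_of_pos hmz (tau ν 1)
      calc _ = min 1 (r * z) ^ tau ν 1 *
            (min 1 (r * t) ^ tau ν 0 * min 1 (r * t) ^ tau ν 0) := by ring
        _ ≤ _ := by gcongr
    | 1 =>
      have e1 : min 1 (r * t) ^ tau ν 0 * min 1 (r * t) ^ tau ν 1 ≤ potWeight ν.re t := by
        rw [← Real.rpow_add hmt]
        exact min_rpow_le_potWeight hr ht0 (tau_add_bounds hσ 0 1)
      have p1 := Real.rpow_pos_of_pos hmz (tau ν 1)
      calc _ = min 1 (r * z) ^ tau ν 1 *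
            (min 1 (r * t) ^ tau ν 0 * min 1 (r * t) ^ tau ν 1) := by ring
        _ ≤ _ := by gcongr
  have hexp : Real.exp (ω.im * (r * (z - t))) * Real.exp (ω.im * (r * t)) =
      Real.exp (ω.im * (r * z)) := by rw [← Real.exp_add]; ring_nf
  have hdt := expN_pos (ν := ν) (ω := ω) j hr0 ht0
  calc _ ≤ 2 * C ^ 2 / ‖b 0‖ / r * (min 1 (r * t) ^ tau ν 0 * min 1 (r * z) ^ tau ν 1 *
        Real.exp (ω.im * (r * (z - t)))) * ‖Q t‖ * expN ν ω j r t := by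
        gcongr; exact R.norm_hsG_le hσ hr0 ht0 htz
    _ = 2 * C ^ 2 / ‖b 0‖ / r * ((min 1 (r * t) ^ tau ν 0 * min 1 (r * z) ^ tau ν 1 *
        min 1 (r * t) ^ tau ν j) * (Real.exp (ω.im * (r * (z - t))) *
        Real.exp (ω.im * (r * t)))) * ‖Q t‖ := by unfold expN; ring
    _ ≤ 2 * C ^ 2 / ‖b 0‖ / r * ((min 1 (r * z) ^ tau ν j * potWeight ν.re t) *
        (Real.exp (ω.im * (r * (z - t))) * Real.exp (ω.im * (r * t)))) * ‖Q t‖ := by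
        gcongr
    _ = _ := by rw [hexp]; unfold expN; ring

end RayModel

end Ray

/-! ### Asymptotics of the perturbed solutions on a ray -/

/-- The sign of e is left open because τ₀ = 1/2 - Re ν can have either sign; one of the two summands
is always enough. -/
lemma rpow_le_add_rpow {x x1 x2 e : ℝ} (h0 : 0 < x1) (h1 : x1 ≤ x) (h2 : x ≤ x2) :
    x ^ e ≤ x1 ^ e + x2 ^ e := by
  have hx := h0.trans_le h1
  have p1 := Real.rpow_pos_of_pos h0 e
  have p2 := Real.rpow_pos_of_pos (hx.trans_le h2) e
  rcases le_total 0 e with h | h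
  · have := Real.rpow_le_rpow hx.le h2 h
    linarith
  · have := Real.rpow_le_rpow_of_nonpos h0 h1 h
    linarith

section RayAsymptotics

variable {ν ω : ℂ} {c b : Fin 2 → ℂ} {d : ℂ} {C : ℝ} {Q : ℝ → ℂ}

/-- For fixed r this brings the decaying weight into the class O(z ^ τ₀), in which solutions on (0,
L] are unique. -/
lemma exists_decayN_le {r L : ℝ} (hω : 0 < ω.im) (hr : 0 < r) (hL : 0 < L) :
    ∃ M, 0 ≤ M ∧ ∀ z ∈ Ioc 0 L, decayN ν ω r z ≤ M * z ^ tau ν 0 := by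
  refine ⟨min (1 / L) r ^ tau ν 0 + r ^ tau ν 0, by positivity, fun z hz => ?_⟩
  have hz0 := hz.1
  have hm : min 1 (r * z) = z * min (1 / z) r := by
    rw [mul_min_of_nonneg _ _ hz0.le, mul_one_div_cancel hz0.ne', mul_comm]
  have h1 : Real.exp (-(ω.im * (r * z))) ≤ 1 := Real.exp_le_one_iff.2 (by
    have : 0 ≤ ω.im * (r * z) := by positivity
    linarith)
  have h2 : min (1 / z) r ^ tau ν 0 ≤ min (1 / L) r ^ tau ν 0 + r ^ tau ν 0 :=
    rpow_le_add_rpow (lt_min (by positivity) hr)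
      (min_le_min (one_div_le_one_div_of_le hz0 hz.2) le_rfl) (min_le_right _ _)
  have h3 : 0 < min (1 / z) r := lt_min (by positivity) hr
  have p0 := Real.rpow_pos_of_pos hz0 (tau ν 0)
  have p1 := Real.rpow_pos_of_pos h3 (tau ν 0)
  rw [decayN, hm, Real.mul_rpow hz0.le h3.le]
  calc _ ≤ z ^ tau ν 0 * min (1 / z) r ^ tau ν 0 * 1 := by gcongr
    _ ≤ z ^ tau ν 0 * (min (1 / L) r ^ tau ν 0 + r ^ tau ν 0) := by rw [mul_one]; gcongr
    _ = _ := by ring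

namespace RayModel

variable (R : RayModel ν c ω b d C) (P : Params ν c) (hQ : HalfPot ν.re Q)
include R P hQ

/-- On a ray the solutions are close to the free ones. -/
lemma norm_halfSol_sub_le : ∃ M : ℝ, 0 < M ∧ ∀ r : ℝ, 1 ≤ r → ∀ j, ∀ z, 0 < z →
    ‖halfSol ν c Q j (rayLam ω r) z - hsr ν c j (rayLam ω r) z‖ ≤
      M / r * r ^ (-tau ν j) * expN ν ω j r z := by
  set K := 2 * C ^ 2 / ‖b 0‖ with hKdef
  have hb0 : 0 < ‖b 0‖ := norm_pos_iff.2 (R.b_ne 0)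
  have hC := R.C_pos
  have hK : 0 < K := by positivity
  have hI := potMass_nonneg ν.re Q
  -- The summand 1 only serves to keep the constant positive when the potential has zero mass.
  refine ⟨2 * C * Real.exp (2 * (K * potMass ν.re Q)) * (K * potMass ν.re Q) + 1, by positivity,
    fun r hr j z hz => ?_⟩
  have hr0 : 0 < r := by linarith
  have B := R.volterraBound_exp P hQ hr j z
  have hX0 : Ioc 0 z ⊆ Ioi 0 := fun x hx => hx.1
  have hint : ∫ t in Ioc 0 z, K / r * (potWeight ν.re t * ‖Q t‖) ≤ K / r * potMass ν.re Q := by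
    rw [integral_const_mul]
    gcongr
    exact hQ.setIntegral_le_potMass hX0
  have hint2 : K / r * potMass ν.re Q ≤ K * potMass ν.re Q := by
    gcongr; exact div_le_self hK.le hr
  have hp := Real.rpow_pos_of_pos hr0 (-tau ν j)
  have hN := expN_pos (ν := ν) (ω := ω) j hr0 hz
  have h := B.norm_sol_sub_le' (f := hsr ν c j (rayLam ω r)) (K := C * r ^ (-tau ν j))
    (by positivity) ((P.continuousOn_hsr j _).mono hX0) (fun x hx => R.norm_hsr_le j hr0 (hX0 hx))
    (⟨hz, le_rfl⟩ : z ∈ Ioc 0 z)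
  refine h.trans ?_
  have hnn : 0 ≤ ∫ t in Ioc 0 z, K / r * (potWeight ν.re t * ‖Q t‖) := B.setIntegral_nonneg
  calc _ ≤ 2 * (C * r ^ (-tau ν j)) * Real.exp (2 * (K * potMass ν.re Q)) * expN ν ω j r z *
        (K / r * potMass ν.re Q) := by
        gcongr
        exact hint.trans hint2
    _ = (2 * C * Real.exp (2 * (K * potMass ν.re Q)) * (K * potMass ν.re Q)) / r *
        r ^ (-tau ν j) * expN ν ω j r z := by ring
    _ ≤ _ := by gcongr; linarith

lemma norm_halfSol_ray_le : ∃ M : ℝ, 0 < M ∧ ∀ r : ℝ, 1 ≤ r → ∀ j, ∀ z, 0 < z →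
    ‖halfSol ν c Q j (rayLam ω r) z‖ ≤ M * r ^ (-tau ν j) * expN ν ω j r z := by
  obtain ⟨M, hM, h⟩ := R.norm_halfSol_sub_le P hQ
  refine ⟨M + C, add_pos hM R.C_pos, fun r hr j z hz => ?_⟩
  have hr0 : 0 < r := by linarith
  have hp := Real.rpow_pos_of_pos hr0 (-tau ν j)
  have hN := expN_pos (ν := ν) (ω := ω) j hr0 hz
  have h1 := h r hr j z hz
  have h2 := R.norm_hsr_le j hr0 hz
  have h3 := norm_add_le (halfSol ν c Q j (rayLam ω r) z - hsr ν c j (rayLam ω r) z)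
    (hsr ν c j (rayLam ω r) z)
  rw [sub_add_cancel] at h3
  have h4 : M / r * r ^ (-tau ν j) * expN ν ω j r z ≤ M * r ^ (-tau ν j) * expN ν ω j r z := by
    gcongr; exact div_le_self hM.le hr
  calc _ ≤ _ := h3.trans (add_le_add (h1.trans h4) h2)
    _ = _ := by ring

/-- The solution vanishing at `a` with unit derivative, on a ray. -/
lemma norm_leftSol_ray_le {a : ℝ} (ha : 0 < a) : ∃ M : ℝ, 0 < M ∧ ∀ r : ℝ, 1 ≤ r → ∀ z ∈ Ioc 0 a,
    ‖leftSol ν c Q a 0 1 (rayLam ω r) z‖ ≤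
      M / r * Real.exp (ω.im * (r * a)) * decayN ν ω r z := by
  set K := 2 * C ^ 2 / ‖b 0‖ with hKdef
  have hb0 : 0 < ‖b 0‖ := norm_pos_iff.2 (R.b_ne 0)
  have hC := R.C_pos
  have hσ := P.re_pos
  have hK : 0 < K := by positivity
  have hI := potMass_nonneg ν.re Q
  refine ⟨2 * K * Real.exp (2 * (K * potMass ν.re Q)), by positivity, fun r hr z hz => ?_⟩
  have hr0 : 0 < r := by linarith
  have hX0 : Ioc 0 a ⊆ Ioi 0 := fun x hx => hx.1
  have B := R.volterraBound_decay P hQ hr (X := Ioc 0 a) (S := fun z => Icc z a)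
    measurableSet_Ioc hX0 (by
      intro z hz
      ext t
      simp only [mem_Ioc, mem_inter_iff, mem_Ici, mem_Icc]
      exact ⟨fun h => ⟨⟨hz.1.trans_le h.1, h.2⟩, h.1⟩, fun h => ⟨h.2, h.1.2⟩⟩)
  have hint : ∫ t in Ioc 0 a, K / r * (potWeight ν.re t * ‖Q t‖) ≤ K * potMass ν.re Q := by
    rw [integral_const_mul]
    have := hQ.setIntegral_le_potMass hX0
    have h2 : K / r ≤ K := div_le_self hK.le hr
    have h3 : 0 ≤ ∫ t in Ioc 0 a, potWeight ν.re t * ‖Q t‖ :=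
      setIntegral_nonneg measurableSet_Ioc fun t ht => potWeight_mul_nonneg _ _ ht.1
    gcongr
  have hf : ∀ z ∈ Ioc 0 a, ‖leftF ν c a 0 1 (rayLam ω r) z‖ ≤
      K / r * Real.exp (ω.im * (r * a)) * decayN ν ω r z := by
    intro z hz
    have hz0 := hz.1
    -- The free solution vanishing at a with derivative 1 is minus the Green kernel with source z,
    -- so its bound, including the factor 1/r, is the kernel bound.
    have e : leftF ν c a 0 1 (rayLam ω r) z = -hsG ν c a z (rayLam ω r) := by
      simp only [leftF, leftU, leftV, hsG, hsr]; ring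
    rw [e, norm_neg]
    refine (R.norm_hsG_le hσ hr0 hz.1 hz.2).trans ?_
    have hm : min 1 (r * a) ^ tau ν 1 ≤ 1 := Real.rpow_le_one (le_min zero_le_one (by positivity))
      (min_le_left _ _) (by rw [tau_one]; linarith)
    have p0 := Real.rpow_pos_of_pos (min_one_pos (show 0 < r * z by positivity)) (tau ν 0)
    have hexp : Real.exp (ω.im * (r * (a - z))) =
        Real.exp (ω.im * (r * a)) * Real.exp (-(ω.im * (r * z))) := by
      rw [← Real.exp_add]; ring_nf
    rw [hexp, decayN]
    calc _ ≤ K / r * (min 1 (r * z) ^ tau ν 0 * 1 *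
          (Real.exp (ω.im * (r * a)) * Real.exp (-(ω.im * (r * z))))) := by gcongr
      _ = _ := by ring
  refine (B.norm_sol_le (K := K / r * Real.exp (ω.im * (r * a))) (by positivity)
    (P.continuousOn_leftF 0 1 _) hf hz).trans ?_
  have hN := decayN_pos (ν := ν) (ω := ω) hr0 hz.1
  calc _ ≤ 2 * (K / r * Real.exp (ω.im * (r * a))) * Real.exp (2 * (K * potMass ν.re Q)) *
        decayN ν ω r z := by gcongr
    _ = _ := by ring

/-- The Jost solution on a ray. -/
lemma exists_jost : ∃ M : ℝ, 0 < M ∧ ∀ r : ℝ, 1 ≤ r → ∃ β : Fin 2 → ℂ,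
    (∀ j, ‖β j - b j * (r : ℂ) ^ expo ν j‖ ≤ M / r * r ^ tau ν j) ∧
    (∀ z, 0 < z → ‖β 0 * halfSol ν c Q 0 (rayLam ω r) z +
      β 1 * halfSol ν c Q 1 (rayLam ω r) z‖ ≤ M * decayN ν ω r z) ∧
    Tendsto (fun z : ℝ => (β 0 * halfSol ν c Q 0 (rayLam ω r) z +
      β 1 * halfSol ν c Q 1 (rayLam ω r) z) * Complex.exp (-(Complex.I * (r * ω) * z)))
      atTop (𝓝 1) := by
  set K := 2 * C ^ 2 / ‖b 0‖ with hKdef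
  have hb0 : 0 < ‖b 0‖ := norm_pos_iff.2 (R.b_ne 0)
  have hC := R.C_pos
  have hω := R.im_pos
  have hσ := P.re_pos
  have hK : 0 < K := by positivity
  have hI := potMass_nonneg ν.re Q
  set M1 := 2 * C * Real.exp (2 * (K * potMass ν.re Q)) with hM1
  have hM1p : 0 < M1 := by positivity
  refine ⟨M1 + C * M1 * potMass ν.re Q, by positivity, fun r hr => ?_⟩
  have hr0 : 0 < r := by linarith
  have B := R.volterraBound_decay P hQ hr (X := Ioi 0) (S := fun z => Ici z)
    measurableSet_Ioi subset_rfl (by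
      intro z hz
      ext t
      simp only [mem_inter_iff, mem_Ioi, mem_Ici]
      exact ⟨fun h => ⟨lt_of_lt_of_le hz h, h⟩, fun h => h.2⟩)
  have hint : ∫ t in Ioi 0, K / r * (potWeight ν.re t * ‖Q t‖) ≤ K * potMass ν.re Q := by
    rw [integral_const_mul]
    have h2 : K / r ≤ K := div_le_self hK.le hr
    exact mul_le_mul_of_nonneg_right h2 hI
  set lam := rayLam ω r with hlam
  set V := freeJost ν c ω b r with hV
  set e := volterraSol (fun z => Ici z) (hsr ν c 1 lam) (hsr ν c 0 lam) Q V with he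
  have hVc : ContinuousOn V (Ioi 0) := by
    refine ContinuousOn.congr (f := fun z => b 0 * (r : ℂ) ^ expo ν 0 * hsr ν c 0 lam z +
      b 1 * (r : ℂ) ^ expo ν 1 * hsr ν c 1 lam z) ?_ fun z hz => freeJost_eq hr0 hz
    have := P.continuousOn_hsr 0 lam
    have := P.continuousOn_hsr 1 lam
    fun_prop
  have hVb : ∀ z ∈ Ioi (0 : ℝ), ‖V z‖ ≤ C * decayN ν ω r z := fun z hz =>
    R.norm_freeJost_le hr0 hz
  have heb : ∀ z, 0 < z → ‖e z‖ ≤ M1 * decayN ν ω r z := by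
    intro z hz
    have hN := decayN_pos (ν := ν) (ω := ω) hr0 hz
    refine (B.norm_sol_le hC.le hVc hVb hz).trans ?_
    rw [hM1]
    gcongr
  have hec : ContinuousOn e (Ioi 0) := B.continuousOn_sol hC.le hVc hVb
  obtain ⟨hi1, hi0⟩ := B.integrableOn_mul hec heb
  have hJ : ∀ i : Fin 2, ‖∫ t in Ioi 0, hsr ν c i lam t * Q t * e t‖ ≤
      C * M1 * potMass ν.re Q * r ^ (-tau ν i) := by
    intro i
    have hp := Real.rpow_pos_of_pos hr0 (-tau ν i)
    have : C * M1 * potMass ν.re Q * r ^ (-tau ν i) =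
        ∫ t in Ioi 0, C * M1 * r ^ (-tau ν i) * (potWeight ν.re t * ‖Q t‖) := by
      rw [integral_const_mul, potMass]; ring
    rw [this]
    refine norm_integral_le_of_norm_le (hQ.int.const_mul _) ?_
    refine (ae_restrict_iff' measurableSet_Ioi).2 (Eventually.of_forall fun t ht => ?_)
    have ht0 : 0 < t := ht
    rw [norm_mul, norm_mul]
    have hN := expN_pos (ν := ν) (ω := ω) i hr0 ht0
    calc _ ≤ C * r ^ (-tau ν i) * expN ν ω i r t * ‖Q t‖ * (M1 * decayN ν ω r t) := by
          gcongr
          · exact R.norm_hsr_le i hr0 ht0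
          · exact heb t ht0
      _ = C * M1 * r ^ (-tau ν i) * ((expN ν ω i r t * decayN ν ω r t) * ‖Q t‖) := by ring
      _ ≤ _ := by
          rw [expN_mul_decayN i hr0 ht0]
          gcongr
          exact min_rpow_le_potWeight hr ht0 (tau_add_bounds hσ i 0)
  -- The solution e is constructed from infinity. Writing the integral over (z, ∞) as the one over
  -- (0, ∞) minus the one over (0, z) turns its equation into one from 0, and the full integrals
  -- become corrections to the coefficients.
  set β : Fin 2 → ℂ := ![b 0 * (r : ℂ) ^ expo ν 0 + ∫ t in Ioi 0, hsr ν c 1 lam t * Q t * e t,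
    b 1 * (r : ℂ) ^ expo ν 1 - ∫ t in Ioi 0, hsr ν c 0 lam t * Q t * e t] with hβ
  have hβ0 : β 0 = b 0 * (r : ℂ) ^ expo ν 0 + ∫ t in Ioi 0, hsr ν c 1 lam t * Q t * e t := rfl
  have hβ1 : β 1 = b 1 * (r : ℂ) ^ expo ν 1 - ∫ t in Ioi 0, hsr ν c 0 lam t * Q t * e t := rfl
  have hsplit : ∀ i : Fin 2, ∀ z, 0 < z → IntegrableOn (fun t => hsr ν c i lam t * Q t * e t)
      (Ioi 0) → ∫ t in Ici z, hsr ν c i lam t * Q t * e t =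
      (∫ t in Ioi 0, hsr ν c i lam t * Q t * e t) -
        ∫ t in Ioc 0 z, hsr ν c i lam t * Q t * e t := by
    intro i z hz hi
    rw [integral_Ici_eq_integral_Ioi, ← Ioc_union_Ioi_eq_Ioi hz.le,
      setIntegral_union (Ioc_disjoint_Ioi le_rfl) measurableSet_Ioi
        (hi.mono_set fun x hx => hx.1) (hi.mono_set fun x hx => hz.trans hx)]
    ring
  -- Both sides are O(z ^ τ₀) and satisfy the same Volterra equation from 0, so they coincide.
  have hcomb : ∀ z, 0 < z → e z = β 0 * halfSol ν c Q 0 lam z + β 1 * halfSol ν c Q 1 lam z := by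
    intro z hz
    obtain ⟨M0, hM0, h0⟩ := P.norm_halfSol_le_rpow hQ 0 lam hz
    obtain ⟨M2, hM2, h2⟩ := P.norm_halfSol_le_rpow hQ 1 lam hz
    obtain ⟨M3, hM3, h3⟩ := exists_decayN_le (ν := ν) hω hr0 hz
    have hI0 := fun i => P.integrableOn_hsr_mul_halfSol hQ i 0 lam hz
    have hI1 := fun i => P.integrableOn_hsr_mul_halfSol hQ i 1 lam hz
    have hIe : ∀ i : Fin 2, IntegrableOn (fun t => hsr ν c i lam t * Q t * e t) (Ioi 0) := fun i =>
      match i with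
      | 0 => hi0
      | 1 => hi1
    obtain ⟨D, K', G⟩ := P.exists_growthBound
    refine sub_eq_zero.1 (P.eq_zero_of_eq_volterraOp hQ hz lam
      (d := fun x => e x - (β 0 * halfSol ν c Q 0 lam x + β 1 * halfSol ν c Q 1 lam x))
      (M := M1 * M3 + (‖β 0‖ * M0 + ‖β 1‖ * M2)) (fun x hx => ?_) (fun x hx => ?_) ⟨hz, le_rfl⟩)
    · refine (norm_sub_le _ _).trans ((add_le_add le_rfl (norm_add_le _ _)).trans ?_)
      rw [norm_mul, norm_mul]
      calc _ ≤ M1 * (M3 * x ^ tau ν 0) + (‖β 0‖ * (M0 * x ^ tau ν 0) +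
            ‖β 1‖ * (M2 * x ^ tau ν 0)) := by
            gcongr
            · exact (heb x hx.1).trans (by gcongr; exact h3 x hx)
            · exact h0 x hx
            · exact h2 x hx
        _ = _ := by ring
    · have hsub : Ioc 0 x ⊆ Ioc 0 z := Ioc_subset_Ioc_right hx.2
      have hsub' : Ioc 0 x ⊆ Ioi 0 := fun t ht => ht.1
      have hl : ∀ i, ∫ t in Ioc 0 x, hsr ν c i lam t * Q t *
          (e t - (β 0 * halfSol ν c Q 0 lam t + β 1 * halfSol ν c Q 1 lam t)) =
          (∫ t in Ioc 0 x, hsr ν c i lam t * Q t * e t) -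
          (β 0 * (∫ t in Ioc 0 x, hsr ν c i lam t * Q t * halfSol ν c Q 0 lam t) +
          β 1 * ∫ t in Ioc 0 x, hsr ν c i lam t * Q t * halfSol ν c Q 1 lam t) := by
        intro i
        have j0 := ((hI0 i).mono_set hsub).const_mul (β 0)
        have j1 := ((hI1 i).mono_set hsub).const_mul (β 1)
        have j2 : IntegrableOn (fun t => β 0 * (hsr ν c i lam t * Q t * halfSol ν c Q 0 lam t) +
            β 1 * (hsr ν c i lam t * Q t * halfSol ν c Q 1 lam t)) (Ioc 0 x) := j0.add j1
        rw [← integral_const_mul, ← integral_const_mul, ← integral_add j0 j1,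
          ← integral_sub ((hIe i).mono_set hsub') j2]
        congr 1; ext t; ring
      have hdi : ∀ i, IntegrableOn (fun t => hsr ν c i lam t * Q t *
          (e t - (β 0 * halfSol ν c Q 0 lam t + β 1 * halfSol ν c Q 1 lam t))) (Ioc 0 x) := by
        intro i
        refine (((hIe i).mono_set hsub').sub ((((hI0 i).mono_set hsub).const_mul (β 0)).add
          (((hI1 i).mono_set hsub).const_mul (β 1)))).congr (Eventually.of_forall fun t => ?_)
        simp only [Pi.sub_apply, Pi.add_apply]; ring
      have Bx := P.volterraBound_growth hQ G hx.1 0 (le_refl √‖lam‖)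
      have hxx : x ∈ Ioc 0 x := ⟨hx.1, le_rfl⟩
      rw [Bx.volterraOp_eq (hdi 0) (hdi 1) hxx, hl 0, hl 1]
      have q1 := B.sol_eq hC.le hVc hVb hx.1
      rw [B.volterraOp_eq hi1 hi0 hx.1, hsplit 0 x hx.1 hi0, hsplit 1 x hx.1 hi1, hV,
        freeJost_eq hr0 hx.1] at q1
      have q2 := P.halfSol_eq hQ 0 lam hx.1
      rw [Bx.volterraOp_eq ((hI0 0).mono_set hsub) ((hI0 1).mono_set hsub) hxx] at q2
      have q3 := P.halfSol_eq hQ 1 lam hx.1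
      rw [Bx.volterraOp_eq ((hI1 0).mono_set hsub) ((hI1 1).mono_set hsub) hxx] at q3
      linear_combination q1 - (β 0) * q2 - (β 1) * q3 - hsr ν c 0 lam x * hβ0 -
        hsr ν c 1 lam x * hβ1
  have htau := (two_tau ν).2.1
  refine ⟨β, fun j => ?_, fun z hz => ?_, ?_⟩
  · have hb : ‖β j - b j * (r : ℂ) ^ expo ν j‖ ≤
        C * M1 * potMass ν.re Q * r ^ (tau ν j - 1) := by
      match j with
      | 0 =>
        rw [hβ0, add_sub_cancel_left]
        refine (hJ 1).trans (le_of_eq ?_)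
        congr 2; linarith
      | 1 =>
        rw [hβ1, sub_sub_cancel_left, norm_neg]
        refine (hJ 0).trans (le_of_eq ?_)
        congr 2; linarith
    refine hb.trans ?_
    rw [Real.rpow_sub_one hr0.ne']
    have := Real.rpow_pos_of_pos hr0 (tau ν j)
    calc _ = (C * M1 * potMass ν.re Q) / r * r ^ tau ν j := by ring
      _ ≤ _ := by gcongr; linarith
  · rw [← hcomb z hz]
    refine (heb z hz).trans ?_
    have hN := decayN_pos (ν := ν) (ω := ω) hr0 hz
    gcongr
    have : 0 ≤ C * M1 * potMass ν.re Q := by positivity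
    linarith
  · have hfree : Tendsto (fun z : ℝ => V z * Complex.exp (-(Complex.I * (r * ω) * z))) atTop
        (𝓝 1) := by
      have h1 : Tendsto (fun z : ℝ => r * z) atTop atTop := tendsto_id.const_mul_atTop hr0
      refine (R.lim_jost.comp h1).congr fun z => ?_
      simp only [Function.comp_apply, hV, freeJost]
      congr 2
      push_cast; ring
    -- For rz ≥ 1 the decaying weight is the pure exponential, which cancels the factor exp(-iρz) in
    -- modulus; what remains is the tail of an integrable function.
    have hdiff : Tendsto (fun z : ℝ => (e z - V z) * Complex.exp (-(Complex.I * (r * ω) * z)))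
        atTop (𝓝 0) := by
      have htail : Tendsto (fun z : ℝ => M1 * ∫ t in Ici z, K / r * (potWeight ν.re t * ‖Q t‖))
          atTop (𝓝 0) := by
        have hi : IntegrableOn (fun t => K / r * (potWeight ν.re t * ‖Q t‖)) (Ioi 0) :=
          hQ.int.const_mul _
        have h1 := intervalIntegral_tendsto_integral_Ioi (μ := volume) 0 hi
          (tendsto_id (α := ℝ) (x := atTop))
        have h2 := (h1.const_sub
          (∫ t in Ioi 0, K / r * (potWeight ν.re t * ‖Q t‖))).const_mul M1
        rw [sub_self, mul_zero] at h2
        refine h2.congr' ?_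
        filter_upwards [eventually_gt_atTop 0] with z hz
        rw [id, intervalIntegral.integral_of_le hz.le, integral_Ici_eq_integral_Ioi,
          ← Ioc_union_Ioi_eq_Ioi hz.le, setIntegral_union (Ioc_disjoint_Ioi le_rfl)
          measurableSet_Ioi (hi.mono_set fun x hx => hx.1) (hi.mono_set fun x hx => hz.trans hx)]
        ring
      refine squeeze_zero_norm' ?_ htail
      filter_upwards [eventually_ge_atTop (1 / r)] with z hz
      have hz0 : 0 < z := lt_of_lt_of_le (by positivity) hz
      have hrz : 1 ≤ r * z := by
        rw [div_le_iff₀ hr0] at hz; linarith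
      have hn : ‖Complex.exp (-(Complex.I * (r * ω) * z))‖ = Real.exp (ω.im * (r * z)) := by
        have := (norm_exp_I_mul (r * ω) z).2
        rw [this]
        congr 1
        simp [Complex.mul_im]; ring
      have hD : decayN ν ω r z = Real.exp (-(ω.im * (r * z))) := by
        rw [decayN, min_eq_left hrz, Real.one_rpow, one_mul]
      have hmain := B.norm_sol_sub_le hC.le hVc hVb hz0
      rw [norm_mul, hn]
      have hnn : 0 ≤ ∫ t in Ici z, K / r * (potWeight ν.re t * ‖Q t‖) :=
        setIntegral_nonneg measurableSet_Ici fun t ht => mul_nonneg (by positivity)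
          (potWeight_mul_nonneg _ _ (hz0.trans_le ht))
      calc _ ≤ M1 * decayN ν ω r z * (∫ t in Ici z, K / r * (potWeight ν.re t * ‖Q t‖)) *
            Real.exp (ω.im * (r * z)) := by
            gcongr
            refine hmain.trans ?_
            have hN := decayN_pos (ν := ν) (ω := ω) hr0 hz0
            rw [hM1]
            gcongr
        _ = M1 * (∫ t in Ici z, K / r * (potWeight ν.re t * ‖Q t‖)) *
            (Real.exp (-(ω.im * (r * z))) * Real.exp (ω.im * (r * z))) := by rw [hD]; ring
        _ = _ := by rw [← Real.exp_add, neg_add_cancel, Real.exp_zero, mul_one]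
    have hsum := hdiff.add hfree
    rw [zero_add] at hsum
    refine hsum.congr' ?_
    filter_upwards [eventually_gt_atTop 0] with z hz
    rw [← hcomb z hz]; ring

/-- Large solutions dominate: the second regular solution is not `O(exp (-i ρ z))⁻¹`. -/
lemma exists_tendsto_norm_halfSol_atTop : ∃ r₀ : ℝ, 1 ≤ r₀ ∧ ∀ r : ℝ, r₀ ≤ r →
    Tendsto (fun z : ℝ => ‖halfSol ν c Q 1 (rayLam ω r) z *
      Complex.exp (-(Complex.I * (r * ω) * z))‖) atTop atTop := by
  obtain ⟨M, hM, h⟩ := R.norm_halfSol_sub_le P hQ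
  have hd : 0 < ‖d‖ := norm_pos_iff.2 R.d_ne
  have hω := R.im_pos
  -- For such r the relative error M/r is at most |d|/4, half of the eventual lower bound |d|/2 for
  -- the normalised free solution.
  refine ⟨1 + 4 * M / ‖d‖, by
    have : 0 < 4 * M / ‖d‖ := by positivity
    linarith, fun r hr => ?_⟩
  have hpos : 0 < 4 * M / ‖d‖ := by positivity
  have hr1 : 1 ≤ r := by linarith
  have hr0 : 0 < r := by linarith
  have hMr : M / r ≤ ‖d‖ / 4 := by
    rw [div_le_iff₀ hr0]
    have : 4 * M / ‖d‖ ≤ r := by linarith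
    rw [div_le_iff₀ hd] at this
    linarith
  have hp := Real.rpow_pos_of_pos hr0 (-tau ν 1)
  have h1 : Tendsto (fun z : ℝ => r * z) atTop atTop := tendsto_id.const_mul_atTop hr0
  have hg : ∀ᶠ z : ℝ in atTop, ‖d‖ / 2 ≤ ‖hs ν c 1 ((r * z : ℝ) : ℂ) (ω ^ 2) *
      Complex.exp (Complex.I * ω * ((r * z : ℝ) : ℂ))‖ :=
    (R.lim_grow.comp h1).norm.eventually (Ici_mem_nhds (by linarith))
  have hlow : Tendsto (fun z : ℝ => r ^ (-tau ν 1) * (‖d‖ / 4) * Real.exp (2 * ω.im * r * z))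
      atTop atTop :=
    (Real.tendsto_exp_atTop.comp (tendsto_id.const_mul_atTop (by positivity))).const_mul_atTop
      (by positivity)
  refine tendsto_atTop_mono' _ ?_ hlow
  filter_upwards [hg, eventually_ge_atTop (1 / r)] with z hz hz1
  have hz0 : 0 < z := lt_of_lt_of_le (by positivity) hz1
  have hrz : 1 ≤ r * z := by
    rw [div_le_iff₀ hr0] at hz1; linarith
  have hn : ‖Complex.exp (-(Complex.I * (r * ω) * z))‖ = Real.exp (ω.im * (r * z)) := by
    rw [(norm_exp_I_mul (r * ω) z).2]
    congr 1
    simp [Complex.mul_im]; ring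
  rw [norm_mul, (norm_exp_I_mul ω (r * z)).1] at hz
  have hE : expN ν ω 1 r z = Real.exp (ω.im * (r * z)) := by
    rw [expN, min_eq_left hrz, Real.one_rpow, one_mul]
  have h2 := h r hr1 1 z hz0
  rw [hE] at h2
  have h3 : ‖hsr ν c 1 (rayLam ω r) z‖ = r ^ (-tau ν 1) * ‖hs ν c 1 ((r * z : ℝ) : ℂ) (ω ^ 2)‖ := by
    rw [hsr_eq_scale 1 hr0 hz0, norm_div, norm_cpow_expo 1 hr0, Real.rpow_neg hr0.le]
    ring
  have h4 : ‖d‖ / 2 * Real.exp (ω.im * (r * z)) ≤ ‖hs ν c 1 ((r * z : ℝ) : ℂ) (ω ^ 2)‖ := by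
    rw [Real.exp_neg, ← div_eq_mul_inv, le_div_iff₀ (Real.exp_pos _)] at hz
    exact hz
  have h5 := norm_sub_norm_le (hsr ν c 1 (rayLam ω r) z)
    (hsr ν c 1 (rayLam ω r) z - halfSol ν c Q 1 (rayLam ω r) z)
  rw [sub_sub_cancel, norm_sub_rev] at h5
  have hEp := Real.exp_pos (ω.im * (r * z))
  have h6 : r ^ (-tau ν 1) * (‖d‖ / 4) * Real.exp (ω.im * (r * z)) ≤
      ‖halfSol ν c Q 1 (rayLam ω r) z‖ := by
    refine le_trans ?_ h5
    rw [h3]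
    have h7 : M / r * r ^ (-tau ν 1) * Real.exp (ω.im * (r * z)) ≤
      ‖d‖ / 4 * r ^ (-tau ν 1) * Real.exp (ω.im * (r * z)) := by gcongr
    have h8 : r ^ (-tau ν 1) * (‖d‖ / 2 * Real.exp (ω.im * (r * z))) ≤
      r ^ (-tau ν 1) * ‖hs ν c 1 ((r * z : ℝ) : ℂ) (ω ^ 2)‖ := by gcongr
    linarith
  rw [norm_mul, hn]
  calc _ = r ^ (-tau ν 1) * (‖d‖ / 4) * Real.exp (ω.im * (r * z)) *
        Real.exp (ω.im * (r * z)) := by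
        rw [mul_assoc _ (Real.exp _) (Real.exp _), ← Real.exp_add]; ring_nf
    _ ≤ _ := by gcongr

end RayModel

end RayAsymptotics

/-! ### Comparison of two potentials along the rays -/

/-- A linear combination of the two solutions on the half-line. -/
noncomputable def comb (ν : ℂ) (c : Fin 2 → ℂ) (Q : ℝ → ℂ) (β : Fin 2 → ℂ) (lam : ℂ) (z : ℝ) : ℂ :=
  β 0 * halfSol ν c Q 0 lam z + β 1 * halfSol ν c Q 1 lam z

/-- The derivative of `comb`. -/
noncomputable def combD (ν : ℂ) (c : Fin 2 → ℂ) (Q : ℝ → ℂ) (β : Fin 2 → ℂ) (lam : ℂ) (z : ℝ) :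
    ℂ :=
  solD ν c lam
    (fun z => β 0 * halfU ν c Q lam (if (0 : Fin 2) = 1 then 1 else 0) (halfSol ν c Q 0 lam) z +
      β 1 * halfU ν c Q lam (if (1 : Fin 2) = 1 then 1 else 0) (halfSol ν c Q 1 lam) z)
    (fun z => β 0 * halfV ν c Q lam (if (0 : Fin 2) = 0 then 1 else 0) (halfSol ν c Q 0 lam) z +
      β 1 * halfV ν c Q lam (if (1 : Fin 2) = 0 then 1 else 0) (halfSol ν c Q 1 lam) z) z

lemma tendsto_inv_zero_of_norm_le {F : ℝ → ℂ} {M : ℝ} (h : ∀ᶠ r in atTop, ‖F r‖ ≤ M / r) :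
    Tendsto F atTop (𝓝 0) :=
  squeeze_zero_norm' h (tendsto_const_nhds.div_atTop tendsto_id)

/-- An entire function of order `1 / 2` which decays along both imaginary half-axes vanishes. -/
lemma HalfOrder.eq_zero {F : ℂ → ℂ} (hF : Differentiable ℂ F) (hg : HalfOrder F) {ω ω' : ℂ}
    (h1 : ω ^ 2 = Complex.I) (h2 : ω' ^ 2 = -Complex.I)
    (t1 : Tendsto (fun r => F (rayLam ω r)) atTop (𝓝 0))
    (t2 : Tendsto (fun r => F (rayLam ω' r)) atTop (𝓝 0)) (l : ℂ) : F l = 0 := by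
  obtain ⟨A, B, -, -, h⟩ := hg
  have hs : ∀ᶠ t : ℝ in atTop, ((√t : ℝ) : ℂ) ^ 2 = t := by
    filter_upwards [eventually_ge_atTop 0] with t ht
    rw [← Complex.ofReal_pow, Real.sq_sqrt ht]
  refine eq_zero_of_tendsto_zero_imaginary hF h ?_ ?_ l
  · refine (t1.comp Real.tendsto_sqrt_atTop).congr' ?_
    filter_upwards [hs] with t ht
    rw [Function.comp_apply, rayLam, mul_pow, ht, h1]
  · refine (t2.comp Real.tendsto_sqrt_atTop).congr' ?_
    filter_upwards [hs] with t ht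
    rw [Function.comp_apply, rayLam, mul_pow, ht, h2]
    congr 1; ring

section

variable {ν ω : ℂ} {c b : Fin 2 → ℂ} {d : ℂ} {C : ℝ} {Q Q' : ℝ → ℂ} {a : ℝ}

lemma Params.localSol_comb (P : Params ν c) (hQ : HalfPot ν.re Q) (β : Fin 2 → ℂ) (lam : ℂ)
    (L : ℝ) : LocalSol ν c Q lam L (comb ν c Q β lam)
    (fun z => β 0 * halfU ν c Q lam (if (0 : Fin 2) = 1 then 1 else 0) (halfSol ν c Q 0 lam) z +
      β 1 * halfU ν c Q lam (if (1 : Fin 2) = 1 then 1 else 0) (halfSol ν c Q 1 lam) z)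
    (fun z => β 0 * halfV ν c Q lam (if (0 : Fin 2) = 0 then 1 else 0) (halfSol ν c Q 0 lam) z +
      β 1 * halfV ν c Q lam (if (1 : Fin 2) = 0 then 1 else 0) (halfSol ν c Q 1 lam) z) :=
  ((P.localSol_halfSol hQ 0 lam L).smul (β 0)).add P hQ.integrableOn
    ((P.localSol_halfSol hQ 1 lam L).smul (β 1))

lemma Params.hasDerivAt_comb (P : Params ν c) (hQ : HalfPot ν.re Q) (β : Fin 2 → ℂ) (lam : ℂ)
    {z : ℝ} (hz : 0 < z) : HasDerivAt (comb ν c Q β lam) (combD ν c Q β lam z) z :=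
  (P.localSol_comb hQ β lam (z + 1)).hasDerivAt P hQ.integrableOn ⟨hz, by linarith⟩

lemma Params.comb_eq_leftSol (P : Params ν c) (hQ : HalfPot ν.re Q) (β : Fin 2 → ℂ) (lam : ℂ)
    {z : ℝ} (hz : z ∈ Ioc 0 a) :
    comb ν c Q β lam z = comb ν c Q β lam a * leftSol ν c Q a 1 0 lam z +
      combD ν c Q β lam a * leftSol ν c Q a 0 1 lam z := by
  have ha := hz.1.trans_le hz.2
  obtain ⟨M0, hM0, h0⟩ := P.norm_halfSol_le_rpow hQ 0 lam ha
  obtain ⟨M1, hM1, h1⟩ := P.norm_halfSol_le_rpow hQ 1 lam ha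
  refine P.eq_leftSol hQ ha (L := a + 1) (by linarith) (P.localSol_comb hQ β lam (a + 1))
    (M := ‖β 0‖ * M0 + ‖β 1‖ * M1) (fun x hx => ?_) hz
  refine (norm_add_le _ _).trans ?_
  rw [norm_mul, norm_mul]
  calc _ ≤ ‖β 0‖ * (M0 * x ^ tau ν 0) + ‖β 1‖ * (M1 * x ^ tau ν 0) := by
        gcongr
        · exact h0 x hx
        · exact h1 x hx
    _ = _ := by ring

/-- The two half-line solutions are linearly independent. -/
lemma Params.comb_injOn (P : Params ν c) (hQ : HalfPot ν.re Q) {β : Fin 2 → ℂ} {lam : ℂ}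
    (ha : 0 < a) (h : ∀ z ∈ Ioo 0 a, comb ν c Q β lam z = 0) : β 0 = 0 ∧ β 1 = 0 := by
  have hz : a / 2 ∈ Ioo 0 a := ⟨by linarith, by linarith⟩
  have H := P.localSol_comb hQ β lam a
  have hD : combD ν c Q β lam (a / 2) = 0 := by
    refine (P.hasDerivAt_comb hQ β lam hz.1).unique
      ((hasDerivAt_const (a / 2) (0 : ℂ)).congr_of_eventuallyEq ?_)
    filter_upwards [Ioo_mem_nhds hz.1 hz.2] with t ht using h t ht
  have hW := P.wronskian_halfSol hQ lam hz.1
  obtain ⟨e1, e2⟩ := H.coeff_eq P hz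
  unfold combD at hD
  rw [hD, h _ hz, mul_zero, mul_zero, sub_zero] at e1 e2
  constructor
  · linear_combination (-(β 0)) * hW +
      halfU ν c Q lam (if (1 : Fin 2) = 1 then 1 else 0) (halfSol ν c Q 1 lam) (a / 2) * e2 -
      halfV ν c Q lam (if (1 : Fin 2) = 0 then 1 else 0) (halfSol ν c Q 1 lam) (a / 2) * e1
  · linear_combination (-(β 1)) * hW +
      halfV ν c Q lam (if (0 : Fin 2) = 0 then 1 else 0) (halfSol ν c Q 0 lam) (a / 2) * e1 -
      halfU ν c Q lam (if (0 : Fin 2) = 1 then 1 else 0) (halfSol ν c Q 0 lam) (a / 2) * e2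

namespace RayModel

variable (R : RayModel ν c ω b d C) (P : Params ν c) (hQ : HalfPot ν.re Q)
include R P hQ

/-- Combinations whose leading coefficients are not those of the Jost solution grow. -/
lemma eventually_norm_comb_div_le (ha : 0 < a) {κ : Fin 2 → ℂ} (hκ : κ 1 * b 0 ≠ κ 0 * b 1)
    {B : ℝ → Fin 2 → ℂ} {δ : ℝ → ℝ} (hδ : Tendsto δ atTop (𝓝 0))
    (hB : ∀ᶠ r : ℝ in atTop, ∀ j, ‖B r j - κ j * (r : ℂ) ^ expo ν j‖ ≤ δ r * r ^ tau ν j) :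
    ∃ M', 0 < M' ∧ ∀ᶠ r : ℝ in atTop, comb ν c Q (B r) (rayLam ω r) a ≠ 0 ∧
      ∀ z, 0 < z → ‖comb ν c Q (B r) (rayLam ω r) z / comb ν c Q (B r) (rayLam ω r) a‖ ≤
        M' * Real.exp (-(ω.im * (r * a))) * expN ν ω 0 r z := by
  obtain ⟨N, hN, hh⟩ := R.norm_halfSol_sub_le P hQ
  have hC := R.C_pos
  have hω := R.im_pos
  have hσ := P.re_pos
  have hb0 := R.b_ne 0
  have hle : ∀ j, ∀ r z : ℝ, 0 < r → 0 < z → expN ν ω j r z ≤ expN ν ω 0 r z := by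
    intro j r z hr hz
    match j with
    | 0 => exact le_rfl
    | 1 =>
      unfold expN
      gcongr ?_ * _
      exact Real.rpow_le_rpow_of_exponent_ge (min_one_pos (by positivity)) (min_le_left _ _)
        (by rw [tau_zero, tau_one]; linarith)
  set η : ℝ → ℝ := fun r => ((‖κ 0‖ + 1) * N / r + C * δ r) + ((‖κ 1‖ + 1) * N / r + C * δ r)
    with hη
  have hη0 : Tendsto η atTop (𝓝 0) := by
    have h1 : ∀ k : ℝ, Tendsto (fun r : ℝ => k / r) atTop (𝓝 0) := fun k =>
      tendsto_const_nhds.div_atTop tendsto_id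
    simpa using (((h1 _).add (hδ.const_mul C)).add ((h1 _).add (hδ.const_mul C)))
  -- Replacing the coefficients by their leading parts and the perturbed solutions by the free ones
  -- changes the combination by a relative o(1): the powers of r in the coefficients cancel those
  -- from the scaling.
  have hclose : ∀ᶠ r : ℝ in atTop, ∀ z, 0 < z →
      ‖comb ν c Q (B r) (rayLam ω r) z - (κ 0 * hs ν c 0 ((r * z : ℝ) : ℂ) (ω ^ 2) +
        κ 1 * hs ν c 1 ((r * z : ℝ) : ℂ) (ω ^ 2))‖ ≤ η r * expN ν ω 0 r z := by
    filter_upwards [hB, hδ.eventually (ge_mem_nhds one_pos), eventually_ge_atTop 1] with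
      r hr hδ1 hr1 z hz
    have hr0 : 0 < r := by linarith
    have hj : ∀ j, ‖B r j * halfSol ν c Q j (rayLam ω r) z -
        κ j * hs ν c j ((r * z : ℝ) : ℂ) (ω ^ 2)‖ ≤
        ((‖κ j‖ + 1) * N / r + C * δ r) * expN ν ω 0 r z := by
      intro j
      have p := Real.rpow_pos_of_pos hr0 (tau ν j)
      have hpp : r ^ tau ν j * r ^ (-tau ν j) = 1 := by
        rw [← Real.rpow_add hr0, add_neg_cancel, Real.rpow_zero]
      have hE := expN_pos (ν := ν) (ω := ω) j hr0 hz
      have hδ0 : 0 ≤ δ r := nonneg_of_mul_nonneg_left ((norm_nonneg _).trans (hr j)) p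
      have hBj : ‖B r j‖ ≤ (‖κ j‖ + 1) * r ^ tau ν j := by
        have h1 := norm_add_le (B r j - κ j * (r : ℂ) ^ expo ν j) (κ j * (r : ℂ) ^ expo ν j)
        rw [sub_add_cancel, norm_mul, norm_cpow_expo j hr0] at h1
        have h2 : δ r * r ^ tau ν j ≤ 1 * r ^ tau ν j := by gcongr
        have := hr j
        linarith
      have e : B r j * halfSol ν c Q j (rayLam ω r) z - κ j * hs ν c j ((r * z : ℝ) : ℂ) (ω ^ 2) =
          B r j * (halfSol ν c Q j (rayLam ω r) z - hsr ν c j (rayLam ω r) z) +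
          (B r j - κ j * (r : ℂ) ^ expo ν j) * hsr ν c j (rayLam ω r) z := by
        rw [hs_scale j hr0 hz]; ring
      rw [e]
      refine (norm_add_le _ _).trans ?_
      rw [norm_mul, norm_mul]
      calc _ ≤ (‖κ j‖ + 1) * r ^ tau ν j * (N / r * r ^ (-tau ν j) * expN ν ω j r z) +
            δ r * r ^ tau ν j * (C * r ^ (-tau ν j) * expN ν ω j r z) := by
            gcongr
            · exact hh r hr1 j z hz
            · exact hr j
            · exact R.norm_hsr_le j hr0 hz
        _ = ((‖κ j‖ + 1) * N / r + C * δ r) * (r ^ tau ν j * r ^ (-tau ν j)) *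
            expN ν ω j r z := by ring
        _ ≤ _ := by
            rw [hpp, mul_one]
            gcongr
            exact hle j r z hr0 hz
    have e : comb ν c Q (B r) (rayLam ω r) z - (κ 0 * hs ν c 0 ((r * z : ℝ) : ℂ) (ω ^ 2) +
        κ 1 * hs ν c 1 ((r * z : ℝ) : ℂ) (ω ^ 2)) =
        (B r 0 * halfSol ν c Q 0 (rayLam ω r) z - κ 0 * hs ν c 0 ((r * z : ℝ) : ℂ) (ω ^ 2)) +
        (B r 1 * halfSol ν c Q 1 (rayLam ω r) z - κ 1 * hs ν c 1 ((r * z : ℝ) : ℂ) (ω ^ 2)) := by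
      unfold comb; ring
    rw [e]
    refine (norm_add_le _ _).trans ((add_le_add (hj 0) (hj 1)).trans (le_of_eq ?_))
    rw [hη]; ring
  have hexpa : ∀ᶠ r : ℝ in atTop, expN ν ω 0 r a = Real.exp (ω.im * (r * a)) := by
    filter_upwards [eventually_ge_atTop (1 / a)] with r hr
    rw [div_le_iff₀ ha] at hr
    rw [expN, min_eq_left hr, Real.one_rpow, one_mul]
  -- Splitting off κ₀/b₀ times the decaying solution leaves a multiple of the growing one. D is the
  -- resulting leading constant, and it is nonzero exactly by the condition on κ.
  set D := (κ 1 - κ 0 * b 1 / b 0) * d with hD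
  have hD0 : D ≠ 0 := by
    refine mul_ne_zero ?_ R.d_ne
    intro h
    apply hκ
    field_simp at h
    linear_combination h
  have hra : Tendsto (fun r : ℝ => r * a) atTop atTop := tendsto_id.atTop_mul_const ha
  have hEn : ∀ t : ℝ, ‖Complex.exp (Complex.I * ω * t)‖ = Real.exp (-(ω.im * t)) := fun t =>
    (norm_exp_I_mul ω t).1
  have hE0 : Tendsto (fun t : ℝ => Complex.exp (Complex.I * ω * t)) atTop (𝓝 0) := by
    rw [tendsto_zero_iff_norm_tendsto_zero]
    simp_rw [hEn]
    exact Real.tendsto_exp_neg_atTop_nhds_zero.comp (tendsto_id.const_mul_atTop hω)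
  have hlim : Tendsto (fun r : ℝ => comb ν c Q (B r) (rayLam ω r) a *
      Complex.exp (Complex.I * ω * ((r * a : ℝ) : ℂ))) atTop (𝓝 D) := by
    have l1 : Tendsto (fun t : ℝ => (κ 0 * hs ν c 0 t (ω ^ 2) + κ 1 * hs ν c 1 t (ω ^ 2)) *
        Complex.exp (Complex.I * ω * t)) atTop (𝓝 D) := by
      have h1 := ((R.lim_jost.mul (hE0.mul hE0)).const_mul (κ 0 / b 0)).add
        (R.lim_grow.const_mul (κ 1 - κ 0 * b 1 / b 0))
      rw [mul_zero, mul_zero, mul_zero, zero_add] at h1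
      refine h1.congr fun t => ?_
      rw [Complex.exp_neg]
      have := Complex.exp_ne_zero (Complex.I * ω * t)
      field_simp
      ring
    have l2 : Tendsto (fun r : ℝ => (comb ν c Q (B r) (rayLam ω r) a -
        (κ 0 * hs ν c 0 ((r * a : ℝ) : ℂ) (ω ^ 2) + κ 1 * hs ν c 1 ((r * a : ℝ) : ℂ) (ω ^ 2))) *
        Complex.exp (Complex.I * ω * ((r * a : ℝ) : ℂ))) atTop (𝓝 0) := by
      refine squeeze_zero_norm' ?_ hη0
      filter_upwards [hclose, hexpa] with r h1 h2
      rw [norm_mul, hEn]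
      have h3 := h1 a ha
      rw [h2] at h3
      calc _ ≤ η r * Real.exp (ω.im * (r * a)) * Real.exp (-(ω.im * (r * a))) := by gcongr
        _ = _ := by rw [mul_assoc, ← Real.exp_add, add_neg_cancel, Real.exp_zero, mul_one]
    have l3 := l2.add (l1.comp hra)
    rw [zero_add] at l3
    refine l3.congr fun r => ?_
    simp only [Function.comp_apply]
    ring
  have hDn : 0 < ‖D‖ := norm_pos_iff.2 hD0
  clear_value D
  have hlow : ∀ᶠ r : ℝ in atTop, ‖D‖ / 2 ≤ ‖comb ν c Q (B r) (rayLam ω r) a *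
      Complex.exp (Complex.I * ω * ((r * a : ℝ) : ℂ))‖ :=
    hlim.norm.eventually (Ici_mem_nhds (by linarith))
  refine ⟨(1 + (‖κ 0‖ + ‖κ 1‖) * C + 1) / (‖D‖ / 2), by positivity, ?_⟩
  filter_upwards [hlow, hclose, hη0.eventually (ge_mem_nhds one_pos), eventually_ge_atTop 1] with
    r h1 h2 hη1 hr1
  have hr0 : 0 < r := by linarith
  rw [norm_mul, hEn] at h1
  have hpos : 0 < ‖comb ν c Q (B r) (rayLam ω r) a‖ := by
    by_contra h
    have h0 : ‖comb ν c Q (B r) (rayLam ω r) a‖ = 0 := le_antisymm (not_lt.1 h) (norm_nonneg _)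
    rw [h0, zero_mul] at h1
    linarith
  refine ⟨norm_pos_iff.1 hpos, fun z hz => ?_⟩
  have hE := expN_pos (ν := ν) (ω := ω) 0 hr0 hz
  have hnum : ‖comb ν c Q (B r) (rayLam ω r) z‖ ≤
      (1 + (‖κ 0‖ + ‖κ 1‖) * C + 1) * expN ν ω 0 r z := by
    have e1 := h2 z hz
    have e2 := norm_add_le (comb ν c Q (B r) (rayLam ω r) z -
      (κ 0 * hs ν c 0 ((r * z : ℝ) : ℂ) (ω ^ 2) + κ 1 * hs ν c 1 ((r * z : ℝ) : ℂ) (ω ^ 2)))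
      (κ 0 * hs ν c 0 ((r * z : ℝ) : ℂ) (ω ^ 2) + κ 1 * hs ν c 1 ((r * z : ℝ) : ℂ) (ω ^ 2))
    rw [sub_add_cancel] at e2
    have e3 : ∀ j, ‖κ j * hs ν c j ((r * z : ℝ) : ℂ) (ω ^ 2)‖ ≤ ‖κ j‖ * (C * expN ν ω 0 r z) := by
      intro j
      rw [norm_mul]
      gcongr
      refine (R.bound j _ (by positivity)).trans ?_
      rw [mul_assoc]
      exact mul_le_mul_of_nonneg_left (hle j r z hr0 hz) hC.le
    have e4 := norm_add_le (κ 0 * hs ν c 0 ((r * z : ℝ) : ℂ) (ω ^ 2))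
      (κ 1 * hs ν c 1 ((r * z : ℝ) : ℂ) (ω ^ 2))
    have e5 : η r * expN ν ω 0 r z ≤ 1 * expN ν ω 0 r z := by gcongr
    have := e3 0
    have := e3 1
    calc _ ≤ 1 * expN ν ω 0 r z + (‖κ 0‖ * (C * expN ν ω 0 r z) +
          ‖κ 1‖ * (C * expN ν ω 0 r z)) := by linarith
      _ ≤ _ := by nlinarith
  rw [norm_div, div_le_iff₀ hpos]
  refine hnum.trans ?_
  have hK : 0 ≤ (1 + (‖κ 0‖ + ‖κ 1‖) * C + 1) / (‖D‖ / 2) * expN ν ω 0 r z := by positivity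
  calc _ = (1 + (‖κ 0‖ + ‖κ 1‖) * C + 1) / (‖D‖ / 2) * expN ν ω 0 r z * (‖D‖ / 2) := by
        field_simp
    _ ≤ (1 + (‖κ 0‖ + ‖κ 1‖) * C + 1) / (‖D‖ / 2) * expN ν ω 0 r z *
        (‖comb ν c Q (B r) (rayLam ω r) a‖ * Real.exp (-(ω.im * (r * a)))) := by gcongr
    _ = _ := by ring

/-- Adding m times the product of the two solutions with data (0, 1) changes nothing in the
difference, so each solution with data (1, 0) may be replaced by a normalised combination with the
common logarithmic derivative m. Then the factor exp(Im ω · ra) of one solution cancels the factor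
exp(-Im ω · ra) of the other, the weights in z multiply to 1 once rz ≥ 1, and 1/r remains. -/
lemma tendsto_leftSol_wronskian (hQ' : HalfPot ν.re Q') (ha : 0 < a) {κ : Fin 2 → ℂ}
    (hκ : κ 1 * b 0 ≠ κ 0 * b 1) {B B' : ℝ → Fin 2 → ℂ} {δ : ℝ → ℝ}
    (hδ : Tendsto δ atTop (𝓝 0))
    (hB : ∀ᶠ r : ℝ in atTop, ∀ j, ‖B r j - κ j * (r : ℂ) ^ expo ν j‖ ≤ δ r * r ^ tau ν j)
    (hB' : ∀ᶠ r : ℝ in atTop, ∀ j, ‖B' r j - κ j * (r : ℂ) ^ expo ν j‖ ≤ δ r * r ^ tau ν j)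
    (heq : ∀ᶠ r : ℝ in atTop, comb ν c Q (B r) (rayLam ω r) a ≠ 0 →
      comb ν c Q' (B' r) (rayLam ω r) a ≠ 0 →
      combD ν c Q (B r) (rayLam ω r) a / comb ν c Q (B r) (rayLam ω r) a =
      combD ν c Q' (B' r) (rayLam ω r) a / comb ν c Q' (B' r) (rayLam ω r) a)
    {z : ℝ} (hz : z ∈ Ioc 0 a) :
    Tendsto (fun r => leftSol ν c Q a 0 1 (rayLam ω r) z * leftSol ν c Q' a 1 0 (rayLam ω r) z -
      leftSol ν c Q' a 0 1 (rayLam ω r) z * leftSol ν c Q a 1 0 (rayLam ω r) z) atTop (𝓝 0) := by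
  obtain ⟨N, hN, h1⟩ := R.eventually_norm_comb_div_le P hQ ha hκ hδ hB
  obtain ⟨N', hN', h1'⟩ := R.eventually_norm_comb_div_le P hQ' ha hκ hδ hB'
  obtain ⟨K, hK, h2⟩ := R.norm_leftSol_ray_le P hQ ha
  obtain ⟨K', hK', h2'⟩ := R.norm_leftSol_ray_le P hQ' ha
  refine tendsto_inv_zero_of_norm_le (M := K * N' + K' * N) ?_
  filter_upwards [h1, h1', heq, eventually_ge_atTop 1, eventually_ge_atTop (1 / z)] with
    r ⟨e1, e2⟩ ⟨e1', e2'⟩ e3 hr1 hrz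
  have hz0 := hz.1
  have hr0 : 0 < r := by linarith
  rw [div_le_iff₀ hz0] at hrz
  set lam := rayLam ω r
  have e4 := e3 e1 e1'
  set m := combD ν c Q (B r) lam a / comb ν c Q (B r) lam a with hm
  have f1 : comb ν c Q (B r) lam z / comb ν c Q (B r) lam a =
      leftSol ν c Q a 1 0 lam z + m * leftSol ν c Q a 0 1 lam z := by
    rw [P.comb_eq_leftSol hQ (B r) lam hz, hm]; field_simp
  have f2 : comb ν c Q' (B' r) lam z / comb ν c Q' (B' r) lam a =
      leftSol ν c Q' a 1 0 lam z + m * leftSol ν c Q' a 0 1 lam z := by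
    rw [P.comb_eq_leftSol hQ' (B' r) lam hz, e4]; field_simp
  have key : leftSol ν c Q a 0 1 lam z * leftSol ν c Q' a 1 0 lam z -
      leftSol ν c Q' a 0 1 lam z * leftSol ν c Q a 1 0 lam z =
      leftSol ν c Q a 0 1 lam z * (comb ν c Q' (B' r) lam z / comb ν c Q' (B' r) lam a) -
      leftSol ν c Q' a 0 1 lam z * (comb ν c Q (B r) lam z / comb ν c Q (B r) lam a) := by
    rw [f1, f2]; ring
  have hprod : decayN ν ω r z * expN ν ω 0 r z = 1 := by
    rw [mul_comm, expN_mul_decayN 0 hr0 hz0, min_eq_left hrz, Real.one_rpow]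
  have hexp : Real.exp (ω.im * (r * a)) * Real.exp (-(ω.im * (r * a))) = 1 := by
    rw [← Real.exp_add, add_neg_cancel, Real.exp_zero]
  have hdp := decayN_pos (ν := ν) (ω := ω) hr0 hz0
  rw [key]
  refine (norm_sub_le _ _).trans ?_
  rw [norm_mul, norm_mul]
  calc _ ≤ K / r * Real.exp (ω.im * (r * a)) * decayN ν ω r z *
        (N' * Real.exp (-(ω.im * (r * a))) * expN ν ω 0 r z) +
        K' / r * Real.exp (ω.im * (r * a)) * decayN ν ω r z *
        (N * Real.exp (-(ω.im * (r * a))) * expN ν ω 0 r z) := by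
        gcongr
        · exact h2 r hr1 z hz
        · exact e2' z hz0
        · exact h2' r hr1 z hz
        · exact e2 z hz0
    _ = (K * N' + K' * N) / r * (Real.exp (ω.im * (r * a)) * Real.exp (-(ω.im * (r * a)))) *
        (decayN ν ω r z * expN ν ω 0 r z) := by ring
    _ = _ := by rw [hprod, hexp, mul_one, mul_one]

/-- As the ratio β₁/β₀ is common to both potentials, each solution of index 0 may be replaced by the
Jost solution divided by β₀. The latter is O(r ^ (-τ₀)) times the decaying weight, the solution of
index 1 is O(r ^ (-τ₁)) times the growing one, and τ₀ + τ₁ = 1 gives O(1/r). -/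
lemma tendsto_halfSol_wronskian (hQ' : HalfPot ν.re Q') {β β' : ℝ → Fin 2 → ℂ} {M : ℝ}
    (hM : 0 < M)
    (hβ : ∀ᶠ r : ℝ in atTop, ‖β r 0 - b 0 * (r : ℂ) ^ expo ν 0‖ ≤ M / r * r ^ tau ν 0)
    (hβ' : ∀ᶠ r : ℝ in atTop, ‖β' r 0 - b 0 * (r : ℂ) ^ expo ν 0‖ ≤ M / r * r ^ tau ν 0)
    (he : ∀ᶠ r : ℝ in atTop, ∀ z, 0 < z →
      ‖comb ν c Q (β r) (rayLam ω r) z‖ ≤ M * decayN ν ω r z)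
    (he' : ∀ᶠ r : ℝ in atTop, ∀ z, 0 < z →
      ‖comb ν c Q' (β' r) (rayLam ω r) z‖ ≤ M * decayN ν ω r z)
    (heq : ∀ᶠ r : ℝ in atTop, β r 0 * β' r 1 = β r 1 * β' r 0) {z : ℝ} (hz : 0 < z) :
    Tendsto (fun r => halfSol ν c Q 1 (rayLam ω r) z * halfSol ν c Q' 0 (rayLam ω r) z -
      halfSol ν c Q' 1 (rayLam ω r) z * halfSol ν c Q 0 (rayLam ω r) z) atTop (𝓝 0) := by
  obtain ⟨K, hK, h1⟩ := R.norm_halfSol_ray_le P hQ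
  obtain ⟨K', hK', h1'⟩ := R.norm_halfSol_ray_le P hQ'
  have hb : 0 < ‖b 0‖ := norm_pos_iff.2 (R.b_ne 0)
  have hlow : ∀ γ : ℝ → Fin 2 → ℂ,
      (∀ᶠ r : ℝ in atTop, ‖γ r 0 - b 0 * (r : ℂ) ^ expo ν 0‖ ≤ M / r * r ^ tau ν 0) →
      ∀ᶠ r : ℝ in atTop, ‖b 0‖ / 2 * r ^ tau ν 0 ≤ ‖γ r 0‖ := by
    intro γ hγ
    filter_upwards [hγ, eventually_ge_atTop 1, eventually_ge_atTop (2 * M / ‖b 0‖)] with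
      r hr hr1 hr2
    have hr0 : 0 < r := by linarith
    have p := Real.rpow_pos_of_pos hr0 (tau ν 0)
    have h3 := norm_sub_norm_le (b 0 * (r : ℂ) ^ expo ν 0) (b 0 * (r : ℂ) ^ expo ν 0 - γ r 0)
    rw [sub_sub_cancel, norm_mul, norm_cpow_expo 0 hr0, norm_sub_rev] at h3
    rw [div_le_iff₀ hb] at hr2
    have h4 : M / r ≤ ‖b 0‖ / 2 := by
      rw [div_le_iff₀ hr0]; linarith
    have h5 : M / r * r ^ tau ν 0 ≤ ‖b 0‖ / 2 * r ^ tau ν 0 := by gcongr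
    linarith
  refine tendsto_inv_zero_of_norm_le (M := K * M / (‖b 0‖ / 2) + K' * M / (‖b 0‖ / 2)) ?_
  filter_upwards [hlow β hβ, hlow β' hβ', he, he', heq, eventually_ge_atTop 1] with
    r l1 l2 e1 e2 e3 hr1
  have hr0 : 0 < r := by linarith
  have p := Real.rpow_pos_of_pos hr0 (tau ν 0)
  have p1 := Real.rpow_pos_of_pos hr0 (-tau ν 1)
  set lam := rayLam ω r
  have n1 : 0 < ‖β r 0‖ := lt_of_lt_of_le (by positivity) l1
  have n2 : 0 < ‖β' r 0‖ := lt_of_lt_of_le (by positivity) l2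
  have m1 := norm_pos_iff.1 n1
  have m2 := norm_pos_iff.1 n2
  have key : halfSol ν c Q 1 lam z * halfSol ν c Q' 0 lam z -
      halfSol ν c Q' 1 lam z * halfSol ν c Q 0 lam z =
      halfSol ν c Q 1 lam z * (comb ν c Q' (β' r) lam z / β' r 0) -
      halfSol ν c Q' 1 lam z * (comb ν c Q (β r) lam z / β r 0) := by
    unfold comb
    field_simp
    linear_combination (halfSol ν c Q 1 lam z * halfSol ν c Q' 1 lam z) * (-e3)
  have hpow : r ^ (-tau ν 1) / r ^ tau ν 0 = 1 / r := by
    have htau := (two_tau ν).2.1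
    rw [← Real.rpow_sub hr0, show -tau ν 1 - tau ν 0 = -1 by linarith, Real.rpow_neg_one, one_div]
  have hED : expN ν ω 1 r z * decayN ν ω r z ≤ 1 := by
    rw [expN_mul_decayN 1 hr0 hz, add_comm, (two_tau ν).2.1, Real.rpow_one]
    exact min_le_left _ _
  have hdp := decayN_pos (ν := ν) (ω := ω) hr0 hz
  have hep := expN_pos (ν := ν) (ω := ω) 1 hr0 hz
  rw [key]
  refine (norm_sub_le _ _).trans ?_
  rw [norm_mul, norm_mul, norm_div, norm_div]
  calc _ ≤ K * r ^ (-tau ν 1) * expN ν ω 1 r z *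
        (M * decayN ν ω r z / (‖b 0‖ / 2 * r ^ tau ν 0)) +
        K' * r ^ (-tau ν 1) * expN ν ω 1 r z *
        (M * decayN ν ω r z / (‖b 0‖ / 2 * r ^ tau ν 0)) := by
        gcongr
        · exact h1 r hr1 1 z hz
        · exact e2 z hz
        · exact h1' r hr1 1 z hz
        · exact e1 z hz
    _ = (K * M / (‖b 0‖ / 2) + K' * M / (‖b 0‖ / 2)) * (r ^ (-tau ν 1) / r ^ tau ν 0) *
        (expN ν ω 1 r z * decayN ν ω r z) := by
        field_simp
    _ ≤ (K * M / (‖b 0‖ / 2) + K' * M / (‖b 0‖ / 2)) * (r ^ (-tau ν 1) / r ^ tau ν 0) * 1 := by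
        gcongr
    _ = _ := by rw [hpow]; ring

end RayModel

/-- Potentials on `(0, a)` whose regular fundamental systems at `a` have equal quotients agree. -/
lemma Params.eq_ae_of_leftSol (P : Params ν c) (hQ : HalfPot ν.re Q) (hQ' : HalfPot ν.re Q')
    (ha : 0 < a) {ω ω' : ℂ} (h1 : ω ^ 2 = Complex.I) (h2 : ω' ^ 2 = -Complex.I)
    (ht : ∀ η ∈ ({ω, ω'} : Set ℂ), ∀ z ∈ Ioc 0 a,
      Tendsto (fun r => leftSol ν c Q a 0 1 (rayLam η r) z * leftSol ν c Q' a 1 0 (rayLam η r) z -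
      leftSol ν c Q' a 0 1 (rayLam η r) z * leftSol ν c Q a 1 0 (rayLam η r) z) atTop (𝓝 0)) :
    ∀ᵐ t, t ∈ Ioo 0 a → Q t = Q' t := by
  -- The difference vanishes for every λ; the single value λ = 0 already suffices to identify the
  -- potentials.
  have hz0 : ∀ z ∈ Ioc 0 a, leftSol ν c Q a 0 1 0 z * leftSol ν c Q' a 1 0 0 z -
      leftSol ν c Q' a 0 1 0 z * leftSol ν c Q a 1 0 0 z = 0 := by
    intro z hz
    exact HalfOrder.eq_zero (F := fun l => leftSol ν c Q a 0 1 l z * leftSol ν c Q' a 1 0 l z -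
      leftSol ν c Q' a 0 1 l z * leftSol ν c Q a 1 0 l z)
      (((P.differentiable_leftSol hQ 0 1 hz).mul (P.differentiable_leftSol hQ' 1 0 hz)).sub
        ((P.differentiable_leftSol hQ' 0 1 hz).mul (P.differentiable_leftSol hQ 1 0 hz)))
      (((P.halfOrder_leftSol hQ 0 1 hz).mul (P.halfOrder_leftSol hQ' 1 0 hz)).sub
        ((P.halfOrder_leftSol hQ' 0 1 hz).mul (P.halfOrder_leftSol hQ 1 0 hz))) h1 h2
      (ht ω (by simp) z hz) (ht ω' (by simp) z hz) 0
  refine LocalSol.eq_ae_of_mul_eq_mul P hQ.integrableOn hQ'.integrableOn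
    (P.localSol_leftSol hQ ha 1 0 0) (P.localSol_leftSol hQ ha 0 1 0)
    (P.localSol_leftSol hQ' ha 1 0 0) (P.localSol_leftSol hQ' ha 0 1 0) one_ne_zero
    (fun t ht => P.wronskian_leftSol hQ 0 ht) (fun t ht => P.wronskian_leftSol hQ' 0 ht)
    fun t ht => ?_
  linear_combination -hz0 t (Ioo_subset_Ioc_self ht)

/-- Potentials on `(0, ∞)` whose solutions regular at `0` have equal quotients agree. -/
lemma Params.eq_ae_of_halfSol (P : Params ν c) (hQ : HalfPot ν.re Q) (hQ' : HalfPot ν.re Q')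
    {ω ω' : ℂ} (h1 : ω ^ 2 = Complex.I) (h2 : ω' ^ 2 = -Complex.I)
    (ht : ∀ η ∈ ({ω, ω'} : Set ℂ), ∀ z, 0 < z →
      Tendsto (fun r => halfSol ν c Q 1 (rayLam η r) z * halfSol ν c Q' 0 (rayLam η r) z -
      halfSol ν c Q' 1 (rayLam η r) z * halfSol ν c Q 0 (rayLam η r) z) atTop (𝓝 0)) :
    ∀ᵐ t, t ∈ Ioi 0 → Q t = Q' t := by
  have hz0 : ∀ z, 0 < z → halfSol ν c Q 1 0 z * halfSol ν c Q' 0 0 z -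
      halfSol ν c Q' 1 0 z * halfSol ν c Q 0 0 z = 0 := by
    intro z hz
    exact HalfOrder.eq_zero (F := fun l => halfSol ν c Q 1 l z * halfSol ν c Q' 0 l z -
      halfSol ν c Q' 1 l z * halfSol ν c Q 0 l z)
      (((P.differentiable_halfSol hQ 1 hz).mul (P.differentiable_halfSol hQ' 0 hz)).sub
        ((P.differentiable_halfSol hQ' 1 hz).mul (P.differentiable_halfSol hQ 0 hz)))
      (((P.halfOrder_halfSol hQ 1 hz).mul (P.halfOrder_halfSol hQ' 0 hz)).sub
        ((P.halfOrder_halfSol hQ' 1 hz).mul (P.halfOrder_halfSol hQ 0 hz))) h1 h2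
      (ht ω (by simp) z hz) (ht ω' (by simp) z hz) 0
  -- The local comparison works on bounded intervals, so the half-line is exhausted by the intervals
  -- (0, n).
  have hn : ∀ n : ℕ, ∀ᵐ t, t ∈ Ioo (0 : ℝ) n → Q t = Q' t := fun n =>
    LocalSol.eq_ae_of_mul_eq_mul P hQ.integrableOn hQ'.integrableOn
      (P.localSol_halfSol hQ 0 0 n) (P.localSol_halfSol hQ 1 0 n)
      (P.localSol_halfSol hQ' 0 0 n) (P.localSol_halfSol hQ' 1 0 n) one_ne_zero
      (fun t ht => P.wronskian_halfSol hQ 0 ht.1) (fun t ht => P.wronskian_halfSol hQ' 0 ht.1)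
      fun t ht => by linear_combination -hz0 t ht.1
  filter_upwards [ae_all_iff.2 hn] with t h ht
  obtain ⟨n, hn⟩ := exists_nat_gt t
  exact h n ⟨ht, hn⟩

end

/-! ### The potentials on the two sides of the singular point -/

/-- The potential to the right of `a`. -/
def rightPot (a : ℝ) (q : ℝ → ℂ) (t : ℝ) : ℂ := q (a + t)

/-- The potential to the left of `a`, reflected and extended by zero. -/
noncomputable def leftPot (a : ℝ) (q : ℝ → ℂ) : ℝ → ℂ := (Ioc 0 a).indicator fun t => q (a - t)

section Potentials

variable {a : ℝ} {ν : ℂ} {q : ℝ → ℂ}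

lemma measurable_potWeight_abs_sub (s a : ℝ) : Measurable fun x : ℝ => potWeight s |x - a| := by
  unfold potWeight
  exact measurable_const.add
    ((continuous_abs.measurable.comp (measurable_id.sub_const a)).pow_const _)

/-- The exponent p = min(0, 1 - 2 Re ν) is nonpositive, so the weight is bounded below on bounded
sets and bounded above away from a. The two local conditions therefore combine into global ones that
no longer involve T. -/
lemma ClassW.integrableOn (hq : ClassW a ν q) :
    IntegrableOn q (Ioi 0) ∧
      IntegrableOn (fun x => potWeight ν.re |x - a| * ‖q x‖) (Ioi 0) := by
  obtain ⟨T, hT, h1, h2⟩ := hq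
  set p := min (0 : ℝ) (1 - 2 * ν.re) with hp
  have hp0 : p ≤ 0 := min_le_left _ _
  -- No sign of a is assumed here, so T ≤ 0 may occur; then (0, ∞) lies in (T, ∞), where the weight
  -- is bounded.
  rcases le_or_gt T 0 with hT0 | hT0
  · have hsub : Ioi (0 : ℝ) ⊆ Ioi T := fun x hx => lt_of_le_of_lt hT0 hx
    have hTa : 0 < T - a := by linarith
    refine ⟨h2.mono_set hsub, ?_⟩
    refine Integrable.mono' ((h2.mono_set hsub).norm.const_mul (1 + (T - a) ^ p)) ?_ ?_
    · refine AEStronglyMeasurable.mul ?_ (h2.mono_set hsub).aestronglyMeasurable.norm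
      exact (measurable_potWeight_abs_sub ν.re a).aestronglyMeasurable
    · refine (ae_restrict_iff' measurableSet_Ioi).2 (Eventually.of_forall fun x hx => ?_)
      have hx' : T < x := hsub hx
      have hxa : T - a ≤ |x - a| := by rw [abs_of_pos] <;> linarith
      have := one_le_potWeight ν.re (hTa.trans_le hxa)
      rw [norm_mul, norm_norm, Real.norm_of_nonneg (by linarith)]
      gcongr
      exact add_le_add le_rfl (Real.rpow_le_rpow_of_nonpos hTa hxa hp0)
  have hw : Measurable fun x : ℝ => ((|x - a| ^ p : ℝ) : ℂ) := by fun_prop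
  have hne : ∀ᵐ x : ℝ, x ≠ a := by simp [ae_iff, measure_singleton]
  -- Only the weighted potential is given as measurable; the weight is nonzero off the null set {a}
  -- and can be divided out.
  have hmeas : AEStronglyMeasurable q (volume.restrict (Ioo 0 T)) := by
    have := h1.aestronglyMeasurable.mul (hw.inv.aestronglyMeasurable)
    refine this.congr ?_
    filter_upwards [ae_restrict_of_ae hne] with x hx
    have : ((|x - a| ^ p : ℝ) : ℂ) ≠ 0 :=
      Complex.ofReal_ne_zero.2 (Real.rpow_pos_of_pos (abs_pos.2 (sub_ne_zero.2 hx)) _).ne'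
    simp only [Pi.mul_apply]
    rw [mul_assoc, Pi.inv_apply, mul_inv_cancel₀ this, mul_one]
  have hq1 : IntegrableOn q (Ioo 0 T) := by
    refine Integrable.mono' (h1.norm.const_mul ((|a| + T) ^ (-p))) hmeas ?_
    filter_upwards [ae_restrict_of_ae hne, ae_restrict_mem measurableSet_Ioo] with x hx hxT
    have hpos := abs_pos.2 (sub_ne_zero.2 hx)
    have hwp := Real.rpow_pos_of_pos hpos p
    have hle : |x - a| ≤ |a| + T := by
      have := abs_sub x a
      rw [abs_of_pos hxT.1] at this
      linarith [hxT.2]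
    have h3 : |x - a| ^ (-p) ≤ (|a| + T) ^ (-p) := by gcongr; linarith
    have h4 : |x - a| ^ (-p) * |x - a| ^ p = 1 := by
      rw [← Real.rpow_add hpos, neg_add_cancel, Real.rpow_zero]
    rw [norm_mul, Complex.norm_of_nonneg hwp.le]
    calc ‖q x‖ = (|x - a| ^ (-p) * |x - a| ^ p) * ‖q x‖ := by rw [h4, one_mul]
      _ ≤ ((|a| + T) ^ (-p) * |x - a| ^ p) * ‖q x‖ := by gcongr
      _ = _ := by ring
  have hset : Ioi (0 : ℝ) =ᵐ[volume] (Ioo 0 T ∪ Ioi T : Set ℝ) := by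
    rw [← Ioc_union_Ioi_eq_Ioi hT0.le]
    exact (Ioo_ae_eq_Ioc.symm).union (ae_eq_refl _)
  refine ⟨(integrableOn_congr_set_ae hset).2 (hq1.union h2), ?_⟩
  refine (integrableOn_congr_set_ae hset).2 (IntegrableOn.union ?_ ?_)
  · refine (hq1.norm.add h1.norm).congr ?_
    refine Eventually.of_forall fun x => ?_
    simp only [Pi.add_apply, potWeight]
    rw [norm_mul, Complex.norm_of_nonneg (Real.rpow_nonneg (abs_nonneg _) _)]
    ring
  · have hTa : 0 < T - a := by linarith
    refine Integrable.mono' (h2.norm.const_mul (1 + (T - a) ^ p)) ?_ ?_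
    · refine AEStronglyMeasurable.mul ?_ h2.aestronglyMeasurable.norm
      exact (measurable_potWeight_abs_sub ν.re a).aestronglyMeasurable
    · refine (ae_restrict_iff' measurableSet_Ioi).2 (Eventually.of_forall fun x hx => ?_)
      have hx' : T < x := hx
      have hxa : T - a ≤ |x - a| := by rw [abs_of_pos] <;> linarith
      have := one_le_potWeight ν.re (hTa.trans_le hxa)
      rw [norm_mul, norm_norm, Real.norm_of_nonneg (by linarith)]
      gcongr
      exact add_le_add le_rfl (Real.rpow_le_rpow_of_nonpos hTa hxa hp0)

lemma integrableOn_comp_add_left {E : Type*} [NormedAddCommGroup E] {f : ℝ → E} (ha : 0 < a)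
    (hf : IntegrableOn f (Ioi 0)) : IntegrableOn (fun t => f (a + t)) (Ioi 0) := by
  have h := ((measurePreserving_add_left volume a).integrableOn_comp_preimage
    (measurableEmbedding_addLeft a) (s := Ioi a)).2
    (hf.mono_set fun x hx => ha.trans hx)
  convert! h using 1
  ext t; simp

lemma integrableOn_comp_sub_left {E : Type*} [NormedAddCommGroup E] {f : ℝ → E}
    (hf : IntegrableOn f (Ioi 0)) : IntegrableOn (fun t => f (a - t)) (Ioc 0 a) := by
  have h := ((Measure.measurePreserving_sub_left volume a).integrableOn_comp_preimage
    (MeasurableEquiv.subLeft a).measurableEmbedding (s := Ico 0 a)).2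
    ((integrableOn_Ico_iff_integrableOn_Ioo).2 (hf.mono_set Ioo_subset_Ioi_self))
  convert! h using 1
  ext t
  simp only [mem_Ioc, mem_preimage, mem_Ico, sub_nonneg, sub_lt_self_iff]
  exact and_comm

lemma ClassW.halfPot_right (ha : 0 < a) (hq : ClassW a ν q) : HalfPot ν.re (rightPot a q) := by
  obtain ⟨h1, h2⟩ := hq.integrableOn
  refine ⟨(integrableOn_comp_add_left ha h1).aestronglyMeasurable, ?_⟩
  refine (integrableOn_comp_add_left ha h2).congr_fun (fun t ht => ?_) measurableSet_Ioi
  simp only [rightPot]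
  rw [add_sub_cancel_left, abs_of_pos ht]

lemma ClassW.halfPot_left (hq : ClassW a ν q) : HalfPot ν.re (leftPot a q) := by
  obtain ⟨h1, h2⟩ := hq.integrableOn
  have hsub : Ioc 0 a ⊆ Ioi 0 := fun x hx => hx.1
  constructor
  · exact ((integrable_indicator_iff measurableSet_Ioc).2
      (integrableOn_comp_sub_left h1)).aestronglyMeasurable.restrict
  · have := (integrable_indicator_iff measurableSet_Ioc).2 (integrableOn_comp_sub_left (a := a) h2)
    refine this.integrableOn.congr_fun (fun t ht => ?_) measurableSet_Ioi
    by_cases h : t ∈ Ioc 0 a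
    · rw [indicator_of_mem h, leftPot, indicator_of_mem h]
      simp only [sub_sub_cancel_left, abs_neg]
      rw [abs_of_pos ht]
    · rw [indicator_of_notMem h, leftPot, indicator_of_notMem h, norm_zero, mul_zero]

end Potentials

/-! ### Reduction of the integral equations to the half-line -/

section Solutions

variable {a : ℝ} {ν : ℂ} {c : Fin 2 → ℂ} {q : ℝ → ℂ}

/-- The boundary values of `z ^ μ` on the negative half-axis. -/
noncomputable def expoPhase (ν : ℂ) (j : Fin 2) : ℂ := Complex.exp (Real.pi * Complex.I * expo ν j)

lemma expoPhase_ne_zero (ν : ℂ) (j : Fin 2) : expoPhase ν j ≠ 0 := Complex.exp_ne_zero _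

lemma expoPhase_mul (ν : ℂ) : expoPhase ν 0 * expoPhase ν 1 = -1 := by
  rw [expoPhase, expoPhase, ← Complex.exp_add, ← mul_add, expo_add, mul_one, Complex.exp_pi_mul_I]

lemma frobSol_add (j : Fin 2) (lam : ℂ) (z : ℝ) :
    frobSol a ν c j (a + z) lam = hsr ν c j lam z := by
  rw [frobSol, add_sub_cancel_left]; rfl

/-- Negative reals have argument π, so (-z) ^ μ = exp(iπμ) z ^ μ, while the series is even in z. -/
lemma frobSol_sub (j : Fin 2) (lam : ℂ) {z : ℝ} (hz : 0 ≤ z) :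
    frobSol a ν c j (a - z) lam = expoPhase ν j * hsr ν c j lam z := by
  rw [frobSol, sub_sub_cancel_left, Complex.ofReal_cpow_of_nonpos (by linarith), hsr, hs, frobF,
    expoPhase]
  push_cast
  rw [neg_neg, neg_sq]
  ring

lemma kernelG_add (lam : ℂ) (z t : ℝ) :
    kernelG a ν c (a + z) (a + t) lam = hsG ν c z t lam := by
  simp only [kernelG, frobSol_add]; rfl

lemma kernelG_sub (lam : ℂ) {z t : ℝ} (hz : 0 ≤ z) (ht : 0 ≤ t) :
    kernelG a ν c (a - z) (a - t) lam = -hsG ν c z t lam := by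
  simp only [kernelG, frobSol_sub _ _ hz, frobSol_sub _ _ ht, hsG, hsr]
  linear_combination (hs ν c 0 t lam * hs ν c 1 z lam - hs ν c 0 z lam * hs ν c 1 t lam) *
    expoPhase_mul ν

/-- After x = a - z the kernel changes sign, because the two phases multiply to exp(iπ) = -1.
Reversing the direction of integration changes it back, so both sides obey the same equation and
only the free term carries a phase. -/
lemma isIntegralSol_iff (ha : 0 < a) (j : Fin 2) (lam : ℂ) (s : ℝ → ℂ) :
    IsIntegralSol a ν c q j lam s ↔
      (∀ z, 0 < z → IntegrableOn (fun t => hsG ν c z t lam * rightPot a q t * s (a + t)) (Ioc 0 z) ∧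
        s (a + z) = hsr ν c j lam z +
          ∫ t in Ioc 0 z, hsG ν c z t lam * rightPot a q t * s (a + t)) ∧
      (∀ z ∈ Ioc 0 a,
        IntegrableOn (fun t => hsG ν c z t lam * leftPot a q t * s (a - t)) (Ioc 0 z) ∧
        s (a - z) = expoPhase ν j * hsr ν c j lam z +
          ∫ t in Ioc 0 z, hsG ν c z t lam * leftPot a q t * s (a - t)) := by
  have hR : ∀ z, 0 < z → ((IntervalIntegrable
      (fun t => kernelG a ν c (a + z) t lam * q t * s t) volume a (a + z) ↔
      IntegrableOn (fun t => hsG ν c z t lam * rightPot a q t * s (a + t)) (Ioc 0 z)) ∧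
      ∫ t in a..(a + z), kernelG a ν c (a + z) t lam * q t * s t =
        ∫ t in Ioc 0 z, hsG ν c z t lam * rightPot a q t * s (a + t)) := by
    intro z hz
    have hf : (fun t => hsG ν c z t lam * rightPot a q t * s (a + t)) =
        fun t => (fun t => kernelG a ν c (a + z) t lam * q t * s t) (a + t) := by
      ext t; simp only [kernelG_add, rightPot]
    rw [hf, ← intervalIntegrable_iff_integrableOn_Ioc_of_le hz.le,
      ← intervalIntegral.integral_of_le hz.le]
    constructor
    · rw [← IntervalIntegrable.comp_add_left_iff (c := a), sub_self, add_sub_cancel_left]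
    · have := intervalIntegral.integral_comp_add_left (a := 0) (b := z)
        (fun t => kernelG a ν c (a + z) t lam * q t * s t) a
      rw [add_zero] at this
      exact this.symm
  have hLft : ∀ z ∈ Ioc 0 a, ((IntervalIntegrable
      (fun t => kernelG a ν c (a - z) t lam * q t * s t) volume a (a - z) ↔
      IntegrableOn (fun t => hsG ν c z t lam * leftPot a q t * s (a - t)) (Ioc 0 z)) ∧
      ∫ t in a..(a - z), kernelG a ν c (a - z) t lam * q t * s t =
        ∫ t in Ioc 0 z, hsG ν c z t lam * leftPot a q t * s (a - t)) := by
    intro z hz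
    have hf : EqOn (fun t => hsG ν c z t lam * leftPot a q t * s (a - t))
        (fun t => -(fun t => kernelG a ν c (a - z) t lam * q t * s t) (a - t)) (Ioc 0 z) := by
      intro t ht
      simp only [kernelG_sub lam hz.1.le ht.1.le, leftPot]
      have hm : t ∈ Ioc 0 a := ⟨ht.1, ht.2.trans hz.2⟩
      rw [indicator_of_mem hm]
      ring
    rw [integrableOn_congr_fun hf measurableSet_Ioc, setIntegral_congr_fun measurableSet_Ioc hf,
      integral_neg, ← intervalIntegral.integral_of_le hz.1.le]
    constructor
    · rw [show (fun t => -(fun t => kernelG a ν c (a - z) t lam * q t * s t) (a - t)) =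
        -(fun t => (fun t => kernelG a ν c (a - z) t lam * q t * s t) (a - t)) from rfl,
        integrableOn_neg_iff, ← intervalIntegrable_iff_integrableOn_Ioc_of_le hz.1.le,
        ← IntervalIntegrable.comp_sub_left_iff (c := a), sub_self, sub_sub_cancel]
    · have := intervalIntegral.integral_comp_sub_left (a := 0) (b := z)
        (fun t => kernelG a ν c (a - z) t lam * q t * s t) a
      rw [sub_zero] at this
      rw [intervalIntegral.integral_symm]
      exact congrArg Neg.neg this.symm
  constructor
  · intro h
    refine ⟨fun z hz => ?_, fun z hz => ?_⟩
    · obtain ⟨h1, h2⟩ := h (a + z) (by linarith) (by linarith)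
      rw [(hR z hz).1] at h1
      rw [(hR z hz).2, frobSol_add] at h2
      exact ⟨h1, h2⟩
    · obtain ⟨h1, h2⟩ := h (a - z) (by linarith [hz.2]) (by linarith [hz.1])
      rw [(hLft z hz).1] at h1
      rw [(hLft z hz).2, frobSol_sub j lam hz.1.le] at h2
      exact ⟨h1, h2⟩
  · rintro ⟨h1, h2⟩ x hx hxa
    rcases lt_or_gt_of_ne hxa with h | h
    · have hz : a - x ∈ Ioc 0 a := ⟨by linarith, by linarith⟩
      have e := hLft _ hz
      obtain ⟨g1, g2⟩ := h2 _ hz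
      rw [← e.1] at g1
      rw [← e.2, ← frobSol_sub (a := a) j lam hz.1.le] at g2
      rw [sub_sub_cancel] at g1 g2
      exact ⟨g1, g2⟩
    · have hz : 0 < x - a := by linarith
      have e := hR _ hz
      obtain ⟨g1, g2⟩ := h1 _ hz
      rw [← e.1] at g1
      rw [← e.2, ← frobSol_add (a := a) j lam] at g2
      rw [add_sub_cancel] at g1 g2
      exact ⟨g1, g2⟩

lemma Params.integrableOn_hsG_mul_halfSol {Q : ℝ → ℂ} (P : Params ν c) (hQ : HalfPot ν.re Q)
    (j : Fin 2) (lam : ℂ) {z : ℝ} (hz : 0 < z) :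
    IntegrableOn (fun t => hsG ν c z t lam * Q t * halfSol ν c Q j lam t) (Ioc 0 z) := by
  refine (((P.integrableOn_hsr_mul_halfSol hQ 0 j lam hz).const_mul (hsr ν c 1 lam z)).sub
    ((P.integrableOn_hsr_mul_halfSol hQ 1 j lam hz).const_mul (hsr ν c 0 lam z))).congr
    (Eventually.of_forall fun t => ?_)
  simp only [hsG, hsr, Pi.sub_apply]; ring

/-- Gluing the two half-line solutions shows that the integral equation is solvable, so the chosen
solution satisfies it. Uniqueness on each side, after division by the phase on the left, then
determines its values. -/
lemma Params.solS_eq (P : Params ν c) (ha : 0 < a) (hq : ClassW a ν q) (j : Fin 2) (lam : ℂ) :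
    (∀ z, 0 < z → solS a ν c q j lam (a + z) = halfSol ν c (rightPot a q) j lam z) ∧
    ∀ z ∈ Ioc 0 a, solS a ν c q j lam (a - z) =
      expoPhase ν j * halfSol ν c (leftPot a q) j lam z := by
  have hR := hq.halfPot_right ha
  have hL := hq.halfPot_left
  have hE := expoPhase_ne_zero ν j
  have hex : ∃ s, IsIntegralSol a ν c q j lam s := by
    refine ⟨fun x => if a < x then halfSol ν c (rightPot a q) j lam (x - a) else
      expoPhase ν j * halfSol ν c (leftPot a q) j lam (a - x), (isIntegralSol_iff ha j lam _).2
      ⟨fun z hz => ?_, fun z hz => ?_⟩⟩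
    · have hf : EqOn (fun t => hsG ν c z t lam * rightPot a q t *
          (if a < a + t then halfSol ν c (rightPot a q) j lam (a + t - a) else
            expoPhase ν j * halfSol ν c (leftPot a q) j lam (a - (a + t))))
          (fun t => hsG ν c z t lam * rightPot a q t * halfSol ν c (rightPot a q) j lam t)
          (Ioc 0 z) := by
        intro t ht
        simp only
        rw [if_pos (by linarith [ht.1]), add_sub_cancel_left]
      rw [integrableOn_congr_fun hf measurableSet_Ioc, setIntegral_congr_fun measurableSet_Ioc hf,
        if_pos (by linarith), add_sub_cancel_left]
      exact ⟨P.integrableOn_hsG_mul_halfSol hR j lam hz, P.halfSol_eq hR j lam hz⟩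
    · have hf : EqOn (fun t => hsG ν c z t lam * leftPot a q t *
          (if a < a - t then halfSol ν c (rightPot a q) j lam (a - t - a) else
            expoPhase ν j * halfSol ν c (leftPot a q) j lam (a - (a - t))))
          (fun t => expoPhase ν j *
            (hsG ν c z t lam * leftPot a q t * halfSol ν c (leftPot a q) j lam t))
          (Ioc 0 z) := by
        intro t ht
        simp only
        rw [if_neg (by linarith [ht.1]), sub_sub_cancel]
        ring
      rw [integrableOn_congr_fun hf measurableSet_Ioc, setIntegral_congr_fun measurableSet_Ioc hf,
        if_neg (by linarith [hz.1]), sub_sub_cancel, integral_const_mul, ← mul_add]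
      refine ⟨(P.integrableOn_hsG_mul_halfSol hL j lam hz.1).const_mul _, ?_⟩
      congr 1
      exact P.halfSol_eq hL j lam hz.1
  obtain ⟨h1, h2⟩ := (isIntegralSol_iff ha j lam _).1 (Classical.epsilon_spec hex)
  refine ⟨fun z hz => ?_, fun z hz => ?_⟩
  · exact P.eq_halfSol_of_integral_eq hR j lam (y := fun t => solS a ν c q j lam (a + t)) hz
      (fun w hw => (h1 w hw.1).1) (fun w hw => (h1 w hw.1).2) ⟨hz, le_rfl⟩
  · have := P.eq_halfSol_of_integral_eq hL j lam
      (y := fun t => (expoPhase ν j)⁻¹ * solS a ν c q j lam (a - t)) (hz.1.trans_le hz.2)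
      (fun w hw => ?_) (fun w hw => ?_) hz
    · rw [← this]
      rw [mul_inv_cancel_left₀ hE]
    · refine ((h2 w hw).1.const_mul (expoPhase ν j)⁻¹).congr (Eventually.of_forall fun t => ?_)
      simp only [solS]; ring
    · have e := (h2 w hw).2
      rw [solS, e, mul_add, inv_mul_cancel_left₀ hE, ← integral_const_mul]
      congr 2; ext t; ring

end Solutions

/-! ### Matching, the Jost solution and the Weyl function -/

/-- The coefficients on the left half of the solution which is `β` on the right half, up to a
common factor. -/
noncomputable def leftCoeff (ν : ℂ) (A : Matrix (Fin 2) (Fin 2) ℂ) (β : Fin 2 → ℂ) : Fin 2 → ℂ :=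
  ![expoPhase ν 0 * (β 0 / A 0 0),
    expoPhase ν 1 * ((β 1 - A 1 0 * (β 0 / A 0 0)) / A 1 1)]

section

variable {ν : ℂ} {c : Fin 2 → ℂ} {A : Matrix (Fin 2) (Fin 2) ℂ} {q Q Q' : ℝ → ℂ} {a : ℝ}

/-- The map from right to left coefficients is linear and triangular with nonzero diagonal, hence
invertible, so proportionality can be transported back. -/
lemma leftCoeff_mul_eq_mul (h0 : A 0 0 ≠ 0) (h1 : A 1 1 ≠ 0) {β β' : Fin 2 → ℂ}
    (h : leftCoeff ν A β 0 * leftCoeff ν A β' 1 = leftCoeff ν A β 1 * leftCoeff ν A β' 0) :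
    β 0 * β' 1 = β 1 * β' 0 := by
  have e0 := expoPhase_ne_zero ν 0
  have e1 := expoPhase_ne_zero ν 1
  simp only [leftCoeff, Matrix.cons_val_zero, Matrix.cons_val_one] at h
  field_simp at h
  refine mul_left_cancel₀ h0 ?_
  linear_combination h

/-- The solution for Q' also satisfies the integral equation with Q, the integrands being equal
almost everywhere. -/
lemma Params.halfSol_congr (P : Params ν c) (hQ : HalfPot ν.re Q) (hQ' : HalfPot ν.re Q')
    (h : ∀ᵐ t, t ∈ Ioi (0 : ℝ) → Q t = Q' t) (j : Fin 2) (lam : ℂ) {z : ℝ} (hz : 0 < z) :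
    halfSol ν c Q' j lam z = halfSol ν c Q j lam z := by
  have hae : ∀ w : ℝ, (fun t => hsG ν c w t lam * Q' t * halfSol ν c Q' j lam t)
      =ᵐ[volume.restrict (Ioc 0 w)]
      fun t => hsG ν c w t lam * Q t * halfSol ν c Q' j lam t := by
    intro w
    filter_upwards [ae_restrict_of_ae h, ae_restrict_mem measurableSet_Ioc] with t h1 h2
    rw [h1 h2.1]
  refine P.eq_halfSol_of_integral_eq hQ j lam hz (fun w hw => ?_) (fun w hw => ?_)
    (right_mem_Ioc.2 hz)
  · exact (P.integrableOn_hsG_mul_halfSol hQ' j lam hw.1).congr (hae w)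
  · rw [← integral_congr_ae (hae w)]
    exact P.halfSol_eq hQ' j lam hw.1

lemma Params.comb_congr (P : Params ν c) (hQ : HalfPot ν.re Q) (hQ' : HalfPot ν.re Q')
    (h : ∀ᵐ t, t ∈ Ioi (0 : ℝ) → Q t = Q' t) (β : Fin 2 → ℂ) (lam : ℂ) {z : ℝ} (hz : 0 < z) :
    comb ν c Q' β lam z = comb ν c Q β lam z ∧ combD ν c Q' β lam z = combD ν c Q β lam z := by
  have e : ∀ w, 0 < w → comb ν c Q' β lam w = comb ν c Q β lam w := fun w hw => by
    rw [comb, comb, P.halfSol_congr hQ hQ' h 0 lam hw, P.halfSol_congr hQ hQ' h 1 lam hw]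
  refine ⟨e z hz, (P.hasDerivAt_comb hQ' β lam hz).unique
    ((P.hasDerivAt_comb hQ β lam hz).congr_of_eventuallyEq ?_)⟩
  filter_upwards [lt_mem_nhds hz] with w hw using e w hw

/-- Solutions with the same logarithmic derivative at `a` are proportional. -/
lemma Params.coeff_mul_eq_mul (P : Params ν c) (hQ : HalfPot ν.re Q) (ha : 0 < a)
    {B B' : Fin 2 → ℂ} {lam : ℂ} (hB : comb ν c Q B lam a ≠ 0) (hB' : comb ν c Q B' lam a ≠ 0)
    (h : combD ν c Q B lam a / comb ν c Q B lam a =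
      combD ν c Q B' lam a / comb ν c Q B' lam a) : B 0 * B' 1 = B 1 * B' 0 := by
  rw [div_eq_div_iff hB hB'] at h
  -- Cross-multiplied by their values at a, the two combinations have the same value and derivative
  -- there. Their difference therefore vanishes on (0, a), and independence of the basic solutions
  -- makes its coefficients zero.
  obtain ⟨h0, h1⟩ := P.comb_injOn hQ (lam := lam) ha
    (β := fun j => comb ν c Q B lam a * B' j - comb ν c Q B' lam a * B j) (fun z hz => by
      have e := P.comb_eq_leftSol hQ B lam (Ioo_subset_Ioc_self hz)
      have e' := P.comb_eq_leftSol hQ B' lam (Ioo_subset_Ioc_self hz)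
      have : comb ν c Q (fun j => comb ν c Q B lam a * B' j - comb ν c Q B' lam a * B j) lam z =
          comb ν c Q B lam a * comb ν c Q B' lam z - comb ν c Q B' lam a * comb ν c Q B lam z := by
        unfold comb; ring
      rw [this, e, e']
      linear_combination -leftSol ν c Q a 0 1 lam z * h)
  refine mul_left_cancel₀ hB ?_
  linear_combination B 0 * h1 - B 1 * h0

/-- The combination γ₀ · (first) - β₀ · (second) contains only the solution of index 1. Multiplied
by exp(-iρz) it has a finite limit although that solution is then unbounded, so its coefficient
vanishes, and comparison of the limits gives the factor. -/
lemma eq_mul_of_tendsto_comb {ρ lam s : ℂ} {β γ : Fin 2 → ℂ} (hβ0 : β 0 ≠ 0)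
    (hβ : Tendsto (fun z : ℝ => comb ν c Q β lam z * Complex.exp (-(Complex.I * ρ * z))) atTop
      (𝓝 1))
    (hγ : Tendsto (fun z : ℝ => comb ν c Q γ lam z * Complex.exp (-(Complex.I * ρ * z))) atTop
      (𝓝 s))
    (hinf : Tendsto (fun z : ℝ => ‖halfSol ν c Q 1 lam z * Complex.exp (-(Complex.I * ρ * z))‖)
      atTop atTop) (j : Fin 2) : γ j = s * β j := by
  have h1 : Tendsto (fun z : ℝ => (γ 0 * β 1 - β 0 * γ 1) *
      (halfSol ν c Q 1 lam z * Complex.exp (-(Complex.I * ρ * z)))) atTop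
      (𝓝 (γ 0 * 1 - β 0 * s)) := by
    refine ((hβ.const_mul (γ 0)).sub (hγ.const_mul (β 0))).congr fun z => ?_
    unfold comb; ring
  have h2 : γ 0 * β 1 - β 0 * γ 1 = 0 := by
    by_contra hne
    have h3 := hinf.const_mul_atTop (norm_pos_iff.2 hne)
    refine not_tendsto_atTop_of_tendsto_nhds h1.norm (h3.congr fun z => ?_)
    rw [norm_mul, norm_mul, norm_mul]
  have h3 : γ 0 * 1 - β 0 * s = 0 := by
    refine tendsto_nhds_unique h1 ?_
    simp [h2]
  match j with
  | 0 => linear_combination h3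
  | 1 =>
    refine mul_left_cancel₀ hβ0 ?_
    linear_combination -h2 + β 1 * h3

/-- The matching at `a`, in terms of the solutions on the two half-lines. -/
lemma Params.sum_solSigma_eq (P : Params ν c) (ha : 0 < a) (hq : ClassW a ν q) (hA : A 0 1 = 0)
    (B : Fin 2 → ℂ) (lam : ℂ) :
    (∀ z, 0 < z → ∑ k : Fin 2, B k * solSigma a ν c A q k (a + z) lam =
      comb ν c (rightPot a q) ![A 0 0 * B 0, A 1 0 * B 0 + A 1 1 * B 1] lam z) ∧
    ∀ z ∈ Ioc 0 a, ∑ k : Fin 2, B k * solSigma a ν c A q k (a - z) lam =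
      comb ν c (leftPot a q) (fun j => expoPhase ν j * B j) lam z := by
  constructor
  · intro z hz
    have hn : ¬ a + z < a := by linarith
    simp only [Fin.sum_univ_two, solSigma, if_neg hn, (P.solS_eq ha hq _ lam).1 z hz, comb, hA,
      Matrix.cons_val_zero, Matrix.cons_val_one]
    ring
  · intro z hz
    have hn : a - z < a := by linarith [hz.1]
    simp only [Fin.sum_univ_two, solSigma, if_pos hn, (P.solS_eq ha hq _ lam).2 z hz, comb]
    ring

/-- Existence: the triangular matching relations are solved for the coefficients that produce β on
the right. Uniqueness: the growth of the solution of index 1 forces every Jost solution to have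
these coefficients. The factor exp(iρa) comes from normalising at x = a + z rather than at z. -/
lemma Params.jost_eq (P : Params ν c) (ha : 0 < a) (hq : ClassW a ν q) (hA : A 0 1 = 0)
    (h0 : A 0 0 ≠ 0) (h1 : A 1 1 ≠ 0) {ρ : ℂ} {β : Fin 2 → ℂ} (hβ0 : β 0 ≠ 0)
    (hβ : Tendsto (fun z : ℝ => comb ν c (rightPot a q) β (ρ ^ 2) z *
      Complex.exp (-(Complex.I * ρ * z))) atTop (𝓝 1))
    (hinf : Tendsto (fun z : ℝ => ‖halfSol ν c (rightPot a q) 1 (ρ ^ 2) z *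
      Complex.exp (-(Complex.I * ρ * z))‖) atTop atTop) {z : ℝ} (hz : z ∈ Ioc 0 a) :
    jost a ν c A q ρ (a - z) = Complex.exp (Complex.I * ρ * a) *
      comb ν c (leftPot a q) (leftCoeff ν A β) (ρ ^ 2) z := by
  set s := Complex.exp (Complex.I * ρ * a) with hs
  have hexp : ∀ w : ℝ, s * Complex.exp (-(Complex.I * ρ * ((a + w : ℝ) : ℂ))) =
      Complex.exp (-(Complex.I * ρ * w)) := by
    intro w
    rw [hs, ← Complex.exp_add]
    congr 1; push_cast; ring
  have hex : ∃ e, IsJost a ν c A q ρ e := by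
    refine ⟨fun x => ∑ k : Fin 2, (![s * (β 0 / A 0 0),
      s * ((β 1 - A 1 0 * (β 0 / A 0 0)) / A 1 1)] : Fin 2 → ℂ) k * solSigma a ν c A q k x (ρ ^ 2),
      ⟨_, fun x _ _ => rfl⟩, ?_⟩
    have := hβ.comp (tendsto_atTop_add_const_right atTop (-a) tendsto_id)
    refine this.congr' ?_
    filter_upwards [eventually_gt_atTop a] with x hx
    have e := (P.sum_solSigma_eq ha hq hA (![s * (β 0 / A 0 0),
      s * ((β 1 - A 1 0 * (β 0 / A 0 0)) / A 1 1)]) (ρ ^ 2)).1 (x - a) (by linarith)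
    rw [add_sub_cancel] at e
    rw [e, Function.comp_apply, id, ← sub_eq_add_neg, ← hexp (x - a), add_sub_cancel]
    simp only [comb, Matrix.cons_val_zero, Matrix.cons_val_one]
    field_simp
    ring
  obtain ⟨⟨B, hB⟩, hlim⟩ := Classical.epsilon_spec hex
  have hR := (P.sum_solSigma_eq ha hq hA B (ρ ^ 2)).1
  have hγ : Tendsto (fun z : ℝ => comb ν c (rightPot a q)
      ![A 0 0 * B 0, A 1 0 * B 0 + A 1 1 * B 1] (ρ ^ 2) z *
      Complex.exp (-(Complex.I * ρ * z))) atTop (𝓝 s) := by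
    have := (hlim.comp (tendsto_atTop_add_const_left atTop a tendsto_id)).const_mul s
    rw [mul_one] at this
    refine this.congr' ?_
    filter_upwards [eventually_gt_atTop 0] with w hw
    rw [Function.comp_apply, id, hB (a + w) (by linarith) (by linarith), hR w hw, ← hexp w]
    ring
  have e0 := eq_mul_of_tendsto_comb hβ0 hβ hγ hinf 0
  have e1 := eq_mul_of_tendsto_comb hβ0 hβ hγ hinf 1
  simp only [Matrix.cons_val_zero, Matrix.cons_val_one] at e0 e1
  have f0 : B 0 = s * (β 0 / A 0 0) := by
    field_simp; linear_combination e0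
  have f1 : B 1 = s * ((β 1 - A 1 0 * (β 0 / A 0 0)) / A 1 1) := by
    rw [f0] at e1
    field_simp at e1 ⊢
    linear_combination e1
  rw [jost, hB (a - z) (by linarith [hz.2]) (by linarith [hz.1]),
    (P.sum_solSigma_eq ha hq hA B (ρ ^ 2)).2 z hz]
  simp only [comb, leftCoeff, f0, f1, Matrix.cons_val_zero, Matrix.cons_val_one]
  ring

/-- The factor s cancels in the Weyl solution, and the sign comes from x = a - z. Agreement on [0,
a) is enough for the one-sided derivative at 0. -/
lemma Params.weylFn_eq (P : Params ν c) (ha : 0 < a) (hq : ClassW a ν q) {ρ s : ℂ}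
    (hs : s ≠ 0) {B : Fin 2 → ℂ}
    (h : ∀ z ∈ Ioc 0 a, jost a ν c A q ρ (a - z) = s * comb ν c (leftPot a q) B (ρ ^ 2) z) :
    charFn a ν c A q ρ = s * comb ν c (leftPot a q) B (ρ ^ 2) a ∧
    weylFn a ν c A q ρ = -(combD ν c (leftPot a q) B (ρ ^ 2) a /
      comb ν c (leftPot a q) B (ρ ^ 2) a) := by
  have hc : charFn a ν c A q ρ = s * comb ν c (leftPot a q) B (ρ ^ 2) a := by
    have := h a ⟨ha, le_rfl⟩
    rwa [sub_self] at this
  refine ⟨hc, ?_⟩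
  have hw : ∀ x ∈ Ico 0 a, weylSol a ν c A q ρ x = comb ν c (leftPot a q) B (ρ ^ 2) (a - x) /
      comb ν c (leftPot a q) B (ρ ^ 2) a := by
    intro x hx
    have := h (a - x) ⟨by linarith [hx.2], by linarith [hx.1]⟩
    rw [sub_sub_cancel] at this
    rw [weylSol, hc, this, mul_div_mul_left _ _ hs]
  have hd : HasDerivAt (fun x : ℝ => comb ν c (leftPot a q) B (ρ ^ 2) (a - x) /
      comb ν c (leftPot a q) B (ρ ^ 2) a) (-combD ν c (leftPot a q) B (ρ ^ 2) a /
      comb ν c (leftPot a q) B (ρ ^ 2) a) 0 := by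
    refine HasDerivAt.div_const ?_ _
    have e := P.hasDerivAt_comb hq.halfPot_left B (ρ ^ 2) ha
    rw [← sub_zero a] at e
    have := HasDerivAt.comp_const_sub a 0 e
    simpa using this
  have hd' : HasDerivWithinAt (weylSol a ν c A q ρ) (-combD ν c (leftPot a q) B (ρ ^ 2) a /
      comb ν c (leftPot a q) B (ρ ^ 2) a) (Ici 0) 0 := by
    refine hd.hasDerivWithinAt.congr_of_eventuallyEq ?_ (hw 0 ⟨le_rfl, ha⟩)
    filter_upwards [Ico_mem_nhdsGE ha] with x hx using hw x hx
  rw [weylFn, hd'.derivWithin (uniqueDiffOn_Ici 0 0 self_mem_Ici), neg_div]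

end

/-! ### Jost data along a ray -/

/-- The Jost solution at `ρ = r ω` has right coefficients `β`, close to those of the unperturbed
equation, and it gives the Weyl function. -/
structure RayJost (a : ℝ) (ν : ℂ) (c : Fin 2 → ℂ) (A : Matrix (Fin 2) (Fin 2) ℂ) (q : ℝ → ℂ)
    (ω : ℂ) (b : Fin 2 → ℂ) (M r : ℝ) (β : Fin 2 → ℂ) : Prop where
  asymp : ∀ j, ‖β j - b j * (r : ℂ) ^ expo ν j‖ ≤ M / r * r ^ tau ν j
  decay : ∀ z, 0 < z → ‖comb ν c (rightPot a q) β (rayLam ω r) z‖ ≤ M * decayN ν ω r z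
  charFn_ne : comb ν c (leftPot a q) (leftCoeff ν A β) (rayLam ω r) a ≠ 0 →
    charFn a ν c A q (r * ω) ≠ 0
  weylFn_eq : weylFn a ν c A q (r * ω) =
    -(combD ν c (leftPot a q) (leftCoeff ν A β) (rayLam ω r) a /
      comb ν c (leftPot a q) (leftCoeff ν A β) (rayLam ω r) a)

section

variable {ν ω d : ℂ} {c b β : Fin 2 → ℂ} {A : Matrix (Fin 2) (Fin 2) ℂ} {q : ℝ → ℂ} {a C M r : ℝ}

lemma RayJost.mono {M' : ℝ} (h : RayJost a ν c A q ω b M r β) (hM : M ≤ M') (hr : 0 < r) :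
    RayJost a ν c A q ω b M' r β where
  asymp j := (h.asymp j).trans (by
    have := Real.rpow_pos_of_pos hr (tau ν j)
    gcongr)
  decay z hz := (h.decay z hz).trans (by
    have := decayN_pos (ν := ν) (ω := ω) hr hz
    gcongr)
  charFn_ne := h.charFn_ne
  weylFn_eq := h.weylFn_eq

/-- For large r the leading term |b₀| r ^ τ₀ exceeds the error, so β₀ ≠ 0, and the solution of index
1 grows. These are the two conditions under which the Jost solution is determined. -/
lemma RayModel.exists_rayJost (R : RayModel ν c ω b d C) (P : Params ν c) (ha : 0 < a)
    (hq : ClassW a ν q) (hA : A 0 1 = 0) (h0 : A 0 0 ≠ 0) (h1 : A 1 1 ≠ 0) :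
    ∃ M, 0 < M ∧ ∀ᶠ r : ℝ in atTop, ∃ β, RayJost a ν c A q ω b M r β := by
  obtain ⟨M, hM, h⟩ := R.exists_jost P (hq.halfPot_right ha)
  obtain ⟨r₀, -, hr₀⟩ := R.exists_tendsto_norm_halfSol_atTop P (hq.halfPot_right ha)
  have hb : 0 < ‖b 0‖ := norm_pos_iff.2 (R.b_ne 0)
  refine ⟨M, hM, ?_⟩
  filter_upwards [eventually_ge_atTop 1, eventually_ge_atTop r₀,
    eventually_gt_atTop (M / ‖b 0‖)] with r hr1 hr2 hr3
  have hr : 0 < r := by linarith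
  obtain ⟨β, e1, e2, e3⟩ := h r hr1
  have hβ0 : β 0 ≠ 0 := by
    intro h0
    have p := Real.rpow_pos_of_pos hr (tau ν 0)
    have := e1 0
    rw [h0, zero_sub, norm_neg, norm_mul, norm_cpow_expo 0 hr] at this
    have h4 := le_of_mul_le_mul_right this p
    rw [div_lt_iff₀ hb] at hr3
    rw [le_div_iff₀ hr] at h4
    linarith
  have hj := fun z hz => P.jost_eq (z := z) (ρ := r * ω) ha hq hA h0 h1 hβ0 e3 (hr₀ r hr2) hz
  obtain ⟨w1, w2⟩ := P.weylFn_eq ha hq (Complex.exp_ne_zero _) hj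
  exact ⟨β, e1, e2, fun hne => w1 ▸ mul_ne_zero (Complex.exp_ne_zero _) hne, w2⟩

/-- The relative size of the error in the left coefficients. -/
noncomputable def leftErr (ν : ℂ) (A : Matrix (Fin 2) (Fin 2) ℂ) (b : Fin 2 → ℂ) (M r : ℝ) : ℝ :=
  (‖expoPhase ν 0 / A 0 0‖ + ‖expoPhase ν 1 / A 1 1‖) * (M / r) +
    ‖expoPhase ν 1 / A 1 1‖ * ‖A 1 0 / A 0 0‖ * (‖b 0‖ + M) * r ^ (-(2 * ν.re))

lemma tendsto_leftErr (hν : 0 < ν.re) : Tendsto (leftErr ν A b M) atTop (𝓝 0) := by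
  have h1 : Tendsto (fun r : ℝ => M / r) atTop (𝓝 0) := tendsto_const_nhds.div_atTop tendsto_id
  have h2 := tendsto_rpow_neg_atTop (show 0 < 2 * ν.re by linarith)
  have h3 := (h1.const_mul (‖expoPhase ν 0 / A 0 0‖ + ‖expoPhase ν 1 / A 1 1‖)).add
    (h2.const_mul (‖expoPhase ν 1 / A 1 1‖ * ‖A 1 0 / A 0 0‖ * (‖b 0‖ + M)))
  rwa [mul_zero, mul_zero, add_zero] at h3

/-- The entry a₂₁ adds a multiple of β₀ to the second left coefficient. That term has size r ^ τ₀ =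
r ^ (-2 Re ν) r ^ τ₁ and is of lower order, so only the diagonal entries enter the leading
coefficients. -/
lemma RayJost.norm_leftCoeff_sub_le (h : RayJost a ν c A q ω b M r β) (hM : 0 < M) (hr : 1 ≤ r)
    (j : Fin 2) : ‖leftCoeff ν A β j - (![expoPhase ν 0 / A 0 0 * b 0,
      expoPhase ν 1 / A 1 1 * b 1] : Fin 2 → ℂ) j * (r : ℂ) ^ expo ν j‖ ≤
      leftErr ν A b M r * r ^ tau ν j := by
  have hr0 : 0 < r := by linarith
  have p0 := Real.rpow_pos_of_pos hr0 (tau ν 0)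
  have p1 := Real.rpow_pos_of_pos hr0 (tau ν 1)
  have p2 := Real.rpow_pos_of_pos hr0 (-(2 * ν.re))
  have a0 := h.asymp 0
  have a1 := h.asymp 1
  match j with
  | 0 =>
    have e : leftCoeff ν A β 0 - (![expoPhase ν 0 / A 0 0 * b 0,
        expoPhase ν 1 / A 1 1 * b 1] : Fin 2 → ℂ) 0 * (r : ℂ) ^ expo ν 0 =
        expoPhase ν 0 / A 0 0 * (β 0 - b 0 * (r : ℂ) ^ expo ν 0) := by
      simp only [leftCoeff, Matrix.cons_val_zero]; ring
    rw [e, norm_mul]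
    calc _ ≤ ‖expoPhase ν 0 / A 0 0‖ * (M / r * r ^ tau ν 0) := by gcongr
      _ = ((‖expoPhase ν 0 / A 0 0‖ + 0) * (M / r) + 0) * r ^ tau ν 0 := by ring
      _ ≤ _ := by
        unfold leftErr
        gcongr <;> positivity
  | 1 =>
    have hβ : ‖β 0‖ ≤ (‖b 0‖ + M) * (r ^ (-(2 * ν.re)) * r ^ tau ν 1) := by
      have e := norm_add_le (β 0 - b 0 * (r : ℂ) ^ expo ν 0) (b 0 * (r : ℂ) ^ expo ν 0)
      rw [sub_add_cancel, norm_mul, norm_cpow_expo 0 hr0] at e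
      have e2 : M / r * r ^ tau ν 0 ≤ M * r ^ tau ν 0 := by
        gcongr
        exact div_le_self hM.le hr
      rw [← Real.rpow_add hr0, show -(2 * ν.re) + tau ν 1 = tau ν 0 by
        linarith [(two_tau ν).2.2]]
      linarith
    have e : leftCoeff ν A β 1 - (![expoPhase ν 0 / A 0 0 * b 0,
        expoPhase ν 1 / A 1 1 * b 1] : Fin 2 → ℂ) 1 * (r : ℂ) ^ expo ν 1 =
        expoPhase ν 1 / A 1 1 * (β 1 - b 1 * (r : ℂ) ^ expo ν 1) -
          expoPhase ν 1 / A 1 1 * (A 1 0 / A 0 0 * β 0) := by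
      simp only [leftCoeff, Matrix.cons_val_one, Matrix.cons_val_zero]; ring
    rw [e]
    refine (norm_sub_le _ _).trans ?_
    rw [norm_mul, norm_mul, norm_mul]
    calc _ ≤ ‖expoPhase ν 1 / A 1 1‖ * (M / r * r ^ tau ν 1) + ‖expoPhase ν 1 / A 1 1‖ *
          (‖A 1 0 / A 0 0‖ * ((‖b 0‖ + M) * (r ^ (-(2 * ν.re)) * r ^ tau ν 1))) := by gcongr
      _ = ((0 + ‖expoPhase ν 1 / A 1 1‖) * (M / r) + ‖expoPhase ν 1 / A 1 1‖ *
          ‖A 1 0 / A 0 0‖ * (‖b 0‖ + M) * r ^ (-(2 * ν.re))) * r ^ tau ν 1 := by ring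
      _ ≤ _ := by
        unfold leftErr
        gcongr
        positivity

/-- `ξ₁₂ ≠ 0` says that the left part of the Jost solution is not the decaying one. -/
lemma leftCoeff_leading_ne (hξ : xi ν A 0 1 ≠ 0) (h0 : A 0 0 ≠ 0) (h1 : A 1 1 ≠ 0)
    (hb0 : b 0 ≠ 0) (hb1 : b 1 ≠ 0) :
    (![expoPhase ν 0 / A 0 0 * b 0, expoPhase ν 1 / A 1 1 * b 1] : Fin 2 → ℂ) 1 * b 0 ≠
      (![expoPhase ν 0 / A 0 0 * b 0, expoPhase ν 1 / A 1 1 * b 1] : Fin 2 → ℂ) 0 * b 1 := by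
  intro h
  simp only [Matrix.cons_val_zero, Matrix.cons_val_one] at h
  have h' : A 0 0 * expoPhase ν 1 = A 1 1 * expoPhase ν 0 := by
    field_simp at h
    linear_combination h
  -- The common factor exp(iπ/2) of the two phases drops out, leaving exactly the combination of a₁₁
  -- and a₂₂ that appears in ξ₁₂.
  have e1 : expoPhase ν 1 = Complex.exp (Real.pi * Complex.I / 2) *
      Complex.exp (1 * Real.pi * Complex.I * ν) := by
    rw [expoPhase, expo_one, ← Complex.exp_add]; congr 1; ring
  have e0 : expoPhase ν 0 = Complex.exp (Real.pi * Complex.I / 2) *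
      Complex.exp (-1 * Real.pi * Complex.I * ν) := by
    rw [expoPhase, expo_zero, ← Complex.exp_add]; congr 1; ring
  rw [e0, e1] at h'
  apply hξ
  have h2 : A 0 0 * Complex.exp (1 * Real.pi * Complex.I * ν) -
      A 1 1 * Complex.exp (-1 * Real.pi * Complex.I * ν) = 0 := by
    refine mul_left_cancel₀ (Complex.exp_ne_zero (Real.pi * Complex.I / 2)) ?_
    linear_combination h'
  simp only [xi, Matrix.smul_apply, Matrix.of_apply, Matrix.cons_val_zero, Matrix.cons_val_one,
    smul_eq_mul]
  rw [h2, mul_zero, mul_zero]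

end

/-! ### Conclusion -/

/-- The points exp(iπ/4) and exp(3iπ/4) lie in the open upper half-plane, and their squares point
along the two imaginary half-axes. -/
lemma exists_rays : ∃ ω ω' : ℂ, 0 < ω.im ∧ 0 < ω'.im ∧ ω ^ 2 = Complex.I ∧
    ω' ^ 2 = -Complex.I := by
  have h2 : (√2 : ℝ) ^ 2 = 2 := Real.sq_sqrt (by norm_num)
  have hp : 0 < √2 / 2 := by positivity
  refine ⟨⟨√2 / 2, √2 / 2⟩, ⟨-(√2 / 2), √2 / 2⟩, hp, hp, ?_, ?_⟩
  all_goals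
    apply Complex.ext <;> simp [pow_two]
    all_goals nlinarith

section

variable {ν : ℂ} {c : Fin 2 → ℂ} {A : Matrix (Fin 2) (Fin 2) ℂ} {q q' : ℝ → ℂ} {a : ℝ}

lemma ae_eq_of_leftPot (h : ∀ᵐ t, t ∈ Ioo 0 a → leftPot a q t = leftPot a q' t) :
    ∀ᵐ x, x ∈ Ioo 0 a → q x = q' x := by
  have := (Measure.measurePreserving_sub_left volume a).quasiMeasurePreserving.ae h
  filter_upwards [this] with x hx hxa
  have hm : a - x ∈ Ioo 0 a := ⟨by linarith [hxa.2], by linarith [hxa.1]⟩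
  have e := hx hm
  rwa [leftPot, leftPot, indicator_of_mem (Ioo_subset_Ioc_self hm),
    indicator_of_mem (Ioo_subset_Ioc_self hm), sub_sub_cancel] at e

lemma ae_eq_of_rightPot (h : ∀ᵐ t, t ∈ Ioi (0 : ℝ) → rightPot a q t = rightPot a q' t) :
    ∀ᵐ x, x ∈ Ioi a → q x = q' x := by
  have := (measurePreserving_sub_right volume a).quasiMeasurePreserving.ae h
  filter_upwards [this] with x hx hxa
  have e := hx (mem_Ioi.2 (sub_pos.2 (mem_Ioi.1 hxa)))
  rwa [rightPot, rightPot, add_sub_cancel] at e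

lemma ae_leftPot_eq (h : ∀ᵐ t, t ∈ Ioo 0 a → leftPot a q t = leftPot a q' t) :
    ∀ᵐ t, t ∈ Ioi (0 : ℝ) → leftPot a q t = leftPot a q' t := by
  have hne : ∀ᵐ t : ℝ, t ≠ a := by simp [ae_iff, measure_singleton]
  filter_upwards [h, hne] with t ht hta h0
  by_cases hm : t ∈ Ioc 0 a
  · exact ht ⟨h0, lt_of_le_of_ne hm.2 hta⟩
  · rw [leftPot, leftPot, indicator_of_notMem hm, indicator_of_notMem hm]

/-- The Weyl function determines the logarithmic derivatives at the left end, along a ray. -/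
lemma RayModel.exists_rayJost_pair {ω d : ℂ} {b : Fin 2 → ℂ} {C : ℝ} (R : RayModel ν c ω b d C)
    (P : Params ν c) (ha : 0 < a) (hq : ClassW a ν q) (hq' : ClassW a ν q') (hA : A 0 1 = 0)
    (h0 : A 0 0 ≠ 0) (h1 : A 1 1 ≠ 0)
    (hM : ∀ ρ : ℂ, 0 ≤ ρ.im → ρ ≠ 0 → charFn a ν c A q ρ ≠ 0 → charFn a ν c A q' ρ ≠ 0 →
      weylFn a ν c A q ρ = weylFn a ν c A q' ρ) :
    ∃ M, 0 < M ∧ ∃ β β' : ℝ → Fin 2 → ℂ,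
      (∀ᶠ r in atTop, RayJost a ν c A q ω b M r (β r)) ∧
      (∀ᶠ r in atTop, RayJost a ν c A q' ω b M r (β' r)) ∧
      ∀ᶠ r : ℝ in atTop, comb ν c (leftPot a q) (leftCoeff ν A (β r)) (rayLam ω r) a ≠ 0 →
        comb ν c (leftPot a q') (leftCoeff ν A (β' r)) (rayLam ω r) a ≠ 0 →
        combD ν c (leftPot a q) (leftCoeff ν A (β r)) (rayLam ω r) a /
          comb ν c (leftPot a q) (leftCoeff ν A (β r)) (rayLam ω r) a =
        combD ν c (leftPot a q') (leftCoeff ν A (β' r)) (rayLam ω r) a /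
          comb ν c (leftPot a q') (leftCoeff ν A (β' r)) (rayLam ω r) a := by
  obtain ⟨M, hM0, h⟩ := R.exists_rayJost P ha hq hA h0 h1
  obtain ⟨M', -, h'⟩ := R.exists_rayJost P ha hq' hA h0 h1
  -- Coefficients exist only for large r, but functions of all r are needed; elsewhere the chosen
  -- value is arbitrary.
  have hex : ∀ r : ℝ, ∃ β, (∃ β, RayJost a ν c A q ω b M r β) → RayJost a ν c A q ω b M r β :=
    fun r => ⟨Classical.epsilon _, fun h => Classical.epsilon_spec h⟩
  have hex' : ∀ r : ℝ, ∃ β, (∃ β, RayJost a ν c A q' ω b M' r β) →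
      RayJost a ν c A q' ω b M' r β :=
    fun r => ⟨Classical.epsilon _, fun h => Classical.epsilon_spec h⟩
  choose β hβ using hex
  choose β' hβ' using hex'
  have k : ∀ᶠ r in atTop, RayJost a ν c A q ω b (max M M') r (β r) := by
    filter_upwards [h, eventually_gt_atTop 0] with r hr hr0
    exact (hβ r hr).mono (le_max_left _ _) hr0
  have k' : ∀ᶠ r in atTop, RayJost a ν c A q' ω b (max M M') r (β' r) := by
    filter_upwards [h', eventually_gt_atTop 0] with r hr hr0
    exact (hβ' r hr).mono (le_max_right _ _) hr0
  refine ⟨max M M', lt_max_of_lt_left hM0, β, β', k, k', ?_⟩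
  filter_upwards [k, k', eventually_gt_atTop 0] with r hr hr' hr0 hne hne'
  have him : 0 < ((r : ℂ) * ω).im := by
    rw [Complex.im_ofReal_mul]
    exact mul_pos hr0 R.im_pos
  have e := hM (r * ω) him.le (fun h => by rw [h] at him; exact lt_irrefl _ him)
    (hr.charFn_ne hne) (hr'.charFn_ne hne')
  rw [hr.weylFn_eq, hr'.weylFn_eq] at e
  exact neg_injective e

end

end SingularSL

open SingularSL MeasureTheory Filter Set
theorem theorem4
    (a : ℝ) (ha : 0 < a)
    (ν : ℂ) (hν : 0 < ν.re) (hν_int : ∀ n : ℕ, ν ≠ (n : ℂ))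
    (c : Fin 2 → ℂ) (hc : c 0 * c 1 = (2 * ν)⁻¹)
    (A : Matrix (Fin 2) (Fin 2) ℂ) (hA : A.det ≠ 0) (hA12 : A 0 1 = 0)
    (hξ12 : 0 < ‖SingularSL.xi ν A 0 1‖)
    (hξ : ∀ j : Fin 2, ‖SingularSL.xi ν A 0 1‖ < ‖SingularSL.xi ν A j j‖)
    (q q' : ℝ → ℂ)
    (hq : SingularSL.ClassW a ν q) (hq' : SingularSL.ClassW a ν q')
    (hM : ∀ ρ : ℂ, 0 ≤ ρ.im → ρ ≠ 0 →
      SingularSL.charFn a ν c A q ρ ≠ 0 → SingularSL.charFn a ν c A q' ρ ≠ 0 →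
      SingularSL.weylFn a ν c A q ρ = SingularSL.weylFn a ν c A q' ρ) :
    ∀ᵐ x ∂(MeasureTheory.volume.restrict (Set.Ioi (0 : ℝ))), q x = q' x := by
  have P : Params ν c := ⟨hν, hν_int, hc⟩
  have hdet : A 0 0 * A 1 1 ≠ 0 := by
    rwa [Matrix.det_fin_two, hA12, zero_mul, sub_zero] at hA
  have h0 := left_ne_zero_of_mul hdet
  have h1 := right_ne_zero_of_mul hdet
  have hξ' := norm_pos_iff.1 hξ12
  have hL := hq.halfPot_left
  have hL' := hq'.halfPot_left
  have hR := hq.halfPot_right ha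
  have hR' := hq'.halfPot_right ha
  obtain ⟨ω, ω', hω, hω', e1, e2⟩ := exists_rays
  have him : ∀ η ∈ ({ω, ω'} : Set ℂ), 0 < η.im := by
    rintro η (rfl | rfl)
    exacts [hω, hω']
  -- On the left, the common Weyl function is the common logarithmic derivative, and ξ₁₂ ≠ 0 is the
  -- growth condition on the leading left coefficients.
  have hleft : ∀ᵐ t, t ∈ Ioo 0 a → leftPot a q t = leftPot a q' t := by
    refine P.eq_ae_of_leftSol hL hL' ha e1 e2 fun η hη z hz => ?_
    obtain ⟨b, d, C, R⟩ := P.exists_rayModel (him η hη)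
    obtain ⟨M, hM0, β, β', k, k', heq⟩ := R.exists_rayJost_pair P ha hq hq' hA12 h0 h1 hM
    refine R.tendsto_leftSol_wronskian P hL hL' ha
      (leftCoeff_leading_ne hξ' h0 h1 (R.b_ne 0) (R.b_ne 1))
      (tendsto_leftErr (A := A) (b := b) (M := M) hν) ?_ ?_ heq hz
    · filter_upwards [k, eventually_ge_atTop 1] with r hr hr1 j
      exact hr.norm_leftCoeff_sub_le hM0 hr1 j
    · filter_upwards [k', eventually_ge_atTop 1] with r hr hr1 j
      exact hr.norm_leftCoeff_sub_le hM0 hr1 j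
  -- On the right, the input is that the two β are proportional; it is deduced from the equality of
  -- the left potentials just obtained.
  have hright : ∀ᵐ t, t ∈ Ioi (0 : ℝ) → rightPot a q t = rightPot a q' t := by
    refine P.eq_ae_of_halfSol hR hR' e1 e2 fun η hη z hz => ?_
    obtain ⟨b, d, C, R⟩ := P.exists_rayModel (him η hη)
    obtain ⟨M, hM0, β, β', k, k', heq⟩ := R.exists_rayJost_pair P ha hq hq' hA12 h0 h1 hM
    have hκ := leftCoeff_leading_ne hξ' h0 h1 (R.b_ne 0) (R.b_ne 1)
    have hδ := tendsto_leftErr (A := A) (b := b) (M := M) hν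
    obtain ⟨_, -, n⟩ := R.eventually_norm_comb_div_le P hL ha hκ hδ (B := fun r =>
      leftCoeff ν A (β r)) (by
        filter_upwards [k, eventually_ge_atTop 1] with r hr hr1 j
        exact hr.norm_leftCoeff_sub_le hM0 hr1 j)
    obtain ⟨_, -, n'⟩ := R.eventually_norm_comb_div_le P hL' ha hκ hδ (B := fun r =>
      leftCoeff ν A (β' r)) (by
        filter_upwards [k', eventually_ge_atTop 1] with r hr hr1 j
        exact hr.norm_leftCoeff_sub_le hM0 hr1 j)
    refine R.tendsto_halfSol_wronskian P hR hR' hM0 (β := β) (β' := β')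
      (k.mono fun r hr => hr.asymp 0) (k'.mono fun r hr => hr.asymp 0)
      (k.mono fun r hr => hr.decay) (k'.mono fun r hr => hr.decay) ?_ hz
    filter_upwards [n, n', heq] with r m m' he
    have he := he m.1 m'.1
    have m' := m'.1
    -- Both left parts can now be written with the solutions of one potential, so equal logarithmic
    -- derivatives mean proportional coefficients.
    obtain ⟨f1, f2⟩ := P.comb_congr hL hL' (ae_leftPot_eq hleft) (leftCoeff ν A (β' r))
      (rayLam η r) ha
    rw [f1] at m'
    rw [f1, f2] at he
    exact leftCoeff_mul_eq_mul h0 h1 (P.coeff_mul_eq_mul hL ha m.1 m' he)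
  have hne : ∀ᵐ x : ℝ, x ≠ a := by simp [ae_iff, measure_singleton]
  rw [ae_restrict_iff' measurableSet_Ioi]
  filter_upwards [ae_eq_of_leftPot hleft, ae_eq_of_rightPot hright, hne] with x hl hr hxa hx
  rcases lt_or_gt_of_ne hxa with h | h
  exacts [hl ⟨hx, h⟩, hr h]
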